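/- \textbf{Conventions.} A hypergraph is a pair $(V,E)$ with $V$ a finite non-empty set and $E$ a set of subsets of $V$ (hyperedges); the arity of a hyperedge is its number of vertices. We write $n=|V|$ and $m=|E|$; the input is given as a list of the hyperedges. A \emph{$k$-independent set} is a set of $k$ vertices that contains no hyperedge; the problem $k$-Independent Set asks whether one exists. Algorithms are deterministic programs for the unit-cost word RAM with words of $O(\log(n+m))$ bits. Let $\omega$ be the matrix multiplication exponent, i.e. the infimum of all $\tau$ such that two $n\times n$ matrices, with integer entries of $O(\log n)$ bits, can be multiplied in time $O(n^{\tau})$ (with words of $O(\log n)$ bits). The \emph{$k$-Clique Hypothesis} states that for no $k>2$ and $\varepsilon>0$ can one detect $k$-cliques in $n$-vertex graphs in time $O(n^{\omega k/3-\varepsilon})$. The \emph{3-uniform Hyperclique Hypothesis} states that for no $k>3$ and $\varepsilon>0$ can one detect, in $n$-vertex 3-uniform hypergraphs, a set of $k$ vertices all of whose 3-element subsets are hyperedges, in time $O(n^{k-\varepsilon})$. For $k\ge 2$ let \[ f_k(n,m)=\min\{\,n^{\omega k/3}+m^{k/3},\; n^k\,\}. \] \textbf{Theorem.} There is a constant $c$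 such that the following holds for every integer $k\ge 2$. (1) (Upper bound) For every constant $b$, there is an algorithm that solves $k$-Independent Set on all hypergraphs with $n$ vertices and $m\le b\,n^k$ hyperedges, each of arity at least $2$, in time $O(n^{c}\cdot f_k(n,m))$. (2) (Lower bound) Assume the $k$-Clique Hypothesis and the 3-uniform Hyperclique Hypothesis. Then for every real $\gamma$ with $2\le\gamma\le k$, no algorithm solves $k$-Independent Set in time $O(n^{-c}\cdot f_k(n,m))$, even when restricted to hypergraphs with $n$ vertices and $m=\Theta(n^{\gamma})$ hyperedges, each of arity at least $2$ and at most $k$. That is, there are $a>0$ and $b$ depending only on $k$ and $\gamma$ such that no algorithm achieves this on all such hypergraphs with $a\,n^{\gamma}\le m\le b\,n^{\gamma}$. -/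

import Mathlib

/-! ## The machine model: a unit-cost random access machine with bounded words

A machine has registers and one random access memory, both holding natural numbers.  Programs are
built from the usual unit-cost instructions by sequencing, branching and while loops.  A run is
performed relative to a word bound `W`: an instruction whose result exceeds `W` cannot be executed
(the run is stuck), so a halting run only ever handles words with `O(log W)` bits. -/

namespace WordRAM

/-- The arithmetic, comparison and bitwise instructions. -/
inductive Op where
  | add | sub | mul | div | mod | lt | eq | land | lor | xor

/-- Meaning of the instructions: subtraction is truncated at `0`, division rounds down, and the
comparisons return `1` for true and `0` for false. -/
def Op.eval : Op → ℕ → ℕ → ℕ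
  | .add, x, y => x + y
  | .sub, x, y => x - y
  | .mul, x, y => x * y
  | .div, x, y => x / y
  | .mod, x, y => x % y
  | .lt, x, y => if x < y then 1 else 0
  | .eq, x, y => if x = y then 1 else 0
  | .land, x, y => x &&& y
  | .lor, x, y => x ||| y
  | .xor, x, y => x ^^^ y

/-- Programs.  Numerals `r`, `a`, `b` name registers. -/
inductive Prog where
  /-- do nothing -/
  | skip
  /-- `r := c` -/
  | const (r c : ℕ)
  /-- `r := o a b` -/
  | op (o : Op) (r a b : ℕ)
  /-- `r := memory[a]` (indirect addressing) -/
  | load (r a : ℕ)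
  /-- `memory[a] := b` (indirect addressing) -/
  | store (a b : ℕ)
  /-- first `p`, then `q` -/
  | seq (p q : Prog)
  /-- if `r ≠ 0` then `p` else `q` -/
  | ite (r : ℕ) (p q : Prog)
  /-- while `r ≠ 0` do `p` -/
  | loop (r : ℕ) (p : Prog)

/-- Contents of the registers and of the memory. -/
structure State where
  reg : ℕ → ℕ
  mem : ℕ → ℕ

/-- The state in which the machine starts on the input words `w`: the input occupies the memory
cells `0, 1, 2, …`, everything else is `0`. -/
def State.init (w : List ℕ) : State where
  reg := fun _ => 0
  mem := fun i => w.getD i 0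

/-- Write `v` into register `r`. -/
def State.setReg (s : State) (r v : ℕ) : State where
  reg := Function.update s.reg r v
  mem := s.mem

/-- Write `v` into memory cell `i`. -/
def State.setMem (s : State) (i v : ℕ) : State where
  reg := s.reg
  mem := Function.update s.mem i v

/-- `Exec W p s t s'`: with word bound `W`, program `p` started in state `s` halts after exactly
`t` steps in state `s'`.  Every instruction and every test of a branch or a loop is one step. -/
inductive Exec (W : ℕ) : Prog → State → ℕ → State → Prop where
  | skip (s : State) : Exec W .skip s 1 s
  | const (s : State) (r c : ℕ) (h : c ≤ W) : Exec W (.const r c) s 1 (s.setReg r c)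
  | op (s : State) (o : Op) (r a b : ℕ) (h : o.eval (s.reg a) (s.reg b) ≤ W) :
      Exec W (.op o r a b) s 1 (s.setReg r (o.eval (s.reg a) (s.reg b)))
  | load (s : State) (r a : ℕ) : Exec W (.load r a) s 1 (s.setReg r (s.mem (s.reg a)))
  | store (s : State) (a b : ℕ) : Exec W (.store a b) s 1 (s.setMem (s.reg a) (s.reg b))
  | seq {p q : Prog} {s s₁ s₂ : State} {t₁ t₂ : ℕ} (h₁ : Exec W p s t₁ s₁)
      (h₂ : Exec W q s₁ t₂ s₂) : Exec W (.seq p q) s (t₁ + t₂) s₂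
  | iteTrue {r : ℕ} {p q : Prog} {s s₁ : State} {t : ℕ} (hr : s.reg r ≠ 0)
      (h : Exec W p s t s₁) : Exec W (.ite r p q) s (t + 1) s₁
  | iteFalse {r : ℕ} {p q : Prog} {s s₁ : State} {t : ℕ} (hr : s.reg r = 0)
      (h : Exec W q s t s₁) : Exec W (.ite r p q) s (t + 1) s₁
  | loopDone {r : ℕ} {p : Prog} {s : State} (hr : s.reg r = 0) : Exec W (.loop r p) s 1 s
  | loopStep {r : ℕ} {p : Prog} {s s₁ s₂ : State} {t₁ t₂ : ℕ} (hr : s.reg r ≠ 0)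
      (h₁ : Exec W p s t₁ s₁) (h₂ : Exec W (.loop r p) s₁ t₂ s₂) :
      Exec W (.loop r p) s (t₁ + t₂ + 1) s₂

/-- `Runs W p w t s`: every input word is at most `W`, and on input `w` the program `p` halts after
`t` steps in state `s`, handling only words that are at most `W`. -/
def Runs (W : ℕ) (p : Prog) (w : List ℕ) (t : ℕ) (s : State) : Prop :=
  (∀ x ∈ w, x ≤ W) ∧ Exec W p (State.init w) t s

end WordRAM

/-! ## The matrix multiplication exponent -/

namespace MatMul

open WordRAM

/-- The entries of a matrix, row by row. -/
def rowMajor {n : ℕ} (A : Matrix (Fin n) (Fin n) ℕ) : List ℕ :=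
  (List.finRange n).flatMap fun i => (List.finRange n).map fun j => A i j

/-- `p` multiplies any two `n × n` matrices with entries in `{0, …, n ^ q}` in time `T n`, with
words of `O(log n)` bits.  The input is `n` followed by the entries of the two matrices; the product
is written, row by row, behind the input. -/
def MultipliesInTime (p : Prog) (q : ℕ) (T : ℕ → ℝ) : Prop :=
  ∃ D : ℕ, ∀ n : ℕ, 0 < n → ∀ A B : Matrix (Fin n) (Fin n) ℕ,
    (∀ i j, A i j ≤ n ^ q) → (∀ i j, B i j ≤ n ^ q) →
    ∃ (t : ℕ) (s : State), Runs ((n + 2) ^ D) p (n :: (rowMajor A ++ rowMajor B)) t s ∧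
      (t : ℝ) ≤ T n ∧
      ∀ i j : Fin n, s.mem (1 + 2 * n ^ 2 + (i * n + j)) = (A * B) i j

/-- The matrix multiplication exponent: the infimum of all `τ` such that two `n × n` matrices, with
integer entries of `O(log n)` bits, can be multiplied in time `O(n ^ τ)`. -/
noncomputable def omega : ℝ :=
  sInf {τ : ℝ | ∀ q : ℕ, ∃ (p : Prog) (C : ℝ), MultipliesInTime p q fun n => C * (n : ℝ) ^ τ}

end MatMul

/-! ## Decision problems on finite hypergraphs

A hypergraph on the vertex set `{0, …, n - 1}` is given by its set of hyperedges
`E : Finset (Finset (Fin n))`. -/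

namespace HyperIS

open WordRAM

/-- The list of words `w` describes the hypergraph `E` on `n` vertices: first `n`, then the number of
hyperedges, then the hyperedges, each once and in an arbitrary order, each of them as its arity
followed by its vertices in an arbitrary order. -/
def Encodes {n : ℕ} (E : Finset (Finset (Fin n))) (w : List ℕ) : Prop :=
  ∃ L : List (List (Fin n)), (∀ e ∈ L, e.Nodup) ∧ (L.map List.toFinset).Nodup ∧
    (L.map List.toFinset).toFinset = E ∧
    w = n :: L.length :: L.flatMap fun e => e.length :: e.map Fin.val

/-- Properties of hypergraphs. -/
abbrev HProp : Type := (n : ℕ) → Finset (Finset (Fin n)) → Prop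

/-- The program `p` decides the property `Q` on all hypergraphs of the class `K` (with at least one
vertex), in time `T n m` on hypergraphs with `n` vertices and `m` hyperedges, with words of
`O(log (n + m))` bits.  The answer is yes if register `0` is nonzero at the end. -/
def DecidesInTime (p : Prog) (K Q : HProp) (T : ℕ → ℕ → ℝ) : Prop :=
  ∃ D : ℕ, ∀ n : ℕ, 0 < n → ∀ E : Finset (Finset (Fin n)), K n E →
    ∀ w : List ℕ, Encodes E w →
      ∃ (t : ℕ) (s : State), Runs ((n + E.card + 2) ^ D) p w t s ∧
        (t : ℝ) ≤ T n E.card ∧ (s.reg 0 ≠ 0 ↔ Q n E)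

/-- Some set of `k` vertices contains no hyperedge. -/
def HasIndependentSet (k : ℕ) : HProp := fun n E =>
  ∃ S : Finset (Fin n), S.card = k ∧ ∀ e ∈ E, ¬ e ⊆ S

/-- Some set of `k` vertices has all its subsets of size `d` among the hyperedges. -/
def HasHyperclique (d k : ℕ) : HProp := fun n E =>
  ∃ S : Finset (Fin n), S.card = k ∧ ∀ e ⊆ S, e.card = d → e ∈ E

/-- The `d`-uniform hypergraphs; for `d = 2` these are the graphs. -/
def Uniform (d : ℕ) : HProp := fun _ E => ∀ e ∈ E, e.card = d

/-- The `k`-Clique Hypothesis: for no `k > 2` and `ε > 0` can `k`-cliques in `n`-vertex graphs be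
detected in time `O(n ^ (ω k / 3 - ε))`. -/
def CliqueHypothesis : Prop :=
  ∀ k : ℕ, 2 < k → ∀ ε : ℝ, 0 < ε →
    ¬ ∃ (p : Prog) (C : ℝ), DecidesInTime p (Uniform 2) (HasHyperclique 2 k)
      fun n _ => C * (n : ℝ) ^ (MatMul.omega * k / 3 - ε)

/-- The `d`-uniform Hyperclique Hypothesis (for `d ≥ 3`): for no `k > d` and `ε > 0` can `k`-cliques
in `n`-vertex `d`-uniform hypergraphs be detected in time `O(n ^ (k - ε))`. -/
def HypercliqueHypothesis (d : ℕ) : Prop :=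
  ∀ k : ℕ, d < k → ∀ ε : ℝ, 0 < ε →
    ¬ ∃ (p : Prog) (C : ℝ), DecidesInTime p (Uniform d) (HasHyperclique d k)
      fun n _ => C * (n : ℝ) ^ ((k : ℝ) - ε)

/-- `min {n ^ (ω k / 3) + m ^ (k / 3), n ^ k}`. -/
noncomputable def timeBound (k n m : ℕ) : ℝ :=
  min ((n : ℝ) ^ (MatMul.omega * k / 3) + (m : ℝ) ^ ((k : ℝ) / 3)) ((n : ℝ) ^ k)

/-- Hypergraphs with hyperedges of arity at least `2` whose number is at most `b * n ^ k`. -/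
def MixedArity (k : ℕ) (b : ℝ) : HProp := fun n E =>
  (∀ e ∈ E, 2 ≤ e.card) ∧ (E.card : ℝ) ≤ b * (n : ℝ) ^ k

/-- Hypergraphs with hyperedges of arity at least `2` and at most `k` whose number `m` satisfies
`a * n ^ γ ≤ m ≤ b * n ^ γ`. -/
def OfDensity (k : ℕ) (γ a b : ℝ) : HProp := fun n E =>
  (∀ e ∈ E, 2 ≤ e.card ∧ e.card ≤ k) ∧
    a * (n : ℝ) ^ γ ≤ E.card ∧ (E.card : ℝ) ≤ b * (n : ℝ) ^ γ

end HyperIS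

/-! ## A structured language that compiles to the word RAM -/

namespace WordRAM

/-! Upper bound. If `m > n ^ 3`, the claimed time is `n ^ k` and exhaustive search suffices: the
hyperedges with at most `k` vertices are marked in a table indexed by `k`-tuples, and every
`k`-tuple of vertices is tested against the table (`manyS_tri`).

If `m ≤ n ^ 3`, the independent sets of size `k` are counted. A chain is a list of hyperedges, each
preceding the one chosen before it and adding at least three vertices to the union. A hyperedge that
still precedes the chain and has at most two vertices outside the union becomes active. Let `S`
contain the union and no active hyperedge. Either `S` contains no hyperedge preceding the chain, or
the first hyperedge inside `S` extends the chain, and it is the only extension after which nothing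
in `S` precedes the chain (`Chain.leaf_eq`). So the sum over chain lengths with alternating signs
telescopes to the number of independent sets (`Chain.sum_chains`, `Chain.card_independent`).

A chain with `t` entries covers at least `3 * t` vertices. The at most `k - 3 * t` missing ones are
subject to conditions on pairs only, since active hyperedges have at most two vertices left
(`Triples.card_leaf`). As for cliques in graphs, they are cut into three blocks and counted by one
matrix product of dimension about `n ^ (k / 3 - t)` (`Triples.card_triples`,
`Triples.sum_matrices`). The total `∑ m ^ t * n ^ (ω * (k / 3 - t))` lies below the sum of its two
extreme cases `n ^ (ω * k / 3)` and `m ^ (k / 3)`, up to a factor (`ChainExpr.pow_mul_rpow_le`,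
`ChainExpr.chainTime_le`).

Lower bound. For `k < 45` the time `n ^ (-45) * f_k` tends to `0`, so nothing is to be shown. For
larger `k`, a graph or 3-uniform hypergraph on `N` vertices is turned into an instance on `n ≈ N ^
σ` vertices: the hyperedges are the missing `d`-sets, all pairs that meet the dummy vertices, and
padding sets of `k` dummy vertices that raise the number of hyperedges to order `n ^ γ`. Its
independent `k`-sets are the hypercliques (`Padded.exists_independent_iff`). Cliques with `σ = 1`
serve for `γ ≤ ω`, hypercliques with `σ = 3 / γ` for `ω < γ < 3`, and hypercliques with `σ = 1` for
`γ ≥ 3` (`Padded.not_exists_algorithm`). Instead of computing real powers, the reduction tries all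
of polynomially many paddings; wrong answers do no harm because a solution is built by deleting
vertices and then verified (`Padded.reduceS_tri`, `Padded.trialS_tri`).

Machines. The algorithms are written in a structured language that compiles to the word RAM
(`Expr.code_exec`, `HExec.exec`). The programs supplied by the definition of `ω` and by the
hypothetical fast algorithm are arbitrary; they run in a sandbox with a step limit on inputs that
are computed on demand (`Sandbox.box_exec`, `Sandbox.run_exec`). -/

theorem lor_le_add (x y : ℕ) : x ||| y ≤ x + y := by
  induction x using Nat.strong_induction_on generalizing y with
  | _ x ih =>
    rcases Nat.eq_zero_or_pos x with rfl | hx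
    · simp
    · have h := ih (x / 2) (by omega) (y / 2)
      have h1 : (x ||| y) / 2 = x / 2 ||| y / 2 := Nat.or_div_two
      have h2 : (x ||| y) % 2 ≤ x % 2 + y % 2 := by
        have := Nat.or_mod_two_eq_one (a := x) (b := y)
        omega
      omega

theorem xor_le_add (x y : ℕ) : x ^^^ y ≤ x + y := by
  induction x using Nat.strong_induction_on generalizing y with
  | _ x ih =>
    rcases Nat.eq_zero_or_pos x with rfl | hx
    · simp
    · have h := ih (x / 2) (by omega) (y / 2)
      have h1 : (x ^^^ y) / 2 = x / 2 ^^^ y / 2 := Nat.xor_div_two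
      have h2 : (x ^^^ y) % 2 ≤ x % 2 + y % 2 := by
        have := Nat.xor_mod_two_eq_one (a := x) (b := y)
        omega
      omega

/-- Both powers are at least `2`, so their sum is at most their product. Every instruction except
multiplication is bounded by the sum of its arguments or by `1`. Exponents therefore add under each
operation. -/
theorem Op.eval_le_of_le {M : ℕ} (hM : 2 ≤ M) {i j : ℕ} (hi : 1 ≤ i) (hj : 1 ≤ j) (o : Op)
    {x y : ℕ} (hx : x ≤ M ^ i) (hy : y ≤ M ^ j) : o.eval x y ≤ M ^ (i + j) := by
  have h1 : 2 ≤ M ^ i := hM.trans (Nat.le_self_pow (by omega) M)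
  have h2 : 2 ≤ M ^ j := hM.trans (Nat.le_self_pow (by omega) M)
  have h3 : M ^ i + M ^ j ≤ M ^ (i + j) := by rw [pow_add]; nlinarith
  have hd := Nat.div_le_self x y
  have hm := Nat.mod_le x y
  have hl := lor_le_add x y
  have hxr := xor_le_add x y
  have ha : x &&& y ≤ x := Nat.and_le_left
  cases o <;> simp only [Op.eval]
  case mul => rw [pow_add]; exact Nat.mul_le_mul hx hy
  all_goals first | omega | (split_ifs <;> omega)

@[simp] theorem State.reg_setReg (s : State) (x v y : ℕ) :
    (s.setReg x v).reg y = if y = x then v else s.reg y := by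
  simp [State.setReg, Function.update_apply]

@[simp] theorem State.mem_setReg (s : State) (x v : ℕ) : (s.setReg x v).mem = s.mem := rfl

@[simp] theorem State.reg_setMem (s : State) (x v : ℕ) : (s.setMem x v).reg = s.reg := rfl

@[simp] theorem State.mem_setMem (s : State) (x v y : ℕ) :
    (s.setMem x v).mem y = if y = x then v else s.mem y := by
  simp [State.setMem, Function.update_apply]

@[ext] theorem State.ext' {s t : State} (h₁ : s.reg = t.reg) (h₂ : s.mem = t.mem) : s = t := by
  cases s; cases t; simp_all

/-- Pure expressions over variables and memory, with bounded sums and local definitions. -/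
inductive Expr where
  | const (c : ℕ)
  | var (x : ℕ)
  | load (a : Expr)
  | op (o : Op) (a b : Expr)
  | ite (c a b : Expr)
  | letE (x : ℕ) (a b : Expr)
  /-- the sum of `e` over all `x` smaller than `b` -/
  | sum (x : ℕ) (b e : Expr)

namespace Expr

instance : Add Expr := ⟨op .add⟩
instance : Sub Expr := ⟨op .sub⟩
instance : Mul Expr := ⟨op .mul⟩
instance : Div Expr := ⟨op .div⟩
instance : Mod Expr := ⟨op .mod⟩
instance (n : ℕ) : OfNat Expr n := ⟨const n⟩

/-- The value of an expression. -/
def eval : Expr → State → ℕ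
  | const c, _ => c
  | var x, s => s.reg x
  | load a, s => s.mem (a.eval s)
  | op o a b, s => o.eval (a.eval s) (b.eval s)
  | ite c a b, s => if c.eval s ≠ 0 then a.eval s else b.eval s
  | letE x a b, s => b.eval (s.setReg x (a.eval s))
  | sum x b e, s => ∑ i ∈ Finset.range (b.eval s), e.eval (s.setReg x i)

/-- The number of steps that the evaluation takes. -/
def cost : Expr → State → ℕ
  | const _, _ => 1
  | var _, _ => 1
  | load a, s => a.cost s + 1
  | op _ a b, s => a.cost s + b.cost s + 1
  | ite c a b, s => c.cost s + (if c.eval s ≠ 0 then a.cost s else b.cost s) + 1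
  | letE x a b, s => a.cost s + b.cost (s.setReg x (a.eval s)) + 4
  | sum x b e, s => b.cost s + (∑ i ∈ Finset.range (b.eval s), (e.cost (s.setReg x i) + 4)) + 8

/-- All values that occur during the evaluation are at most `W`. -/
def Ok (W : ℕ) : Expr → State → Prop
  | const c, _ => c ≤ W
  | var x, s => s.reg x ≤ W
  | load a, s => a.Ok W s ∧ s.mem (a.eval s) ≤ W
  | op o a b, s => a.Ok W s ∧ b.Ok W s ∧ o.eval (a.eval s) (b.eval s) ≤ W
  | ite c a b, s => c.Ok W s ∧ a.Ok W s ∧ b.Ok W s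
  | letE x a b, s => s.reg x ≤ W ∧ a.Ok W s ∧ b.Ok W (s.setReg x (a.eval s))
  | sum x b e, s => 1 ≤ W ∧ s.reg x ≤ W ∧ b.Ok W s ∧
      (∀ i < b.eval s, e.Ok W (s.setReg x i)) ∧
      ∑ i ∈ Finset.range (b.eval s), e.eval (s.setReg x i) ≤ W

theorem Ok.eval_le {W : ℕ} {e : Expr} {s : State} (h : e.Ok W s) : e.eval s ≤ W := by
  induction e generalizing s with
  | const c => exact h
  | var x => exact h
  | load a _ => exact h.2
  | op o a b _ _ => exact h.2.2
  | ite c a b _ iha ihb =>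
    simp only [eval]; split_ifs
    · exact iha h.2.1
    · exact ihb h.2.2
  | letE x a b _ ihb => exact ihb h.2.2
  | sum x b e _ _ => exact h.2.2.2.2

/-- The code that evaluates an expression into register `2 * d + 1`. -/
def code : Expr → ℕ → Prog
  | const c, d => .const (2 * d + 1) c
  | var x, d => .op .lor (2 * d + 1) (2 * x) (2 * x)
  | load a, d => .seq (a.code d) (.load (2 * d + 1) (2 * d + 1))
  | op o a b, d => .seq (a.code d) (.seq (b.code (d + 1))
      (.op o (2 * d + 1) (2 * d + 1) (2 * (d + 1) + 1)))
  | ite c a b, d => .seq (c.code d) (.ite (2 * d + 1) (a.code d) (b.code d))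
  | letE x a b, d => .seq (a.code d) <|
      .seq (.op .lor (2 * (d + 1) + 1) (2 * x) (2 * x)) <|
      .seq (.op .lor (2 * x) (2 * d + 1) (2 * d + 1)) <|
      .seq (b.code (d + 2)) <|
      .seq (.op .lor (2 * x) (2 * (d + 1) + 1) (2 * (d + 1) + 1))
        (.op .lor (2 * d + 1) (2 * (d + 2) + 1) (2 * (d + 2) + 1))
  | sum x b e, d => .seq (b.code d) <|
      .seq (.op .lor (2 * (d + 1) + 1) (2 * x) (2 * x)) <|
      .seq (.const (2 * (d + 2) + 1) 0) <|
      .seq (.const (2 * x) 0) <|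
      .seq (.const (2 * (d + 3) + 1) 1) <|
      .seq (.op .lt (2 * (d + 4) + 1) (2 * x) (2 * d + 1)) <|
      .seq (.loop (2 * (d + 4) + 1) <| .seq (e.code (d + 5)) <|
        .seq (.op .add (2 * (d + 2) + 1) (2 * (d + 2) + 1) (2 * (d + 5) + 1)) <|
        .seq (.op .add (2 * x) (2 * x) (2 * (d + 3) + 1))
          (.op .lt (2 * (d + 4) + 1) (2 * x) (2 * d + 1))) <|
      .seq (.op .lor (2 * x) (2 * (d + 1) + 1) (2 * (d + 1) + 1))
        (.op .lor (2 * d + 1) (2 * (d + 2) + 1) (2 * (d + 2) + 1))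

end Expr

/-- The machine state `σ` represents the state `s` of the structured language. -/
def Rel (s σ : State) : Prop := (∀ x, σ.reg (2 * x) = s.reg x) ∧ σ.mem = s.mem

theorem Exec.op' {W : ℕ} {s s' : State} {o : Op} {r a b v : ℕ}
    (hv : o.eval (s.reg a) (s.reg b) = v) (h : v ≤ W) (hs : s' = s.setReg r v) :
    Exec W (.op o r a b) s 1 s' := by
  subst hv hs; exact Exec.op s o r a b h

/-- `σ'` differs from `σ` at most in the odd registers from `2 * d + 1` on, where `2 * d + 1`
holds `v`. -/
def Put (d v : ℕ) (σ σ' : State) : Prop :=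
  σ'.reg (2 * d + 1) = v ∧ (∀ x, σ'.reg (2 * x) = σ.reg (2 * x)) ∧
    (∀ j < d, σ'.reg (2 * j + 1) = σ.reg (2 * j + 1)) ∧ σ'.mem = σ.mem

theorem Put.rel {d v : ℕ} {s σ σ' : State} (h : Put d v σ σ') (hr : Rel s σ) : Rel s σ' :=
  ⟨fun x => by rw [h.2.1, hr.1], by rw [h.2.2.2, hr.2]⟩

namespace Expr

/-- One round of the loop that evaluates a sum adds a term. -/
theorem loop_exec {W x d B : ℕ} {e : Expr} {s : State} {f : ℕ → ℕ} {c : ℕ → ℕ}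
    (hW : 1 ≤ W) (hB : B ≤ W) (hS : ∑ i ∈ Finset.range B, f i ≤ W)
    (he : ∀ i < B, ∀ σ, Rel (s.setReg x i) σ → ∃ t ≤ c i, ∃ σ', Exec W (e.code (d + 5)) σ t σ' ∧
      Put (d + 5) (f i) σ σ') (j i : ℕ) (hij : i + j = B) (σ : State)
    (hσ : Rel (s.setReg x i) σ) (h0 : σ.reg (2 * d + 1) = B)
    (h2 : σ.reg (2 * (d + 2) + 1) = ∑ l ∈ Finset.range i, f l) (h3 : σ.reg (2 * (d + 3) + 1) = 1)
    (h4 : σ.reg (2 * (d + 4) + 1) = if i < B then 1 else 0) :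
    ∃ t ≤ (∑ l ∈ Finset.Ico i B, (c l + 4)) + 1, ∃ σ',
      Exec W (.loop (2 * (d + 4) + 1) <| .seq (e.code (d + 5)) <|
        .seq (.op .add (2 * (d + 2) + 1) (2 * (d + 2) + 1) (2 * (d + 5) + 1)) <|
        .seq (.op .add (2 * x) (2 * x) (2 * (d + 3) + 1))
          (.op .lt (2 * (d + 4) + 1) (2 * x) (2 * d + 1))) σ t σ' ∧
      (∀ y, y ≠ x → σ'.reg (2 * y) = σ.reg (2 * y)) ∧
      (∀ j < d + 2, σ'.reg (2 * j + 1) = σ.reg (2 * j + 1)) ∧ σ'.mem = σ.mem ∧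
      σ'.reg (2 * (d + 2) + 1) = ∑ l ∈ Finset.range B, f l := by
  induction j generalizing i σ with
  | zero =>
    obtain rfl : i = B := by omega
    refine ⟨1, by omega, σ, Exec.loopDone (by simpa using h4), fun _ _ => rfl, fun _ _ => rfl, rfl,
      h2⟩
  | succ j ih =>
    have hi : i < B := by omega
    obtain ⟨t, ht, σ₁, h₁, p1, p2, p3, p4⟩ := he i hi σ hσ
    set σ₂ := σ₁.setReg (2 * (d + 2) + 1) (∑ l ∈ Finset.range (i + 1), f l) with hσ₂
    set σ₃ := σ₂.setReg (2 * x) (i + 1) with hσ₃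
    set σ₄ := σ₃.setReg (2 * (d + 4) + 1) (if i + 1 < B then 1 else 0) with hσ₄
    have hle : ∑ l ∈ Finset.range (i + 1), f l ≤ W :=
      (Finset.sum_le_sum_of_subset (Finset.range_mono (by omega))).trans hS
    have hx : σ₁.reg (2 * x) = i := by rw [p2, hσ.1]; simp
    have e2 : Exec W (.op .add (2 * (d + 2) + 1) (2 * (d + 2) + 1) (2 * (d + 5) + 1)) σ₁ 1 σ₂ := by
      refine Exec.op' ?_ hle hσ₂
      rw [p3 _ (by omega), h2, p1, Finset.sum_range_succ]; rfl
    have e3 : Exec W (.op .add (2 * x) (2 * x) (2 * (d + 3) + 1)) σ₂ 1 σ₃ := by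
      refine Exec.op' ?_ (by omega) hσ₃
      simp only [hσ₂, State.reg_setReg, Op.eval]
      rw [if_neg (by omega), if_neg (by omega), hx, p3 _ (by omega), h3]
    have e4 : Exec W (.op .lt (2 * (d + 4) + 1) (2 * x) (2 * d + 1)) σ₃ 1 σ₄ := by
      have hl : σ₃.reg (2 * x) = i + 1 := by simp [hσ₃]
      have hr : σ₃.reg (2 * d + 1) = B := by
        simp only [hσ₃, hσ₂, State.reg_setReg]
        rw [if_neg (by omega), if_neg (by omega), p3 _ (by omega), h0]
      exact Exec.op' (by rw [hl, hr]; rfl) (by split_ifs <;> omega) hσ₄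
    have hrel : Rel (s.setReg x (i + 1)) σ₄ := by
      refine ⟨fun y => ?_, ?_⟩
      · simp only [hσ₄, hσ₃, hσ₂, State.reg_setReg]
        rw [if_neg (by omega), if_neg (by omega : ¬ 2 * y = 2 * (d + 2) + 1), p2, hσ.1]
        by_cases h : y = x <;> simp [h]
      · simp only [hσ₄, hσ₃, hσ₂, State.mem_setReg, p4]; exact hσ.2
    obtain ⟨t', ht', σ', hex, q1, q2, q3, q4⟩ := ih (i + 1) (by omega) σ₄ hrel
      (by simp only [hσ₄, hσ₃, hσ₂, State.reg_setReg]
          rw [if_neg (by omega), if_neg (by omega), if_neg (by omega), p3 _ (by omega), h0])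
      (by simp only [hσ₄, hσ₃, hσ₂, State.reg_setReg]
          rw [if_neg (by omega), if_neg (by omega), if_pos trivial])
      (by simp only [hσ₄, hσ₃, hσ₂, State.reg_setReg]
          rw [if_neg (by omega), if_neg (by omega), if_neg (by omega), p3 _ (by omega), h3])
      (by simp [hσ₄])
    refine ⟨_, ?_, σ', Exec.loopStep (by rw [h4, if_pos hi]; simp)
      (Exec.seq h₁ (Exec.seq e2 (Exec.seq e3 e4))) hex, ?_, ?_, ?_, q4⟩
    · rw [Finset.sum_eq_sum_Ico_succ_bot hi]; omega
    · intro y hy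
      rw [q1 y hy]; simp only [hσ₄, hσ₃, hσ₂, State.reg_setReg]
      rw [if_neg (by omega), if_neg (by omega), if_neg (by omega), p2]
    · intro l hl
      rw [q2 l hl]; simp only [hσ₄, hσ₃, hσ₂, State.reg_setReg]
      rw [if_neg (by omega), if_neg (by omega), if_neg (by omega), p3 _ (by omega)]
    · rw [q3]; simp [hσ₄, hσ₃, hσ₂, p4]

/-- This is how registers are copied: the compiled code moves a word by `lor` of a register with
itself, which never exceeds the word bound. -/
theorem lor_self_eval (x : ℕ) : Op.lor.eval x x = x := by simp [Op.eval]

/-- The code of an expression computes its value. -/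
theorem code_exec {W : ℕ} (e : Expr) (d : ℕ) (s σ : State) (hok : e.Ok W s) (hr : Rel s σ) :
    ∃ t ≤ e.cost s, ∃ σ', Exec W (e.code d) σ t σ' ∧ Put d (e.eval s) σ σ' := by
  induction e generalizing d s σ with
  | const c =>
    refine ⟨1, le_rfl, _, Exec.const σ _ c hok, ?_⟩
    refine ⟨by simp [eval], fun x => ?_, fun j hj => ?_, rfl⟩ <;> simp <;> intros <;> omega
  | var x =>
    refine ⟨1, le_rfl, σ.setReg (2 * d + 1) (s.reg x),
      Exec.op' (by rw [hr.1, lor_self_eval]) hok rfl, ?_⟩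
    refine ⟨by simp [eval], fun x => ?_, fun j hj => ?_, rfl⟩ <;> simp <;> intros <;> omega
  | load a iha =>
    obtain ⟨t, ht, σ₁, h₁, p1, p2, p3, p4⟩ := iha d s σ hok.1 hr
    refine ⟨t + 1, by simp only [cost]; omega, _, Exec.seq h₁ (Exec.load σ₁ _ _), ?_⟩
    refine ⟨by simp [eval, p1, p4, hr.2], fun x => ?_, fun j hj => ?_, by simp [p4]⟩
    · simp only [State.reg_setReg]; rw [if_neg (by omega), p2]
    · simp only [State.reg_setReg]; rw [if_neg (by omega), p3 _ hj]
  | op o a b iha ihb =>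
    obtain ⟨t, ht, σ₁, h₁, p⟩ := iha d s σ hok.1 hr
    obtain ⟨t', ht', σ₂, h₂, q⟩ := ihb (d + 1) s σ₁ hok.2.1 (p.rel hr)
    refine ⟨t + (t' + 1), by simp only [cost]; omega, _, Exec.seq h₁ (Exec.seq h₂
      (Exec.op' (v := o.eval (a.eval s) (b.eval s)) ?_ hok.2.2 rfl)), ?_⟩
    -- The code of `b` works at depth `d + 1` and so preserves the value of `a` in register `2 * d +
    -- 1`.
    · rw [q.2.2.1 _ (by omega), p.1, q.1]
    refine ⟨by simp [eval], fun x => ?_, fun j hj => ?_, by simp [p.2.2.2, q.2.2.2]⟩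
    · simp only [State.reg_setReg]; rw [if_neg (by omega), q.2.1, p.2.1]
    · simp only [State.reg_setReg]
      rw [if_neg (by omega), q.2.2.1 _ (by omega), p.2.2.1 _ (by omega)]
  | ite c a b ihc iha ihb =>
    obtain ⟨t, ht, σ₁, h₁, p⟩ := ihc d s σ hok.1 hr
    have key : ∀ (e : Expr), (∃ t ≤ e.cost s, ∃ σ', Exec W (e.code d) σ₁ t σ' ∧
        Put d (e.eval s) σ₁ σ') → ∃ t ≤ e.cost s, ∃ σ', Exec W (e.code d) σ₁ t σ' ∧
        Put d (e.eval s) σ σ' := by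
      rintro e ⟨t', ht', σ₂, h₂, q⟩
      exact ⟨t', ht', σ₂, h₂, q.1, fun x => by rw [q.2.1, p.2.1],
        fun j hj => by rw [q.2.2.1 _ hj, p.2.2.1 _ hj], by rw [q.2.2.2, p.2.2.2]⟩
    simp only [eval, cost]
    by_cases hc : c.eval s ≠ 0
    · obtain ⟨t', ht', σ₂, h₂, q⟩ := key a (iha d s σ₁ hok.2.1 (p.rel hr))
      rw [if_pos hc, if_pos hc]
      exact ⟨t + (t' + 1), by omega, σ₂, Exec.seq h₁ (Exec.iteTrue (by rw [p.1]; exact hc) h₂), q⟩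
    · obtain ⟨t', ht', σ₂, h₂, q⟩ := key b (ihb d s σ₁ hok.2.2 (p.rel hr))
      rw [if_neg hc, if_neg hc]
      exact ⟨t + (t' + 1), by omega, σ₂,
        Exec.seq h₁ (Exec.iteFalse (by rw [p.1]; simpa using hc) h₂), q⟩
  | letE x a b iha ihb =>
    obtain ⟨t, ht, σ₁, h₁, p⟩ := iha d s σ hok.2.1 hr
    -- The old value of `x` is parked in the temporary `d + 1` and restored at the end, so a local
    -- definition has no side effect; the body uses temporaries from `d + 2` on.
    set σ₂ := σ₁.setReg (2 * (d + 1) + 1) (s.reg x) with hσ₂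
    set σ₃ := σ₂.setReg (2 * x) (a.eval s) with hσ₃
    have e2 : Exec W (.op .lor (2 * (d + 1) + 1) (2 * x) (2 * x)) σ₁ 1 σ₂ :=
      Exec.op' (by rw [p.2.1, hr.1, lor_self_eval]) hok.1 hσ₂
    have e3 : Exec W (.op .lor (2 * x) (2 * d + 1) (2 * d + 1)) σ₂ 1 σ₃ := by
      refine Exec.op' ?_ hok.2.1.eval_le hσ₃
      rw [lor_self_eval, hσ₂, State.reg_setReg, if_neg (by omega), p.1]
    have hrel : Rel (s.setReg x (a.eval s)) σ₃ := by
      refine ⟨fun y => ?_, ?_⟩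
      · simp only [hσ₃, hσ₂, State.reg_setReg]
        rw [if_neg (by omega : ¬ 2 * y = 2 * (d + 1) + 1), p.2.1, hr.1]
        by_cases h : y = x <;> simp [h]
      · simp only [hσ₃, hσ₂, State.mem_setReg, p.2.2.2, hr.2]
    obtain ⟨t', ht', σ₄, h₄, q⟩ := ihb (d + 2) _ σ₃ hok.2.2 hrel
    set σ₅ := σ₄.setReg (2 * x) (s.reg x) with hσ₅
    set σ₆ := σ₅.setReg (2 * d + 1) (b.eval (s.setReg x (a.eval s))) with hσ₆
    have e5 : Exec W (.op .lor (2 * x) (2 * (d + 1) + 1) (2 * (d + 1) + 1)) σ₄ 1 σ₅ := by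
      refine Exec.op' ?_ hok.1 hσ₅
      rw [lor_self_eval, q.2.2.1 _ (by omega), hσ₃, hσ₂, State.reg_setReg, if_neg (by omega)]
      simp
    have e6 : Exec W (.op .lor (2 * d + 1) (2 * (d + 2) + 1) (2 * (d + 2) + 1)) σ₅ 1 σ₆ := by
      refine Exec.op' ?_ hok.2.2.eval_le hσ₆
      rw [lor_self_eval, hσ₅, State.reg_setReg, if_neg (by omega), q.1]
    refine ⟨_, ?_, σ₆, Exec.seq h₁ (Exec.seq e2 (Exec.seq e3 (Exec.seq h₄ (Exec.seq e5 e6)))),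
      ?_, ?_, ?_, ?_⟩
    · simp only [cost]; omega
    · simp [hσ₆, eval]
    · intro y
      simp only [hσ₆, hσ₅, State.reg_setReg]
      rw [if_neg (by omega), q.2.1]
      by_cases h : y = x
      · subst h; simp [hr.1]
      · rw [if_neg (by omega), hσ₃, hσ₂, State.reg_setReg, State.reg_setReg, if_neg (by omega),
          if_neg (by omega), p.2.1]
    · intro j hj
      simp only [hσ₆, hσ₅, State.reg_setReg]
      rw [if_neg (by omega), if_neg (by omega), q.2.2.1 _ (by omega), hσ₃, hσ₂, State.reg_setReg,
        State.reg_setReg, if_neg (by omega), if_neg (by omega), p.2.2.1 _ hj]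
    · simp [hσ₆, hσ₅, q.2.2.2, hσ₃, hσ₂, p.2.2.2]
  | sum x b e ihb ihe =>
    obtain ⟨hW, hxW, hb, he, hS⟩ := hok
    obtain ⟨t, ht, σ₁, h₁, p⟩ := ihb d s σ hb hr
    set B := b.eval s with hB
    -- The five temporaries from `d` on hold the number of terms, the old value of `x`, the partial
    -- sum, the constant `1`, and the loop test. The summand is evaluated from `d + 5` on.
    set σ₂ := σ₁.setReg (2 * (d + 1) + 1) (s.reg x) with hσ₂
    set σ₃ := σ₂.setReg (2 * (d + 2) + 1) 0 with hσ₃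
    set σ₄ := σ₃.setReg (2 * x) 0 with hσ₄
    set σ₅ := σ₄.setReg (2 * (d + 3) + 1) 1 with hσ₅
    set σ₆ := σ₅.setReg (2 * (d + 4) + 1) (if 0 < B then 1 else 0) with hσ₆
    have e2 : Exec W (.op .lor (2 * (d + 1) + 1) (2 * x) (2 * x)) σ₁ 1 σ₂ :=
      Exec.op' (by rw [p.2.1, hr.1, lor_self_eval]) hxW hσ₂
    have e3 : Exec W (.const (2 * (d + 2) + 1) 0) σ₂ 1 σ₃ := Exec.const _ _ _ (by omega)
    have e4 : Exec W (.const (2 * x) 0) σ₃ 1 σ₄ := Exec.const _ _ _ (by omega)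
    have e5 : Exec W (.const (2 * (d + 3) + 1) 1) σ₄ 1 σ₅ := Exec.const _ _ _ hW
    have e6 : Exec W (.op .lt (2 * (d + 4) + 1) (2 * x) (2 * d + 1)) σ₅ 1 σ₆ := by
      have hl : σ₅.reg (2 * x) = 0 := by
        simp only [hσ₅, hσ₄, State.reg_setReg]
        rw [if_neg (by omega), if_pos trivial]
      have hr : σ₅.reg (2 * d + 1) = B := by
        simp only [hσ₅, hσ₄, hσ₃, hσ₂, State.reg_setReg]
        rw [if_neg (by omega), if_neg (by omega), if_neg (by omega), if_neg (by omega), p.1]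
      exact Exec.op' (by rw [hl, hr]; rfl) (by split_ifs <;> omega) hσ₆
    have hrel : Rel (s.setReg x 0) σ₆ := by
      refine ⟨fun y => ?_, ?_⟩
      · simp only [hσ₆, hσ₅, hσ₄, hσ₃, hσ₂, State.reg_setReg]
        rw [if_neg (by omega), if_neg (by omega), if_neg (by omega : ¬ 2 * y = 2 * (d + 2) + 1),
          if_neg (by omega : ¬ 2 * y = 2 * (d + 1) + 1), p.2.1, hr.1]
        by_cases h : y = x <;> simp [h]
      · simp only [hσ₆, hσ₅, hσ₄, hσ₃, hσ₂, State.mem_setReg, p.2.2.2, hr.2]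
    have r6 : ∀ j < d, σ₆.reg (2 * j + 1) = σ.reg (2 * j + 1) := fun j hj => by
      simp only [hσ₆, hσ₅, hσ₄, hσ₃, hσ₂, State.reg_setReg]
      rw [if_neg (by omega), if_neg (by omega), if_neg (by omega), if_neg (by omega),
        if_neg (by omega), p.2.2.1 _ hj]
    have r6' : ∀ y, y ≠ x → σ₆.reg (2 * y) = σ.reg (2 * y) := fun y hy => by
      simp only [hσ₆, hσ₅, hσ₄, hσ₃, hσ₂, State.reg_setReg]
      rw [if_neg (by omega), if_neg (by omega), if_neg (by omega), if_neg (by omega),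
        if_neg (by omega), p.2.1]
    obtain ⟨t', ht', σ₇, h₇, q1, q2, q3, q4⟩ := loop_exec (W := W) (x := x) (d := d) (B := B)
      (e := e) (s := s) (f := fun i => e.eval (s.setReg x i)) (c := fun i => e.cost (s.setReg x i))
      hW hb.eval_le hS (fun i hi σ hσ => ihe (d + 5) _ σ (he i hi) hσ) B 0 (by omega) σ₆ hrel
      (by simp only [hσ₆, hσ₅, hσ₄, hσ₃, hσ₂, State.reg_setReg]
          rw [if_neg (by omega), if_neg (by omega), if_neg (by omega), if_neg (by omega),
            if_neg (by omega), p.1])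
      (by simp only [hσ₆, hσ₅, hσ₄, hσ₃, hσ₂, State.reg_setReg]
          rw [if_neg (by omega), if_neg (by omega), if_neg (by omega), if_pos trivial]; simp)
      (by simp only [hσ₆, hσ₅, State.reg_setReg]
          rw [if_neg (by omega), if_pos trivial])
      (by simp [hσ₆])
    have hx7 : σ₇.reg (2 * (d + 1) + 1) = s.reg x := by
      rw [q2 _ (by omega)]; simp only [hσ₆, hσ₅, hσ₄, hσ₃, hσ₂, State.reg_setReg]
      rw [if_neg (by omega), if_neg (by omega), if_neg (by omega), if_neg (by omega), if_pos trivial]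
    set σ₈ := σ₇.setReg (2 * x) (s.reg x) with hσ₈
    set σ₉ := σ₈.setReg (2 * d + 1) (∑ i ∈ Finset.range B, e.eval (s.setReg x i)) with hσ₉
    have e8 : Exec W (.op .lor (2 * x) (2 * (d + 1) + 1) (2 * (d + 1) + 1)) σ₇ 1 σ₈ :=
      Exec.op' (by rw [lor_self_eval, hx7]) hxW hσ₈
    have e9 : Exec W (.op .lor (2 * d + 1) (2 * (d + 2) + 1) (2 * (d + 2) + 1)) σ₈ 1 σ₉ := by
      refine Exec.op' ?_ hS hσ₉
      rw [lor_self_eval, hσ₈, State.reg_setReg, if_neg (by omega), q4]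
    refine ⟨_, ?_, σ₉, Exec.seq h₁ (Exec.seq e2 (Exec.seq e3 (Exec.seq e4 (Exec.seq e5
      (Exec.seq e6 (Exec.seq h₇ (Exec.seq e8 e9))))))), ?_, ?_, ?_, ?_⟩
    · simp only [cost]; rw [← Finset.range_eq_Ico, hB] at ht'; omega
    · simp [hσ₉, eval, hB]
    · intro y
      simp only [hσ₉, hσ₈, State.reg_setReg]
      rw [if_neg (by omega)]
      by_cases h : y = x
      · subst h; simp [hr.1]
      · rw [if_neg (by omega), q1 y h, r6' y h]
    · intro j hj
      simp only [hσ₉, hσ₈, State.reg_setReg]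
      rw [if_neg (by omega), if_neg (by omega), q2 _ (by omega), r6 j hj]
    · simp [hσ₉, hσ₈, q3, hσ₆, hσ₅, hσ₄, hσ₃, hσ₂, p.2.2.2]

end Expr

end WordRAM

/-! ### Bounds for values and costs of expressions; statements and their compilation. -/

namespace WordRAM

/-- All registers and all memory cells hold values that are at most `X`. -/
def State.Bdd (X : ℕ) (s : State) : Prop := (∀ r, s.reg r ≤ X) ∧ ∀ i, s.mem i ≤ X

theorem State.Bdd.mono {X Y : ℕ} {s : State} (h : s.Bdd X) (hXY : X ≤ Y) : s.Bdd Y :=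
  ⟨fun r => (h.1 r).trans hXY, fun i => (h.2 i).trans hXY⟩

theorem State.Bdd.setReg {X : ℕ} {s : State} (h : s.Bdd X) (x : ℕ) {v : ℕ} (hv : v ≤ X) :
    (s.setReg x v).Bdd X := by
  refine ⟨fun r => ?_, fun i => h.2 i⟩
  rw [State.reg_setReg]; split_ifs
  exacts [hv, h.1 r]

theorem State.Bdd.setMem {X : ℕ} {s : State} (h : s.Bdd X) (x : ℕ) {v : ℕ} (hv : v ≤ X) :
    (s.setMem x v).Bdd X := by
  refine ⟨fun i => h.1 i, fun r => ?_⟩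
  rw [State.mem_setMem]; split_ifs
  exacts [hv, h.2 r]

namespace Expr

/-- If all values of the state are at most `X`, then those of the expression are at most
`X ^ e.deg`. -/
def deg : Expr → ℕ
  | const _ => 1
  | var _ => 1
  | load a => a.deg
  | op _ a b => a.deg + b.deg
  | ite c a b => c.deg + a.deg + b.deg
  | letE _ a b => a.deg * (b.deg + 1)
  | sum _ b e => b.deg * (e.deg + 1)

/-- The largest constant of an expression. -/
def cmax : Expr → ℕ
  | const c => c
  | var _ => 0
  | load a => a.cmax
  | op _ a b => max a.cmax b.cmax
  | ite c a b => max c.cmax (max a.cmax b.cmax)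
  | letE _ a b => max a.cmax b.cmax
  | sum _ b e => max b.cmax e.cmax

/-- The size of an expression, up to a constant. -/
def size : Expr → ℕ
  | const _ => 1
  | var _ => 1
  | load a => a.size + 1
  | op _ a b => a.size + b.size + 1
  | ite c a b => c.size + a.size + b.size + 1
  | letE _ a b => a.size + b.size + 4
  | sum _ b e => b.size + e.size + 12

/-- The nesting depth of sums. -/
def depth : Expr → ℕ
  | const _ => 0
  | var _ => 0
  | load a => a.depth
  | op _ a b => max a.depth b.depth
  | ite c a b => max c.depth (max a.depth b.depth)
  | letE _ a b => max a.depth b.depth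
  | sum _ b e => max b.depth (e.depth + 1)

/-- All sums have at most `Y` terms. -/
def Short (Y : ℕ) : Expr → State → Prop
  | const _, _ => True
  | var _, _ => True
  | load a, s => a.Short Y s
  | op _ a b, s => a.Short Y s ∧ b.Short Y s
  | ite c a b, s => c.Short Y s ∧ (c.eval s ≠ 0 → a.Short Y s) ∧ (c.eval s = 0 → b.Short Y s)
  | letE x a b, s => a.Short Y s ∧ b.Short Y (s.setReg x (a.eval s))
  | sum x b e, s => b.Short Y s ∧ b.eval s ≤ Y ∧ ∀ i < b.eval s, e.Short Y (s.setReg x i)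

theorem deg_pos (e : Expr) : 1 ≤ e.deg := by
  induction e with
  | letE _ a b iha _ => exact Nat.mul_pos iha (Nat.succ_pos _)
  | sum _ b e ihb _ => exact Nat.mul_pos ihb (Nat.succ_pos _)
  | const | var => exact le_rfl
  | load a ih => exact ih
  | op | ite => simp only [deg]; omega

/-- By structural induction with `X` varying. Under a binder the new variable may be as large as `X
^ a.deg`, so the body is estimated with that power in place of `X` and degrees multiply. A sum has
one more such factor for its number of terms. Since degrees are fixed numbers, polynomially bounded
states never overflow a suitable polynomial word bound. -/
theorem ok_of_bdd {X : ℕ} (hX : 2 ≤ X) {e : Expr} {s : State} (hs : s.Bdd X) (hc : e.cmax ≤ X)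
    {W : ℕ} (hW : X ^ e.deg ≤ W) : e.Ok W s ∧ e.eval s ≤ X ^ e.deg := by
  induction e generalizing X W s with
  | const c => simp only [deg, pow_one, cmax] at *; exact ⟨hc.trans hW, hc⟩
  | var x => simp only [deg, pow_one, cmax] at *; exact ⟨(hs.1 x).trans hW, hs.1 x⟩
  | load a ih =>
    have h := (hs.2 (a.eval s)).trans (Nat.le_self_pow (Nat.pos_iff_ne_zero.1 a.deg_pos) X)
    exact ⟨⟨(ih hX hs hc hW).1, h.trans hW⟩, h⟩
  | op o a b iha ihb =>
    simp only [cmax, max_le_iff] at hc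
    have h1 : X ^ a.deg ≤ W := (Nat.pow_le_pow_right (by omega) (by simp [deg])).trans hW
    have h2 : X ^ b.deg ≤ W := (Nat.pow_le_pow_right (by omega) (by simp [deg])).trans hW
    have ha := iha hX hs hc.1 h1
    have hb := ihb hX hs hc.2 h2
    have h := Op.eval_le_of_le hX a.deg_pos b.deg_pos o ha.2 hb.2
    exact ⟨⟨ha.1, hb.1, h.trans hW⟩, h⟩
  | ite c a b ihc iha ihb =>
    simp only [cmax, max_le_iff] at hc
    have h0 : X ^ c.deg ≤ W := (Nat.pow_le_pow_right (by omega) (by simp [deg]; omega)).trans hW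
    have h1' : X ^ a.deg ≤ X ^ (ite c a b).deg :=
      Nat.pow_le_pow_right (by omega) (by simp [deg]; omega)
    have h2' : X ^ b.deg ≤ X ^ (ite c a b).deg :=
      Nat.pow_le_pow_right (by omega) (by simp [deg])
    have ha := iha hX hs hc.2.1 (h1'.trans hW)
    have hb := ihb hX hs hc.2.2 (h2'.trans hW)
    refine ⟨⟨(ihc hX hs hc.1 h0).1, ha.1, hb.1⟩, ?_⟩
    simp only [eval]; split_ifs
    exacts [ha.2.trans h1', hb.2.trans h2']
  | letE x a b iha ihb =>
    simp only [cmax, max_le_iff] at hc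
    have hp := a.deg_pos
    have h1 : X ^ a.deg ≤ W :=
      (Nat.pow_le_pow_right (by omega) (by simp only [deg]; nlinarith)).trans hW
    have ha := iha hX hs hc.1 h1
    have hX' : X ≤ X ^ a.deg := Nat.le_self_pow (by omega) X
    have hle : (X ^ a.deg) ^ b.deg ≤ X ^ (letE x a b).deg := by
      rw [← pow_mul]; exact Nat.pow_le_pow_right (by omega) (by simp only [deg]; nlinarith)
    have hb := ihb (hX.trans hX') ((hs.mono hX').setReg x ha.2) (hc.2.trans hX') (hle.trans hW)
    exact ⟨⟨(hs.1 x).trans (hX'.trans h1), ha.1, hb.1⟩, hb.2.trans hle⟩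
  | sum x b e ihb ihe =>
    simp only [cmax, max_le_iff] at hc
    have hp := b.deg_pos
    have h1 : X ^ b.deg ≤ W :=
      (Nat.pow_le_pow_right (by omega) (by simp only [deg]; nlinarith)).trans hW
    have hb := ihb hX hs hc.1 h1
    have hX' : X ≤ X ^ b.deg := Nat.le_self_pow (by omega) X
    have heq : X ^ b.deg * (X ^ b.deg) ^ e.deg = X ^ (sum x b e).deg := by
      rw [← pow_mul, ← pow_add]; simp only [deg]; ring_nf
    have hle : (X ^ b.deg) ^ e.deg ≤ X ^ (sum x b e).deg := by
      rw [← heq]; exact Nat.le_mul_of_pos_left _ (by positivity)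
    have he : ∀ i < b.eval s, _ := fun i hi => ihe (s := s.setReg x i) (hX.trans hX')
      ((hs.mono hX').setReg x (hi.le.trans hb.2)) (hc.2.trans hX') (hle.trans hW)
    have hsum : ∑ i ∈ Finset.range (b.eval s), e.eval (s.setReg x i) ≤ X ^ (sum x b e).deg := by
      rw [← heq]
      refine (Finset.sum_le_card_nsmul _ _ ((X ^ b.deg) ^ e.deg)
        fun i hi => (he i (Finset.mem_range.1 hi)).2).trans ?_
      simp only [Finset.card_range, smul_eq_mul]
      exact Nat.mul_le_mul_right _ hb.2
    exact ⟨⟨by omega, (hs.1 x).trans (hX'.trans h1), hb.1, fun i hi => (he i hi).1,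
      hsum.trans hW⟩, hsum⟩

theorem cost_sum_le {x : ℕ} {b e : Expr} {s : State} {T : ℕ}
    (h : ∀ i < b.eval s, e.cost (s.setReg x i) ≤ T) :
    (sum x b e).cost s ≤ b.cost s + b.eval s * (T + 4) + 8 := by
  simp only [cost]
  have := Finset.sum_le_card_nsmul (Finset.range (b.eval s)) (fun i => e.cost (s.setReg x i) + 4)
    (T + 4) fun i hi => by have := h i (Finset.mem_range.1 hi); omega
  simp only [Finset.card_range, smul_eq_mul] at this
  omega

/-- Every level of nested sums multiplies the cost by at most `Y + 1`. The base is `Y + 1` rather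
than `Y` so that all powers are at least `1` and can absorb the additive costs. -/
theorem cost_le_of_short {Y : ℕ} {e : Expr} {s : State} (h : e.Short Y s) :
    e.cost s ≤ e.size * (Y + 1) ^ e.depth := by
  have mono : ∀ {i j : ℕ}, i ≤ j → (Y + 1) ^ i ≤ (Y + 1) ^ j := fun hij =>
    Nat.pow_le_pow_right (Nat.succ_pos Y) hij
  have pos : ∀ i : ℕ, 1 ≤ (Y + 1) ^ i := fun i => Nat.one_le_pow _ _ (Nat.succ_pos Y)
  induction e generalizing s with
  | const c => simp [cost, size, depth]
  | var c => simp [cost, size, depth]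
  | load a ih => simp only [cost, size, depth]; have := ih h; have := pos a.depth; nlinarith
  | op o a b iha ihb =>
    have h1 := (iha h.1).trans (Nat.mul_le_mul_left a.size (mono (le_max_left a.depth b.depth)))
    have h2 := (ihb h.2).trans (Nat.mul_le_mul_left b.size (mono (le_max_right a.depth b.depth)))
    have := pos (max a.depth b.depth)
    simp only [cost, size, depth]; nlinarith
  | ite c a b ihc iha ihb =>
    simp only [cost, size, depth]
    have h0 := (ihc h.1).trans (Nat.mul_le_mul_left c.size
      (mono (le_max_left c.depth (max a.depth b.depth))))
    have := pos (max c.depth (max a.depth b.depth))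
    split_ifs with hc
    · have := (iha (h.2.1 hc)).trans (Nat.mul_le_mul_left a.size
        (mono ((le_max_left a.depth b.depth).trans (le_max_right c.depth _))))
      nlinarith [Nat.zero_le (b.size * (Y + 1) ^ max c.depth (max a.depth b.depth))]
    · have := (ihb (h.2.2 (by simpa using hc))).trans (Nat.mul_le_mul_left b.size
        (mono ((le_max_right a.depth b.depth).trans (le_max_right c.depth _))))
      nlinarith [Nat.zero_le (a.size * (Y + 1) ^ max c.depth (max a.depth b.depth))]
  | letE x a b iha ihb =>
    have h1 := (iha h.1).trans (Nat.mul_le_mul_left a.size (mono (le_max_left a.depth b.depth)))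
    have h2 := (ihb h.2).trans (Nat.mul_le_mul_left b.size (mono (le_max_right a.depth b.depth)))
    have := pos (max a.depth b.depth)
    simp only [cost, size, depth]; nlinarith
  | sum x b e ihb ihe =>
    have h1 := (ihb h.1).trans (Nat.mul_le_mul_left b.size
      (mono (le_max_left b.depth (e.depth + 1))))
    have h2 := cost_sum_le fun i hi => ihe (h.2.2 i hi)
    have h3 : b.eval s * (e.size * (Y + 1) ^ e.depth + 4) ≤ (e.size + 4) * (Y + 1) ^ (e.depth + 1) := by
      rw [pow_succ]
      have := pos e.depth
      calc _ ≤ (Y + 1) * (e.size * (Y + 1) ^ e.depth + 4 * (Y + 1) ^ e.depth) :=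
            Nat.mul_le_mul (by have := h.2.1; omega) (by omega)
        _ = _ := by ring
    have h4 := h3.trans (Nat.mul_le_mul_left (e.size + 4)
      (mono (le_max_right b.depth (e.depth + 1))))
    have := pos (max b.depth (e.depth + 1))
    simp only [size, depth]; nlinarith

end Expr

/-- Statements of the structured language. -/
inductive Stmt where
  | skip
  | assign (x : ℕ) (e : Expr)
  | store (a e : Expr)
  | seq (p q : Stmt)
  | ite (c : Expr) (p q : Stmt)
  | loop (c : Expr) (p : Stmt)

namespace Stmt

/-- The translation into word RAM programs. -/
def compile : Stmt → Prog
  | skip => .skip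
  | assign x e => .seq (e.code 0) (.op .lor (2 * x) 1 1)
  | store a e => .seq (a.code 0) (.seq (e.code 1) (.store 1 3))
  | seq p q => .seq p.compile q.compile
  | ite c p q => .seq (c.code 0) (.ite 1 p.compile q.compile)
  | loop c p => .seq (c.code 0) (.loop 1 (.seq p.compile (c.code 0)))

/-- The largest degree of an expression of the statement. -/
def deg : Stmt → ℕ
  | skip => 1
  | assign _ e => e.deg
  | store a e => max a.deg e.deg
  | seq p q => max p.deg q.deg
  | ite c p q => max c.deg (max p.deg q.deg)
  | loop c p => max c.deg p.deg

/-- The largest constant of the statement. -/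
def cmax : Stmt → ℕ
  | skip => 0
  | assign _ e => e.cmax
  | store a e => max a.cmax e.cmax
  | seq p q => max p.cmax q.cmax
  | ite c p q => max c.cmax (max p.cmax q.cmax)
  | loop c p => max c.cmax p.cmax

end Stmt

/-- `HExec X p s t s'`: the statement `p` started in `s` halts in state `s'`, within `t` steps
after compilation, and all values that it writes are at most `X`. -/
inductive HExec (X : ℕ) : Stmt → State → ℕ → State → Prop where
  | skip (s : State) : HExec X .skip s 1 s
  | assign (s : State) (x : ℕ) (e : Expr) (h : e.eval s ≤ X) :
      HExec X (.assign x e) s (e.cost s + 1) (s.setReg x (e.eval s))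
  | store (s : State) (a e : Expr) (h : e.eval s ≤ X) :
      HExec X (.store a e) s (a.cost s + e.cost s + 1) (s.setMem (a.eval s) (e.eval s))
  | seq {p q : Stmt} {s s₁ s₂ : State} {t₁ t₂ : ℕ} (h₁ : HExec X p s t₁ s₁)
      (h₂ : HExec X q s₁ t₂ s₂) : HExec X (.seq p q) s (t₁ + t₂) s₂
  | iteTrue {c : Expr} {p q : Stmt} {s s₁ : State} {t : ℕ} (hc : c.eval s ≠ 0)
      (h : HExec X p s t s₁) : HExec X (.ite c p q) s (c.cost s + t + 1) s₁
  | iteFalse {c : Expr} {p q : Stmt} {s s₁ : State} {t : ℕ} (hc : c.eval s = 0)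
      (h : HExec X q s t s₁) : HExec X (.ite c p q) s (c.cost s + t + 1) s₁
  | loopDone {c : Expr} {p : Stmt} {s : State} (hc : c.eval s = 0) :
      HExec X (.loop c p) s (c.cost s + 1) s
  | loopStep {c : Expr} {p : Stmt} {s s₁ s₂ : State} {t₁ t₂ : ℕ} (hc : c.eval s ≠ 0)
      (h₁ : HExec X p s t₁ s₁) (h₂ : HExec X (.loop c p) s₁ t₂ s₂) :
      HExec X (.loop c p) s (c.cost s + t₁ + t₂ + 1) s₂

theorem HExec.bdd {X : ℕ} {p : Stmt} {s s' : State} {t : ℕ} (h : HExec X p s t s')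
    (hs : s.Bdd X) : s'.Bdd X := by
  induction h with
  | skip | loopDone => exact hs
  | assign s x e h => exact hs.setReg x h
  | store s a e h => exact hs.setMem _ h
  | seq _ _ ih₁ ih₂ => exact ih₂ (ih₁ hs)
  | iteTrue _ _ ih => exact ih hs
  | iteFalse _ _ ih => exact ih hs
  | loopStep _ _ _ ih₁ ih₂ => exact ih₂ (ih₁ hs)

/-- The compiled program runs as the statement does. -/
theorem HExec.exec {X W : ℕ} (hX : 2 ≤ X) {p : Stmt} {s s' : State} {t : ℕ} (h : HExec X p s t s')
    (hs : s.Bdd X) (hc : p.cmax ≤ X) (hW : X ^ p.deg ≤ W) {σ : State} (hr : Rel s σ) :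
    ∃ t' ≤ t, ∃ σ', Exec W p.compile σ t' σ' ∧ Rel s' σ' := by
  have pw : ∀ {i j : ℕ}, i ≤ j → X ^ j ≤ W → X ^ i ≤ W := fun hij h =>
    (Nat.pow_le_pow_right (by omega) hij).trans h
  have code : ∀ {e : Expr} {s σ : State}, s.Bdd X → e.cmax ≤ X → X ^ e.deg ≤ W → Rel s σ →
      ∃ t ≤ e.cost s, ∃ σ', Exec W (e.code 0) σ t σ' ∧ Put 0 (e.eval s) σ σ' :=
    fun {e s σ} hs hc hW hr => e.code_exec 0 s σ (Expr.ok_of_bdd hX hs hc hW).1 hr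
  induction h generalizing σ with
  | skip s => exact ⟨1, le_rfl, σ, Exec.skip σ, hr⟩
  | assign s x e h =>
    obtain ⟨t, ht, σ₁, h₁, p⟩ := code hs hc hW hr
    refine ⟨t + 1, by omega, _, Exec.seq h₁ (Exec.op' (v := e.eval s) ?_ ?_ rfl), ?_, ?_⟩
    · rw [p.1, Expr.lor_self_eval]
    · exact ((Expr.ok_of_bdd hX hs hc hW).1).eval_le
    · intro y
      rw [State.reg_setReg, State.reg_setReg, p.2.1, hr.1]
      by_cases h : y = x <;> simp [h]
    · simp [p.2.2.2, hr.2]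
  | store s a e h =>
    simp only [Stmt.cmax, max_le_iff] at hc
    obtain ⟨t, ht, σ₁, h₁, p⟩ := code hs hc.1 (pw (le_max_left _ _) hW) hr
    obtain ⟨t', ht', σ₂, h₂, q⟩ := e.code_exec 1 s σ₁
      (Expr.ok_of_bdd hX hs hc.2 (pw (le_max_right _ _) hW)).1 (p.rel hr)
    refine ⟨t + (t' + 1), by omega, _, Exec.seq h₁ (Exec.seq h₂ (Exec.store σ₂ 1 3)), ?_, ?_⟩
    · intro y
      rw [State.reg_setMem, State.reg_setMem, q.2.1, p.2.1, hr.1]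
    · have e1 : σ₂.reg 1 = a.eval s := by rw [q.2.2.1 0 (by omega)]; exact p.1
      have e2 : σ₂.reg 3 = e.eval s := q.1
      rw [e1, e2]; simp only [State.setMem, q.2.2.2, p.2.2.2, hr.2]
  | seq _ _ ih₁ ih₂ =>
    rename_i h₁ _
    simp only [Stmt.cmax, max_le_iff] at hc
    obtain ⟨t, ht, σ₁, e₁, r₁⟩ := ih₁ hs hc.1 (pw (le_max_left _ _) hW) hr
    obtain ⟨t', ht', σ₂, e₂, r₂⟩ := ih₂ (h₁.bdd hs) hc.2 (pw (le_max_right _ _) hW) r₁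
    exact ⟨t + t', by omega, σ₂, Exec.seq e₁ e₂, r₂⟩
  | iteTrue hc' _ ih =>
    simp only [Stmt.cmax, max_le_iff] at hc
    obtain ⟨t, ht, σ₁, h₁, p⟩ := code hs hc.1 (pw (le_max_left _ _) hW) hr
    obtain ⟨t', ht', σ₂, e₂, r₂⟩ := ih hs hc.2.1
      (pw ((le_max_left _ _).trans (le_max_right _ _)) hW) (p.rel hr)
    exact ⟨t + (t' + 1), by omega, σ₂, Exec.seq h₁ (Exec.iteTrue (by rw [p.1]; exact hc') e₂), r₂⟩
  | iteFalse hc' _ ih =>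
    simp only [Stmt.cmax, max_le_iff] at hc
    obtain ⟨t, ht, σ₁, h₁, p⟩ := code hs hc.1 (pw (le_max_left _ _) hW) hr
    obtain ⟨t', ht', σ₂, e₂, r₂⟩ := ih hs hc.2.2
      (pw ((le_max_right _ _).trans (le_max_right _ _)) hW) (p.rel hr)
    exact ⟨t + (t' + 1), by omega, σ₂, Exec.seq h₁ (Exec.iteFalse (by rw [p.1]; exact hc') e₂), r₂⟩
  | loopDone hc' =>
    simp only [Stmt.cmax, max_le_iff] at hc
    obtain ⟨t, ht, σ₁, h₁, p⟩ := code hs hc.1 (pw (le_max_left _ _) hW) hr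
    exact ⟨t + 1, by omega, σ₁, Exec.seq h₁ (Exec.loopDone (by rw [p.1]; exact hc')), p.rel hr⟩
  | loopStep hc' _ _ ih₁ ih₂ =>
    rename_i h₁ _
    have hc2 := hc
    simp only [Stmt.cmax, max_le_iff] at hc2
    obtain ⟨t, ht, σ₁, e₁, p⟩ := code hs hc2.1 (pw (le_max_left _ _) hW) hr
    obtain ⟨t', ht', σ₂, e₂, r₂⟩ := ih₁ hs hc2.2 (pw (le_max_right _ _) hW) (p.rel hr)
    obtain ⟨t'', ht'', σ₃, e₃, r₃⟩ := ih₂ (h₁.bdd hs) hc hW r₂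
    -- The compiled loop evaluates its condition before the first test and again after each round.
    -- The run given by induction starts with such an evaluation; it is split off to close the
    -- current round.
    cases e₃ with
    | @seq _ _ _ σc _ tc tl hcode hloop =>
      exact ⟨t + (t' + tc + tl + 1), by omega, σ₃, Exec.seq e₁
        (Exec.loopStep (by rw [p.1]; exact hc') (Exec.seq e₂ hcode) hloop), r₃⟩

/-- `Tri X p s T Q`: the statement `p` started in `s` halts within `T` steps in a state that
satisfies `Q`, and all values that it writes are at most `X`. -/
def Tri (X : ℕ) (p : Stmt) (s : State) (T : ℕ) (Q : State → Prop) : Prop :=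
  ∃ t s', HExec X p s t s' ∧ t ≤ T ∧ Q s'

namespace Tri

variable {X T T₁ T₂ : ℕ} {p q : Stmt} {s : State} {P Q : State → Prop}

theorem mono (h : Tri X p s T P) (hT : T ≤ T₁) (hQ : ∀ s', P s' → Q s') : Tri X p s T₁ Q :=
  let ⟨t, s', e, ht, hP⟩ := h
  ⟨t, s', e, ht.trans hT, hQ s' hP⟩

theorem skip (hT : 1 ≤ T) (h : Q s) : Tri X .skip s T Q := ⟨1, s, HExec.skip s, hT, h⟩

theorem assign {x : ℕ} {e : Expr} {v : ℕ} (hv : e.eval s = v) (hX : v ≤ X)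
    (hT : e.cost s + 1 ≤ T) (h : Q (s.setReg x v)) : Tri X (.assign x e) s T Q := by
  subst hv; exact ⟨_, _, HExec.assign s x e hX, hT, h⟩

theorem store {a e : Expr} {u v : ℕ} (hu : a.eval s = u) (hv : e.eval s = v) (hX : v ≤ X)
    (hT : a.cost s + e.cost s + 1 ≤ T) (h : Q (s.setMem u v)) : Tri X (.store a e) s T Q := by
  subst hu hv; exact ⟨_, _, HExec.store s a e hX, hT, h⟩

theorem seq (h : Tri X p s T₁ P) (h' : ∀ s', P s' → Tri X q s' T₂ Q) (hT : T₁ + T₂ ≤ T) :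
    Tri X (.seq p q) s T Q := by
  obtain ⟨t, s', e, ht, hP⟩ := h
  obtain ⟨t', s'', e', ht', hQ⟩ := h' s' hP
  exact ⟨_, s'', HExec.seq e e', by omega, hQ⟩

theorem assign_seq {x : ℕ} {e : Expr} {v : ℕ} (hv : e.eval s = v) (hX : v ≤ X)
    (h : Tri X q (s.setReg x v) T₂ Q) (hT : e.cost s + 1 + T₂ ≤ T) :
    Tri X (.seq (.assign x e) q) s T Q :=
  seq (P := fun s' => s' = s.setReg x v) (assign hv hX le_rfl rfl) (by rintro _ rfl; exact h) hT

theorem store_seq {a e : Expr} {u v : ℕ} (hu : a.eval s = u) (hv : e.eval s = v) (hX : v ≤ X)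
    (h : Tri X q (s.setMem u v) T₂ Q) (hT : a.cost s + e.cost s + 1 + T₂ ≤ T) :
    Tri X (.seq (.store a e) q) s T Q :=
  seq (P := fun s' => s' = s.setMem u v) (store hu hv hX le_rfl rfl) (by rintro _ rfl; exact h) hT

theorem ite {c : Expr} (h : c.eval s ≠ 0 → Tri X p s T₁ Q) (h' : c.eval s = 0 → Tri X q s T₁ Q)
    (hT : c.cost s + T₁ + 1 ≤ T) : Tri X (.ite c p q) s T Q := by
  by_cases hc : c.eval s = 0
  · obtain ⟨t, s', e, ht, hP⟩ := h' hc
    exact ⟨_, s', HExec.iteFalse hc e, by omega, hP⟩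
  · obtain ⟨t, s', e, ht, hP⟩ := h hc
    exact ⟨_, s', HExec.iteTrue hc e, by omega, hP⟩

end Tri

/-- `for x < y do p`, where `y` is a variable. -/
def Stmt.forL (x y : ℕ) (p : Stmt) : Stmt :=
  .seq (.assign x 0) (.loop (.op .lt (.var x) (.var y)) (.seq p (.assign x (.var x + 1))))

/-- The rule for counting loops. The limit is read from variable `y` before every round, so the
invariant has to fix it. The overhead of `8` per round pays for test and increment, the final `6`
for the initialisation and the last test. -/
theorem Tri.forL {X T N x y : ℕ} {p : Stmt} {s : State} {Q : State → Prop}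
    (inv : ℕ → State → Prop) (hN : N ≤ X) (h0 : inv 0 (s.setReg x 0))
    (hy : ∀ i s, inv i s → s.reg y = N)
    (hstep : ∀ i < N, ∀ s, inv i s → s.reg x = i →
      Tri X p s T (fun s' => s'.reg x = i ∧ inv (i + 1) (s'.setReg x (i + 1))))
    (hQ : ∀ s, inv N s → s.reg x = N → Q s) :
    Tri X (.forL x y p) s (N * (T + 8) + 6) Q := by
  have hc : ∀ s : State, Expr.cost (.op .lt (.var x) (.var y)) s = 3 := fun s => rfl
  have main : ∀ j i s, i + j = N → inv i s → s.reg x = i →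
      Tri X (.loop (.op .lt (.var x) (.var y)) (.seq p (.assign x (.var x + 1)))) s
        (j * (T + 8) + 4) Q := by
    intro j
    induction j with
    | zero =>
      intro i s hij hi hx
      obtain rfl : i = N := by omega
      refine ⟨_, s, HExec.loopDone ?_, by rw [hc]; omega, hQ s hi hx⟩
      simp [Expr.eval, Op.eval, hx, hy i s hi]
    | succ j ih =>
      intro i s hij hi hx
      have hiN : i < N := by omega
      obtain ⟨t, s₁, e, ht, hx₁, hi₁⟩ := hstep i hiN s hi hx
      have hv : Expr.eval (.var x + 1) s₁ = i + 1 := by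
        change s₁.reg x + 1 = _; rw [hx₁]
      obtain ⟨t', s₂, e', ht', hQ'⟩ := ih (i + 1) _ (by omega) hi₁ (by simp)
      refine ⟨_, s₂, HExec.loopStep (s₁ := s₁.setReg x (i + 1)) ?_
        (HExec.seq e (t₂ := Expr.cost (.var x + 1) s₁ + 1) ?_) e', ?_, hQ'⟩
      · simp [Expr.eval, Op.eval, hx, hy i s hi, hiN]
      · rw [← hv]; exact HExec.assign _ _ _ (by rw [hv]; omega)
      · have : Expr.cost (.var x + 1) s₁ = 3 := rfl
        rw [hc, this, Nat.succ_mul]; omega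
  refine Tri.assign_seq (v := 0) rfl (Nat.zero_le X) (main N 0 _ (by omega) h0 (by simp)) ?_
  have : Expr.cost (0 : Expr) s = 1 := rfl
  omega

theorem State.init_bdd {X : ℕ} {w : List ℕ} (h : ∀ x ∈ w, x ≤ X) : (State.init w).Bdd X := by
  refine ⟨fun r => Nat.zero_le _, fun i => ?_⟩
  simp only [State.init, List.getD_eq_getElem?_getD]
  rcases lt_or_ge i w.length with hi | hi
  · rw [List.getElem?_eq_getElem hi]; exact h _ (List.getElem_mem hi)
  · rw [List.getElem?_eq_none hi]; exact Nat.zero_le _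

/-- A statement yields a run of the compiled program. -/
theorem Tri.runs {X W T : ℕ} {p : Stmt} {w : List ℕ} {Q : State → Prop} (hX : 2 ≤ X)
    (hc : p.cmax ≤ X) (hW : X ^ p.deg ≤ W) (hd : 1 ≤ p.deg) (hw : ∀ x ∈ w, x ≤ X)
    (h : Tri X p (State.init w) T Q) :
    ∃ t s σ, Runs W p.compile w t σ ∧ t ≤ T ∧ Rel s σ ∧ Q s := by
  obtain ⟨t, s, e, ht, hQ⟩ := h
  obtain ⟨t', ht', σ, e', r⟩ := e.exec hX (State.init_bdd hw) hc hW
    (σ := State.init w) ⟨fun _ => rfl, rfl⟩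
  exact ⟨t', s, σ, ⟨fun x hx => (hw x hx).trans ((Nat.le_self_pow (by omega) X).trans hW), e'⟩,
    by omega, r, hQ⟩

end WordRAM

/-! ## Running an arbitrary program in a sandbox

The program sees virtual registers and a virtual memory, whose initial contents are computed on
demand.  Every step consumes fuel; without fuel, or after a word has exceeded the limit, nothing
happens any more.  Variable `1` holds the stamp that marks the cells written in the current run,
`2` the address where the virtual memory begins, `3` the limit for words, `4` the fuel, and `5` the
index of the cell whose initial contents are asked for.  Virtual register `r` is variable
`100 + r`. -/

namespace WordRAM

theorem Exec.bdd {W : ℕ} {p : Prog} {s s' : State} {t : ℕ} (h : Exec W p s t s')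
    (hs : s.Bdd W) : s'.Bdd W := by
  induction h with
  | skip | loopDone => exact hs
  | const s r c h => exact hs.setReg _ h
  | op s o r a b h => exact hs.setReg _ h
  | load s r a => exact hs.setReg _ (hs.2 _)
  | store s a b => exact hs.setMem _ (hs.1 _)
  | seq _ _ ih₁ ih₂ => exact ih₂ (ih₁ hs)
  | iteTrue _ _ ih => exact ih hs
  | iteFalse _ _ ih => exact ih hs
  | loopStep _ _ _ ih₁ ih₂ => exact ih₂ (ih₁ hs)

theorem Exec.time_pos {W : ℕ} {p : Prog} {s s' : State} {t : ℕ} (h : Exec W p s t s') : 1 ≤ t := by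
  induction h <;> omega

/-- A strict upper bound on the registers that a program mentions. -/
def Prog.regs : Prog → ℕ
  | skip => 0
  | const r _ => r + 1
  | op _ r a b => max (r + 1) (max (a + 1) (b + 1))
  | load r a => max (r + 1) (a + 1)
  | store a b => max (a + 1) (b + 1)
  | seq p q => max p.regs q.regs
  | ite r p q => max (r + 1) (max p.regs q.regs)
  | loop r p => max (r + 1) p.regs

namespace Sandbox

/-- The contents of the virtual cell with index in variable `5`. -/
def read (g : Expr) : Expr :=
  .ite (.op .eq (.load (.var 2 + 2 * .var 5)) (.var 1)) (.load (.var 2 + 2 * .var 5 + 1)) g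

/-- Assign `e` to virtual register `r`, unless it exceeds the limit. -/
def guard (r : ℕ) (e : Expr) : Stmt :=
  .ite (.op .lt (.var 3) e) (.assign 4 0)
    (.seq (.assign (100 + r) e) (.assign 4 (.var 4 - 1)))

/-- The sandboxed program; `g` computes the initial contents of the virtual memory. -/
def box (g : Expr) : Prog → Stmt
  | .skip => .assign 4 (.var 4 - 1)
  | .const r c => .ite (.var 4) (guard r (.const c)) .skip
  | .op o r a b => .ite (.var 4) (guard r (.op o (.var (100 + a)) (.var (100 + b)))) .skip
  | .load r a => .ite (.var 4) (.seq (.assign 5 (.var (100 + a))) (guard r (read g))) .skip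
  | .store a b => .ite (.var 4) (.seq (.store (.var 2 + 2 * .var (100 + a)) (.var 1))
      (.seq (.store (.var 2 + 2 * .var (100 + a) + 1) (.var (100 + b)))
        (.assign 4 (.var 4 - 1)))) .skip
  | .seq p q => .seq (box g p) (box g q)
  | .ite r p q => .ite (.var 4) (.seq (.assign 4 (.var 4 - 1))
      (.ite (.var (100 + r)) (box g p) (box g q))) .skip
  | .loop r p => .seq (.loop (.ite (.var 4) (.var (100 + r)) 0)
      (.seq (.assign 4 (.var 4 - 1)) (box g p))) (.assign 4 (.var 4 - 1))

/-- `s` agrees with `s₀` outside the variables and the memory that the sandbox uses. -/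
def Agree (s₀ s : State) : Prop :=
  (∀ r < 100, r ≠ 4 → r ≠ 5 → s.reg r = s₀.reg r) ∧ ∀ a < s₀.reg 2, s.mem a = s₀.mem a

/-- The invariant of a sandboxed run that began in state `s₀`. -/
structure Inv (X R : ℕ) (s₀ s : State) : Prop where
  agree : Agree s₀ s
  stamp : ∀ i, s.mem (s₀.reg 2 + 2 * i) ≤ s₀.reg 1
  fuel : s.reg 4 ≤ X
  reg : ∀ r, s.reg (100 + r) ≤ X
  rest : ∀ r, R ≤ r → s.reg (100 + r) = s₀.reg (100 + r)

/-- The virtual state. -/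
def virt (cell : ℕ → ℕ) (s : State) : State where
  reg r := s.reg (100 + r)
  mem a := if s.mem (s.reg 2 + 2 * a) = s.reg 1 then s.mem (s.reg 2 + 2 * a + 1) else cell a

theorem virt_setReg_lt (cell : ℕ → ℕ) (s : State) {x v : ℕ} (hx : x = 4 ∨ x = 5) :
    virt cell (s.setReg x v) = virt cell s := by
  ext r <;> simp only [virt, State.reg_setReg, State.mem_setReg]
  · rw [if_neg (by omega)]
  · rcases hx with rfl | rfl <;> simp

theorem virt_setReg (cell : ℕ → ℕ) (s : State) (r v : ℕ) :
    virt cell (s.setReg (100 + r) v) = (virt cell s).setReg r v := by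
  have h1 : ¬ 1 = 100 + r := by omega
  have h2 : ¬ 2 = 100 + r := by omega
  ext x <;> simp [virt, h1, h2]

/-- A virtual cell occupies two consecutive cells, the stamp followed by the contents; parity keeps
the stamps and the contents of different virtual cells apart. -/
theorem virt_setMem (cell : ℕ → ℕ) (s : State) (a v : ℕ) :
    virt cell ((s.setMem (s.reg 2 + 2 * a) (s.reg 1)).setMem (s.reg 2 + 2 * a + 1) v) =
      (virt cell s).setMem a v := by
  ext x <;> simp only [virt, State.reg_setMem, State.mem_setMem]
  by_cases h : x = a
  · subst h; simp
  · have h1 : ∀ b, ¬ b + 2 * x = b + 2 * a := by omega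
    have h2 : ∀ b, ¬ b + 2 * x = b + 2 * a + 1 := by omega
    have h3 : ∀ b, ¬ b + 2 * x + 1 = b + 2 * a := by omega
    have h4 : ∀ b, ¬ b + 2 * x + 1 = b + 2 * a + 1 := by omega
    simp only [h, h1, h2, h3, h4, if_false]

namespace Inv

variable {X R : ℕ} {s₀ s : State}

theorem setFuel (h : Inv X R s₀ s) {v : ℕ} (hv : v ≤ X) : Inv X R s₀ (s.setReg 4 v) := by
  refine ⟨⟨fun r h1 h2 h3 => ?_, h.agree.2⟩, h.stamp, by simpa using hv, fun r => ?_,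
    fun r hr => ?_⟩ <;> rw [State.reg_setReg, if_neg (by omega)]
  exacts [h.agree.1 r h1 h2 h3, h.reg r, h.rest r hr]

theorem setCell (h : Inv X R s₀ s) (v : ℕ) : Inv X R s₀ (s.setReg 5 v) := by
  refine ⟨⟨fun r h1 h2 h3 => ?_, h.agree.2⟩, h.stamp, by simpa using h.fuel, fun r => ?_,
    fun r hr => ?_⟩ <;> rw [State.reg_setReg, if_neg (by omega)]
  exacts [h.agree.1 r h1 h2 h3, h.reg r, h.rest r hr]

theorem setReg (h : Inv X R s₀ s) {r v : ℕ} (hr : r < R) (hv : v ≤ X) :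
    Inv X R s₀ (s.setReg (100 + r) v) := by
  refine ⟨⟨fun r h1 h2 h3 => ?_, h.agree.2⟩, h.stamp, ?_, fun r' => ?_,
    fun r' hr' => ?_⟩
  · rw [State.reg_setReg, if_neg (by omega), h.agree.1 r h1 h2 h3]
  · rw [State.reg_setReg, if_neg (by omega)]; exact h.fuel
  · rw [State.reg_setReg]; split_ifs; exacts [hv, h.reg r']
  · rw [State.reg_setReg, if_neg (by omega), h.rest r' hr']

theorem store (h : Inv X R s₀ s) (a v : ℕ) :
    Inv X R s₀ ((s.setMem (s.reg 2 + 2 * a) (s.reg 1)).setMem (s.reg 2 + 2 * a + 1) v) := by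
  have h2 : s.reg 2 = s₀.reg 2 := h.agree.1 2 (by omega) (by omega) (by omega)
  have h1 : s.reg 1 = s₀.reg 1 := h.agree.1 1 (by omega) (by omega) (by omega)
  refine ⟨⟨h.agree.1, fun b hb => ?_⟩, fun i => ?_, h.fuel, h.reg, h.rest⟩
  · rw [State.mem_setMem, State.mem_setMem, if_neg (by omega), if_neg (by omega), h.agree.2 b hb]
  · rw [State.mem_setMem, State.mem_setMem, if_neg (by omega)]
    split_ifs; exacts [h1.le, h.stamp i]

end Inv

/-- The initial contents of the virtual memory are computed by `g`, in at most `G` steps. -/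
def Computes (g : Expr) (s₀ : State) (cell : ℕ → ℕ) (G : ℕ) : Prop :=
  ∀ s, Agree s₀ s → g.eval s = cell (s.reg 5) ∧ g.cost s ≤ G

/-- A word beyond the limit would leave the original program stuck; emptying the fuel stops the
simulation too. The expression is evaluated for the test and again for the assignment, whence `2 *
G`. -/
theorem guard_exec {X r v G : ℕ} {e : Expr} {s : State} (hv : e.eval s = v) (hG : e.cost s ≤ G)
    (hX : s.reg 3 ≤ X) (h4 : s.reg 4 ≤ X) :
    ∃ t s', HExec X (guard r e) s t s' ∧ t ≤ 2 * G + 12 ∧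
      (v ≤ s.reg 3 → s' = (s.setReg (100 + r) v).setReg 4 (s.reg 4 - 1)) ∧
      (s.reg 3 < v → s' = s.setReg 4 0) := by
  have hc : Expr.cost (.op .lt (.var 3) e) s ≤ G + 2 := by simp only [Expr.cost]; omega
  by_cases h : v ≤ s.reg 3
  · refine ⟨_, _, HExec.iteFalse (s₁ := (s.setReg (100 + r) v).setReg 4 (s.reg 4 - 1)) ?_
      (HExec.seq (t₁ := e.cost s + 1) (t₂ := 4) (s₁ := s.setReg (100 + r) v) ?_ ?_), ?_,
      fun _ => rfl, fun h' => by omega⟩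
    · simp [Expr.eval, Op.eval, hv, h]
    · rw [← hv]; exact HExec.assign _ _ _ (by omega)
    · have hv' : Expr.eval (.var 4 - 1) (s.setReg (100 + r) v) = s.reg 4 - 1 := by
        change (s.setReg (100 + r) v).reg 4 - 1 = _
        rw [State.reg_setReg, if_neg (by omega)]
      have := HExec.assign (X := X) (s.setReg (100 + r) v) 4 (.var 4 - 1) (by rw [hv']; omega)
      rw [hv'] at this; exact this
    · omega
  · refine ⟨_, _, HExec.iteTrue (s₁ := s.setReg 4 0) ?_ (HExec.assign s 4 0 (Nat.zero_le _)), ?_,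
      fun h' => absurd h' h, fun _ => rfl⟩
    · simp only [Expr.eval, Op.eval, hv]; rw [if_pos (by omega)]; simp
    · have : Expr.cost (0 : Expr) s = 1 := rfl
      omega

/-- What a sandboxed run of `p` from state `s` to state `s'` in `t` steps has to satisfy. -/
def Good (X R : ℕ) (s₀ : State) (cell : ℕ → ℕ) (H A B : ℕ) (p : Prog) (s : State) (t : ℕ)
    (s' : State) : Prop :=
  Inv X R s₀ s' ∧ s'.reg 4 ≤ s.reg 4 ∧ t ≤ (A * (s.reg 4 - s'.reg 4) + B) * H ∧
    ∀ t₀ v, (virt cell s).Bdd (s₀.reg 3) → Exec (s₀.reg 3) p (virt cell s) t₀ v →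
      t₀ < s.reg 4 → s'.reg 4 + t₀ = s.reg 4 ∧ virt cell s' = v

theorem dec_exec {X : ℕ} (s : State) (h : s.reg 4 ≤ X) :
    HExec X (.assign 4 (.var 4 - 1)) s 4 (s.setReg 4 (s.reg 4 - 1)) :=
  HExec.assign s 4 (.var 4 - 1) (show s.reg 4 - 1 ≤ X by omega)

theorem read_spec {X R G : ℕ} {g : Expr} {s₀ s : State} {cell : ℕ → ℕ}
    (hg : Computes g s₀ cell G) (h : Inv X R s₀ s) :
    (read g).eval s = (virt cell s).mem (s.reg 5) ∧ (read g).cost s ≤ G + 18 := by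
  have := hg s h.agree
  constructor
  · simp only [read, virt, Expr.eval, this.1]
    change (if (if s.mem (s.reg 2 + 2 * s.reg 5) = s.reg 1 then 1 else 0) ≠ 0 then
      s.mem (s.reg 2 + 2 * s.reg 5 + 1) else cell (s.reg 5)) = _
    split_ifs <;> simp_all
  · have h1 : Expr.cost (.op .eq (.load (.var 2 + 2 * .var 5)) (.var 1)) s = 8 := rfl
    have h2 : Expr.cost (.load (.var 2 + 2 * .var 5 + 1)) s = 8 := rfl
    simp only [read, Expr.cost] at *
    split_ifs <;> omega

/-- The common part of all instructions that first look at the fuel. With an empty tank nothing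
happens, and the claim about faithful simulation is vacuous because it concerns only runs shorter
than the fuel. -/
theorem step_exec {X R H A B : ℕ} {s₀ s : State} {cell : ℕ → ℕ} {p : Prog} {q : Stmt}
    (hH : 60 ≤ H) (hB : 2 ≤ B) (h : Inv X R s₀ s)
    (hq : s.reg 4 ≠ 0 → ∃ t s', HExec X q s t s' ∧ Good X R s₀ cell H A (B - 1) p s t s') :
    ∃ t s', HExec X (.ite (.var 4) q .skip) s t s' ∧ Good X R s₀ cell H A B p s t s' := by
  by_cases h4 : s.reg 4 = 0
  · refine ⟨_, s, HExec.iteFalse h4 (HExec.skip s), h, le_rfl, ?_, fun t v _ _ ht => by omega⟩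
    have : Expr.cost (.var 4) s = 1 := rfl
    have := Nat.mul_le_mul hB hH
    rw [add_mul]; omega
  · obtain ⟨t, s', e, h1, h2, h3, h5⟩ := hq h4
    refine ⟨_, s', HExec.iteTrue h4 e, h1, h2, ?_, h5⟩
    have : Expr.cost (.var 4) s = 1 := rfl
    obtain ⟨B, rfl⟩ : ∃ B', B = B' + 1 := ⟨B - 1, by omega⟩
    simp only [Nat.add_sub_cancel] at h3
    rw [this]; nlinarith

/-- Every program runs in the sandbox, in time proportional to the fuel that it consumes. -/
theorem box_exec (p : Prog) : ∃ A B : ℕ, ∀ (X R : ℕ) (s₀ : State) (cell : ℕ → ℕ) (g : Expr)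
    (G : ℕ), p.regs ≤ R → s₀.reg 3 ≤ X → s₀.reg 1 ≤ X → Computes g s₀ cell G →
    ∀ s, Inv X R s₀ s → ∃ t s', HExec X (box g p) s t s' ∧
      Good X R s₀ cell (60 + 3 * G) A B p s t s' := by
  induction p with
  | skip =>
    refine ⟨0, 1, fun X R s₀ cell g G hR h3 h1 hg s h => ⟨_, _, dec_exec s h.fuel,
      h.setFuel (by have := h.fuel; omega), by simp, by omega, fun t v _ e ht => ?_⟩⟩
    cases e
    rw [virt_setReg_lt _ _ (Or.inl rfl)]; simp; omega
  | const r c =>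
    refine ⟨0, 2, fun X R s₀ cell g G hR h3 h1 hg s h => step_exec (by omega) le_rfl h fun h4 => ?_⟩
    have e3 : s.reg 3 = s₀.reg 3 := h.agree.1 3 (by omega) (by omega) (by omega)
    have hf := h.fuel
    simp only [Prog.regs] at hR
    obtain ⟨t, s', e, ht, ha, hb⟩ := guard_exec (X := X) (r := r) (e := .const c) (s := s) (v := c)
      (G := 1) rfl le_rfl (by omega) h.fuel
    refine ⟨t, s', e, ?_⟩
    rcases le_or_gt c (s.reg 3) with hc | hc
    · rw [ha hc]
      refine ⟨(h.setReg (by omega) (by omega)).setFuel (by omega), by simp, by omega,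
        fun t v _ e ht => ?_⟩
      cases e
      rw [virt_setReg_lt _ _ (Or.inl rfl), virt_setReg]; simp; omega
    · rw [hb hc]
      refine ⟨h.setFuel (by omega), by simp, by omega, fun t v _ e ht => ?_⟩
      cases e; omega
  | op o r a b =>
    refine ⟨0, 2, fun X R s₀ cell g G hR h3 h1 hg s h => step_exec (by omega) le_rfl h fun h4 => ?_⟩
    have e3 : s.reg 3 = s₀.reg 3 := h.agree.1 3 (by omega) (by omega) (by omega)
    have hf := h.fuel
    simp only [Prog.regs] at hR
    obtain ⟨t, s', e, ht, ha, hb⟩ := guard_exec (X := X) (r := r)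
      (e := .op o (.var (100 + a)) (.var (100 + b))) (s := s)
      (v := o.eval ((virt cell s).reg a) ((virt cell s).reg b)) (G := 3) rfl le_rfl (by omega) h.fuel
    refine ⟨t, s', e, ?_⟩
    rcases le_or_gt (o.eval ((virt cell s).reg a) ((virt cell s).reg b)) (s.reg 3) with hc | hc
    · rw [ha hc]
      refine ⟨(h.setReg (by omega) (by omega)).setFuel (by omega), by simp, by omega,
        fun t v _ e ht => ?_⟩
      cases e
      rw [virt_setReg_lt _ _ (Or.inl rfl), virt_setReg]; simp; omega
    · rw [hb hc]
      refine ⟨h.setFuel (by omega), by simp, by omega, fun t v _ e ht => ?_⟩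
      cases e; omega
  | load r a =>
    refine ⟨0, 2, fun X R s₀ cell g G hR h3 h1 hg s h => step_exec (by omega) le_rfl h fun h4 => ?_⟩
    have e3 : s.reg 3 = s₀.reg 3 := h.agree.1 3 (by omega) (by omega) (by omega)
    have hf := h.fuel
    simp only [Prog.regs] at hR
    have h' := h.setCell (s.reg (100 + a))
    have hr := read_spec hg h'
    rw [virt_setReg_lt _ _ (Or.inr rfl), State.reg_setReg, if_pos rfl] at hr
    obtain ⟨t, s', e, ht, ha, hb⟩ := guard_exec (X := X) (r := r)
      (e := read g) (s := s.setReg 5 (s.reg (100 + a))) hr.1 hr.2 (by simp; omega) h'.fuel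
    simp only [State.reg_setReg] at ha hb
    rw [if_neg (by omega)] at ha hb
    refine ⟨_, s', HExec.seq (HExec.assign s 5 (.var (100 + a)) (h.reg a)) e, ?_⟩
    have hcost : Expr.cost (.var (100 + a)) s = 1 := rfl
    rcases le_or_gt ((virt cell s).mem (s.reg (100 + a))) (s.reg 3) with hc | hc
    · rw [ha hc]
      refine ⟨(h'.setReg (by omega) (by omega)).setFuel ?_, by simp, by rw [hcost]; omega,
        fun t v _ e ht => ?_⟩
      · rw [if_neg (by omega)]; omega
      cases e
      rw [virt_setReg_lt _ _ (Or.inl rfl), virt_setReg, virt_setReg_lt _ _ (Or.inr rfl)]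
      simp [virt]; omega
    · rw [hb hc]
      refine ⟨h'.setFuel (by omega), by simp, by rw [hcost]; omega, fun t v hbd e ht => ?_⟩
      -- Loading is the only writing of a register that `Exec` does not check against the word
      -- bound, so here the bound on the virtual memory is needed to exclude an overflow.
      have := hbd.2 (s.reg (100 + a)); omega
  | store a b =>
    refine ⟨0, 2, fun X R s₀ cell g G hR h3 h1 hg s h => step_exec (by omega) le_rfl h fun h4 => ?_⟩
    have e1 : s.reg 1 = s₀.reg 1 := h.agree.1 1 (by omega) (by omega) (by omega)
    have hf := h.fuel
    have h' := h.store (s.reg (100 + a)) (s.reg (100 + b))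
    refine ⟨_, _, HExec.seq (HExec.store s (.var 2 + 2 * .var (100 + a)) (.var 1)
        (show s.reg 1 ≤ X by omega)) (HExec.seq (HExec.store _ (.var 2 + 2 * .var (100 + a) + 1)
        (.var (100 + b)) (h.reg b)) (dec_exec _ h'.fuel)),
        h'.setFuel (le_trans (Nat.sub_le _ _) h'.fuel), ?_, ?_, fun t v _ e ht => ?_⟩
    · simp
    · have c1 : ∀ s, Expr.cost (.var 2 + 2 * .var (100 + a)) s = 5 := fun _ => rfl
      have c2 : ∀ s, Expr.cost (.var 2 + 2 * .var (100 + a) + 1) s = 7 := fun _ => rfl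
      have c3 : ∀ x s, Expr.cost (.var x) s = 1 := fun _ _ => rfl
      rw [c1, c2, c3, c3]; omega
    · cases e
      refine ⟨by simp [Expr.eval]; omega, ?_⟩
      rw [virt_setReg_lt _ _ (Or.inl rfl)]
      exact virt_setMem cell s (s.reg (100 + a)) (s.reg (100 + b))
  | seq p q ihp ihq =>
    obtain ⟨A₁, B₁, h₁⟩ := ihp
    obtain ⟨A₂, B₂, h₂⟩ := ihq
    refine ⟨A₁ + A₂, B₁ + B₂, fun X R s₀ cell g G hR h3 h1 hg s h => ?_⟩
    simp only [Prog.regs, max_le_iff] at hR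
    obtain ⟨t, s', e, i, hf, ht, hs⟩ := h₁ X R s₀ cell g G hR.1 h3 h1 hg s h
    obtain ⟨t', s'', e', i', hf', ht', hs'⟩ := h₂ X R s₀ cell g G hR.2 h3 h1 hg s' i
    refine ⟨_, s'', HExec.seq e e', i', hf'.trans hf, ?_, fun t₀ v hb ex hlt => ?_⟩
    · refine (Nat.add_le_add ht ht').trans ?_
      rw [← add_mul]
      refine Nat.mul_le_mul_right _ ?_
      have a1 : A₁ * (s.reg 4 - s'.reg 4) ≤ A₁ * (s.reg 4 - s''.reg 4) :=
        Nat.mul_le_mul_left _ (by omega)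
      have a2 : A₂ * (s'.reg 4 - s''.reg 4) ≤ A₂ * (s.reg 4 - s''.reg 4) :=
        Nat.mul_le_mul_left _ (by omega)
      rw [add_mul]; omega
    · cases ex with
      | @seq _ _ _ v₁ _ t₁ t₂ ex₁ ex₂ =>
        obtain ⟨f1, rfl⟩ := hs t₁ v₁ hb ex₁ (by omega)
        obtain ⟨f2, rfl⟩ := hs' t₂ v (ex₁.bdd hb) ex₂ (by omega)
        exact ⟨by omega, rfl⟩
  | ite r p q ihp ihq =>
    obtain ⟨A₁, B₁, h₁⟩ := ihp
    obtain ⟨A₂, B₂, h₂⟩ := ihq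
    refine ⟨A₁ + A₂, B₁ + B₂ + 2, fun X R s₀ cell g G hR h3 h1 hg s h =>
      step_exec (by omega) (by omega) h fun h4 => ?_⟩
    simp only [Prog.regs, max_le_iff] at hR
    have hf := h.fuel
    have h' := h.setFuel (v := s.reg 4 - 1) (by omega)
    set s₁ := s.setReg 4 (s.reg 4 - 1) with hs₁
    have f1 : s₁.reg 4 = s.reg 4 - 1 := by simp [hs₁]
    have fr : s₁.reg (100 + r) = s.reg (100 + r) := by
      rw [hs₁, State.reg_setReg, if_neg (by omega)]
    have hvirt : virt cell s₁ = virt cell s := virt_setReg_lt _ _ (Or.inl rfl)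
    have hcost : Expr.cost (.var (100 + r)) s₁ = 1 := rfl
    by_cases hr : s.reg (100 + r) ≠ 0
    · obtain ⟨t, s', e, i, hf', ht, hs⟩ := h₁ X R s₀ cell g G hR.2.1 h3 h1 hg s₁ h'
      refine ⟨_, s', HExec.seq (dec_exec s h.fuel) (HExec.iteTrue (by rw [← fr] at hr; exact hr) e),
        i, by omega, ?_, fun t₀ v hb ex hlt => ?_⟩
      · have a1 : A₁ * (s₁.reg 4 - s'.reg 4) ≤ (A₁ + A₂) * (s.reg 4 - s'.reg 4) :=
          Nat.mul_le_mul (by omega) (by omega)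
        have := Nat.mul_le_mul_right (60 + 3 * G) a1
        have hH : 60 ≤ 60 + 3 * G := by omega
        rw [hcost]
        have : B₁ + B₂ + 2 - 1 = B₁ + B₂ + 1 := by omega
        rw [this]
        generalize (A₁ + A₂) * (s.reg 4 - s'.reg 4) = u at *
        generalize 60 + 3 * G = H at *
        rw [add_mul] at ht ⊢
        rw [add_mul (B₁ + B₂), add_mul B₁]
        omega
      · cases ex with
        | @iteTrue _ _ _ _ _ t₁ hc ex =>
          obtain ⟨f2, rfl⟩ := hs t₁ v (hvirt ▸ hb) (hvirt ▸ ex) (by omega)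
          exact ⟨by omega, rfl⟩
        | iteFalse hc ex => exact absurd hc hr
    · obtain ⟨t, s', e, i, hf', ht, hs⟩ := h₂ X R s₀ cell g G hR.2.2 h3 h1 hg s₁ h'
      rw [not_not] at hr
      refine ⟨_, s', HExec.seq (dec_exec s h.fuel) (HExec.iteFalse (by rw [← fr] at hr; exact hr) e),
        i, by omega, ?_, fun t₀ v hb ex hlt => ?_⟩
      · have a1 : A₂ * (s₁.reg 4 - s'.reg 4) ≤ (A₁ + A₂) * (s.reg 4 - s'.reg 4) :=
          Nat.mul_le_mul (by omega) (by omega)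
        have := Nat.mul_le_mul_right (60 + 3 * G) a1
        have hH : 60 ≤ 60 + 3 * G := by omega
        rw [hcost]
        have : B₁ + B₂ + 2 - 1 = B₁ + B₂ + 1 := by omega
        rw [this]
        generalize (A₁ + A₂) * (s.reg 4 - s'.reg 4) = u at *
        generalize 60 + 3 * G = H at *
        rw [add_mul] at ht ⊢
        rw [add_mul (B₁ + B₂), add_mul B₁]
        omega
      · cases ex with
        | iteTrue hc ex => exact absurd hr hc
        | @iteFalse _ _ _ _ _ t₁ hc ex =>
          obtain ⟨f2, rfl⟩ := hs t₁ v (hvirt ▸ hb) (hvirt ▸ ex) (by omega)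
          exact ⟨by omega, rfl⟩
  | loop r p ih =>
    obtain ⟨A, B, ih⟩ := ih
    -- Every round consumes at least one unit of fuel, so the fixed cost `B` of a round is charged
    -- to the fuel and the number of rounds does not enter the estimate.
    refine ⟨A + B + 1, 1, fun X R s₀ cell g G hR h3 h1 hg s h => ?_⟩
    simp only [Prog.regs, max_le_iff] at hR
    have hcost : ∀ s : State, Expr.cost (.ite (.var 4) (.var (100 + r)) 0) s = 3 := by
      intro s; simp only [Expr.cost]; split_ifs <;> rfl
    -- Strong induction on the fuel, since the original loop need not terminate. The last, failing
    -- test of the loop is a step of the original run but is paid for only by the assignment behind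
    -- the loop; hence the `+ 1` in the balance of the fuel.
    have main : ∀ f s, s.reg 4 = f → Inv X R s₀ s → ∃ t s', HExec X (.loop (.ite (.var 4)
        (.var (100 + r)) 0) (.seq (.assign 4 (.var 4 - 1)) (box g p))) s t s' ∧ Inv X R s₀ s' ∧
        s'.reg 4 ≤ s.reg 4 ∧ t ≤ ((A + B + 1) * (s.reg 4 - s'.reg 4)) * (60 + 3 * G) + 4 ∧
        ∀ t₀ v, (virt cell s).Bdd (s₀.reg 3) → Exec (s₀.reg 3) (.loop r p) (virt cell s) t₀ v →
          t₀ < s.reg 4 → s'.reg 4 + t₀ = s.reg 4 + 1 ∧ virt cell s' = v := by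
      intro f
      induction f using Nat.strong_induction_on with
      | _ f ihf =>
        intro s hsf h
        by_cases hc : s.reg 4 ≠ 0 ∧ s.reg (100 + r) ≠ 0
        · have hf := h.fuel
          have h' := h.setFuel (v := s.reg 4 - 1) (by omega)
          obtain ⟨t, s', e, i, hf', ht, hs⟩ := ih X R s₀ cell g G hR.2 h3 h1 hg _ h'
          have hvirt : virt cell (s.setReg 4 (s.reg 4 - 1)) = virt cell s :=
            virt_setReg_lt _ _ (Or.inl rfl)
          rw [State.reg_setReg, if_pos rfl] at hf' ht hs
          rw [hvirt] at hs
          obtain ⟨t', s'', e', i', hf'', ht', hs'⟩ := ihf (s'.reg 4) (by omega) s' rfl i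
          refine ⟨_, s'', HExec.loopStep ?_ (HExec.seq (dec_exec s h.fuel) e) e', i', by omega, ?_,
            fun t₀ v hb ex hlt => ?_⟩
          · change (if s.reg 4 ≠ 0 then s.reg (100 + r) else 0) ≠ 0
            rw [if_pos hc.1]; exact hc.2
          · rw [hcost]
            obtain ⟨a, ha⟩ : ∃ a, s.reg 4 - 1 - s'.reg 4 = a := ⟨_, rfl⟩
            obtain ⟨b, hb⟩ : ∃ b, s'.reg 4 - s''.reg 4 = b := ⟨_, rfl⟩
            have hab : s.reg 4 - s''.reg 4 = a + b + 1 := by omega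
            rw [ha] at ht; rw [hb] at ht'; rw [hab]
            have : (A * a + B) * (60 + 3 * G) + (A + B + 1) * b * (60 + 3 * G) + (60 + 3 * G) ≤
                (A + B + 1) * (a + b + 1) * (60 + 3 * G) := by
              rw [← add_mul, ← Nat.succ_mul]
              refine Nat.mul_le_mul_right _ ?_
              rw [Nat.succ_eq_add_one]; ring_nf; omega
            omega
          · cases ex with
            | loopDone hr => exact absurd hr hc.2
            | @loopStep _ _ _ v₁ _ t₁ t₂ hr ex₁ ex₂ =>
              obtain ⟨f1, rfl⟩ := hs t₁ v₁ hb ex₁ (by omega)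
              obtain ⟨f2, rfl⟩ := hs' t₂ v (ex₁.bdd hb) ex₂ (by omega)
              exact ⟨by omega, rfl⟩
        · refine ⟨_, s, HExec.loopDone ?_, h, le_rfl, by rw [hcost]; simp,
            fun t₀ v hb ex hlt => ?_⟩
          · change (if s.reg 4 ≠ 0 then s.reg (100 + r) else 0) = 0
            split_ifs with h0
            · by_contra h0'; exact hc ⟨h0, h0'⟩
            · rfl
          · cases ex with
            | loopDone hr => exact ⟨rfl, rfl⟩
            | loopStep hr ex₁ ex₂ => exact absurd ⟨by omega, hr⟩ hc
    obtain ⟨t, s', e, i, hf, ht, hs⟩ := main _ s rfl h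
    refine ⟨_, _, HExec.seq e (dec_exec s' i.fuel), i.setFuel (by have := i.fuel; omega), ?_, ?_,
      fun t₀ v hb ex hlt => ?_⟩
    · simp; omega
    · rw [State.reg_setReg, if_pos rfl]
      have : (A + B + 1) * (s.reg 4 - s'.reg 4) ≤ (A + B + 1) * (s.reg 4 - (s'.reg 4 - 1)) :=
        Nat.mul_le_mul_left _ (by omega)
      have := Nat.mul_le_mul_right (60 + 3 * G) this
      rw [add_mul]; omega
    · obtain ⟨f, rfl⟩ := hs t₀ v hb ex hlt
      rw [virt_setReg_lt _ _ (Or.inl rfl)]; simp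
      have := ex.time_pos
      omega

end Sandbox

end WordRAM

/-! ### Fresh runs in the sandbox. -/

namespace WordRAM

namespace Sandbox

/-- Set the virtual registers below `R` to `0`. -/
def zero : ℕ → Stmt
  | 0 => .skip
  | R + 1 => .seq (.assign (100 + R) 0) (zero R)

theorem zero_exec (X R : ℕ) (s : State) : Tri X (zero R) s (2 * R + 1) fun s' =>
    s'.mem = s.mem ∧ ∀ r, s'.reg r = if 100 ≤ r ∧ r < 100 + R then 0 else s.reg r := by
  induction R generalizing s with
  | zero => exact Tri.skip le_rfl ⟨rfl, fun r => by rw [if_neg (by omega)]⟩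
  | succ R ih =>
    refine Tri.assign_seq (v := 0) rfl (Nat.zero_le _) ((ih _).mono le_rfl ?_)
      (show 1 + 1 + (2 * R + 1) ≤ _ by omega)
    rintro s' ⟨hm, hr⟩
    refine ⟨hm, fun r => ?_⟩
    rw [hr r, State.reg_setReg]
    split_ifs <;> first | rfl | omega

/-- A fresh run of `p` in the sandbox. -/
def run (g : Expr) (p : Prog) : Stmt :=
  .seq (.assign 1 (.var 1 + 1)) (.seq (zero p.regs) (box g p))

/-- Agreement outside of what a run of the sandbox changes. -/
def Frame (s₀ s : State) : Prop :=
  (∀ r < 100, r ≠ 1 → r ≠ 4 → r ≠ 5 → s.reg r = s₀.reg r) ∧ ∀ a < s₀.reg 2, s.mem a = s₀.mem a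

theorem Frame.trans {s₁ s₂ s₃ : State} (h : Frame s₁ s₂) (h' : Frame s₂ s₃) : Frame s₁ s₃ :=
  ⟨fun r a b c d => (h'.1 r a b c d).trans (h.1 r a b c d), fun a ha => (h'.2 a (by
    rw [h.1 2 (by omega) (by omega) (by omega) (by omega)]; exact ha)).trans (h.2 a ha)⟩

/-- The sandbox is ready for a run of `p`. -/
structure Ready (p : Prog) (s : State) : Prop where
  stamp : ∀ i, s.mem (s.reg 2 + 2 * i) ≤ s.reg 1
  rest : ∀ r, p.regs ≤ r → s.reg (100 + r) = 0

/-- Increasing the stamp resets the virtual memory at once: all stamps in memory are at most the old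
one, so every virtual cell counts as unwritten and shows its initial contents. A run therefore costs
nothing for cleaning up after earlier ones. -/
theorem run_exec (p : Prog) : ∃ A : ℕ, ∀ (X : ℕ) (s : State) (cell : ℕ → ℕ) (g : Expr) (G : ℕ),
    s.reg 1 + 1 ≤ X → s.reg 3 ≤ X → s.reg 4 ≤ X → Ready p s →
    (∀ s', Frame s s' → g.eval s' = cell (s'.reg 5) ∧ g.cost s' ≤ G) →
    ∃ t s', HExec X (run g p) s t s' ∧ t ≤ A * (s.reg 4 - s'.reg 4 + 1) * (60 + 3 * G) ∧
      Frame s s' ∧ s'.reg 1 = s.reg 1 + 1 ∧ Ready p s' ∧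
        ∀ t₀ v, (∀ a, cell a ≤ s.reg 3) → Exec (s.reg 3) p ⟨fun _ => 0, cell⟩ t₀ v →
          t₀ < s.reg 4 → s'.reg 4 + t₀ = s.reg 4 ∧ virt cell s' = v := by
  obtain ⟨A, B, h⟩ := box_exec p
  refine ⟨A + B + 2 * p.regs + 5, fun X s cell g G h1 h3 h4 hR hg => ?_⟩
  obtain ⟨tz, s₁, ez, htz, hm, hr⟩ := zero_exec X p.regs (s.setReg 1 (s.reg 1 + 1))
  have e0 : HExec X (.assign 1 (.var 1 + 1)) s 4 (s.setReg 1 (s.reg 1 + 1)) :=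
    HExec.assign s 1 (.var 1 + 1) h1
  have e2 : s₁.reg 2 = s.reg 2 := by rw [hr, if_neg (by omega)]; simp
  have e1 : s₁.reg 1 = s.reg 1 + 1 := by rw [hr, if_neg (by omega)]; simp
  have e3 : s₁.reg 3 = s.reg 3 := by rw [hr, if_neg (by omega)]; simp
  have e4 : s₁.reg 4 = s.reg 4 := by rw [hr, if_neg (by omega)]; simp
  have hz : ∀ r, s₁.reg (100 + r) = 0 := fun r => by
    rw [hr]; split_ifs with hlt
    · rfl
    · rw [State.reg_setReg, if_neg (by omega), hR.rest r (by omega)]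
  have hf : Frame s s₁ := ⟨fun r a b _ _ => by
    rw [hr, if_neg (by omega), State.reg_setReg, if_neg b], fun a _ => by rw [hm]; rfl⟩
  have hinv : Inv X p.regs s₁ s₁ := ⟨⟨fun _ _ _ _ => rfl, fun _ _ => rfl⟩, fun i => by
    rw [e1, e2, hm]; exact (hR.stamp i).trans (Nat.le_succ _), by omega,
    fun r => by rw [hz]; exact Nat.zero_le X, fun _ _ => rfl⟩
  obtain ⟨t, s', e, ⟨i, hfl, ht, hsim⟩⟩ := h X p.regs s₁ cell g G le_rfl (by omega) (by omega)
    (fun s' hs' => hg s' (hf.trans ⟨fun r a _ c d => hs'.1 r a c d, hs'.2⟩)) s₁ hinv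
  refine ⟨_, s', HExec.seq e0 (HExec.seq ez e), ?_, ?_⟩
  · rw [e4] at ht
    have h5 : (A * (s.reg 4 - s'.reg 4) + B + (2 * p.regs + 5)) ≤
        (A + B + 2 * p.regs + 5) * (s.reg 4 - s'.reg 4 + 1) := by
      nlinarith [Nat.zero_le (B * (s.reg 4 - s'.reg 4)),
        Nat.zero_le (p.regs * (s.reg 4 - s'.reg 4))]
    have h6 := Nat.mul_le_mul_right (60 + 3 * G) h5
    rw [add_mul] at h6
    have h7 : 2 * p.regs + 5 ≤ (2 * p.regs + 5) * (60 + 3 * G) :=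
      Nat.le_mul_of_pos_right _ (by omega)
    omega
  have i1 := i.agree.1 1 (by omega) (by omega) (by omega)
  have i2 := i.agree.1 2 (by omega) (by omega) (by omega)
  refine ⟨hf.trans ⟨fun r a _ c d => i.agree.1 r a c d, i.agree.2⟩, by rw [i1, e1],
    ⟨fun j => by rw [i1, i2]; exact i.stamp j, fun r hr => by rw [i.rest r hr, hz]⟩,
    fun t₀ v hc ex hlt => ?_⟩
  have hv : virt cell s₁ = ⟨fun _ => 0, cell⟩ := by
    ext r
    · exact hz r
    · simp only [virt]
      rw [if_neg]
      rw [e1, e2, hm]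
      exact (lt_of_le_of_lt (hR.stamp r) (Nat.lt_succ_self _)).ne
  rw [← e4]
  refine hsim t₀ v ?_ (by rw [hv, e3]; exact ex) (by omega)
  rw [hv, e3]; exact ⟨fun _ => Nat.zero_le _, hc⟩

/-- Two ways to use a run. The first bounds the time by the fuel and needs no knowledge of `p`; it
serves for a program that may misbehave. The second charges the true running time and serves for
matrix multiplication, where the fuel is a generous overestimate. -/
theorem run_tri (p : Prog) : ∃ A : ℕ, ∀ (X : ℕ) (s : State) (cell : ℕ → ℕ) (g : Expr) (G : ℕ),
    s.reg 1 + 1 ≤ X → s.reg 3 ≤ X → s.reg 4 ≤ X → Ready p s →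
    (∀ s', Frame s s' → g.eval s' = cell (s'.reg 5) ∧ g.cost s' ≤ G) →
    Tri X (run g p) s (A * (s.reg 4 + 1) * (60 + 3 * G)) (fun s' =>
      Frame s s' ∧ s'.reg 1 = s.reg 1 + 1 ∧ Ready p s' ∧
        ∀ t₀ v, (∀ a, cell a ≤ s.reg 3) → Exec (s.reg 3) p ⟨fun _ => 0, cell⟩ t₀ v →
          t₀ < s.reg 4 → s'.reg 4 + t₀ = s.reg 4 ∧ virt cell s' = v) ∧
    ∀ t₀ v, (∀ a, cell a ≤ s.reg 3) → Exec (s.reg 3) p ⟨fun _ => 0, cell⟩ t₀ v → t₀ < s.reg 4 →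
      Tri X (run g p) s (A * (t₀ + 1) * (60 + 3 * G)) fun s' =>
        Frame s s' ∧ s'.reg 1 = s.reg 1 + 1 ∧ Ready p s' ∧ virt cell s' = v := by
  obtain ⟨A, h⟩ := run_exec p
  refine ⟨A, fun X s cell g G h1 h3 h4 hR hg => ?_⟩
  obtain ⟨t, s', e, ht, hf, h1', hR', hsim⟩ := h X s cell g G h1 h3 h4 hR hg
  refine ⟨⟨t, s', e, ht.trans (Nat.mul_le_mul_right _ (Nat.mul_le_mul_left _ (by omega))),
    hf, h1', hR', hsim⟩, fun t₀ v hc ex hlt => ?_⟩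
  obtain ⟨hd, hv⟩ := hsim t₀ v hc ex hlt
  rw [show s.reg 4 - s'.reg 4 = t₀ by omega] at ht
  exact ⟨t, s', e, ht, hf, h1', hR', hv⟩

theorem read_eval (g : Expr) (s : State) : (read g).eval s =
    if s.mem (s.reg 2 + 2 * s.reg 5) = s.reg 1 then s.mem (s.reg 2 + 2 * s.reg 5 + 1)
    else g.eval s := by
  simp only [read, Expr.eval]
  change (if (if s.mem (s.reg 2 + 2 * s.reg 5) = s.reg 1 then 1 else 0) ≠ 0 then
      s.mem (s.reg 2 + 2 * s.reg 5 + 1) else g.eval s) = _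
  split_ifs <;> simp_all

end Sandbox

/-! ### Logical connectives, quantifiers and cost rules for expressions. -/

namespace Expr

def notE (a : Expr) : Expr := .op .eq a 0
def andE (a b : Expr) : Expr := .ite a b 0
def orE (a b : Expr) : Expr := .ite a 1 b
def eqE (a b : Expr) : Expr := .op .eq a b
def ltE (a b : Expr) : Expr := .op .lt a b
def boolE (a : Expr) : Expr := .ite a 1 0
/-- All expressions of the list are true. -/
def allE (l : List Expr) : Expr := l.foldr andE 1
/-- Some expression of the list is true. -/
def anyE (l : List Expr) : Expr := l.foldr orE 0
/-- The sum of the list. -/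
def addE (l : List Expr) : Expr := l.foldr (· + ·) 0

/-- An expression is true if its value is not `0`. -/
def Holds (e : Expr) (s : State) : Prop := e.eval s ≠ 0

variable {s : State} {a b : Expr} {l : List Expr}

@[simp] theorem eval_const (c : ℕ) : (Expr.const c).eval s = c := rfl
@[simp] theorem eval_ofNat (c : ℕ) : (no_index (OfNat.ofNat c) : Expr).eval s = c := rfl
@[simp] theorem eval_zero : (0 : Expr).eval s = 0 := rfl
@[simp] theorem eval_one : (1 : Expr).eval s = 1 := rfl
@[simp] theorem eval_var (x : ℕ) : (Expr.var x).eval s = s.reg x := rfl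
@[simp] theorem eval_load : (Expr.load a).eval s = s.mem (a.eval s) := rfl
@[simp] theorem eval_add : (a + b).eval s = a.eval s + b.eval s := rfl
@[simp] theorem eval_sub : (a - b).eval s = a.eval s - b.eval s := rfl
@[simp] theorem eval_mul : (a * b).eval s = a.eval s * b.eval s := rfl
@[simp] theorem eval_div : (a / b).eval s = a.eval s / b.eval s := rfl
@[simp] theorem eval_mod : (a % b).eval s = a.eval s % b.eval s := rfl
@[simp] theorem eval_letE (x : ℕ) : (letE x a b).eval s = b.eval (s.setReg x (a.eval s)) := rfl
@[simp] theorem eval_sum (x : ℕ) : (sum x a b).eval s =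
    ∑ i ∈ Finset.range (a.eval s), b.eval (s.setReg x i) := rfl
@[simp] theorem eval_addE : (addE l).eval s = (l.map fun e => e.eval s).sum := by
  induction l with
  | nil => rfl
  | cons a l ih => simp [addE] at ih ⊢; rw [ih]

open Classical in
theorem eval_boolE : (boolE a).eval s = if a.Holds s then 1 else 0 := by
  by_cases h : a.eval s = 0 <;> simp [boolE, eval, Holds, h]

open Classical in
theorem eval_ite (c : Expr) :
    (ite c a b).eval s = if c.Holds s then a.eval s else b.eval s := by
  by_cases h : c.eval s = 0 <;> simp [eval, Holds, h]

@[simp] theorem holds_notE : (notE a).Holds s ↔ ¬ a.Holds s := by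
  simp only [Holds, notE, eval, Op.eval]; split_ifs <;> simp_all
@[simp] theorem holds_andE : (andE a b).Holds s ↔ a.Holds s ∧ b.Holds s := by
  simp only [Holds, andE, eval]; split_ifs <;> simp_all
@[simp] theorem holds_orE : (orE a b).Holds s ↔ a.Holds s ∨ b.Holds s := by
  simp only [Holds, orE, eval]; split_ifs <;> simp_all
@[simp] theorem holds_eqE : (eqE a b).Holds s ↔ a.eval s = b.eval s := by
  simp [Holds, eqE, eval, Op.eval]
@[simp] theorem holds_ltE : (ltE a b).Holds s ↔ a.eval s < b.eval s := by
  simp [Holds, ltE, eval, Op.eval]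
@[simp] theorem holds_boolE : (boolE a).Holds s ↔ a.Holds s := by
  simp only [Holds, boolE, eval]; split_ifs <;> simp_all
@[simp] theorem holds_allE : (allE l).Holds s ↔ ∀ a ∈ l, a.Holds s := by
  induction l with
  | nil => simp [allE, Holds]
  | cons a l ih => simp only [allE, List.foldr_cons, holds_andE, List.forall_mem_cons] at ih ⊢; rw [ih]
@[simp] theorem holds_anyE : (anyE l).Holds s ↔ ∃ a ∈ l, a.Holds s := by
  induction l with
  | nil => simp [anyE, Holds]
  | cons a l ih => simp only [anyE, List.foldr_cons, holds_orE, List.exists_mem_cons_iff] at ih ⊢; rw [ih]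
-- A sum of natural numbers is nonzero as soon as one term is, so sums double as bounded existential
-- quantifiers.
@[simp] theorem holds_sum (x : ℕ) :
    (sum x a b).Holds s ↔ ∃ i < a.eval s, b.Holds (s.setReg x i) := by
  simp [Holds, Finset.sum_eq_zero_iff]
@[simp] theorem holds_letE (x : ℕ) : (letE x a b).Holds s ↔ b.Holds (s.setReg x (a.eval s)) :=
  Iff.rfl
@[simp] theorem holds_ite (c : Expr) :
    (ite c a b).Holds s ↔ (c.Holds s → a.Holds s) ∧ (¬ c.Holds s → b.Holds s) := by
  simp only [Holds, eval]; split_ifs with h <;> simp_all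

open Classical in
theorem eval_sum_boolE (x : ℕ) : (sum x a (boolE b)).eval s =
    ((Finset.range (a.eval s)).filter fun i => b.Holds (s.setReg x i)).card := by
  simp only [eval_sum, eval_boolE, Finset.card_filter]

theorem depth_allE {D : ℕ} (h : ∀ a ∈ l, a.depth ≤ D) : (allE l).depth ≤ D := by
  induction l with
  | nil => exact Nat.zero_le _
  | cons a l ih =>
    simp only [List.forall_mem_cons] at h
    exact max_le h.1 (max_le (ih h.2) (Nat.zero_le _))
theorem depth_anyE {D : ℕ} (h : ∀ a ∈ l, a.depth ≤ D) : (anyE l).depth ≤ D := by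
  induction l with
  | nil => exact Nat.zero_le _
  | cons a l ih =>
    simp only [List.forall_mem_cons] at h
    exact max_le h.1 (max_le (Nat.zero_le _) (ih h.2))
theorem depth_addE {D : ℕ} (h : ∀ a ∈ l, a.depth ≤ D) : (addE l).depth ≤ D := by
  induction l with
  | nil => exact Nat.zero_le _
  | cons a l ih =>
    simp only [List.forall_mem_cons] at h
    exact max_le h.1 (ih h.2)

theorem short_allE {Y : ℕ} (h : ∀ a ∈ l, a.Short Y s) : (allE l).Short Y s := by
  induction l with
  | nil => trivial
  | cons a l ih =>
    simp only [List.forall_mem_cons] at h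
    exact ⟨h.1, fun _ => ih h.2, fun _ => trivial⟩
theorem short_anyE {Y : ℕ} (h : ∀ a ∈ l, a.Short Y s) : (anyE l).Short Y s := by
  induction l with
  | nil => trivial
  | cons a l ih =>
    simp only [List.forall_mem_cons] at h
    exact ⟨h.1, fun _ => trivial, fun _ => ih h.2⟩
theorem short_addE {Y : ℕ} (h : ∀ a ∈ l, a.Short Y s) : (addE l).Short Y s := by
  induction l with
  | nil => trivial
  | cons a l ih =>
    simp only [List.forall_mem_cons] at h
    exact ⟨h.1, ih h.2⟩

/-- The sums of the expression have at most `Y` terms and are nested at most `D` deep. -/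
def Cheap (Y D : ℕ) (e : Expr) (s : State) : Prop := e.Short Y s ∧ e.depth ≤ D

section Cheap

variable {Y D : ℕ} {c : Expr}

theorem Cheap.cost_le (h : a.Cheap Y D s) : a.cost s ≤ a.size * (Y + 1) ^ D :=
  (cost_le_of_short h.1).trans
    (Nat.mul_le_mul_left _ (Nat.pow_le_pow_right (Nat.succ_pos Y) h.2))

theorem Cheap.mono {D' : ℕ} (h : a.Cheap Y D s) (hD : D ≤ D') : a.Cheap Y D' s :=
  ⟨h.1, h.2.trans hD⟩
theorem cheap_const (x : ℕ) : (Expr.const x).Cheap Y D s := ⟨trivial, Nat.zero_le _⟩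
theorem cheap_ofNat (x : ℕ) : (OfNat.ofNat x : Expr).Cheap Y D s := ⟨trivial, Nat.zero_le _⟩
theorem cheap_zero : (0 : Expr).Cheap Y D s := ⟨trivial, Nat.zero_le _⟩
theorem cheap_one : (1 : Expr).Cheap Y D s := ⟨trivial, Nat.zero_le _⟩
theorem cheap_var (x : ℕ) : (Expr.var x).Cheap Y D s := ⟨trivial, Nat.zero_le _⟩
theorem cheap_load (h : a.Cheap Y D s) : (Expr.load a).Cheap Y D s := h
theorem cheap_op (o : Op) (h : a.Cheap Y D s) (h' : b.Cheap Y D s) :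
    (Expr.op o a b).Cheap Y D s := ⟨⟨h.1, h'.1⟩, max_le h.2 h'.2⟩
theorem cheap_add (h : a.Cheap Y D s) (h' : b.Cheap Y D s) : (a + b).Cheap Y D s := cheap_op _ h h'
theorem cheap_sub (h : a.Cheap Y D s) (h' : b.Cheap Y D s) : (a - b).Cheap Y D s := cheap_op _ h h'
theorem cheap_mul (h : a.Cheap Y D s) (h' : b.Cheap Y D s) : (a * b).Cheap Y D s := cheap_op _ h h'
theorem cheap_div (h : a.Cheap Y D s) (h' : b.Cheap Y D s) : (a / b).Cheap Y D s := cheap_op _ h h'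
theorem cheap_mod (h : a.Cheap Y D s) (h' : b.Cheap Y D s) : (a % b).Cheap Y D s := cheap_op _ h h'
theorem cheap_ite (hc : c.Cheap Y D s) (h : a.Cheap Y D s) (h' : b.Cheap Y D s) :
    (Expr.ite c a b).Cheap Y D s :=
  ⟨⟨hc.1, fun _ => h.1, fun _ => h'.1⟩, max_le hc.2 (max_le h.2 h'.2)⟩
theorem cheap_letE {x : ℕ} (h : a.Cheap Y D s) (h' : b.Cheap Y D (s.setReg x (a.eval s))) :
    (Expr.letE x a b).Cheap Y D s := ⟨⟨h.1, h'.1⟩, max_le h.2 h'.2⟩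
-- The depth is syntactic and has to be bounded even if the sum is empty in the given state; this is
-- why `hb` is asked for in addition to `h'`.
theorem cheap_sum {x : ℕ} (h : a.Cheap Y (D + 1) s) (hY : a.eval s ≤ Y)
    (h' : ∀ i < a.eval s, b.Cheap Y D (s.setReg x i)) (hb : b.depth ≤ D) :
    (Expr.sum x a b).Cheap Y (D + 1) s :=
  ⟨⟨h.1, hY, fun i hi => (h' i hi).1⟩, max_le h.2 (Nat.succ_le_succ hb)⟩
theorem cheap_notE (h : a.Cheap Y D s) : (notE a).Cheap Y D s := cheap_op _ h cheap_zero
theorem cheap_andE (h : a.Cheap Y D s) (h' : b.Cheap Y D s) : (andE a b).Cheap Y D s :=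
  cheap_ite h h' cheap_zero
theorem cheap_orE (h : a.Cheap Y D s) (h' : b.Cheap Y D s) : (orE a b).Cheap Y D s :=
  cheap_ite h cheap_one h'
theorem cheap_eqE (h : a.Cheap Y D s) (h' : b.Cheap Y D s) : (eqE a b).Cheap Y D s :=
  cheap_op _ h h'
theorem cheap_ltE (h : a.Cheap Y D s) (h' : b.Cheap Y D s) : (ltE a b).Cheap Y D s :=
  cheap_op _ h h'
theorem cheap_boolE (h : a.Cheap Y D s) : (boolE a).Cheap Y D s :=
  cheap_ite h cheap_one cheap_zero
theorem cheap_allE (h : ∀ a ∈ l, a.Cheap Y D s) : (allE l).Cheap Y D s :=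
  ⟨short_allE fun a ha => (h a ha).1, depth_allE fun a ha => (h a ha).2⟩
theorem cheap_anyE (h : ∀ a ∈ l, a.Cheap Y D s) : (anyE l).Cheap Y D s :=
  ⟨short_anyE fun a ha => (h a ha).1, depth_anyE fun a ha => (h a ha).2⟩
theorem cheap_addE (h : ∀ a ∈ l, a.Cheap Y D s) : (addE l).Cheap Y D s :=
  ⟨short_addE fun a ha => (h a ha).1, depth_addE fun a ha => (h a ha).2⟩

end Cheap

end Expr

end WordRAM

/-! ### Matrices stored row by row. -/

theorem List.length_flatMap_const {α β : Type*} (L : List α) {f : α → List β} {c : ℕ}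
    (h : ∀ x ∈ L, (f x).length = c) : (L.flatMap f).length = L.length * c := by
  induction L with
  | nil => simp
  | cons a L ih =>
    rw [List.forall_mem_cons] at h
    simp [ih h.2, h.1]; ring

theorem List.getElem?_flatMap_const {α β : Type*} (L : List α) {f : α → List β} {c : ℕ}
    (h : ∀ x ∈ L, (f x).length = c) {i j : ℕ} (hi : i < L.length) (hj : j < c) :
    (L.flatMap f)[i * c + j]? = (f L[i])[j]? := by
  induction L generalizing i with
  | nil => simp at hi
  | cons a L ih =>
    rw [List.forall_mem_cons] at h
    rw [List.flatMap_cons]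
    cases i with
    | zero =>
      rw [List.getElem?_append_left (by rw [h.1]; omega)]; simp
    | succ i =>
      rw [List.getElem?_append_right (by rw [h.1, Nat.succ_mul]; omega), h.1,
        show (i + 1) * c + j - c = i * c + j by rw [Nat.succ_mul]; omega, ih h.2 (by simpa using hi)]
      simp

namespace MatMul

open WordRAM

theorem length_rowMajor {n : ℕ} (A : Matrix (Fin n) (Fin n) ℕ) : (rowMajor A).length = n * n := by
  rw [rowMajor, List.length_flatMap_const (c := n)] <;> simp

theorem rowMajor_getD {n : ℕ} (A : Matrix (Fin n) (Fin n) ℕ) (i j : Fin n) :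
    (rowMajor A).getD (i * n + j) 0 = A i j := by
  rw [List.getD_eq_getElem?_getD, rowMajor, List.getElem?_flatMap_const (c := n)]
  · simp
  · simp
  · simp
  · simp

theorem input_left {n : ℕ} (A B : Matrix (Fin n) (Fin n) ℕ) (i j : Fin n) :
    (n :: (rowMajor A ++ rowMajor B)).getD (1 + (i * n + j)) 0 = A i j := by
  have : (i : ℕ) * n + j < n * n := by have := i.2; have := j.2; nlinarith
  rw [add_comm, List.getD_cons_succ, List.getD_append _ _ _ _ (by rwa [length_rowMajor]),
    rowMajor_getD]

theorem input_right {n : ℕ} (A B : Matrix (Fin n) (Fin n) ℕ) (i j : Fin n) :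
    (n :: (rowMajor A ++ rowMajor B)).getD (1 + n * n + (i * n + j)) 0 = B i j := by
  rw [add_right_comm, Nat.add_comm, Nat.add_comm 1, ← add_assoc, List.getD_cons_succ,
    List.getD_append_right _ _ _ _ (by rw [length_rowMajor]; omega), length_rowMajor,
    Nat.add_sub_cancel_left, rowMajor_getD]

theorem input_beyond {n : ℕ} (A B : Matrix (Fin n) (Fin n) ℕ) {a : ℕ} (h : 1 + 2 * n ^ 2 ≤ a) :
    (n :: (rowMajor A ++ rowMajor B)).getD a 0 = 0 := by
  rw [List.getD_eq_getElem?_getD, List.getElem?_eq_none]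
  · rfl
  · simp [length_rowMajor]; nlinarith

end MatMul

/-! ### Schoolbook multiplication and the bounds `2 ≤ ω ≤ 3`. -/

namespace WordRAM

theorem Stmt.deg_pos (p : Stmt) : 1 ≤ p.deg := by
  induction p with
  | skip => exact le_rfl
  | assign x e => exact e.deg_pos
  | store a e => exact a.deg_pos.trans (le_max_left _ _)
  | seq p q ih _ => exact ih.trans (le_max_left _ _)
  | ite c p q _ _ => exact c.deg_pos.trans (le_max_left _ _)
  | loop c p _ => exact c.deg_pos.trans (le_max_left _ _)

/-- A run of `t` steps changes at most `t` memory cells. -/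
theorem Exec.exists_changed {W : ℕ} {p : Prog} {s s' : State} {t : ℕ} (h : Exec W p s t s') :
    ∃ F : Finset ℕ, F.card ≤ t ∧ ∀ i ∉ F, s'.mem i = s.mem i := by
  induction h with
  | skip | const | op | load | loopDone => exact ⟨∅, by simp, fun _ _ => rfl⟩
  | store s a b => exact ⟨{s.reg a}, by simp, fun i hi => by simp at hi; simp [hi]⟩
  | seq _ _ ih₁ ih₂ =>
    obtain ⟨F, hF, h⟩ := ih₁
    obtain ⟨F', hF', h'⟩ := ih₂
    refine ⟨F ∪ F', (Finset.card_union_le _ _).trans (by omega), fun i hi => ?_⟩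
    rw [Finset.notMem_union] at hi
    rw [h' i hi.2, h i hi.1]
  | iteTrue _ _ ih | iteFalse _ _ ih =>
    obtain ⟨F, hF, h⟩ := ih
    exact ⟨F, by omega, h⟩
  | loopStep _ _ _ ih₁ ih₂ =>
    obtain ⟨F, hF, h⟩ := ih₁
    obtain ⟨F', hF', h'⟩ := ih₂
    refine ⟨F ∪ F', (Finset.card_union_le _ _).trans (by omega), fun i hi => ?_⟩
    rw [Finset.notMem_union] at hi
    rw [h' i hi.2, h i hi.1]

end WordRAM

namespace MatMul

open WordRAM Expr

/-- The schoolbook algorithm. -/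
def naive : Stmt :=
  .seq (.assign 6 (.load 0)) <| .forL 7 6 <| .forL 8 6 <|
    .store (1 + 2 * (.var 6 * .var 6) + (.var 7 * .var 6 + .var 8))
      (.sum 9 (.var 6) (.load (1 + (.var 7 * .var 6 + .var 9)) *
        .load (1 + .var 6 * .var 6 + (.var 9 * .var 6 + .var 8))))

theorem naive_spec {X n : ℕ} (w : List ℕ) (h0 : w.getD 0 0 = n) (hn : n ≤ X)
    (hX : ∀ i < n, ∀ j < n, ∑ l ∈ Finset.range n, w.getD (1 + (i * n + l)) 0 *
      w.getD (1 + n * n + (l * n + j)) 0 ≤ X) :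
    Tri X naive (State.init w) (n * ((n * ((100 * (n + 1)) + 8) + 6) + 8) + 6 + 3) fun s =>
      ∀ i < n, ∀ j < n, s.mem (1 + 2 * n ^ 2 + (i * n + j)) =
        ∑ l ∈ Finset.range n, w.getD (1 + (i * n + l)) 0 *
          w.getD (1 + n * n + (l * n + j)) 0 := by
  set P : ℕ → ℕ → ℕ := fun i j => ∑ l ∈ Finset.range n, w.getD (1 + (i * n + l)) 0 *
    w.getD (1 + n * n + (l * n + j)) 0 with hP
  refine Tri.assign_seq (v := n) h0 hn
    (T₂ := n * ((n * ((100 * (n + 1)) + 8) + 6) + 8) + 6) ?_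
    (show 2 + 1 + _ ≤ _ by omega)
  refine Tri.forL (N := n) (fun i s => s.reg 6 = n ∧ (∀ a < 1 + 2 * n ^ 2, s.mem a = w.getD a 0) ∧
    ∀ i' < i, ∀ j < n, s.mem (1 + 2 * n ^ 2 + (i' * n + j)) = P i' j) hn ?_ ?_ ?_ ?_
  · exact ⟨by simp, fun a _ => rfl, fun i' hi' => by omega⟩
  · exact fun i s h => h.1
  · rintro i hi s ⟨h6, hm, hd⟩ h7
    refine Tri.forL (N := n) (fun j s => s.reg 6 = n ∧ s.reg 7 = i ∧
      (∀ a < 1 + 2 * n ^ 2, s.mem a = w.getD a 0) ∧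
      (∀ i' < i, ∀ j < n, s.mem (1 + 2 * n ^ 2 + (i' * n + j)) = P i' j) ∧
      ∀ j' < j, s.mem (1 + 2 * n ^ 2 + (i * n + j')) = P i j') hn ?_ ?_ ?_ ?_
    · exact ⟨by simpa using h6, by simpa using h7, hm, hd, fun j hj => by omega⟩
    · exact fun i s h => h.1
    · rintro j hj s ⟨h6, h7, hm, hd, he⟩ h8
      refine Tri.store (u := 1 + 2 * n ^ 2 + (i * n + j)) (v := P i j) ?_ ?_ (hX i hi j hj) ?_ ?_
      · simp [h6, h7, h8]; ring
      · simp only [eval_sum, eval_var, h6, hP]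
        refine Finset.sum_congr rfl fun l hl => ?_
        have hl' : l < n := Finset.mem_range.1 hl
        simp only [eval_mul, eval_load, eval_add, eval_one, eval_var, State.reg_setReg,
          State.mem_setReg, h6, h7, h8]
        norm_num
        rw [hm _ (by nlinarith), hm _ (by nlinarith)]; simp
      · have := cost_sum_le (x := 9) (b := .var 6) (s := s) (T := 30)
          (e := .load (1 + (.var 7 * .var 6 + .var 9)) *
            .load (1 + .var 6 * .var 6 + (.var 9 * .var 6 + .var 8))) fun i _ => by
              simp only [HAdd.hAdd, Add.add, Expr.cost]; decide
        have hc : Expr.cost (1 + 2 * (.var 6 * .var 6) + (.var 7 * .var 6 + .var 8)) s = 13 := rfl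
        have hc' : Expr.cost (.var 6) s = 1 := rfl
        rw [eval_var, h6] at this
        rw [hc]; omega
      · refine ⟨by simpa using h8, by simpa using h6, by simpa using h7, fun a ha => ?_,
          fun i' hi' j' hj' => ?_, fun j' hj' => ?_⟩
        · rw [State.mem_setReg, State.mem_setMem, if_neg (by omega), hm a ha]
        · rw [State.mem_setReg, State.mem_setMem, if_neg (by nlinarith), hd i' hi' j' hj']
        · rw [State.mem_setReg, State.mem_setMem]
          split_ifs with h
          · rw [show j' = j by omega]
          · exact he j' (by rcases Nat.lt_succ_iff_lt_or_eq.1 hj' with h' | rfl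
                            · exact h'
                            · exact absurd rfl h)
    · rintro s ⟨h6, h7, hm, hd, he⟩ _
      refine ⟨h7, by simpa using h6, hm, fun i' hi' j hj => ?_⟩
      rcases Nat.lt_succ_iff_lt_or_eq.1 hi' with h' | rfl
      · exact hd i' h' j hj
      · exact he j hj
  · exact fun s h _ => h.2.2

theorem sum_getD_eq_mul {n : ℕ} (A B : Matrix (Fin n) (Fin n) ℕ) (i j : Fin n) :
    ∑ l ∈ Finset.range n, (n :: (rowMajor A ++ rowMajor B)).getD (1 + (i * n + l)) 0 *
      (n :: (rowMajor A ++ rowMajor B)).getD (1 + n * n + (l * n + j)) 0 = (A * B) i j := by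
  rw [Finset.sum_range, Matrix.mul_apply]
  refine Finset.sum_congr rfl fun l _ => ?_
  rw [input_left, input_right]

theorem mem_input {n q : ℕ} {A B : Matrix (Fin n) (Fin n) ℕ} (hA : ∀ i j, A i j ≤ n ^ q)
    (hB : ∀ i j, B i j ≤ n ^ q) {x : ℕ} (hx : x ∈ n :: (rowMajor A ++ rowMajor B)) :
    x ≤ max n (n ^ q) := by
  simp only [List.mem_cons, List.mem_append, rowMajor, List.mem_flatMap, List.mem_map] at hx
  rcases hx with rfl | ⟨i, _, j, _, rfl⟩ | ⟨i, _, j, _, rfl⟩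
  · exact le_max_left _ _
  · exact (hA i j).trans (le_max_right _ _)
  · exact (hB i j).trans (le_max_right _ _)

/-- Needed only to know that the set of exponents defining `omega` is not empty and contains `3`. -/
theorem naive_multiplies (q : ℕ) :
    MultipliesInTime naive.compile q fun n => (300 : ℝ) * (n : ℝ) ^ (3 : ℝ) := by
  refine ⟨(2 * q + 1) * naive.deg, fun n hn A B hA hB => ?_⟩
  have hpow : ∀ {i}, i ≤ 2 * q + 1 → n ^ i ≤ (n + 2) ^ (2 * q + 1) := fun {i} hi =>
    (Nat.pow_le_pow_left (by omega) i).trans (Nat.pow_le_pow_right (by omega) hi)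
  have hX : ∀ i < n, ∀ j < n, ∑ l ∈ Finset.range n,
      (n :: (rowMajor A ++ rowMajor B)).getD (1 + (i * n + l)) 0 *
      (n :: (rowMajor A ++ rowMajor B)).getD (1 + n * n + (l * n + j)) 0 ≤ (n + 2) ^ (2 * q + 1) := by
    intro i hi j hj
    have := sum_getD_eq_mul A B ⟨i, hi⟩ ⟨j, hj⟩
    simp only at this
    rw [this, Matrix.mul_apply]
    refine (Finset.sum_le_card_nsmul _ _ (n ^ q * n ^ q) fun l _ =>
      Nat.mul_le_mul (hA _ _) (hB _ _)).trans ?_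
    simp only [Finset.card_univ, Fintype.card_fin, smul_eq_mul]
    calc n * (n ^ q * n ^ q) = n ^ (2 * q + 1) := by ring
      _ ≤ _ := hpow le_rfl
  have h := naive_spec (X := (n + 2) ^ (2 * q + 1)) (n := n) (n :: (rowMajor A ++ rowMajor B)) rfl
    (by simpa using hpow (i := 1) (by omega)) hX
  have h2 : 2 ≤ (n + 2) ^ (2 * q + 1) :=
    le_trans (by omega) (Nat.le_self_pow (by omega) (n + 2))
  obtain ⟨t, s, σ, hr, ht, hrel, hs⟩ := h.runs h2 (le_trans (by decide) h2) le_rfl naive.deg_pos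
    (fun x hx => (mem_input hA hB hx).trans (max_le (by simpa using hpow (i := 1) (by omega))
      (hpow (by omega))))
  refine ⟨t, σ, by rwa [pow_mul], ?_, fun i j => ?_⟩
  · have h3 : n * ((n * ((100 * (n + 1)) + 8) + 6) + 8) + 6 + 3 ≤ 300 * n ^ 3 := by
      obtain ⟨m, rfl⟩ : ∃ m, n = m + 1 := ⟨n - 1, by omega⟩
      ring_nf; nlinarith [Nat.zero_le m, Nat.zero_le (m ^ 2), Nat.zero_le (m ^ 3)]
    have h4 : (t : ℝ) ≤ ((300 * n ^ 3 : ℕ) : ℝ) := by exact_mod_cast ht.trans h3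
    refine h4.trans (le_of_eq ?_)
    push_cast
    rw [show (3 : ℝ) = ((3 : ℕ) : ℝ) by norm_num, Real.rpow_natCast]
  · rw [hrel.2, hs i i.2 j j.2, sum_getD_eq_mul]

/-- Multiply two all-ones matrices. All `n ^ 2` entries of the product are nonzero and have to
appear in cells that are `0` at the beginning, while a step changes at most one cell. -/
theorem sq_le_time {p : Prog} {T : ℕ → ℝ} (h : MultipliesInTime p 0 T) {n : ℕ} (hn : 0 < n) :
    (n : ℝ) ^ 2 ≤ T n := by
  obtain ⟨D, h⟩ := h
  obtain ⟨t, s, hr, ht, hs⟩ := h n hn (Matrix.of fun _ _ => 1) (Matrix.of fun _ _ => 1) (by simp) (by simp)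
  obtain ⟨F, hF, hch⟩ := hr.2.exists_changed
  have hsub : (Finset.range (n * n)).image (fun a => 1 + 2 * n ^ 2 + a) ⊆ F := by
    intro a ha
    obtain ⟨u, hu, rfl⟩ := Finset.mem_image.1 ha
    rw [Finset.mem_range] at hu
    by_contra hc
    have h1 := hch _ hc
    have h2 := hs ⟨u / n, Nat.div_lt_of_lt_mul hu⟩ ⟨u % n, Nat.mod_lt _ hn⟩
    simp only at h2
    rw [Nat.div_add_mod', h1, State.init] at h2
    simp only at h2
    rw [input_beyond _ _ (by omega), Matrix.mul_apply] at h2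
    simp at h2; omega
  have h1 := Finset.card_le_card hsub
  rw [Finset.card_image_of_injective _ (fun a b h => by simpa using h), Finset.card_range] at h1
  have h2 : n ^ 2 ≤ t := by nlinarith
  calc (n : ℝ) ^ 2 = ((n ^ 2 : ℕ) : ℝ) := by push_cast; rfl
    _ ≤ t := by exact_mod_cast h2
    _ ≤ T n := ht

/-- A polynomial that is bounded by another one has at most its degree. -/
theorem _root_.le_of_forall_rpow_le {C x y : ℝ} (h : ∀ n : ℕ, 0 < n → (n : ℝ) ^ x ≤ C * (n : ℝ) ^ y) :
    x ≤ y := by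
  by_contra hlt
  push Not at hlt
  have ht := (tendsto_rpow_atTop (sub_pos.2 hlt)).comp tendsto_natCast_atTop_atTop
  obtain ⟨n, hn, hn0⟩ := ((ht.eventually_gt_atTop C).and (Filter.eventually_gt_atTop 0)).exists
  have hp : (0 : ℝ) < n := by exact_mod_cast hn0
  have := h n hn0
  simp only [Function.comp] at hn
  rw [Real.rpow_sub hp, lt_div_iff₀ (Real.rpow_pos_of_pos hp _)] at hn
  linarith

theorem two_le_of_multiplies {τ C : ℝ} {p : Prog}
    (h : MultipliesInTime p 0 fun n => C * (n : ℝ) ^ τ) : 2 ≤ τ := by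
  refine le_of_forall_rpow_le (C := C) fun n hn => ?_
  rw [Real.rpow_two]; exact sq_le_time h hn

/-- Without this `sInf` would take its default value and `omega` would carry no information. -/
theorem exponents_bddBelow : BddBelow {τ : ℝ | ∀ q : ℕ, ∃ (p : Prog) (C : ℝ),
    MultipliesInTime p q fun n => C * (n : ℝ) ^ τ} :=
  ⟨2, fun _ hτ => let ⟨_, _, h⟩ := hτ 0; two_le_of_multiplies h⟩

theorem three_mem_exponents : (3 : ℝ) ∈ {τ : ℝ | ∀ q : ℕ, ∃ (p : Prog) (C : ℝ),
    MultipliesInTime p q fun n => C * (n : ℝ) ^ τ} :=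
  fun q => ⟨_, 300, naive_multiplies q⟩

theorem two_le_omega : 2 ≤ omega :=
  le_csInf ⟨3, three_mem_exponents⟩ fun _ hτ => let ⟨_, _, h⟩ := hτ 0; two_le_of_multiplies h

theorem omega_le_three : omega ≤ 3 := csInf_le exponents_bddBelow three_mem_exponents

/-- The infimum need not be attained, so some exponent slightly above it is used. The case `q = 0`
of matrices with entries `0` and `1` is all that the counting needs. -/
theorem exists_multiplies {δ : ℝ} (hδ : 0 < δ) : ∃ τ < omega + δ, 2 ≤ τ ∧ ∃ (p : Prog) (C : ℝ),
    MultipliesInTime p 0 fun n => C * (n : ℝ) ^ τ := by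
  obtain ⟨τ, hτ, hlt⟩ := exists_lt_of_csInf_lt ⟨3, three_mem_exponents⟩
    (lt_add_of_pos_right omega hδ)
  obtain ⟨p, C, h⟩ := hτ 0
  exact ⟨τ, hlt, two_le_of_multiplies h, p, C, h⟩

end MatMul

/-! ## Counting independent sets by chains of hyperedges -/

namespace Chain

section

variable (F : ℕ → Finset ℕ) (m : ℕ)

/-- The union of the hyperedges of a chain. -/
def U : List ℕ → Finset ℕ
  | [] => ∅
  | e :: c => U c ∪ F e

/-- `f` precedes the first index of the chain. -/
def Below : List ℕ → ℕ → Prop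
  | [], _ => True
  | e :: _, f => f < e

/-- The indices decrease towards the head, and each hyperedge contributes at least three new
vertices. -/
def Valid : List ℕ → Prop
  | [] => True
  | e :: c => Below c e ∧ 3 ≤ (F e \ U F c).card ∧ Valid c

/-- The hyperedges that are reduced to at most two vertices at some stage of the chain. -/
def Active : List ℕ → ℕ → Prop
  | [], f => (F f).card ≤ 2
  | e :: c, f => (f < e ∧ (F f \ U F (e :: c)).card ≤ 2) ∨ Active c f

/-- `S` contains no active hyperedge. -/
def Leaf (c : List ℕ) (S : Finset ℕ) : Prop := ∀ f < m, F f ⊆ S → ¬ Active F c f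

/-- `S` contains no active hyperedge and no hyperedge that precedes the chain. -/
def Full (c : List ℕ) (S : Finset ℕ) : Prop := Leaf F m c S ∧ ∀ f < m, F f ⊆ S → ¬ Below c f

/-- The chain with `t` entries that is given by the digits of a number in base `m`. -/
def digits : ℕ → ℕ → List ℕ
  | 0, _ => []
  | t + 1, x => (x % m) :: digits t (x / m)

end

variable {F : ℕ → Finset ℕ} {m : ℕ}

theorem length_digits (t x : ℕ) : (digits m t x).length = t := by
  induction t generalizing x with
  | zero => rfl
  | succ t ih => simp [digits, ih]

theorem active_of_below {c : List ℕ} {f : ℕ} (h : Below c f) (hc : (F f \ U F c).card ≤ 2) :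
    Active F c f := by
  cases c with
  | nil => simpa [U, Active] using hc
  | cons e c => exact Or.inl ⟨h, hc⟩

/-- A hyperedge is activated at some earlier stage of the chain; the union only grows afterwards, so
at most two vertices remain outside. -/
theorem card_sdiff_le_of_active {c : List ℕ} {f : ℕ} (h : Active F c f) :
    (F f \ U F c).card ≤ 2 := by
  induction c with
  | nil => simpa [U, Active] using h
  | cons e c ih =>
    rcases h with h | h
    · exact h.2
    · exact (Finset.card_le_card (Finset.sdiff_subset_sdiff le_rfl Finset.subset_union_left)).trans
        (ih h)

/-- Each entry is responsible for three vertices of its own. This trades a factor `m` in the number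
of chains for three vertices fewer to be chosen, and it bounds the length of the chains. -/
theorem three_mul_length_le {c : List ℕ} (h : Valid F c) : 3 * c.length ≤ (U F c).card := by
  induction c with
  | nil => simp
  | cons e c ih =>
    have h1 := ih h.2.2
    have h2 := h.2.1
    have h3 : (U F (e :: c)).card = (F e \ U F c).card + (U F c).card := by
      rw [U, Finset.card_sdiff_add_card, Finset.union_comm]
    rw [List.length_cons]; omega

-- The heart of the counting argument. If `S` has no active hyperedge but contains some hyperedge
-- preceding the chain, let `e` be the first hyperedge inside `S`. It is not active, so it adds at
-- least three vertices and `e :: c` is valid. No other `e'` contributes, because `e` precedes `e'`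
-- and lies in `S`. If `S` contains an active hyperedge, then neither `c` nor an extension
-- contributes, since active hyperedges stay active.
open Classical in
theorem leaf_eq {c : List ℕ} (hc : Valid F c) (S : Finset ℕ) :
    (if Leaf F m c S then 1 else 0 : ℤ) = (if Full F m c S then 1 else 0) +
      ∑ e ∈ Finset.range m, if Valid F (e :: c) ∧ F e ⊆ S ∧ Full F m (e :: c) S then 1 else 0 := by
  by_cases hl : Leaf F m c S
  · by_cases hf : Full F m c S
    · rw [if_pos hl, if_pos hf, Finset.sum_eq_zero]; · simp
      intro e he
      rw [if_neg]
      rintro ⟨hv, hs, -⟩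
      exact hf.2 e (Finset.mem_range.1 he) hs hv.1
    · have hex : ∃ f, f < m ∧ F f ⊆ S ∧ Below c f := by
        by_contra hcon
        exact hf ⟨hl, fun f hf hs hb => hcon ⟨f, hf, hs, hb⟩⟩
      have hex' : ∃ f, f < m ∧ F f ⊆ S := let ⟨f, h1, h2, _⟩ := hex; ⟨f, h1, h2⟩
      obtain ⟨hm, hs⟩ := Nat.find_spec hex'
      have hmin : ∀ f < m, F f ⊆ S → Nat.find hex' ≤ f := fun f h1 h2 => Nat.find_min' hex' ⟨h1, h2⟩
      set e := Nat.find hex'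
      have hb : Below c e := by
        obtain ⟨f, h1, h2, h3⟩ := hex
        cases c with
        | nil => trivial
        | cons e' c => exact lt_of_le_of_lt (hmin f h1 h2) h3
      have hv : Valid F (e :: c) := by
        refine ⟨hb, ?_, hc⟩
        by_contra hlt
        -- With at most two new vertices `e` would be active, and `S` contains no active hyperedge.
        exact hl e hm hs (active_of_below hb (by omega))
      -- Hyperedges that are active for `e :: c` but not for `c` precede `e`, so by minimality none
      -- of them lies in `S`.
      have hfull : Full F m (e :: c) S := by
        refine ⟨fun f h1 h2 h3 => ?_, fun f h1 h2 h3 => absurd (hmin f h1 h2) (not_le.2 h3)⟩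
        rcases h3 with h3 | h3
        · exact absurd (hmin f h1 h2) (not_le.2 h3.1)
        · exact hl f h1 h2 h3
      rw [if_pos hl, if_neg hf, Finset.sum_eq_single e]
      · rw [if_pos ⟨hv, hs, hfull⟩]; simp
      · intro e' he' hne
        rw [if_neg]
        rintro ⟨-, hs', hf'⟩
        exact hf'.2 e hm hs (lt_of_le_of_ne (hmin e' (Finset.mem_range.1 he') hs') hne.symm)
      · intro h; exact absurd (Finset.mem_range.2 hm) h
  · rw [if_neg hl, if_neg fun h => hl h.1, Finset.sum_eq_zero]; · simp
    intro e _
    rw [if_neg]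
    rintro ⟨-, -, h⟩
    exact hl fun f h1 h2 h3 => h.1 f h1 h2 (Or.inr h3)

theorem _root_.Finset.sum_range_mul' {M : Type*} [AddCommMonoid M] (a m : ℕ) (f : ℕ → M) :
    ∑ x ∈ Finset.range (a * m), f x =
      ∑ y ∈ Finset.range a, ∑ e ∈ Finset.range m, f (y * m + e) := by
  induction a with
  | zero => simp
  | succ a ih => rw [Finset.sum_range_succ, Nat.succ_mul, Finset.sum_range_add, ih]

/-- The lowest digit is the head of the chain, so the numbers below `m ^ (t + 1)` run through all
one-step extensions of the chains with `t` entries. -/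
theorem sum_digits {M : Type*} [AddCommMonoid M] (t : ℕ) (h : List ℕ → M) :
    ∑ x ∈ Finset.range (m ^ (t + 1)), h (digits m (t + 1) x) =
      ∑ x ∈ Finset.range (m ^ t), ∑ e ∈ Finset.range m, h (e :: digits m t x) := by
  rw [pow_succ, Finset.sum_range_mul']
  refine Finset.sum_congr rfl fun x _ => Finset.sum_congr rfl fun e he => ?_
  have he := Finset.mem_range.1 he
  have h1 : (x * m + e) % m = e := by
    rw [mul_comm, Nat.mul_add_mod, Nat.mod_eq_of_lt he]
  have h2 : (x * m + e) / m = x := by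
    rw [mul_comm, Nat.mul_add_div (by omega), Nat.div_eq_of_lt he, add_zero]
  rw [digits, h1, h2]

-- By `leaf_eq`, the number of chains of length `t` that end in a leaf is `full t + full (t + 1)`,
-- and the alternating sum telescopes. The top term vanishes since `T + 1` entries would need more
-- vertices than `S` has; `full 0` concerns the empty chain, which every hyperedge precedes.
open Classical in
theorem sum_chains (S : Finset ℕ) {T : ℕ} (hT : S.card < 3 * (T + 1)) :
    ∑ t ∈ Finset.range (T + 1), (-1) ^ t * ∑ x ∈ Finset.range (m ^ t),
      (if Valid F (digits m t x) ∧ U F (digits m t x) ⊆ S ∧ Leaf F m (digits m t x) S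
        then 1 else 0 : ℤ) = if ∀ f < m, ¬ F f ⊆ S then 1 else 0 := by
  set full : ℕ → ℤ := fun t => ∑ x ∈ Finset.range (m ^ t),
    (if Valid F (digits m t x) ∧ U F (digits m t x) ⊆ S ∧ Full F m (digits m t x) S
        then 1 else 0 : ℤ) with hfull
  have step : ∀ t, ∑ x ∈ Finset.range (m ^ t),
      (if Valid F (digits m t x) ∧ U F (digits m t x) ⊆ S ∧ Leaf F m (digits m t x) S
        then 1 else 0 : ℤ) = full t + full (t + 1) := by
    intro t
    simp only [hfull]
    rw [sum_digits t fun c => (if Valid F c ∧ U F c ⊆ S ∧ Full F m c S then 1 else 0 : ℤ),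
      ← Finset.sum_add_distrib]
    refine Finset.sum_congr rfl fun x _ => ?_
    set c := digits m t x
    by_cases hc : Valid F c ∧ U F c ⊆ S
    · have h1 : (if Valid F c ∧ U F c ⊆ S ∧ Leaf F m c S then 1 else 0 : ℤ) =
          if Leaf F m c S then 1 else 0 := by simp [hc.1, hc.2]
      have h2 : (if Valid F c ∧ U F c ⊆ S ∧ Full F m c S then 1 else 0 : ℤ) =
          if Full F m c S then 1 else 0 := by simp [hc.1, hc.2]
      rw [h1, h2, leaf_eq hc.1]
      congr 1
      refine Finset.sum_congr rfl fun e _ => ?_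
      have : U F (e :: c) ⊆ S ↔ F e ⊆ S := by
        rw [U, Finset.union_subset_iff]; exact and_iff_right hc.2
      simp only [this]
    · rw [if_neg fun h => hc ⟨h.1, h.2.1⟩, if_neg fun h => hc ⟨h.1, h.2.1⟩, Finset.sum_eq_zero]
      · simp
      · intro e _
        rw [if_neg]
        rintro ⟨h1, h2, -⟩
        exact hc ⟨h1.2.2, Finset.union_subset_left h2⟩
  have tele : ∀ N, ∑ t ∈ Finset.range N, (-1) ^ t * (full t + full (t + 1)) =
      full 0 - (-1) ^ N * full N := by
    intro N
    induction N with
    | zero => simp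
    | succ N ih => rw [Finset.sum_range_succ, ih, pow_succ]; ring
  have hlast : full (T + 1) = 0 := by
    refine Finset.sum_eq_zero fun x _ => if_neg ?_
    rintro ⟨h1, h2, -⟩
    have := three_mul_length_le h1
    rw [length_digits] at this
    have := Finset.card_le_card h2
    omega
  have hfirst : full 0 = if ∀ f < m, ¬ F f ⊆ S then 1 else 0 := by
    have : ∀ c : List ℕ, c = [] → ((Valid F c ∧ U F c ⊆ S ∧ Full F m c S) ↔
        ∀ f < m, ¬ F f ⊆ S) := by
      rintro _ rfl
      constructor
      · rintro ⟨-, -, h⟩ f hf hs; exact h.2 f hf hs trivial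
      · intro h; exact ⟨trivial, by simp [U], fun f hf hs => absurd hs (h f hf),
          fun f hf hs => absurd hs (h f hf)⟩
    simp only [hfull, pow_zero, Finset.range_one, Finset.sum_singleton]
    congr 1
    exact propext (this _ rfl)
  simp only [step]
  rw [tele, hlast, hfirst]; simp

open Classical in
/-- The number of independent sets is an alternating sum over the chains. -/
theorem card_independent {n k T : ℕ} (hT : k < 3 * (T + 1)) :
    ∑ t ∈ Finset.range (T + 1), (-1) ^ t * ∑ x ∈ Finset.range (m ^ t),
      (if Valid F (digits m t x) then (((Finset.range n).powersetCard k).filter fun S =>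
        U F (digits m t x) ⊆ S ∧ Leaf F m (digits m t x) S).card else 0 : ℤ) =
    (((Finset.range n).powersetCard k).filter fun S => ∀ f < m, ¬ F f ⊆ S).card := by
  rw [Finset.card_filter, Nat.cast_sum]
  have : ∀ S ∈ (Finset.range n).powersetCard k, ((if ∀ f < m, ¬ F f ⊆ S then 1 else 0 : ℕ) : ℤ) =
      ∑ t ∈ Finset.range (T + 1), (-1) ^ t * ∑ x ∈ Finset.range (m ^ t),
      (if Valid F (digits m t x) ∧ U F (digits m t x) ⊆ S ∧ Leaf F m (digits m t x) S
        then 1 else 0 : ℤ) := by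
    intro S hS
    rw [sum_chains S (by rw [(Finset.mem_powersetCard.1 hS).2]; exact hT)]
    push_cast; rfl
  rw [Finset.sum_congr rfl this, Finset.sum_comm]
  refine Finset.sum_congr rfl fun t _ => ?_
  rw [← Finset.mul_sum, Finset.sum_comm]
  congr 1
  refine Finset.sum_congr rfl fun x _ => ?_
  split_ifs with h
  · simp only [h, true_and, Finset.card_filter]; push_cast; rfl
  · simp [h]

end Chain

/-! ## Small sets as triples of numbers -/

namespace Triples

/-- The digit of `a` at position `i` in base `n`. -/
def dig (n a i : ℕ) : ℕ := a / n ^ i % n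

/-- The number with the given digits in base `n`. -/
def enc (n p : ℕ) (x : ℕ → ℕ) : ℕ := ∑ i ∈ Finset.range p, x i * n ^ i

theorem enc_succ (n p : ℕ) (x : ℕ → ℕ) : enc n (p + 1) x = x 0 + n * enc n p fun i => x (i + 1) := by
  rw [enc, Finset.sum_range_succ', enc, Finset.mul_sum, add_comm]
  simp only [pow_zero, mul_one]
  congr 1
  exact Finset.sum_congr rfl fun i _ => by ring

theorem dig_succ (n a i : ℕ) : dig n a (i + 1) = dig n (a / n) i := by
  rw [dig, dig, pow_succ', Nat.div_div_eq_div_mul]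

theorem enc_lt {n p : ℕ} {x : ℕ → ℕ} (h : ∀ i < p, x i < n) : enc n p x < n ^ p := by
  induction p generalizing x with
  | zero => simp [enc]
  | succ p ih =>
    have h1 := h 0 (by omega)
    have h2 := ih (x := fun i => x (i + 1)) fun i hi => h (i + 1) (by omega)
    rw [enc_succ, pow_succ']
    nlinarith

theorem dig_enc {n p : ℕ} {x : ℕ → ℕ} (h : ∀ i < p, x i < n) {i : ℕ} (hi : i < p) :
    dig n (enc n p x) i = x i := by
  induction p generalizing x i with
  | zero => omega
  | succ p ih =>
    have h1 := h 0 (by omega)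
    rw [enc_succ]
    cases i with
    | zero => rw [dig, pow_zero, Nat.div_one, Nat.add_mul_mod_self_left, Nat.mod_eq_of_lt h1]
    | succ i =>
      rw [dig_succ, Nat.add_mul_div_left _ _ (by omega), Nat.div_eq_of_lt h1, zero_add,
        ih (fun i hi => h (i + 1) (by omega)) (by omega)]

theorem enc_dig {n p a : ℕ} (ha : a < n ^ p) : enc n p (dig n a) = a := by
  induction p generalizing a with
  | zero => simp [enc] at ha ⊢; omega
  | succ p ih =>
    rw [enc_succ]
    simp only [dig_succ]
    rw [ih (Nat.div_lt_of_lt_mul (by rwa [← pow_succ'])), dig, pow_zero, Nat.div_one,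
      Nat.mod_add_div]

theorem dig_lt {n : ℕ} (hn : 0 < n) (a i : ℕ) : dig n a i < n := Nat.mod_lt _ hn

theorem enc_congr {n p : ℕ} {x y : ℕ → ℕ} (h : ∀ i < p, x i = y i) : enc n p x = enc n p y :=
  Finset.sum_congr rfl fun i hi => by rw [h i (Finset.mem_range.1 hi)]

/-- Position `i` of the tuple of length `3 * p` that is given by three numbers. -/
def pos (n p a b c i : ℕ) : ℕ :=
  if i < p then dig n a i else if i < 2 * p then dig n b (i - p) else dig n c (i - 2 * p)

/-- The condition on the entries `u`, `v` of the tuple at positions `i ≤ j`: the first `r` entries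
increase and satisfy `Q` in pairs, the other ones are `0`. -/
def PairOk (Q : ℕ → ℕ → Prop) (r i j u v : ℕ) : Prop :=
  (j < r → Q u v ∧ (i < j → u < v)) ∧ (r ≤ j → v = 0)

/-- The entries of a finite set in increasing order, continued by `0`. -/
noncomputable def entry (R : Finset ℕ) (i : ℕ) : ℕ :=
  if h : i < R.card then R.orderEmbOfFin rfl ⟨i, h⟩ else 0

theorem entry_mem {R : Finset ℕ} {i : ℕ} (h : i < R.card) : entry R i ∈ R := by
  rw [entry, dif_pos h]; exact Finset.orderEmbOfFin_mem _ _ _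

theorem entry_lt_entry {R : Finset ℕ} {i j : ℕ} (hij : i < j) (h : j < R.card) :
    entry R i < entry R j := by
  rw [entry, entry, dif_pos h, dif_pos (hij.trans h)]
  exact (R.orderEmbOfFin rfl).strictMono (by simpa using hij)

theorem image_entry (R : Finset ℕ) : (Finset.range R.card).image (entry R) = R := by
  ext x
  constructor
  · intro h
    obtain ⟨i, hi, rfl⟩ := Finset.mem_image.1 h
    exact entry_mem (Finset.mem_range.1 hi)
  · intro h
    rw [← Finset.image_orderEmbOfFin_univ R rfl] at h
    obtain ⟨i, -, rfl⟩ := Finset.mem_image.1 h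
    exact Finset.mem_image.2 ⟨i, Finset.mem_range.2 i.2, by rw [entry, dif_pos i.2]⟩

theorem entry_image {r : ℕ} {x : ℕ → ℕ} (h : ∀ i j, i < j → j < r → x i < x j) :
    ((Finset.range r).image x).card = r ∧
      ∀ i < r, entry ((Finset.range r).image x) i = x i := by
  have hinj : Set.InjOn x (Finset.range r) := by
    intro i hi j hj hij
    simp only [Finset.coe_range, Set.mem_Iio] at hi hj
    rcases lt_trichotomy i j with hlt | rfl | hlt
    · exact absurd hij (h i j hlt hj).ne
    · rfl
    · exact absurd hij (h j i hlt hi).ne'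
  have hcard : ((Finset.range r).image x).card = r := by
    rw [Finset.card_image_of_injOn hinj, Finset.card_range]
  refine ⟨hcard, fun i hi => ?_⟩
  have := Finset.orderEmbOfFin_unique (s := (Finset.range r).image x)
    (k := ((Finset.range r).image x).card) rfl (f := fun i => x i)
    (fun i => Finset.mem_image_of_mem _ (Finset.mem_range.2 (lt_of_lt_of_eq i.2 hcard)))
    (fun i j hij => h _ _ hij (lt_of_lt_of_eq j.2 hcard))
  rw [entry, dif_pos (by omega), ← this]

theorem entry_lt {n : ℕ} (hn : 0 < n) {R : Finset ℕ} (hR : R ⊆ Finset.range n) (i : ℕ) :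
    entry R i < n := by
  by_cases h : i < R.card
  · exact Finset.mem_range.1 (hR (entry_mem h))
  · rw [entry, dif_neg h]; exact hn

theorem pos_enc {n p : ℕ} (hn : 0 < n) {R : Finset ℕ} (hR : R ⊆ Finset.range n) {i : ℕ}
    (hi : i < 3 * p) : pos n p (enc n p (entry R)) (enc n p fun i => entry R (p + i))
      (enc n p fun i => entry R (2 * p + i)) i = entry R i := by
  have hlt := entry_lt hn hR
  simp only [pos]
  split_ifs with h1 h2
  · exact dig_enc (fun i _ => hlt i) h1
  · rw [dig_enc (fun i _ => hlt _) (by omega)]; congr 1; omega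
  · rw [dig_enc (fun i _ => hlt _) (by omega)]; congr 1; omega

/-- The elements of `R` satisfy `Q` in pairs. -/
def OkSet (Q : ℕ → ℕ → Prop) (R : Finset ℕ) : Prop := ∀ x ∈ R, ∀ y ∈ R, x ≤ y → Q x y

open Classical in
/-- The sets of size `r` whose elements satisfy `Q` in pairs correspond to the triples that satisfy
the conditions on all pairs of positions. -/
theorem card_triples {n p r : ℕ} (hn : 0 < n) (hr : r ≤ 3 * p) (Q : ℕ → ℕ → Prop) :
    ((Finset.range (n ^ p) ×ˢ Finset.range (n ^ p) ×ˢ Finset.range (n ^ p)).filter fun t =>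
      ∀ i j, i ≤ j → j < 3 * p →
        PairOk Q r i j (pos n p t.1 t.2.1 t.2.2 i) (pos n p t.1 t.2.1 t.2.2 j)).card =
    (((Finset.range n).powersetCard r).filter fun R => OkSet Q R).card := by
  refine Finset.card_bij' (fun t _ => (Finset.range r).image (pos n p t.1 t.2.1 t.2.2))
    (fun R _ => (enc n p (entry R), enc n p fun i => entry R (p + i),
      enc n p fun i => entry R (2 * p + i))) ?_ ?_ ?_ ?_
  · rintro ⟨a, b, c⟩ h
    obtain ⟨hm, h⟩ := Finset.mem_filter.1 h
    simp only at h ⊢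
    have hmono : ∀ i j, i < j → j < r → pos n p a b c i < pos n p a b c j :=
      fun i j hij hj => ((h i j hij.le (by omega)).1 hj).2 hij
    refine Finset.mem_filter.2 ⟨Finset.mem_powersetCard.2 ⟨fun x hx => ?_,
      (entry_image hmono).1⟩, fun x hx y hy hxy => ?_⟩
    · obtain ⟨i, hi, rfl⟩ := Finset.mem_image.1 hx
      rw [Finset.mem_range, pos]
      split_ifs <;> exact dig_lt hn _ _
    · obtain ⟨i, hi, rfl⟩ := Finset.mem_image.1 hx
      obtain ⟨j, hj, rfl⟩ := Finset.mem_image.1 hy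
      rw [Finset.mem_range] at hi hj
      rcases le_or_gt i j with hij | hij
      · exact ((h i j hij (by omega)).1 hj).1
      · exact absurd hxy (not_le.2 (hmono j i hij hi))
  · intro R hRf
    obtain ⟨hm, hq⟩ := Finset.mem_filter.1 hRf
    obtain ⟨hR, rfl⟩ := Finset.mem_powersetCard.1 hm
    have hlt := entry_lt hn hR
    refine Finset.mem_filter.2 ⟨?_, fun i j hij hj => ?_⟩
    · simp only [Finset.mem_product, Finset.mem_range]
      exact ⟨enc_lt fun i _ => hlt i, enc_lt fun i _ => hlt _, enc_lt fun i _ => hlt _⟩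
    · simp only
      rw [pos_enc hn hR (by omega), pos_enc hn hR hj]
      refine ⟨fun hjr => ⟨?_, fun hlt => entry_lt_entry hlt hjr⟩, fun hjr => ?_⟩
      · refine hq _ (entry_mem (by omega)) _ (entry_mem hjr) ?_
        rcases hij.eq_or_lt with rfl | hij
        · exact le_rfl
        · exact (entry_lt_entry hij hjr).le
      · rw [entry, dif_neg (by omega)]
  · rintro ⟨a, b, c⟩ h
    obtain ⟨hm, h⟩ := Finset.mem_filter.1 h
    simp only [Finset.mem_product, Finset.mem_range] at hm h ⊢
    have hmono : ∀ i j, i < j → j < r → pos n p a b c i < pos n p a b c j :=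
      fun i j hij hj => ((h i j hij.le (by omega)).1 hj).2 hij
    obtain ⟨hc, he⟩ := entry_image hmono
    -- The positions from `r` on are forced to be `0`, which is also the default value of `entry`;
    -- so the triple can be recovered from the set.
    have key : ∀ i < 3 * p, entry ((Finset.range r).image (pos n p a b c)) i = pos n p a b c i := by
      intro i hi
      rcases lt_or_ge i r with hir | hir
      · exact he i hir
      · rw [(h i i le_rfl hi).2 hir, entry, dif_neg (by omega)]
    refine Prod.ext ?_ (Prod.ext ?_ ?_)
    · simp only
      rw [enc_congr (y := dig n a), enc_dig hm.1]
      intro i hi; rw [key i (by omega), pos, if_pos hi]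
    · simp only
      rw [enc_congr (y := dig n b), enc_dig hm.2.1]
      intro i hi
      rw [key _ (by omega), pos, if_neg (by omega), if_pos (by omega), Nat.add_sub_cancel_left]
    · simp only
      rw [enc_congr (y := dig n c), enc_dig hm.2.2]
      intro i hi
      rw [key _ (by omega), pos, if_neg (by omega), if_neg (by omega), Nat.add_sub_cancel_left]
  · intro R h
    obtain ⟨hm, h⟩ := Finset.mem_filter.1 h
    obtain ⟨hR, rfl⟩ := Finset.mem_powersetCard.1 hm
    conv_rhs => rw [← image_entry R]
    exact Finset.image_congr fun i hi => pos_enc hn hR (by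
      have := Finset.mem_range.1 hi; omega)

/-- All pairs of positions outside of block `o` satisfy the condition. -/
def BlockOk (Q : ℕ → ℕ → Prop) (r n p o a b c : ℕ) : Prop :=
  ∀ i j, i ≤ j → j < 3 * p → ¬ (o * p ≤ i ∧ i < o * p + p) → ¬ (o * p ≤ j ∧ j < o * p + p) →
    PairOk Q r i j (pos n p a b c i) (pos n p a b c j)

theorem blockOk_zero (Q : ℕ → ℕ → Prop) (r n p a a' b c : ℕ) :
    BlockOk Q r n p 0 a b c ↔ BlockOk Q r n p 0 a' b c := by
  unfold BlockOk
  refine forall₄_congr fun i j hij hj => imp_congr_right fun hi => imp_congr_right fun hj' => ?_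
  have : ∀ i, ¬ (0 * p ≤ i ∧ i < 0 * p + p) → pos n p a b c i = pos n p a' b c i := by
    intro i hi
    have h : ¬ i < p := by omega
    simp only [pos, h, if_false]
  rw [this i hi, this j hj']

theorem blockOk_one (Q : ℕ → ℕ → Prop) (r n p a b b' c : ℕ) :
    BlockOk Q r n p 1 a b c ↔ BlockOk Q r n p 1 a b' c := by
  unfold BlockOk
  refine forall₄_congr fun i j hij hj => imp_congr_right fun hi => imp_congr_right fun hj' => ?_
  have : ∀ i, ¬ (1 * p ≤ i ∧ i < 1 * p + p) → pos n p a b c i = pos n p a b' c i := by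
    intro i hi
    simp only [pos]; split_ifs <;> first | rfl | omega
  rw [this i hi, this j hj']

theorem blockOk_two (Q : ℕ → ℕ → Prop) (r n p a b c c' : ℕ) :
    BlockOk Q r n p 2 a b c ↔ BlockOk Q r n p 2 a b c' := by
  unfold BlockOk
  refine forall₄_congr fun i j hij hj => imp_congr_right fun hi => imp_congr_right fun hj' => ?_
  have : ∀ i, i < 3 * p → ¬ (2 * p ≤ i ∧ i < 2 * p + p) → pos n p a b c i = pos n p a b c' i := by
    intro i h hi
    simp only [pos]; split_ifs <;> first | rfl | omega
  rw [this i (by omega) hi, this j hj hj']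

/-- Two positions meet at most two of the three blocks and hence avoid one of them. So the
conditions split into three parts, each depending on only two of the three numbers, just as for
triangles in a graph. -/
theorem pairOk_iff_blockOk (Q : ℕ → ℕ → Prop) (r n p a b c : ℕ) :
    (∀ i j, i ≤ j → j < 3 * p → PairOk Q r i j (pos n p a b c i) (pos n p a b c j)) ↔
      BlockOk Q r n p 2 a b 0 ∧ BlockOk Q r n p 0 0 b c ∧ BlockOk Q r n p 1 a 0 c := by
  rw [blockOk_two Q r n p a b 0 c, blockOk_zero Q r n p 0 a b c, blockOk_one Q r n p a 0 b c]
  constructor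
  · exact fun h => ⟨fun i j h1 h2 _ _ => h i j h1 h2, fun i j h1 h2 _ _ => h i j h1 h2,
      fun i j h1 h2 _ _ => h i j h1 h2⟩
  · rintro ⟨h2, h0, h1⟩ i j hij hj
    by_cases a0 : (0 * p ≤ i ∧ i < 0 * p + p) ∨ (0 * p ≤ j ∧ j < 0 * p + p)
    · by_cases a1 : (1 * p ≤ i ∧ i < 1 * p + p) ∨ (1 * p ≤ j ∧ j < 1 * p + p)
      · exact h2 i j hij hj (by omega) (by omega)
      · rw [not_or] at a1; exact h1 i j hij hj a1.1 a1.2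
    · rw [not_or] at a0; exact h0 i j hij hj a0.1 a0.2

open Classical in
/-- The triples are counted by a matrix product. -/
theorem sum_matrices {n p r : ℕ} (Q : ℕ → ℕ → Prop) :
    ∑ a ∈ Finset.range (n ^ p), ∑ c ∈ Finset.range (n ^ p),
      (if BlockOk Q r n p 1 a 0 c then 1 else 0) * (∑ b ∈ Finset.range (n ^ p),
        (if BlockOk Q r n p 2 a b 0 then 1 else 0) * (if BlockOk Q r n p 0 0 b c then 1 else 0)) =
    ((Finset.range (n ^ p) ×ˢ Finset.range (n ^ p) ×ˢ Finset.range (n ^ p)).filter fun t =>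
      ∀ i j, i ≤ j → j < 3 * p →
        PairOk Q r i j (pos n p t.1 t.2.1 t.2.2 i) (pos n p t.1 t.2.1 t.2.2 j)).card := by
  rw [Finset.card_filter, Finset.sum_product]
  refine Finset.sum_congr rfl fun a _ => ?_
  rw [Finset.sum_product_right]
  refine Finset.sum_congr rfl fun c _ => ?_
  rw [Finset.mul_sum]
  refine Finset.sum_congr rfl fun b _ => ?_
  simp only [pairOk_iff_blockOk]
  by_cases h1 : BlockOk Q r n p 1 a 0 c <;> by_cases h2 : BlockOk Q r n p 2 a b 0 <;>
    by_cases h0 : BlockOk Q r n p 0 0 b c <;> simp [h0, h1, h2]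

/-- Some active hyperedge is contained in the union of the chain. -/
def Dead (F : ℕ → Finset ℕ) (m : ℕ) (c : List ℕ) : Prop :=
  ∃ f < m, Chain.Active F c f ∧ F f ⊆ Chain.U F c

/-- The condition on two vertices to extend the union of the chain. -/
def Extends (F : ℕ → Finset ℕ) (m : ℕ) (c : List ℕ) (x y : ℕ) : Prop :=
  x ∉ Chain.U F c ∧ y ∉ Chain.U F c ∧
    ∀ f < m, Chain.Active F c f → ¬ F f ⊆ Chain.U F c ∪ {x, y}

open Chain in
open Classical in
/-- The sets counted at the end of a chain, in terms of conditions on pairs of vertices. -/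
theorem card_leaf {F : ℕ → Finset ℕ} {m n k : ℕ} {c : List ℕ} (hU : U F c ⊆ Finset.range n)
    (hk : (U F c).card ≤ k) :
    (((Finset.range n).powersetCard k).filter fun S => U F c ⊆ S ∧ Leaf F m c S).card =
    if Dead F m c then 0 else (((Finset.range n).powersetCard (k - (U F c).card)).filter fun R =>
      OkSet (Extends F m c) R).card := by
  split_ifs with hdead
  · rw [Finset.card_eq_zero, Finset.filter_eq_empty_iff]
    rintro S - ⟨h1, h2⟩
    obtain ⟨f, hf, ha, hs⟩ := hdead
    exact h2 f hf (hs.trans h1) ha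
  · refine Finset.card_bij' (fun S _ => S \ U F c) (fun R _ => U F c ∪ R) ?_ ?_ ?_ ?_
    · intro S hS
      simp only [Finset.mem_filter, Finset.mem_powersetCard] at hS ⊢
      obtain ⟨⟨h1, h2⟩, h3, h4⟩ := hS
      refine ⟨⟨Finset.sdiff_subset.trans h1, by rw [Finset.card_sdiff_of_subset h3, h2]⟩,
        fun x hx y hy _ => ?_⟩
      rw [Finset.mem_sdiff] at hx hy
      refine ⟨hx.2, hy.2, fun f hf ha hs => h4 f hf (hs.trans ?_) ha⟩
      refine Finset.union_subset h3 fun z hz => ?_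
      simp only [Finset.mem_insert, Finset.mem_singleton] at hz
      rcases hz with rfl | rfl
      exacts [hx.1, hy.1]
    · intro R hR
      simp only [Finset.mem_filter, Finset.mem_powersetCard] at hR ⊢
      obtain ⟨⟨h1, h2⟩, h3⟩ := hR
      have hdisj : Disjoint (U F c) R := by
        rw [Finset.disjoint_left]
        exact fun x hx hxR => (h3 x hxR x hxR le_rfl).1 hx
      refine ⟨⟨Finset.union_subset hU h1, by rw [Finset.card_union_of_disjoint hdisj, h2]; omega⟩,
        Finset.subset_union_left, fun f hf hs ha => ?_⟩
      have hsub : F f \ U F c ⊆ R := by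
        intro x hx
        rw [Finset.mem_sdiff] at hx
        exact (Finset.mem_union.1 (hs hx.1)).resolve_left hx.2
      -- An active hyperedge has at most two vertices outside the union, and at least one since the
      -- chain is not dead. A single vertex is treated as the pair of `x` with itself, which `OkSet`
      -- includes.
      have hxy : ∃ x ∈ R, ∃ y ∈ R, x ≤ y ∧ F f \ U F c ⊆ {x, y} := by
        have hc := card_sdiff_le_of_active ha
        obtain ⟨x, hx⟩ : (F f \ U F c).Nonempty := by
          rw [Finset.nonempty_iff_ne_empty, Ne, Finset.sdiff_eq_empty_iff_subset]
          exact fun h => hdead ⟨f, hf, ha, h⟩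
        by_cases h : ∃ y ∈ F f \ U F c, y ≠ x
        · obtain ⟨y, hy, hne⟩ := h
          have heq : {x, y} = F f \ U F c := by
            refine Finset.eq_of_subset_of_card_le (fun z hz => ?_) ?_
            · simp only [Finset.mem_insert, Finset.mem_singleton] at hz
              rcases hz with rfl | rfl <;> assumption
            · rw [Finset.card_pair hne.symm]; exact hc
          rcases le_total x y with hxy | hxy
          · exact ⟨x, hsub hx, y, hsub hy, hxy, heq.ge⟩
          · exact ⟨y, hsub hy, x, hsub hx, hxy, by rw [Finset.pair_comm]; exact heq.ge⟩
        · refine ⟨x, hsub hx, x, hsub hx, le_rfl, fun z hz => ?_⟩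
          by_contra hz'
          exact h ⟨z, hz, by simpa using hz'⟩
      obtain ⟨x, hx, y, hy, hle, hs'⟩ := hxy
      exact (h3 x hx y hy hle).2.2 f hf ha (sdiff_le_iff.1 hs')
    · intro S hS
      simp only [Finset.mem_filter] at hS
      exact Finset.union_sdiff_of_subset hS.2.1
    · intro R hR
      simp only [Finset.mem_filter] at hR
      have hdisj : Disjoint (U F c) R := by
        rw [Finset.disjoint_left]
        exact fun x hx hxR => (hR.2 x hxR x hxR le_rfl).1 hx
      exact Finset.union_sdiff_cancel_left hdisj

end Triples

/-! ## Expressions for the conditions on chains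

Variable `6` holds the number `n` of vertices, `7` the number `m` of hyperedges, and `8` the
address of a table with the addresses of the hyperedges.  Variables from `20` on are bound by
expressions. -/

namespace ChainExpr

open WordRAM WordRAM.Expr Chain Triples

/-- The state gives access to the hyperedges `F 0, …, F (m - 1)` on `n` vertices. -/
structure Good (n m : ℕ) (F : ℕ → Finset ℕ) (s : State) : Prop where
  six : s.reg 6 = n
  seven : s.reg 7 = m
  mem : ∀ j < m, ∀ v, (∃ z < s.mem (s.mem (s.reg 8 + j)),
    s.mem (s.mem (s.reg 8 + j) + 1 + z) = v) ↔ v ∈ F j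
  len : ∀ j < m, s.mem (s.mem (s.reg 8 + j)) ≤ n
  sub : ∀ j < m, F j ⊆ Finset.range n

theorem Good.setReg {n m : ℕ} {F : ℕ → Finset ℕ} {s : State} (h : Good n m F s) {x v : ℕ}
    (hx : x < 6 ∨ 9 ≤ x) : Good n m F (s.setReg x v) := by
  obtain ⟨h6, h7, hm, hl, hs⟩ := h
  have h8 : (s.setReg x v).reg 8 = s.reg 8 := by rw [State.reg_setReg, if_neg (by omega)]
  refine ⟨by rw [State.reg_setReg, if_neg (by omega), h6],
    by rw [State.reg_setReg, if_neg (by omega), h7], fun j hj v => ?_, fun j hj => ?_, hs⟩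
  · rw [h8]; exact hm j hj v
  · rw [h8]; exact hl j hj

/-- The expression does not depend on bound variables. -/
def Dep (e : Expr) : Prop := ∀ s x v, 20 ≤ x → e.eval (s.setReg x v) = e.eval s

/-- Vertex `x` (a variable) belongs to hyperedge `j`. -/
def inEdgeE (j : Expr) (x : ℕ) : Expr :=
  .sum 21 (.load (.load (.var 8 + j))) (eqE (.load (.load (.var 8 + j) + 1 + .var 21)) (.var x))

/-- Vertex `x` (a variable) belongs to the union of the chain. -/
def inUE (c : List Expr) (x : ℕ) : Expr := anyE (c.map fun e => inEdgeE e x)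

/-- The number of vertices of hyperedge `j` outside the union of the chain. -/
def newE (c : List Expr) (j : Expr) : Expr :=
  .sum 20 (.var 6) (boolE (andE (inEdgeE j 20) (notE (inUE c 20))))

/-- The number of vertices in the union of the chain. -/
def cardUE (c : List Expr) : Expr := .sum 20 (.var 6) (boolE (inUE c 20))

def belowE : List Expr → Expr → Expr
  | [], _ => 1
  | e :: _, j => ltE j e

def validE : List Expr → Expr
  | [] => 1
  | e :: c => andE (belowE c e) (andE (notE (ltE (newE c e) 3)) (validE c))

def activeE : List Expr → Expr → Expr
  | [], j => notE (ltE 2 (newE [] j))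
  | e :: c, j => orE (andE (ltE j e) (notE (ltE 2 (newE (e :: c) j)))) (activeE c j)

def deadE (c : List Expr) : Expr :=
  .sum 22 (.var 7) (andE (activeE c (.var 22)) (notE (newE c (.var 22))))

/-- The condition on the vertices in variables `23` and `24`. -/
def extendsE (c : List Expr) : Expr :=
  andE (notE (inUE c 23)) <| andE (notE (inUE c 24)) <| notE <| .sum 22 (.var 7) <|
    andE (activeE c (.var 22)) <| notE <| .sum 20 (.var 6) <|
      andE (inEdgeE (.var 22) 20) <| notE <| orE (inUE c 20) <|
        orE (eqE (.var 20) (.var 23)) (eqE (.var 20) (.var 24))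

/-- The chain that is given by the digits of a number. -/
def digitsE (x : Expr) : ℕ → List Expr
  | 0 => []
  | t + 1 => (x % .var 7) :: digitsE (x / .var 7) t

variable {n m : ℕ} {F : ℕ → Finset ℕ} {s : State} {c : List Expr} {j : Expr}

theorem holds_inEdgeE (h : Good n m F s) (hj : ∀ i, j.eval (s.setReg 21 i) = j.eval s)
    (hm : j.eval s < m) {x : ℕ} (hx : x ≠ 21) :
    (inEdgeE j x).Holds s ↔ s.reg x ∈ F (j.eval s) := by
  rw [← h.mem _ hm]
  simp [inEdgeE, hj, hx]

theorem holds_inUE (h : Good n m F s) (hc : ∀ e ∈ c, Dep e ∧ e.eval s < m) {x : ℕ} (hx : x ≠ 21) :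
    (inUE c x).Holds s ↔ s.reg x ∈ U F (c.map fun e => e.eval s) := by
  induction c with
  | nil => simp [inUE, U, anyE, Holds]
  | cons e c ih =>
    rw [List.forall_mem_cons] at hc
    have := holds_inEdgeE h (fun i => hc.1.1 s 21 i (by omega)) hc.1.2 hx
    have ih := ih hc.2
    rw [inUE, holds_anyE] at ih ⊢
    rw [List.map_cons, List.exists_mem_cons_iff, this, ih, List.map_cons, U, Finset.mem_union,
      or_comm]

theorem dep_map (hc : ∀ e ∈ c, Dep e) {x : ℕ} (hx : 20 ≤ x) (v : ℕ) :
    (c.map fun e => e.eval (s.setReg x v)) = c.map fun e => e.eval s :=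
  List.map_congr_left fun e he => hc e he s x v hx

theorem dep_setReg (hc : ∀ e ∈ c, Dep e ∧ e.eval s < m) {x : ℕ} (hx : 20 ≤ x) (v : ℕ) :
    ∀ e ∈ c, Dep e ∧ e.eval (s.setReg x v) < m :=
  fun e he => ⟨(hc e he).1, by rw [(hc e he).1 s x v hx]; exact (hc e he).2⟩

/-- Only the variables `20` and `21` are bound inside, so `j` may be variable `22`, over which
`deadE` and `extendsE` sum; this is why `j` is not required to satisfy `Dep`. -/
theorem eval_newE (h : Good n m F s) (hc : ∀ e ∈ c, Dep e ∧ e.eval s < m)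
    (hj : ∀ s x v, (x = 20 ∨ x = 21) → j.eval (s.setReg x v) = j.eval s)
    (hm : j.eval s < m) :
    (newE c j).eval s = (F (j.eval s) \ U F (c.map fun e => e.eval s)).card := by
  rw [newE, eval_sum_boolE]
  congr 1
  ext v
  have h1 := holds_inEdgeE (j := j) (x := 20) (h.setReg (x := 20) (v := v) (by omega))
    (fun i => hj _ 21 i (by omega)) (by rw [hj _ _ _ (by omega)]; exact hm) (by omega)
  have h2 := holds_inUE (x := 20) (h.setReg (x := 20) (v := v) (by omega))
    (dep_setReg hc (by omega) v) (by omega)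
  rw [dep_map (fun e he => (hc e he).1) (by omega)] at h2
  rw [hj _ _ _ (by omega)] at h1
  simp only [Finset.mem_filter, Finset.mem_range, eval_var, h.six, holds_andE, holds_notE, h1, h2,
    Finset.mem_sdiff]
  simp only [State.reg_setReg, if_true]
  exact ⟨fun h => h.2, fun hv => ⟨Finset.mem_range.1 (h.sub _ hm hv.1), hv⟩⟩

theorem U_subset {l : List ℕ} (hF : ∀ j < m, F j ⊆ Finset.range n) (hl : ∀ e ∈ l, e < m) :
    U F l ⊆ Finset.range n := by
  induction l with
  | nil => simp [U]
  | cons e l ih =>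
    rw [List.forall_mem_cons] at hl
    exact Finset.union_subset (ih hl.2) (hF _ hl.1)

theorem eval_cardUE (h : Good n m F s) (hc : ∀ e ∈ c, Dep e ∧ e.eval s < m) :
    (cardUE c).eval s = (U F (c.map fun e => e.eval s)).card := by
  rw [cardUE, eval_sum_boolE]
  congr 1
  ext v
  have h2 := holds_inUE (x := 20) (h.setReg (x := 20) (v := v) (by omega))
    (dep_setReg hc (by omega) v) (by omega)
  rw [dep_map (fun e he => (hc e he).1) (by omega)] at h2
  simp only [Finset.mem_filter, Finset.mem_range, eval_var, h.six, h2]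
  simp only [State.reg_setReg, if_true]
  refine ⟨fun h => h.2, fun hv => ⟨Finset.mem_range.1 (U_subset h.sub ?_ hv), hv⟩⟩
  simp only [List.mem_map]
  rintro _ ⟨e, he, rfl⟩
  exact (hc e he).2

theorem holds_belowE : (belowE c j).Holds s ↔ Below (c.map fun e => e.eval s) (j.eval s) := by
  cases c with
  | nil => simp [belowE, Below, Holds]
  | cons e c => simp [belowE, Below]

theorem holds_validE (h : Good n m F s) (hc : ∀ e ∈ c, Dep e ∧ e.eval s < m) :
    (validE c).Holds s ↔ Valid F (c.map fun e => e.eval s) := by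
  induction c with
  | nil => simp [validE, Valid, Holds]
  | cons e c ih =>
    rw [List.forall_mem_cons] at hc
    rw [validE, List.map_cons, Valid, holds_andE, holds_andE, holds_belowE, ih hc.2, holds_notE,
      holds_ltE, eval_newE h hc.2 (fun s x v hx => hc.1.1 s x v (by omega)) hc.1.2]
    simp

theorem holds_activeE (h : Good n m F s) (hc : ∀ e ∈ c, Dep e ∧ e.eval s < m)
    (hj : ∀ s x v, (x = 20 ∨ x = 21) → j.eval (s.setReg x v) = j.eval s)
    (hm : j.eval s < m) :
    (activeE c j).Holds s ↔ Active F (c.map fun e => e.eval s) (j.eval s) := by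
  induction c with
  | nil =>
    rw [activeE, holds_notE, holds_ltE, eval_newE h hc hj hm]
    simp [Active, U]
  | cons e c ih =>
    have hc' := hc
    rw [List.forall_mem_cons] at hc'
    rw [activeE, holds_orE, holds_andE, holds_ltE, holds_notE, holds_ltE, eval_newE h hc hj hm,
      ih hc'.2]
    simp [Active]

theorem holds_deadE (h : Good n m F s) (hc : ∀ e ∈ c, Dep e ∧ e.eval s < m) :
    (deadE c).Holds s ↔ Dead F m (c.map fun e => e.eval s) := by
  rw [deadE, holds_sum, Dead, eval_var, h.seven]
  refine exists_congr fun f => and_congr_right fun hf => ?_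
  have hg := h.setReg (x := 22) (v := f) (by omega)
  have hc' := dep_setReg hc (x := 22) (by omega) f
  have hj : ∀ s x v, (x = 20 ∨ x = 21) → (Expr.var 22).eval (s.setReg x v) =
      (Expr.var 22).eval s := fun s x v hx => by
    simp only [eval_var, State.reg_setReg]; rw [if_neg (by omega)]
  have hm : (Expr.var 22).eval (s.setReg 22 f) < m := by simpa using hf
  rw [holds_andE, holds_activeE hg hc' hj hm, holds_notE, Holds, eval_newE hg hc' hj hm,
    dep_map (fun e he => (hc e he).1) (by omega)]
  simp

theorem holds_extendsE (h : Good n m F s) (hc : ∀ e ∈ c, Dep e ∧ e.eval s < m) :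
    (extendsE c).Holds s ↔
      Extends F m (c.map fun e => e.eval s) (s.reg 23) (s.reg 24) := by
  have hdep : ∀ e ∈ c, Dep e := fun e he => (hc e he).1
  simp only [extendsE, holds_andE, holds_notE, holds_inUE h hc (show 23 ≠ 21 by omega),
    holds_inUE h hc (show 24 ≠ 21 by omega), Extends]
  refine and_congr_right fun _ => and_congr_right fun _ => ?_
  rw [holds_sum, eval_var, h.seven, not_exists]
  refine forall_congr' fun f => ?_
  rw [not_and]
  refine imp_congr_right fun hf => ?_
  have hg := h.setReg (x := 22) (v := f) (by omega)
  have hc' := dep_setReg hc (x := 22) (by omega) f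
  have hj : ∀ s x v, (x = 20 ∨ x = 21) → (Expr.var 22).eval (s.setReg x v) =
      (Expr.var 22).eval s := fun s x v hx => by
    simp only [eval_var, State.reg_setReg]; rw [if_neg (by omega)]
  have hm : (Expr.var 22).eval (s.setReg 22 f) < m := by simpa using hf
  rw [holds_andE, holds_activeE hg hc' hj hm, dep_map hdep (by omega), not_and]
  have e22 : (Expr.var 22).eval (s.setReg 22 f) = f := by simp
  rw [e22]
  refine imp_congr_right fun _ => not_congr ?_
  rw [holds_notE, holds_sum]
  have key : ∀ v, (andE (inEdgeE (.var 22) 20) <| notE <| orE (inUE c 20) <|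
        orE (eqE (.var 20) (.var 23)) (eqE (.var 20) (.var 24))).Holds
        ((s.setReg 22 f).setReg 20 v) ↔ v ∈ F f ∧ ¬ (v ∈ U F (c.map fun e => e.eval s) ∨
          v = s.reg 23 ∨ v = s.reg 24) := by
    intro v
    have hg2 := hg.setReg (x := 20) (v := v) (by omega)
    rw [holds_andE, holds_inEdgeE hg2 (fun i => by simp) (by simpa using hf) (by omega),
      holds_notE, holds_orE, holds_inUE hg2 (dep_setReg hc' (by omega) v) (by omega),
      dep_map hdep (by omega), dep_map hdep (by omega)]
    simp
  simp only [key, eval_var, hg.six]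
  constructor
  · intro hno v hv
    have hvn : v < n := Finset.mem_range.1 (h.sub f hf hv)
    by_contra hcon
    refine hno ⟨v, hvn, hv, fun hor => hcon ?_⟩
    simp only [Finset.mem_union, Finset.mem_insert, Finset.mem_singleton]
    tauto
  · rintro hsub ⟨v, -, hv, hno⟩
    have := hsub hv
    simp only [Finset.mem_union, Finset.mem_insert, Finset.mem_singleton] at this
    tauto

theorem map_digitsE (x : Expr) (t : ℕ) :
    ((digitsE x t).map fun e => e.eval s) = digits (s.reg 7) t (x.eval s) := by
  induction t generalizing x with
  | zero => rfl
  | succ t ih => rw [digitsE, List.map_cons, ih, digits]; rfl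

theorem dep_digitsE {x : Expr} (hx : Dep x) (t : ℕ) : ∀ e ∈ digitsE x t, Dep e := by
  have h7 : ∀ (s : State) (y v : ℕ), 20 ≤ y → (s.setReg y v).reg 7 = s.reg 7 := fun s y v hy => by
    rw [State.reg_setReg, if_neg (by omega)]
  induction t generalizing x with
  | zero => simp [digitsE]
  | succ t ih =>
    rw [digitsE, List.forall_mem_cons]
    exact ⟨fun s y v hy => by simp only [eval_mod, eval_var, hx s y v hy, h7 s y v hy],
      ih fun s y v hy => by simp only [eval_div, eval_var, hx s y v hy, h7 s y v hy]⟩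

theorem _root_.Chain.lt_of_mem_digits {t x e : ℕ} (hm : 0 < m) (h : e ∈ digits m t x) : e < m := by
  induction t generalizing x with
  | zero => simp [digits] at h
  | succ t ih =>
    rcases List.mem_cons.1 h with rfl | h
    · exact Nat.mod_lt _ hm
    · exact ih h

/-! ### Costs -/

variable {Y : ℕ}

theorem cheap_digitsE {x : Expr} (hx : x.Cheap Y 0 s) (t : ℕ) :
    ∀ e ∈ digitsE x t, e.Cheap Y 0 s := by
  induction t generalizing x with
  | zero => simp [digitsE]
  | succ t ih =>
    rw [digitsE, List.forall_mem_cons]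
    exact ⟨cheap_mod hx (cheap_var 7), ih (cheap_div hx (cheap_var 7))⟩

theorem cheap_inEdgeE (h : Good n m F s) (hY : n ≤ Y) (hj : ∀ s, j.Cheap Y 0 s)
    (hm : j.eval s < m) (x : ℕ) : (inEdgeE j x).Cheap Y 1 s := by
  refine cheap_sum (cheap_load (cheap_load (cheap_add (cheap_var _) ((hj s).mono (by omega)))))
    ((h.len _ hm).trans hY) (fun i _ => ?_) ?_
  · exact cheap_eqE (cheap_load (cheap_add (cheap_add (cheap_load (cheap_add (cheap_var _) (hj _)))
      cheap_one) (cheap_var _))) (cheap_var _)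
  · have := (hj s).2
    simp only [eqE, HAdd.hAdd, Add.add, depth]
    simp only [OfNat.ofNat]; omega

/-- The conditions for the cost estimates on a chain. -/
def CheapChain (Y m : ℕ) (c : List Expr) (s : State) : Prop :=
  ∀ e ∈ c, Dep e ∧ e.eval s < m ∧ ∀ s, e.Cheap Y 0 s

theorem CheapChain.setReg (hc : CheapChain Y m c s) {x : ℕ} (hx : 20 ≤ x) (v : ℕ) :
    CheapChain Y m c (s.setReg x v) := fun e he =>
  ⟨(hc e he).1, by rw [(hc e he).1 s x v hx]; exact (hc e he).2.1, (hc e he).2.2⟩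

theorem cheap_inUE (h : Good n m F s) (hY : n ≤ Y) (hc : CheapChain Y m c s) (x : ℕ) :
    (inUE c x).Cheap Y 1 s := by
  refine cheap_anyE ?_
  simp only [List.mem_map]
  rintro _ ⟨e, he, rfl⟩
  exact cheap_inEdgeE h hY (hc e he).2.2 (hc e he).2.1 x

theorem cheap_newE (h : Good n m F s) (hY : n ≤ Y) (hc : CheapChain Y m c s)
    (hj' : ∀ s, j.Cheap Y 0 s) (hj : ∀ v, j.eval (s.setReg 20 v) = j.eval s) (hm : j.eval s < m) :
    (newE c j).Cheap Y 2 s := by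
  have hb : ∀ i, (boolE (andE (inEdgeE j 20) (notE (inUE c 20)))).Cheap Y 1 (s.setReg 20 i) :=
    fun i => cheap_boolE (cheap_andE (cheap_inEdgeE (h.setReg (by omega)) hY hj'
      (by rw [hj]; exact hm) _) (cheap_notE (cheap_inUE (h.setReg (by omega)) hY
        (hc.setReg (by omega) _) _)))
  exact cheap_sum (cheap_var _) (h.six.trans_le hY) (fun i _ => hb i) (hb 0).2

theorem cheap_cardUE (h : Good n m F s) (hY : n ≤ Y) (hc : CheapChain Y m c s) :
    (cardUE c).Cheap Y 2 s := by
  have hb : ∀ i, (boolE (inUE c 20)).Cheap Y 1 (s.setReg 20 i) :=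
    fun i => cheap_boolE (cheap_inUE (h.setReg (by omega)) hY (hc.setReg (by omega) _) _)
  exact cheap_sum (cheap_var _) (h.six.trans_le hY) (fun i _ => hb i) (hb 0).2

theorem cheap_belowE {D : ℕ} (hc : ∀ e ∈ c, e.Cheap Y D s) (hj : j.Cheap Y D s) :
    (belowE c j).Cheap Y D s := by
  cases c with
  | nil => exact cheap_one
  | cons e c => exact cheap_ltE hj (hc e (by simp))

theorem cheap_validE (h : Good n m F s) (hY : n ≤ Y) (hc : CheapChain Y m c s) :
    (validE c).Cheap Y 2 s := by
  induction c with
  | nil => exact cheap_one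
  | cons e c ih =>
    have hc' := hc
    rw [CheapChain, List.forall_mem_cons] at hc'
    obtain ⟨⟨h1, h2, h3⟩, h4⟩ := hc'
    exact cheap_andE (cheap_belowE (fun e he => ((h4 e he).2.2 s).mono (by omega))
      ((h3 s).mono (by omega))) (cheap_andE (cheap_notE (cheap_ltE
        (cheap_newE h hY h4 h3 (fun v => h1 s 20 v le_rfl) h2) (cheap_ofNat _))) (ih h4))

theorem cheap_activeE (h : Good n m F s) (hY : n ≤ Y) (hc : CheapChain Y m c s)
    (hj' : ∀ s, j.Cheap Y 0 s) (hj : ∀ v, j.eval (s.setReg 20 v) = j.eval s) (hm : j.eval s < m) :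
    (activeE c j).Cheap Y 2 s := by
  induction c with
  | nil => exact cheap_notE (cheap_ltE (cheap_ofNat _) (cheap_newE h hY hc hj' hj hm))
  | cons e c ih =>
    have hc' := hc
    rw [CheapChain, List.forall_mem_cons] at hc'
    exact cheap_orE (cheap_andE (cheap_ltE ((hj' s).mono (by omega))
      ((hc'.1.2.2 s).mono (by omega))) (cheap_notE (cheap_ltE (cheap_ofNat _)
        (cheap_newE h hY hc hj' hj hm)))) (ih hc'.2)

theorem depth_ofNat (x : ℕ) : (no_index (OfNat.ofNat x) : Expr).depth = 0 := rfl
theorem depth_one : (1 : Expr).depth = 0 := rfl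
theorem depth_var (x : ℕ) : (Expr.var x).depth = 0 := rfl
theorem depth_load (a : Expr) : (Expr.load a).depth = a.depth := rfl
theorem depth_add (a b : Expr) : (a + b).depth = max a.depth b.depth := rfl
theorem depth_andE (a b : Expr) : (andE a b).depth = max a.depth (max b.depth 0) := rfl
theorem depth_orE (a b : Expr) : (orE a b).depth = max a.depth (max 0 b.depth) := rfl
theorem depth_notE (a : Expr) : (notE a).depth = max a.depth 0 := rfl
theorem depth_boolE (a : Expr) : (boolE a).depth = max a.depth (max 0 0) := rfl
theorem depth_eqE (a b : Expr) : (eqE a b).depth = max a.depth b.depth := rfl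
theorem depth_ltE (a b : Expr) : (ltE a b).depth = max a.depth b.depth := rfl
theorem depth_sum (x : ℕ) (a b : Expr) : (Expr.sum x a b).depth = max a.depth (b.depth + 1) := rfl

theorem depth_inEdgeE (hj : j.depth = 0) (x : ℕ) : (inEdgeE j x).depth ≤ 1 := by
  simp only [inEdgeE, depth_eqE, depth_add, depth_load, depth_var, depth_sum, hj, depth_one]
  omega

theorem depth_inUE (hc : ∀ e ∈ c, e.depth = 0) (x : ℕ) : (inUE c x).depth ≤ 1 := by
  refine depth_anyE ?_
  simp only [List.mem_map]
  rintro _ ⟨e, he, rfl⟩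
  exact depth_inEdgeE (hc e he) x

theorem depth_newE (hc : ∀ e ∈ c, e.depth = 0) (hj : j.depth = 0) : (newE c j).depth ≤ 2 := by
  have h1 := depth_inUE hc 20
  have := depth_inEdgeE hj 20
  simp only [newE, depth_boolE, depth_sum, depth_var, depth_andE, depth_notE]
  omega

theorem depth_activeE (hc : ∀ e ∈ c, e.depth = 0) (hj : j.depth = 0) :
    (activeE c j).depth ≤ 2 := by
  induction c with
  | nil =>
    have := depth_newE hc hj
    simp only [activeE, depth_notE, depth_ltE, depth_ofNat]
    omega
  | cons e c ih =>
    have := depth_newE hc hj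
    rw [List.forall_mem_cons] at hc
    have := ih hc.2
    simp only [activeE, depth_notE, depth_ltE, depth_ofNat, depth_orE, depth_andE, hj, hc.1]
    omega

theorem CheapChain.depth (hc : CheapChain Y m c s) : ∀ e ∈ c, e.depth = 0 :=
  fun e he => Nat.le_zero.1 ((hc e he).2.2 s).2

/-- A sum over the hyperedges around a count of vertices, each of which is looked up in a hyperedge:
three nested sums. This depth is the source of the factor `(Y + 1) ^ 3` in the time bounds. -/
theorem cheap_deadE (h : Good n m F s) (hY : n ≤ Y) (hY' : m ≤ Y) (hc : CheapChain Y m c s) :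
    (deadE c).Cheap Y 3 s := by
  refine cheap_sum (cheap_var _) (h.seven.trans_le hY') (fun f hf => ?_) ?_
  · rw [eval_var, h.seven] at hf
    have hg := h.setReg (x := 22) (v := f) (by omega)
    have hc' := hc.setReg (x := 22) (by omega) f
    exact cheap_andE (cheap_activeE hg hY hc' (fun _ => cheap_var _) (fun v => by simp)
      (by simpa using hf)) (cheap_notE (cheap_newE hg hY hc' (fun _ => cheap_var _)
        (fun v => by simp) (by simpa using hf)))
  · rw [depth_andE, depth_notE]
    have h1 := depth_activeE hc.depth (j := .var 22) rfl
    have h2 := depth_newE hc.depth (j := .var 22) rfl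
    omega

theorem cheap_extendsE (h : Good n m F s) (hY : n ≤ Y) (hY' : m ≤ Y) (hc : CheapChain Y m c s) :
    (extendsE c).Cheap Y 3 s := by
  refine cheap_andE (cheap_notE ((cheap_inUE h hY hc _).mono (by omega)))
    (cheap_andE (cheap_notE ((cheap_inUE h hY hc _).mono (by omega)))
      (cheap_notE (cheap_sum (cheap_var _) (h.seven.trans_le hY') (fun f hf => ?_) ?_)))
  · rw [eval_var, h.seven] at hf
    have hg := h.setReg (x := 22) (v := f) (by omega)
    have hc' := hc.setReg (x := 22) (by omega) f
    refine cheap_andE (cheap_activeE hg hY hc' (fun _ => cheap_var _)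
      (fun v => by simp) (by simpa using hf)) (cheap_notE ?_)
    have hb : ∀ i, (andE (inEdgeE (.var 22) 20) <| notE <| orE (inUE c 20) <|
        orE (eqE (.var 20) (.var 23)) (eqE (.var 20) (.var 24))).Cheap Y 1
        ((s.setReg 22 f).setReg 20 i) := fun i =>
      cheap_andE (cheap_inEdgeE (hg.setReg (by omega)) hY (fun _ => cheap_var _)
        (by simpa using hf) _) (cheap_notE (cheap_orE (cheap_inUE (hg.setReg (by omega)) hY
          (hc'.setReg (by omega) _) _) (cheap_orE (cheap_eqE (cheap_var _) (cheap_var _))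
            (cheap_eqE (cheap_var _) (cheap_var _)))))
    exact cheap_sum (cheap_var _) (hg.six.trans_le hY) (fun i _ => hb i) (hb 0).2
  · have h1 := depth_inUE hc.depth 20
    have h2 := depth_activeE hc.depth (j := .var 22) rfl
    have h3 := depth_inEdgeE (j := .var 22) rfl 20
    simp only [depth_andE, depth_notE, depth_orE, depth_eqE, depth_sum, depth_var]
    omega

end ChainExpr

namespace ChainExpr

open WordRAM WordRAM.Expr Chain Triples

/-! ### Matrices -/

def powE (e : Expr) : ℕ → Expr
  | 0 => 1
  | i + 1 => powE e i * e

@[simp] theorem eval_powE (e : Expr) (i : ℕ) (s : State) : (powE e i).eval s = e.eval s ^ i := by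
  induction i with
  | zero => rfl
  | succ i ih => simp [powE, ih, pow_succ]

theorem cheap_powE {Y D : ℕ} {e : Expr} {s : State} (h : e.Cheap Y D s) (i : ℕ) :
    (powE e i).Cheap Y D s := by
  induction i with
  | zero => exact cheap_one
  | succ i ih => exact cheap_mul ih h

def digE (x i : ℕ) : Expr := .var x / powE (.var 6) i % .var 6

/-- Position `i` of the tuple that is given by the variables `25`, `26`, `27`. -/
def posE (p i : ℕ) : Expr :=
  if i < p then digE 25 i else if i < 2 * p then digE 26 (i - p) else digE 27 (i - 2 * p)

/-- The condition on positions `i` and `j`, for `r` relevant positions, with `r` in variable `13`. -/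
def pairE (c : List Expr) (p i j : ℕ) : Expr :=
  .letE 23 (posE p i) <| .letE 24 (posE p j) <| .ite (ltE (.const j) (.var 13))
    (andE (extendsE c) (if i < j then ltE (.var 23) (.var 24) else 1)) (eqE (.var 24) 0)

/-- The pairs of positions outside block `o`. -/
def outside (p o : ℕ) : List (ℕ × ℕ) :=
  ((List.range (3 * p)) ×ˢ (List.range (3 * p))).filter fun x =>
    x.1 ≤ x.2 ∧ ¬ (o * p ≤ x.1 ∧ x.1 < o * p + p) ∧ ¬ (o * p ≤ x.2 ∧ x.2 < o * p + p)

def blockE (c : List Expr) (p o : ℕ) : Expr :=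
  allE ((outside p o).map fun x => pairE c p x.1 x.2)

/-- The input of the matrix multiplication, at the address in variable `5`. -/
def cellE (c : List Expr) (p : ℕ) : Expr :=
  .ite (eqE (.var 5) 0) (.var 14) <|
  .ite (ltE (.var 5) (1 + .var 14 * .var 14))
    (.letE 25 ((.var 5 - 1) / .var 14) <| .letE 26 ((.var 5 - 1) % .var 14) <| .letE 27 0 <|
      boolE (blockE c p 2)) <|
  .ite (ltE (.var 5) (1 + 2 * (.var 14 * .var 14)))
    (.letE 26 ((.var 5 - 1 - .var 14 * .var 14) / .var 14) <|
      .letE 27 ((.var 5 - 1 - .var 14 * .var 14) % .var 14) <| .letE 25 0 <|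
      boolE (blockE c p 0)) 0

/-- The evaluation of the product. -/
def traceE (c : List Expr) (p : ℕ) : Expr :=
  .sum 25 (.var 14) <| .sum 27 (.var 14) <| .letE 26 0 (boolE (blockE c p 1)) *
    .letE 5 (1 + 2 * (.var 14 * .var 14) + (.var 25 * .var 14 + .var 27))
      (Sandbox.read (cellE c p))

/-- The chain number `x` with `t` entries is in variable `10`, the number of missing vertices is in
variable `13`, and the dimension of the matrices in variable `14`. -/
structure Ctx (n m : ℕ) (F : ℕ → Finset ℕ) (t x r p : ℕ) (s : State) : Prop where
  good : Good n m F s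
  idx : s.reg 10 = x
  pos : m = 0 → t = 0
  miss : s.reg 13 = r
  dim : s.reg 14 = n ^ p

variable {n m t x r p Y : ℕ} {F : ℕ → Finset ℕ} {s : State}

namespace Ctx

theorem setReg (h : Ctx n m F t x r p s) {y v : ℕ} (hy : y < 6 ∨ 15 ≤ y) :
    Ctx n m F t x r p (s.setReg y v) := by
  refine ⟨h.good.setReg (by omega), ?_, h.pos, ?_, ?_⟩ <;>
    rw [State.reg_setReg, if_neg (by omega)]
  exacts [h.idx, h.miss, h.dim]

theorem map (h : Ctx n m F t x r p s) :
    ((digitsE (.var 10) t).map fun e => e.eval s) = digits m t x := by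
  rw [map_digitsE, h.good.seven, eval_var, h.idx]

theorem chain (h : Ctx n m F t x r p s) (Y : ℕ) : CheapChain Y m (digitsE (.var 10) t) s := by
  intro e he
  refine ⟨dep_digitsE (fun s x v hx => ?_) t e he, ?_, fun s => cheap_digitsE (cheap_var _) t e he⟩
  · simp only [eval_var, State.reg_setReg]; rw [if_neg (by omega)]
  · have h1 : e.eval s ∈ digits m t x := by rw [← h.map]; exact List.mem_map.2 ⟨e, he, rfl⟩
    refine lt_of_mem_digits (Nat.pos_of_ne_zero fun h0 => ?_) h1
    have := length_digits (m := m) t x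
    rw [h.pos h0] at h1
    simp [digits] at h1

theorem dep (h : Ctx n m F t x r p s) :
    ∀ e ∈ digitsE (.var 10) t, Dep e ∧ e.eval s < m :=
  fun e he => ⟨(h.chain 0 e he).1, (h.chain 0 e he).2.1⟩

end Ctx

theorem eval_digE (h6 : s.reg 6 = n) (y i : ℕ) : (digE y i).eval s = dig n (s.reg y) i := by
  simp [digE, dig, h6]

theorem eval_posE (h6 : s.reg 6 = n) (i : ℕ) :
    (posE p i).eval s = pos n p (s.reg 25) (s.reg 26) (s.reg 27) i := by
  simp only [posE, pos]; split_ifs <;> exact eval_digE h6 _ _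

theorem holds_pairE (h : Ctx n m F t x r p s) (i j : ℕ) :
    (pairE (digitsE (.var 10) t) p i j).Holds s ↔ PairOk (Extends F m (digits m t x)) r i j
      (pos n p (s.reg 25) (s.reg 26) (s.reg 27) i) (pos n p (s.reg 25) (s.reg 26) (s.reg 27) j) := by
  set u := pos n p (s.reg 25) (s.reg 26) (s.reg 27) i
  set v := pos n p (s.reg 25) (s.reg 26) (s.reg 27) j
  have h1 : (posE p i).eval s = u := eval_posE h.good.six i
  have h2 : (posE p j).eval (s.setReg 23 u) = v := by
    rw [eval_posE (h.setReg (by omega)).good.six j]; simp [v]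
  have h3 : Ctx n m F t x r p ((s.setReg 23 u).setReg 24 v) :=
    (h.setReg (by omega)).setReg (by omega)
  have h4 := holds_extendsE h3.good h3.dep
  rw [h3.map] at h4
  rw [pairE, holds_letE, h1, holds_letE, h2, holds_ite, holds_andE, h4]
  simp only [holds_ltE, eval_const, eval_var, holds_eqE, eval_zero, h3.miss, PairOk]
  by_cases hij : i < j
  · simp [hij]
  · simp [hij, Holds]

theorem holds_blockE (h : Ctx n m F t x r p s) (o : ℕ) :
    (blockE (digitsE (.var 10) t) p o).Holds s ↔ BlockOk (Extends F m (digits m t x)) r n p o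
      (s.reg 25) (s.reg 26) (s.reg 27) := by
  simp only [blockE, holds_allE, List.forall_mem_map, holds_pairE h, outside, List.mem_filter,
    List.mem_product, List.mem_range, decide_eq_true_eq, Prod.forall, BlockOk]
  constructor
  · exact fun H i j h1 h2 h3 h4 => H i j ⟨⟨by omega, h2⟩, h1, h3, h4⟩
  · exact fun H i j ⟨⟨_, h2⟩, h1, h3, h4⟩ => H i j h1 h2 h3 h4

theorem cheap_digE (y i : ℕ) (D : ℕ) : (digE y i).Cheap Y D s :=
  cheap_mod (cheap_div (cheap_var _) (cheap_powE (cheap_var _) _)) (cheap_var _)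

theorem cheap_posE (i D : ℕ) : (posE p i).Cheap Y D s := by
  unfold posE; split_ifs <;> exact cheap_digE _ _ _

theorem cheap_blockE (h : Ctx n m F t x r p s) (hY : n ≤ Y) (hY' : m ≤ Y) (o : ℕ) :
    (blockE (digitsE (.var 10) t) p o).Cheap Y 3 s := by
  refine cheap_allE ?_
  simp only [List.forall_mem_map]
  intro y _
  refine cheap_letE (cheap_posE _ _) (cheap_letE (cheap_posE _ _) (cheap_ite
    (cheap_ltE (cheap_const _) (cheap_var _)) (cheap_andE ?_ ?_) (cheap_eqE (cheap_var _) cheap_zero)))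
  · have h3 : Ctx n m F t x r p _ := (h.setReg (y := 23) (v := (posE p y.1).eval s)
      (by omega)).setReg (y := 24) (v := (posE p y.2).eval (s.setReg 23 ((posE p y.1).eval s)))
      (by omega)
    exact cheap_extendsE h3.good hY hY' (h3.chain Y)
  · split_ifs
    exacts [cheap_ltE (cheap_var _) (cheap_var _), cheap_one]

theorem cheap_cellE (h : Ctx n m F t x r p s) (hY : n ≤ Y) (hY' : m ≤ Y) :
    (cellE (digitsE (.var 10) t) p).Cheap Y 3 s := by
  have h5 : (Expr.var 5 - 1).Cheap Y 3 s := cheap_sub (cheap_var _) cheap_one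
  have hN : ∀ s, (Expr.var 14 * Expr.var 14).Cheap Y 3 s := fun s =>
    cheap_mul (cheap_var _) (cheap_var _)
  refine cheap_ite (cheap_eqE (cheap_var _) cheap_zero) (cheap_var _) <|
    cheap_ite (cheap_ltE (cheap_var _) (cheap_add cheap_one (hN _))) (cheap_letE
      (cheap_div h5 (cheap_var _)) (cheap_letE (cheap_mod (cheap_sub (cheap_var _) cheap_one)
        (cheap_var _)) (cheap_letE cheap_zero (cheap_boolE (cheap_blockE
          (((h.setReg (by omega)).setReg (by omega)).setReg (by omega)) hY hY' _))))) <|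
    cheap_ite (cheap_ltE (cheap_var _) (cheap_add cheap_one (cheap_mul (cheap_ofNat _) (hN _))))
      (cheap_letE (cheap_div (cheap_sub h5 (hN _)) (cheap_var _)) (cheap_letE (cheap_mod (cheap_sub
        (cheap_sub (cheap_var _) cheap_one) (hN _)) (cheap_var _)) (cheap_letE cheap_zero
        (cheap_boolE (cheap_blockE
          (((h.setReg (by omega)).setReg (by omega)).setReg (by omega)) hY hY' _))))) cheap_zero

open Classical in
/-- The matrix for the blocks other than `2`. -/
noncomputable def matA (F : ℕ → Finset ℕ) (n m t x r p : ℕ) :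
    Matrix (Fin (n ^ p)) (Fin (n ^ p)) ℕ :=
  fun a b => if BlockOk (Extends F m (digits m t x)) r n p 2 a b 0 then 1 else 0

open Classical in
/-- The matrix for the blocks other than `0`. -/
noncomputable def matB (F : ℕ → Finset ℕ) (n m t x r p : ℕ) :
    Matrix (Fin (n ^ p)) (Fin (n ^ p)) ℕ :=
  fun b c => if BlockOk (Extends F m (digits m t x)) r n p 0 0 b c then 1 else 0

-- The input of the matrix multiplication is never written down. Whenever the sandboxed program
-- reads a cell that it has not written, the entry is recomputed from the chain.
open Classical in
theorem eval_cellE (h : Ctx n m F t x r p s) :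
    (cellE (digitsE (.var 10) t) p).eval s =
      (n ^ p :: (MatMul.rowMajor (matA F n m t x r p) ++
        MatMul.rowMajor (matB F n m t x r p))).getD (s.reg 5) 0 := by
  have hN := h.dim
  rw [cellE, eval_ite, eval_ite, eval_ite]
  simp only [holds_eqE, holds_ltE, eval_var, eval_add, eval_mul, hN,
    eval_letE, eval_div, eval_mod, eval_sub, eval_ofNat]
  split_ifs with h1 h2 h3
  · rw [h1]; rfl
  · obtain ⟨u, hu⟩ : ∃ u, s.reg 5 = 1 + u := ⟨s.reg 5 - 1, by omega⟩
    have hu' : u < n ^ p * n ^ p := by omega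
    have hpos : 0 < n ^ p := Nat.pos_of_ne_zero fun h0 => by rw [h0] at hu'; omega
    have key := MatMul.input_left (matA F n m t x r p) (matB F n m t x r p)
      ⟨u / n ^ p, Nat.div_lt_of_lt_mul hu'⟩ ⟨u % n ^ p, Nat.mod_lt _ hpos⟩
    rw [Nat.div_add_mod', ← hu] at key
    rw [key, eval_boolE, matA]
    have hc : Ctx n m F t x r p (((s.setReg 25 (u / n ^ p)).setReg 26 (u % n ^ p)).setReg 27 0) :=
      ((h.setReg (by omega)).setReg (by omega)).setReg (by omega)
    have hb := holds_blockE hc 2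
    have e1 : s.reg 5 - 1 = u := by omega
    have e2 : (s.setReg 25 (u / n ^ p)).reg 5 - 1 = u := by simpa using e1
    have e3 : (s.setReg 25 (u / n ^ p)).reg 14 = n ^ p := by simpa using hN
    refine if_congr ?_ rfl rfl
    simp only [e1, e2, e3, hb]
    simp
  · obtain ⟨u, hu⟩ : ∃ u, s.reg 5 = 1 + n ^ p * n ^ p + u := ⟨s.reg 5 - (1 + n ^ p * n ^ p), by omega⟩
    have hu' : u < n ^ p * n ^ p := by omega
    have hpos : 0 < n ^ p := Nat.pos_of_ne_zero fun h0 => by rw [h0] at hu'; omega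
    have key := MatMul.input_right (matA F n m t x r p) (matB F n m t x r p)
      ⟨u / n ^ p, Nat.div_lt_of_lt_mul hu'⟩ ⟨u % n ^ p, Nat.mod_lt _ hpos⟩
    rw [Nat.div_add_mod', ← hu] at key
    rw [key, eval_boolE, matB]
    have hc : Ctx n m F t x r p (((s.setReg 26 (u / n ^ p)).setReg 27 (u % n ^ p)).setReg 25 0) :=
      ((h.setReg (by omega)).setReg (by omega)).setReg (by omega)
    have hb := holds_blockE hc 0
    have e1 : s.reg 5 - 1 - n ^ p * n ^ p = u := by omega
    have e3 : (s.setReg 26 (u / n ^ p)).reg 14 = n ^ p := by simpa using hN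
    have e2 : (s.setReg 26 (u / n ^ p)).reg 5 - 1 - n ^ p * n ^ p = u := by simpa using e1
    refine if_congr ?_ rfl rfl
    simp only [e1, e2, e3, hb]
    simp
  · rw [MatMul.input_beyond]; rw [pow_two]; omega

-- The third factor of the triangle count is multiplied entrywise with the product of the other two
-- and summed. Entries of the product are fetched through `Sandbox.read`, because a cell that the
-- program left untouched still stands for its initial contents.
open Classical in
theorem eval_traceE (h : Ctx n m F t x r p s) (hn : 0 < n) (hr : r ≤ 3 * p)
    (hs : ∀ i j : Fin (n ^ p), (Sandbox.virt (fun a => (n ^ p :: (MatMul.rowMajor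
        (matA F n m t x r p) ++ MatMul.rowMajor (matB F n m t x r p))).getD a 0) s).mem
          (1 + 2 * (n ^ p) ^ 2 + (i * n ^ p + j)) =
      (matA F n m t x r p * matB F n m t x r p) i j) :
    (traceE (digitsE (.var 10) t) p).eval s =
      (((Finset.range n).powersetCard r).filter fun R =>
        OkSet (Extends F m (digits m t x)) R).card := by
  rw [← card_triples hn hr, ← sum_matrices]
  simp only [traceE, eval_sum, eval_var, h.dim]
  refine Finset.sum_congr rfl fun a ha => ?_
  have e14 : (s.setReg 25 a).reg 14 = n ^ p := by simpa using h.dim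
  rw [e14]
  refine Finset.sum_congr rfl fun c hc => ?_
  rw [Finset.mem_range] at ha hc
  have h1 : Ctx n m F t x r p ((s.setReg 25 a).setReg 27 c) :=
    (h.setReg (by omega)).setReg (by omega)
  have h2 : Ctx n m F t x r p (((s.setReg 25 a).setReg 27 c).setReg 26 0) := h1.setReg (by omega)
  rw [eval_mul, eval_letE, eval_letE, eval_boolE]
  congr 1
  · have := holds_blockE h2 1
    simp only [eval_zero, this]
    simp
  · set ad := 1 + 2 * (n ^ p) ^ 2 + (a * n ^ p + c) with had
    have e : (1 + 2 * (Expr.var 14 * Expr.var 14) + (Expr.var 25 * Expr.var 14 + Expr.var 27)).eval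
        ((s.setReg 25 a).setReg 27 c) = ad := by
      simp [h.dim, had, pow_two]
    rw [e, Sandbox.read_eval]
    have h3 := hs ⟨a, ha⟩ ⟨c, hc⟩
    simp only [Sandbox.virt] at h3
    have h5 : Ctx n m F t x r p (((s.setReg 25 a).setReg 27 c).setReg 5 ad) := h1.setReg (by omega)
    rw [eval_cellE h5]
    simp only [State.mem_setReg, State.reg_setReg] at *
    have hsum : (matA F n m t x r p * matB F n m t x r p) ⟨a, ha⟩ ⟨c, hc⟩ =
        ∑ b ∈ Finset.range (n ^ p),
          (if BlockOk (Extends F m (digits m t x)) r n p 2 a b 0 then 1 else 0) *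
          (if BlockOk (Extends F m (digits m t x)) r n p 0 0 b c then 1 else 0) := by
      rw [Matrix.mul_apply, ← Fin.sum_univ_eq_sum_range (fun b =>
        (if BlockOk (Extends F m (digits m t x)) r n p 2 a b 0 then 1 else 0) *
        (if BlockOk (Extends F m (digits m t x)) r n p 0 0 b c then 1 else 0))]
      rfl
    rw [← hsum, ← h3]
    simp [had]

theorem cost_traceE (h : Ctx n m F t x r p s) (hY : n ≤ Y) (hY' : m ≤ Y) :
    (traceE (digitsE (.var 10) t) p).cost s ≤
      ((n ^ p) ^ 2 + 1) * (((blockE (digitsE (.var 10) t) p 1).size +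
        (cellE (digitsE (.var 10) t) p).size + 100) * (Y + 1) ^ 3) := by
  set B := (blockE (digitsE (.var 10) t) p 1).size
  set D := (cellE (digitsE (.var 10) t) p).size
  have hP : 1 ≤ (Y + 1) ^ 3 := Nat.one_le_pow _ _ (Nat.succ_pos Y)
  set P := (Y + 1) ^ 3
  have hin : ∀ a c, Expr.cost (.letE 26 0 (boolE (blockE (digitsE (.var 10) t) p 1)) *
    .letE 5 (1 + 2 * (.var 14 * .var 14) + (.var 25 * .var 14 + .var 27))
      (Sandbox.read (cellE (digitsE (.var 10) t) p))) ((s.setReg 25 a).setReg 27 c) ≤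
      (B + D + 60) * P := by
    intro a c
    have h1 : Ctx n m F t x r p ((s.setReg 25 a).setReg 27 c) :=
      (h.setReg (by omega)).setReg (by omega)
    have hb : (Expr.letE 26 0 (boolE (blockE (digitsE (.var 10) t) p 1)) *
      .letE 5 (1 + 2 * (.var 14 * .var 14) + (.var 25 * .var 14 + .var 27))
        (Sandbox.read (cellE (digitsE (.var 10) t) p))).Cheap Y 3 ((s.setReg 25 a).setReg 27 c) := by
      refine cheap_mul (cheap_letE cheap_zero (cheap_boolE (cheap_blockE (h1.setReg (by omega))
        hY hY' _))) (cheap_letE (cheap_add (cheap_add cheap_one (cheap_mul (cheap_ofNat _)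
          (cheap_mul (cheap_var _) (cheap_var _)))) (cheap_add (cheap_mul (cheap_var _)
            (cheap_var _)) (cheap_var _))) (cheap_ite (cheap_op _ (cheap_load (cheap_add
              (cheap_var _) (cheap_mul (cheap_ofNat _) (cheap_var _)))) (cheap_var _)) (cheap_load
              (cheap_add (cheap_add (cheap_var _) (cheap_mul (cheap_ofNat _) (cheap_var _)))
                cheap_one)) (cheap_cellE (h1.setReg (by omega)) hY hY')))
    refine hb.cost_le.trans (Nat.mul_le_mul_right _ (le_of_le_of_eq ?_ (b := B + D + 60) rfl))
    change (1 + (B + 1 + 1 + 1) + 4) + ((1 + (1 + (1 + 1 + 1) + 1) + 1 + ((1 + 1 + 1) + 1 + 1) + 1) +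
      (((1 + (1 + 1 + 1) + 1 + 1) + 1 + 1) + ((1 + (1 + 1 + 1) + 1) + 1 + 1 + 1) + D + 1) + 4) + 1 ≤ _
    omega
  have h14 : (Expr.var 14).eval s = n ^ p := h.dim
  have h14' : ∀ a, (Expr.var 14).eval (s.setReg 25 a) = n ^ p := fun a => by
    simpa using h.dim
  have hmid := fun a => cost_sum_le (x := 27) (b := .var 14) (s := s.setReg 25 a) fun c _ => hin a c
  have hout := cost_sum_le (x := 25) (b := .var 14) (s := s) fun a _ => (hmid a).trans (c := n ^ p * ((B + D + 60) * P + 4) + 9)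
    (by rw [h14']; exact le_of_eq (by change 1 + _ + 8 = _; ring))
  rw [h14] at hout
  refine hout.trans ?_
  have hc : ∀ s, (Expr.var 14).cost s = 1 := fun s => rfl
  rw [hc]
  generalize n ^ p = N
  nlinarith [Nat.zero_le (N * N), Nat.zero_le N, Nat.zero_le (B * P), Nat.zero_le (D * P),
    mul_le_mul' (le_refl (N * N)) hP, Nat.zero_le ((N:ℕ) * (N * P)), sq_nonneg ((N : ℤ) - 1)]

end ChainExpr

/-! ### Counting the sets of one chain by a run of the matrix multiplication. -/

namespace ChainExpr

open WordRAM WordRAM.Expr Chain Triples Sandbox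

/-- `p` multiplies `0`-`1`-matrices of dimension `N` in time `Tm N`. -/
structure Multiplier (pM : Prog) (D e₀ C₀ : ℕ) (Tm : ℕ → ℕ) : Prop where
  run : ∀ N : ℕ, 0 < N → ∀ A B : Matrix (Fin N) (Fin N) ℕ, (∀ i j, A i j ≤ 1) →
    (∀ i j, B i j ≤ 1) → ∃ (t : ℕ) (s : State),
      Runs ((N + 2) ^ D) pM (N :: (MatMul.rowMajor A ++ MatMul.rowMajor B)) t s ∧ t ≤ Tm N ∧
        ∀ i j : Fin N, s.mem (1 + 2 * N ^ 2 + (i * N + j)) = (A * B) i j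
  sq : ∀ N : ℕ, 0 < N → N ^ 2 ≤ Tm N
  fuel : ∀ N : ℕ, 0 < N → Tm N < C₀ * N ^ e₀

/-- The hyperedges are stored below address `base`, and the sandbox for `pM` begins there. -/
structure Setup (n m : ℕ) (F : ℕ → Finset ℕ) (pM : Prog) (base : ℕ) (s : State) : Prop where
  good : Good n m F s
  low : ∀ j < m, s.reg 8 + j < base ∧
    ∀ z ≤ s.mem (s.mem (s.reg 8 + j)), s.mem (s.reg 8 + j) + z < base
  two : s.reg 2 = base
  ready : Ready pM s

variable {n m t x r p Y base : ℕ} {F : ℕ → Finset ℕ} {s : State} {pM : Prog}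

theorem _root_.WordRAM.Sandbox.Ready.setReg (h : Ready pM s) {y v : ℕ} (h1 : y ≠ 1) (h2 : y ≠ 2)
    (hy : y < 100) : Ready pM (s.setReg y v) := by
  refine ⟨fun i => ?_, fun r hr => ?_⟩
  · simp only [State.mem_setReg, State.reg_setReg]
    rw [if_neg (by omega), if_neg (by omega)]; exact h.stamp i
  · rw [State.reg_setReg, if_neg (by omega)]; exact h.rest r hr

namespace Setup

theorem setReg (h : Setup n m F pM base s) {y v : ℕ} (h3 : 3 ≤ y) (hy : y < 6 ∨ 9 ≤ y)
    (h100 : y < 100) : Setup n m F pM base (s.setReg y v) := by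
  have e8 : (s.setReg y v).reg 8 = s.reg 8 := by rw [State.reg_setReg, if_neg (by omega)]
  refine ⟨h.good.setReg (by omega), fun j hj => ?_, ?_, h.ready.setReg (by omega) (by omega) h100⟩
  · rw [e8]; exact h.low j hj
  · rw [State.reg_setReg, if_neg (by omega), h.two]

/-- The sandbox writes only from address `base` on, and the hyperedges and their table lie below it;
so they survive a run. -/
theorem frame_good (h : Setup n m F pM base s) {s' : State} (hf : Frame s s') :
    Good n m F s' ∧ ∀ j < m, s'.reg 8 + j < base ∧
      ∀ z ≤ s'.mem (s'.mem (s'.reg 8 + j)), s'.mem (s'.reg 8 + j) + z < base := by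
  obtain ⟨hr, hm⟩ := hf
  rw [h.two] at hm
  have e8 : s'.reg 8 = s.reg 8 := hr 8 (by omega) (by omega) (by omega) (by omega)
  have e1 : ∀ j < m, s'.mem (s.reg 8 + j) = s.mem (s.reg 8 + j) := fun j hj => hm _ (h.low j hj).1
  have e2 : ∀ j < m, ∀ z ≤ s.mem (s.mem (s.reg 8 + j)),
      s'.mem (s.mem (s.reg 8 + j) + z) = s.mem (s.mem (s.reg 8 + j) + z) :=
    fun j hj z hz => hm _ ((h.low j hj).2 z hz)
  have e3 : ∀ j < m, s'.mem (s.mem (s.reg 8 + j)) = s.mem (s.mem (s.reg 8 + j)) :=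
    fun j hj => e2 j hj 0 (Nat.zero_le _)
  refine ⟨⟨?_, ?_, fun j hj v => ?_, fun j hj => ?_, h.good.sub⟩, fun j hj => ?_⟩
  · rw [hr 6 (by omega) (by omega) (by omega) (by omega), h.good.six]
  · rw [hr 7 (by omega) (by omega) (by omega) (by omega), h.good.seven]
  · rw [← h.good.mem j hj, e8, e1 j hj, e3 j hj]
    refine exists_congr fun z => and_congr_right fun hz => ?_
    rw [add_assoc, e2 j hj (1 + z) (by omega), ← add_assoc]
  · rw [e8, e1 j hj, e3 j hj]; exact h.good.len j hj
  · rw [e8, e1 j hj, e3 j hj]; exact h.low j hj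

theorem frame (h : Setup n m F pM base s) {s' : State} (hf : Frame s s') (hr : Ready pM s') :
    Setup n m F pM base s' :=
  ⟨(h.frame_good hf).1, (h.frame_good hf).2, by
    rw [hf.1 2 (by omega) (by omega) (by omega) (by omega), h.two], hr⟩

end Setup

open Classical in
/-- The number of sets that a chain counts. -/
noncomputable def leafCount (F : ℕ → Finset ℕ) (n m k : ℕ) (c : List ℕ) : ℕ :=
  if Valid F c then (((Finset.range n).powersetCard k).filter fun S =>
    U F c ⊆ S ∧ Leaf F m c S).card else 0

open Classical in
theorem leafCount_le (F : ℕ → Finset ℕ) (n m k : ℕ) (c : List ℕ) :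
    leafCount F n m k c ≤ n ^ k := by
  unfold leafCount
  split_ifs
  · refine (Finset.card_filter_le _ _).trans ?_
    rw [Finset.card_powersetCard, Finset.card_range]
    exact Nat.choose_le_pow _ _
  · exact Nat.zero_le _

def leafE (c : List Expr) (k : ℕ) : Expr :=
  andE (validE c) (andE (notE (ltE (.const k) (cardUE c))) (notE (deadE c)))

/-- Add the number of sets of the chain in variable `10` to variable `acc`. -/
def leafS (t k p e₀ C₀ : ℕ) (pM : Prog) (acc : ℕ) : Stmt :=
  .ite (leafE (digitsE (.var 10) t) k)
    (.seq (.assign 13 (.const k - cardUE (digitsE (.var 10) t)))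
      (.seq (.assign 4 (.const C₀ * powE (.var 14) e₀))
        (.seq (run (cellE (digitsE (.var 10) t) p) pM)
          (.assign acc (.var acc + traceE (digitsE (.var 10) t) p))))) .skip

theorem arith_one {a z P : ℕ} (h : a ≤ (1 + z + 1) * P) (hP : 1 ≤ P) : a + 1 ≤ (z + 5) * P := by
  nlinarith

theorem arith_run {z P : ℕ} (hP : 1 ≤ P) : 60 + 3 * (z * P) ≤ (63 + 3 * z) * P := by nlinarith

theorem arith_skip {a L K R e B P Q : ℕ} (h : a ≤ L * P) (hPQ : P ≤ Q) (hQ : 1 ≤ Q) :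
    a + 1 + 1 ≤ (L + K + 100 + e * 10 + R + 2 * B) * Q := by
  have h1 := h.trans (Nat.mul_le_mul_left L hPQ)
  have h2 : (L + 2) * Q ≤ (L + K + 100 + e * 10 + R + 2 * B) * Q :=
    Nat.mul_le_mul_right _ (by omega)
  nlinarith

theorem arith_sum {a L K R e B P Q : ℕ} (h : a ≤ L * P) (hPQ : P ≤ Q) (hQ : 1 ≤ Q) :
    a + ((K + 5) * P + (10 * e + 10) + (R * Q + (B * Q + 3))) + 1 ≤
      (L + K + 100 + e * 10 + R + 2 * B) * Q := by
  have h1 := h.trans (Nat.mul_le_mul_left L hPQ)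
  have h2 := Nat.mul_le_mul_left (K + 5) hPQ
  have h3 := Nat.mul_le_mul_left (10 * e + 14) hQ
  have h4 : (L + (K + 5) + (10 * e + 14) + R + B) * Q ≤ (L + K + 100 + e * 10 + R + 2 * B) * Q :=
    Nat.mul_le_mul_right _ (by omega)
  have h5 : (L + (K + 5) + (10 * e + 14) + R + B) * Q =
    L * Q + (K + 5) * Q + (10 * e + 14) * Q + R * Q + B * Q := by ring
  omega

-- The tests for validity, size of the union and dead chains come before the expensive run. The
-- constant `A` depends on `t`, `k`, `p` and the program, but not on the hypergraph.
open Classical in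
theorem leafS_tri {D e₀ C₀ : ℕ} {Tm : ℕ → ℕ} (hM : Multiplier pM D e₀ C₀ Tm) {k : ℕ}
    (hkp : k ≤ 3 * p + 3 * t) {acc : ℕ} (hacc : acc = 15 ∨ acc = 16) :
    ∃ A, ∀ (X n m : ℕ) (F : ℕ → Finset ℕ) (base Y : ℕ) (s : State), Setup n m F pM base s →
      0 < n → n ≤ Y → m ≤ Y → (m = 0 → t = 0) → s.reg 14 = n ^ p → s.reg 3 = (n ^ p + 2) ^ D →
      s.reg 1 + 1 ≤ X → (n ^ p + 2) ^ D ≤ X → C₀ * (n ^ p) ^ e₀ ≤ X → k ≤ X →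
      s.reg acc + n ^ k ≤ X →
      Tri X (leafS t k p e₀ C₀ pM acc) s (A * ((Tm (n ^ p) + 1) * (Y + 1) ^ 3)) fun s' =>
        Setup n m F pM base s' ∧
        (∀ r < 100, r ≠ 1 → r ≠ 4 → r ≠ 5 → r ≠ 13 → r ≠ acc → s'.reg r = s.reg r) ∧
        s'.reg 1 ≤ s.reg 1 + 1 ∧
        s'.reg acc = s.reg acc + leafCount F n m k (digits m t (s.reg 10)) := by
  obtain ⟨A, hA⟩ := run_tri pM
  set c := digitsE (.var 10) t with hcdef
  refine ⟨(leafE c k).size + (cardUE c).size + 100 + e₀ * 10 + A * (63 + 3 * (cellE c p).size) +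
    2 * ((blockE c p 1).size + (cellE c p).size + 100),
    fun X n m F base Y s hs hn hY hY' hm h14 h3 h1X hDX hCX hkX haX => ?_⟩
  have hN : 0 < n ^ p := Nat.pow_pos hn
  have hP : 1 ≤ (Y + 1) ^ 3 := Nat.one_le_pow _ _ (Nat.succ_pos Y)
  have hctx : Ctx n m F t (s.reg 10) (s.reg 13) p s := ⟨hs.good, rfl, hm, rfl, h14⟩
  have hvalid := holds_validE hctx.good hctx.dep
  have hcard := eval_cardUE hctx.good hctx.dep
  have hdead := holds_deadE hctx.good hctx.dep
  rw [← hcdef] at hvalid hcard hdead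
  have hmap := hctx.map
  rw [← hcdef] at hmap
  rw [hmap] at hvalid hcard hdead
  set l := digits m t (s.reg 10) with hl
  have hleaf : (leafE c k).Holds s ↔ Valid F l ∧ (U F l).card ≤ k ∧ ¬ Dead F m l := by
    rw [leafE, holds_andE, holds_andE, hvalid, holds_notE, holds_notE, hdead, holds_ltE, hcard,
      eval_const, not_lt]
  have hcheap : (leafE c k).Cheap Y 3 s :=
    cheap_andE ((cheap_validE hctx.good hY (hctx.chain Y)).mono (by omega)) (cheap_andE (cheap_notE
      (cheap_ltE (cheap_const _) ((cheap_cardUE hctx.good hY (hctx.chain Y)).mono (by omega))))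
      (cheap_notE (cheap_deadE hctx.good hY hY' (hctx.chain Y))))
  have hUsub : U F l ⊆ Finset.range n := by
    refine U_subset hctx.good.sub fun e he => ?_
    rw [← hmap] at he
    obtain ⟨e', he', rfl⟩ := List.mem_map.1 he
    exact (hctx.dep e' he').2
  have hcost := hcheap.cost_le
  set P := (Y + 1) ^ 3 with hPdef
  set T := Tm (n ^ p) + 1 with hTdef
  have hTP : 1 ≤ T * P := Nat.mul_pos (by omega) hP
  have hPT : P ≤ T * P := Nat.le_mul_of_pos_left _ (by omega)
  by_cases hL : (leafE c k).Holds s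
  swap
  -- Skipping is correct: a chain that is invalid, has too large a union, or is dead counts no set.
  · refine Tri.ite (T₁ := 1) (fun h => absurd h hL) (fun _ => Tri.skip le_rfl ⟨hs, fun _ _ _ _ _ _ _ => rfl,
      Nat.le_succ _, ?_⟩) ?_
    · rw [leafCount]
      split_ifs with hv
      · rw [eq_comm, Nat.add_eq_left, Finset.card_eq_zero, Finset.filter_eq_empty_iff]
        rintro S hS ⟨hUS, hleafS⟩
        have hUk : (U F l).card ≤ k := (Finset.card_le_card hUS).trans
          (Finset.mem_powersetCard.1 hS).2.le
        have hd : Dead F m l := by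
          by_contra hd; exact hL (hleaf.2 ⟨hv, hUk, hd⟩)
        obtain ⟨f, hf, ha, hsub⟩ := hd
        exact hleafS f hf (hsub.trans hUS) ha
      · rfl
    · exact arith_skip hcost hPT hTP
  obtain ⟨hv, hUk, hd⟩ := hleaf.1 hL
  set r := k - (U F l).card with hr
  -- The union has at least `3 * t` vertices, so the missing ones fit into three blocks of `p`
  -- positions.
  have hr3 : r ≤ 3 * p := by
    have := three_mul_length_le hv
    rw [hl, length_digits] at this
    rw [hl] at hr; omega
  have hcount : leafCount F n m k l = (((Finset.range n).powersetCard r).filter fun R =>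
      OkSet (Extends F m l) R).card := by
    rw [leafCount, if_pos hv, card_leaf hUsub hUk, if_neg hd]
  -- the states before the run
  set s₁ := s.setReg 13 r with hs₁
  set s₂ := s₁.setReg 4 (C₀ * (n ^ p) ^ e₀) with hs₂
  have hset₂ : Setup n m F pM base s₂ :=
    (hs.setReg (by omega) (by omega) (by omega)).setReg (by omega) (by omega) (by omega)
  have e1 : s₂.reg 1 = s.reg 1 := by simp [hs₂, hs₁]
  have e3 : s₂.reg 3 = (n ^ p + 2) ^ D := by simp [hs₂, hs₁, h3]
  have e4 : s₂.reg 4 = C₀ * (n ^ p) ^ e₀ := by simp [hs₂]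
  have e10 : s₂.reg 10 = s.reg 10 := by simp [hs₂, hs₁]
  have e13 : s₂.reg 13 = r := by simp [hs₂, hs₁]
  have e14 : s₂.reg 14 = n ^ p := by simp [hs₂, hs₁, h14]
  have hframe : ∀ s', Frame s₂ s' → Ctx n m F t (s.reg 10) r p s' := fun s' hf =>
    ⟨(hset₂.frame_good hf).1, by rw [hf.1 10 (by omega) (by omega) (by omega) (by omega), e10], hm,
      by rw [hf.1 13 (by omega) (by omega) (by omega) (by omega), e13],
      by rw [hf.1 14 (by omega) (by omega) (by omega) (by omega), e14]⟩
  set cell : ℕ → ℕ := fun a => (n ^ p :: (MatMul.rowMajor (matA F n m t (s.reg 10) r p) ++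
    MatMul.rowMajor (matB F n m t (s.reg 10) r p))).getD a 0 with hcell
  obtain ⟨t₀, v, hruns, ht₀, hprod⟩ := hM.run (n ^ p) hN (matA F n m t (s.reg 10) r p)
    (matB F n m t (s.reg 10) r p) (fun i j => by unfold matA; split_ifs <;> omega)
    (fun i j => by unfold matB; split_ifs <;> omega)
  have hcellX : ∀ a, cell a ≤ (n ^ p + 2) ^ D := (State.init_bdd hruns.1).2
  -- The fuel `C₀ * (n ^ p) ^ e₀` is a polynomial that the machine can compute and that exceeds the
  -- running time; only the true time `t₀` of the multiplication is charged.
  have hrun := (hA X s₂ cell (cellE c p) ((cellE c p).size * P) (by omega) (by omega) (by omega)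
    hset₂.ready (fun s' hf => ⟨eval_cellE (hframe s' hf),
      (cheap_cellE (hframe s' hf) hY hY').cost_le⟩)).2 t₀ v (by rw [e3]; exact hcellX)
      (by rw [e3]; exact hruns.2) (by rw [e4]; exact lt_of_le_of_lt ht₀ (hM.fuel _ hN))
  -- the costs
  have hc1 : (Expr.const k - cardUE c).cost s + 1 ≤ ((cardUE c).size + 5) * P := by
    have : (Expr.const k - cardUE c).Cheap Y 3 s := cheap_sub (cheap_const _)
      ((cheap_cardUE hctx.good hY (hctx.chain Y)).mono (by omega))
    have := this.cost_le
    exact arith_one this hP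
  have hc2 : (Expr.const C₀ * powE (.var 14) e₀).cost s₁ + 1 ≤ 10 * e₀ + 10 := by
    have : ∀ i, (powE (.var 14) i).cost s₁ ≤ 10 * i + 1 := fun i => by
      induction i with
      | zero => exact le_rfl
      | succ i ih =>
        change (powE (.var 14) i).cost s₁ + 1 + 1 ≤ _
        omega
    have := this e₀
    change 1 + (powE (.var 14) e₀).cost s₁ + 1 + 1 ≤ _
    omega
  have hT3 : A * (t₀ + 1) * (60 + 3 * ((cellE c p).size * P)) ≤
      A * (63 + 3 * (cellE c p).size) * (T * P) := by
    calc A * (t₀ + 1) * (60 + 3 * ((cellE c p).size * P)) ≤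
        A * T * ((63 + 3 * (cellE c p).size) * P) := Nat.mul_le_mul
          (Nat.mul_le_mul_left _ (by omega)) (arith_run hP)
      _ = _ := by ring
  have hN2 : (n ^ p) ^ 2 + 1 ≤ T := Nat.succ_le_succ (hM.sq _ hN)
  have hB : ((n ^ p) ^ 2 + 1) * (((blockE c p 1).size + (cellE c p).size + 100) * P) ≤
      ((blockE c p 1).size + (cellE c p).size + 100) * (T * P) := by
    calc _ ≤ T * (((blockE c p 1).size + (cellE c p).size + 100) * P) :=
          Nat.mul_le_mul_right _ hN2
      _ = _ := by ring
  rw [leafS, ← hcdef]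
  refine Tri.ite (T₁ := ((cardUE c).size + 5) * P + (10 * e₀ + 10) +
    (A * (63 + 3 * (cellE c p).size) * (T * P) +
      (((blockE c p 1).size + (cellE c p).size + 100) * (T * P) + 3)))
    (fun _ => ?_) (fun h => absurd h hL) ?_
  · refine Tri.assign_seq (v := r) (by rw [eval_sub, eval_const, hcard]) (by omega)
      (T₂ := (10 * e₀ + 10) + (A * (63 + 3 * (cellE c p).size) * (T * P) +
      (((blockE c p 1).size + (cellE c p).size + 100) * (T * P) + 3))) ?_ (by omega)
    refine Tri.assign_seq (v := C₀ * (n ^ p) ^ e₀) ?_ hCX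
      (T₂ := (A * (63 + 3 * (cellE c p).size) * (T * P) +
      (((blockE c p 1).size + (cellE c p).size + 100) * (T * P) + 3))) ?_ (Nat.add_le_add_right hc2 _)
    · rw [eval_mul, eval_powE, eval_var, eval_const]; simp [h14]
    refine Tri.seq hrun (T₂ := ((blockE c p 1).size + (cellE c p).size + 100) * (T * P) + 3) ?_
      (by omega)
    rintro s₃ ⟨hf, h31, hready, hvirt⟩
    have hctx₃ := hframe s₃ hf
    have hset₃ := hset₂.frame hf hready
    have htr : (traceE c p).eval s₃ = leafCount F n m k l := by
      rw [eval_traceE hctx₃ hn hr3 (fun i j => by rw [← hcell, hvirt]; exact hprod i j), hcount]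
    have hacc₃ : s₃.reg acc = s.reg acc := by
      rw [hf.1 acc (by omega) (by omega) (by omega) (by omega), hs₂, State.reg_setReg,
        if_neg (by omega), hs₁, State.reg_setReg, if_neg (by omega)]
    refine Tri.assign (v := s.reg acc + leafCount F n m k l) ?_
      ((Nat.add_le_add_left (leafCount_le F n m k l) _).trans haX) ?_ ⟨hset₃.setReg (by omega)
        (by omega) (by omega), fun r hr h1 h4 h5 h13 ha => ?_, ?_, by simp⟩
    · rw [eval_add, eval_var, hacc₃, htr]
    · have := cost_traceE hctx₃ hY hY'
      rw [← hcdef, ← hPdef] at this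
      change 1 + (traceE c p).cost s₃ + 1 + 1 ≤ _
      omega
    · rw [State.reg_setReg, if_neg ha, hf.1 r hr h1 h4 h5, hs₂, State.reg_setReg, if_neg h4, hs₁,
        State.reg_setReg, if_neg h13]
    · rw [State.reg_setReg, if_neg (by omega), h31, e1]
  · exact arith_sum hcost hPT hTP

end ChainExpr

/-! ### The alternating sum over all chains. -/

namespace ChainExpr

open WordRAM WordRAM.Expr Chain Triples Sandbox

theorem cost_powE {e : Expr} {s : State} (h : e.cost s ≤ 9) (i : ℕ) :
    (powE e i).cost s ≤ 10 * i + 1 := by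
  induction i with
  | zero => exact le_rfl
  | succ i ih =>
    change (powE e i).cost s + e.cost s + 1 ≤ _
    omega

/-- Add the number of sets of all chains with `t` entries to variable `15` or `16`. -/
def chainsS (k D e₀ C₀ : ℕ) (pM : Prog) (t : ℕ) : Stmt :=
  .seq (.assign 12 (powE (.var 7) t)) <| .seq (.assign 14 (powE (.var 6) ((k + 2) / 3 - t))) <|
    .seq (.assign 3 (powE (.var 14 + 2) D)) <|
      .forL 10 12 (leafS t k ((k + 2) / 3 - t) e₀ C₀ pM (15 + t % 2))

/-- The number of sets of all chains with `t` entries. -/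
noncomputable def chainCount (F : ℕ → Finset ℕ) (n m k t : ℕ) : ℕ :=
  ∑ x ∈ Finset.range (m ^ t), leafCount F n m k (digits m t x)

theorem chainCount_le (F : ℕ → Finset ℕ) (n m k t : ℕ) : chainCount F n m k t ≤ m ^ t * n ^ k := by
  refine (Finset.sum_le_card_nsmul _ _ (n ^ k) fun x _ => leafCount_le _ _ _ _ _).trans ?_
  simp

variable {D e₀ C₀ k : ℕ} {pM : Prog} {Tm : ℕ → ℕ}

/-- The blocks have `(k + 2) / 3 - t` positions, where `(k + 2) / 3` is `k / 3` rounded up. As words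
are natural numbers, signs are handled by two accumulators: variable `15` for chains of even length
and `16` for odd length. -/
theorem chainsS_tri (hM : Multiplier pM D e₀ C₀ Tm) (t : ℕ) :
    ∃ A, ∀ (X n m : ℕ) (F : ℕ → Finset ℕ) (base Y : ℕ) (s : State), Setup n m F pM base s →
      0 < n → n ≤ Y → m ≤ Y → (n ^ ((k + 2) / 3 - t) + 2) ^ D ≤ X →
      C₀ * (n ^ ((k + 2) / 3 - t)) ^ e₀ ≤ X → k ≤ X → n ^ k ≤ X →
      s.reg 1 + m ^ t ≤ X → s.reg (15 + t % 2) + (m ^ t + 1) * n ^ k ≤ X →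
      Tri X (chainsS k D e₀ C₀ pM t) s
        (A * ((m ^ t + 1) * ((Tm (n ^ ((k + 2) / 3 - t)) + 1) * (Y + 1) ^ 3))) fun s' =>
        Setup n m F pM base s' ∧ s'.reg (15 + (t + 1) % 2) = s.reg (15 + (t + 1) % 2) ∧
        s'.reg 1 ≤ s.reg 1 + m ^ t ∧
        s'.reg (15 + t % 2) = s.reg (15 + t % 2) + chainCount F n m k t := by
  set p := (k + 2) / 3 - t with hp
  set acc := 15 + t % 2 with hacc
  set oth := 15 + (t + 1) % 2 with hoth
  have hao : (acc = 15 ∨ acc = 16) ∧ (oth = 15 ∨ oth = 16) ∧ acc ≠ oth := by omega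
  obtain ⟨A, hA⟩ := leafS_tri hM (p := p) (t := t) (k := k) (by omega) hao.1
  refine ⟨A + 30 + 10 * t + 10 * p + 10 * D, fun X n m F base Y s hs hn hY hY' hDX hCX hkX hnX h1X haX => ?_⟩
  have hN : 1 ≤ n ^ p := Nat.pow_pos hn
  have hnk : 1 ≤ n ^ k := Nat.pow_pos hn
  have hP : 1 ≤ (Tm (n ^ p) + 1) * (Y + 1) ^ 3 :=
    Nat.mul_pos (Nat.succ_pos _) (Nat.pow_pos (Nat.succ_pos Y))
  set P := (Tm (n ^ p) + 1) * (Y + 1) ^ 3 with hPdef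
  have hpX : n ^ p ≤ X := (Nat.pow_le_pow_right hn (by omega)).trans hnX
  have htot : (10 * t + 1 + 1) + ((10 * p + 1 + 1) + ((10 * D + 1 + 1) + (m ^ t * (A * P + 8) + 6))) ≤
      (A + 30 + 10 * t + 10 * p + 10 * D) * ((m ^ t + 1) * P) := by
    have h1 : m ^ t + 1 ≤ (m ^ t + 1) * P := Nat.le_mul_of_pos_right _ hP
    have h2 : m ^ t * (A * P) ≤ A * ((m ^ t + 1) * P) := by
      calc m ^ t * (A * P) ≤ (m ^ t + 1) * (A * P) := Nat.mul_le_mul_right _ (Nat.le_succ _)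
        _ = _ := by ring
    have h4 : 10 * t + 10 * p + 10 * D + 12 + 8 * m ^ t ≤
        (10 * t + 10 * p + 10 * D + 30) * ((m ^ t + 1) * P) := by
      refine le_trans ?_ (Nat.mul_le_mul_left _ h1)
      have e : (10 * t + 10 * p + 10 * D + 30) * (m ^ t + 1) =
        (10 * t + 10 * p + 10 * D) * m ^ t + (10 * t + 10 * p + 10 * D + 30 * m ^ t + 30) := by ring
      omega
    have h5 : (A + 30 + 10 * t + 10 * p + 10 * D) * ((m ^ t + 1) * P) = A * ((m ^ t + 1) * P) +
      (10 * t + 10 * p + 10 * D + 30) * ((m ^ t + 1) * P) := by ring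
    rw [h5, mul_add]; omega
  set s₁ := s.setReg 12 (m ^ t) with hs₁
  set s₂ := s₁.setReg 14 (n ^ p) with hs₂
  set s₃ := s₂.setReg 3 ((n ^ p + 2) ^ D) with hs₃
  have hset₁ : Setup n m F pM base s₁ := hs.setReg (by omega) (by omega) (by omega)
  have hset₂ : Setup n m F pM base s₂ := hset₁.setReg (by omega) (by omega) (by omega)
  have hset₃ : Setup n m F pM base s₃ := hset₂.setReg (by omega) (by omega) (by omega)
  rw [chainsS, ← hp]
  refine Tri.assign_seq (v := m ^ t) (by rw [eval_powE, eval_var, hs.good.seven])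
    (by omega) (T₂ := (10 * p + 1 + 1) + ((10 * D + 1 + 1) + (m ^ t * (A * P + 8) + 6))) ?_
    (le_trans (Nat.add_le_add_right (Nat.succ_le_succ (cost_powE (by exact (show 1 ≤ 9 by omega)) t)) _) htot)
  refine Tri.assign_seq (v := n ^ p) (by rw [eval_powE, eval_var, hset₁.good.six]) hpX
    (T₂ := ((10 * D + 1 + 1) + (m ^ t * (A * P + 8) + 6))) ?_
    (Nat.add_le_add_right (Nat.succ_le_succ (cost_powE (by exact (show 1 ≤ 9 by omega)) p)) _)
  refine Tri.assign_seq (v := (n ^ p + 2) ^ D) (by rw [eval_powE]; simp) hDX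
    (T₂ := (m ^ t * (A * P + 8) + 6)) ?_
    (Nat.add_le_add_right (Nat.succ_le_succ (cost_powE (by exact (show 3 ≤ 9 by omega)) D)) _)
  have e0 : ∀ y, y ≠ 12 → y ≠ 14 → y ≠ 3 → s₃.reg y = s.reg y := fun y h1 h2 h3 => by
    rw [hs₃, State.reg_setReg, if_neg h3, hs₂, State.reg_setReg, if_neg h2, hs₁,
      State.reg_setReg, if_neg h1]
  refine Tri.forL (N := m ^ t) (fun i s' => Setup n m F pM base s' ∧ s'.reg 12 = m ^ t ∧
    s'.reg 14 = n ^ p ∧ s'.reg 3 = (n ^ p + 2) ^ D ∧ s'.reg 1 ≤ s.reg 1 + i ∧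
    s'.reg acc = s.reg acc + ∑ x ∈ Finset.range i, leafCount F n m k (digits m t x) ∧
    s'.reg oth = s.reg oth) (by omega) ⟨hset₃.setReg (by omega) (by omega) (by omega), ?_, ?_, ?_, ?_,
    ?_, ?_⟩ (fun i s' h => h.2.1) ?_ ?_
  · simp
  · simp
  · simp
  · rw [State.reg_setReg, if_neg (by omega), e0 1 (by omega) (by omega) (by omega)]; omega
  · rw [State.reg_setReg, if_neg (by omega), e0 acc (by omega) (by omega) (by omega)]; simp
  · rw [State.reg_setReg, if_neg (by omega), e0 oth (by omega) (by omega) (by omega)]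
  · rintro i hi s' ⟨g1, g2, g3, g4, g5, g6, g7⟩ h10
    have hsum : ∑ x ∈ Finset.range i, leafCount F n m k (digits m t x) ≤ m ^ t * n ^ k := by
      refine (Finset.sum_le_card_nsmul _ _ (n ^ k) fun x _ => leafCount_le _ _ _ _ _).trans ?_
      simp only [Finset.card_range, smul_eq_mul]
      exact Nat.mul_le_mul_right _ hi.le
    -- Digits in base `0` would be meaningless, but without hyperedges the loop has no round for `t
    -- > 0`.
    have hmt : m = 0 → t = 0 := fun h0 => by
      by_contra ht0
      rw [h0, zero_pow ht0] at hi; omega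
    refine (hA X n m F base Y s' g1 hn hY hY' hmt g3 g4 (by omega) hDX hCX hkX
      (by rw [g6]; rw [add_mul, one_mul] at haX; omega)).mono le_rfl ?_
    rintro s'' ⟨f1, f2, f3, f4⟩
    refine ⟨by rw [f2 10 (by omega) (by omega) (by omega) (by omega) (by omega) (by omega), h10],
      f1.setReg (by omega) (by omega) (by omega), ?_, ?_, ?_, ?_, ?_, ?_⟩ <;>
      rw [State.reg_setReg, if_neg (by omega)]
    · rw [f2 12 (by omega) (by omega) (by omega) (by omega) (by omega) (by omega), g2]
    · rw [f2 14 (by omega) (by omega) (by omega) (by omega) (by omega) (by omega), g3]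
    · rw [f2 3 (by omega) (by omega) (by omega) (by omega) (by omega) (by omega), g4]
    · omega
    · rw [f4, g6, Finset.sum_range_succ, h10, add_assoc]
    · rw [f2 oth (by omega) (by omega) (by omega) (by omega) (by omega) hao.2.2.symm, g7]
  · rintro s' ⟨g1, g2, g3, g4, g5, g6, g7⟩ _
    exact ⟨g1, g7, g5, g6⟩

/-- Count for all chains with fewer than `j` entries. -/
def allChainsS (k D e₀ C₀ : ℕ) (pM : Prog) : ℕ → Stmt
  | 0 => .skip
  | j + 1 => .seq (allChainsS k D e₀ C₀ pM j) (chainsS k D e₀ C₀ pM j)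

/-- The time for all chains with fewer than `j` entries, up to a constant. -/
def chainTime (k : ℕ) (Tm : ℕ → ℕ) (n m Y j : ℕ) : ℕ :=
  ∑ t ∈ Finset.range j, (m ^ t + 1) * ((Tm (n ^ ((k + 2) / 3 - t)) + 1) * (Y + 1) ^ 3)

theorem allChainsS_tri (hM : Multiplier pM D e₀ C₀ Tm) (j : ℕ) (hj : j ≤ k / 3 + 1) :
    ∃ A, ∀ (X n m : ℕ) (F : ℕ → Finset ℕ) (base Y : ℕ) (s : State), Setup n m F pM base s →
      0 < n → n ≤ Y → m ≤ Y → (∀ i ≤ k, (n ^ i + 2) ^ D ≤ X) →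
      (∀ i ≤ k, C₀ * (n ^ i) ^ e₀ ≤ X) → k ≤ X →
      s.reg 1 = 0 → s.reg 15 = 0 → s.reg 16 = 0 →
      (∑ t ∈ Finset.range j, (m ^ t + 1)) * n ^ k + n ^ k ≤ X →
      Tri X (allChainsS k D e₀ C₀ pM j) s (A * (chainTime k Tm n m Y j + 1)) fun s' =>
        Setup n m F pM base s' ∧
        s'.reg 1 ≤ ∑ t ∈ Finset.range j, (m ^ t + 1) ∧
        (s'.reg 15 ≤ (∑ t ∈ Finset.range j, (m ^ t + 1)) * n ^ k ∧
          s'.reg 16 ≤ (∑ t ∈ Finset.range j, (m ^ t + 1)) * n ^ k) ∧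
        (s'.reg 15 : ℤ) - s'.reg 16 =
          ∑ t ∈ Finset.range j, (-1) ^ t * (chainCount F n m k t : ℤ) := by
  induction j with
  | zero => exact ⟨1, fun X n m F base Y s hs hn _ _ _ _ _ h1 h15 h16 _ =>
      Tri.skip (by simp) ⟨hs, by omega, ⟨by omega, by omega⟩, by simp [h15, h16]⟩⟩
  | succ j ih =>
    obtain ⟨A, hA⟩ := ih (by omega)
    obtain ⟨B, hB⟩ := chainsS_tri hM j (k := k)
    refine ⟨A + B, fun X n m F base Y s hs hn hY hY' hDX hCX hkX h1 h15 h16 hX => ?_⟩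
    rw [Finset.sum_range_succ] at hX
    have hnk : 1 ≤ n ^ k := Nat.pow_pos hn
    rw [add_mul] at hX
    have hle := Nat.le_mul_of_pos_right (∑ t ∈ Finset.range j, (m ^ t + 1)) hnk
    have hle2 := Nat.le_mul_of_pos_right (m ^ j + 1) hnk
    refine Tri.seq (hA X n m F base Y s hs hn hY hY' hDX hCX hkX h1 h15 h16 (by omega))
      (T₂ := B * ((m ^ j + 1) * ((Tm (n ^ ((k + 2) / 3 - j)) + 1) * (Y + 1) ^ 3))) ?_ ?_
    · rintro s' ⟨g1, g2, g3, g4⟩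
      have hacc : s'.reg (15 + j % 2) ≤ (∑ t ∈ Finset.range j, (m ^ t + 1)) * n ^ k := by
        rcases Nat.mod_two_eq_zero_or_one j with h | h <;> rw [h]
        exacts [g3.1, g3.2]
      refine (hB X n m F base Y s' g1 hn hY hY' (hDX _ (by omega)) (hCX _ (by omega)) hkX
        (by omega) (by omega) (by omega)).mono le_rfl ?_
      rintro s'' ⟨f1, f2, f3, f4⟩
      have hcc := chainCount_le F n m k j
      rw [Finset.sum_range_succ, Finset.sum_range_succ, add_mul]
      have hcc' : m ^ j * n ^ k ≤ (m ^ j + 1) * n ^ k := Nat.mul_le_mul_right _ (Nat.le_succ _)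
      refine ⟨f1, by omega, ?_⟩
      rcases Nat.even_or_odd j with h | h
      · have h0 : j % 2 = 0 := Nat.even_iff.1 h
        have h1 : (j + 1) % 2 = 1 := by omega
        rw [h0] at f4 hacc; rw [h1] at f2
        simp only [Nat.reduceAdd, Nat.add_zero] at f2 f4 hacc
        rw [h.neg_one_pow, one_mul]
        exact ⟨⟨by omega, by omega⟩, by omega⟩
      · have h0 : j % 2 = 1 := Nat.odd_iff.1 h
        have h1 : (j + 1) % 2 = 0 := by omega
        rw [h0] at f4 hacc; rw [h1] at f2
        simp only [Nat.reduceAdd, Nat.add_zero] at f2 f4 hacc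
        rw [h.neg_one_pow, neg_one_mul]
        exact ⟨⟨by omega, by omega⟩, by omega⟩
    · rw [show chainTime k Tm n m Y (j + 1) = chainTime k Tm n m Y j + _ from
        Finset.sum_range_succ _ _]
      generalize (m ^ j + 1) * ((Tm (n ^ ((k + 2) / 3 - j)) + 1) * (Y + 1) ^ 3) = Z
      nlinarith [Nat.zero_le (A * Z), Nat.zero_le (B * chainTime k Tm n m Y j)]

/-- Decide whether there is an independent set of size `k`. -/
def countS (k D e₀ C₀ : ℕ) (pM : Prog) : Stmt :=
  .seq (allChainsS k D e₀ C₀ pM (k / 3 + 1)) (.assign 0 (notE (eqE (.var 15) (.var 16))))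

/-- The difference of the two accumulators is the number of independent sets, so there is one
exactly if the accumulators differ. Lengths up to `k / 3` suffice since `k < 3 * (k / 3 + 1)`. -/
theorem countS_tri (hM : Multiplier pM D e₀ C₀ Tm) (k : ℕ) :
    ∃ A, ∀ (X n m : ℕ) (F : ℕ → Finset ℕ) (base Y : ℕ) (s : State), Setup n m F pM base s →
      0 < n → n ≤ Y → m ≤ Y → (∀ i ≤ k, (n ^ i + 2) ^ D ≤ X) →
      (∀ i ≤ k, C₀ * (n ^ i) ^ e₀ ≤ X) → k ≤ X →
      s.reg 1 = 0 → s.reg 15 = 0 → s.reg 16 = 0 →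
      (∑ t ∈ Finset.range (k / 3 + 1), (m ^ t + 1)) * n ^ k + n ^ k ≤ X →
      Tri X (countS k D e₀ C₀ pM) s (A * (chainTime k Tm n m Y (k / 3 + 1) + 1)) fun s' =>
        (s'.reg 0 ≠ 0 ↔ ∃ S ∈ (Finset.range n).powersetCard k, ∀ f < m, ¬ F f ⊆ S) := by
  classical
  obtain ⟨A, hA⟩ := allChainsS_tri hM (k / 3 + 1) (k := k) le_rfl
  refine ⟨A + 10, fun X n m F base Y s hs hn hY hY' hDX hCX hkX h1 h15 h16 hX => ?_⟩
  have hnk : 1 ≤ n ^ k := Nat.pow_pos hn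
  refine Tri.seq (hA X n m F base Y s hs hn hY hY' hDX hCX hkX h1 h15 h16 hX) (T₂ := 6) ?_ (by
    nlinarith)
  rintro s' ⟨-, -, -, h⟩
  have hval : (notE (eqE (.var 15) (.var 16))).eval s' ≤ 1 := by
    change (if (if s'.reg 15 = s'.reg 16 then 1 else 0) = 0 then 1 else 0) ≤ 1
    split_ifs <;> omega
  refine Tri.assign rfl (by omega) (le_of_eq_of_le (b := 6) rfl le_rfl) ?_
  have hiff : (notE (eqE (.var 15) (.var 16))).eval s' ≠ 0 ↔ s'.reg 15 ≠ s'.reg 16 := by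
    have := holds_notE (s := s') (a := eqE (.var 15) (.var 16))
    rw [holds_eqE] at this
    exact this
  simp only [State.reg_setReg, if_true]
  rw [hiff]
  have hci := card_independent (F := F) (m := m) (n := n) (k := k) (T := k / 3) (by omega)
  have hcc : ∀ t, ((chainCount F n m k t : ℕ) : ℤ) = ∑ x ∈ Finset.range (m ^ t),
      (if Valid F (digits m t x) then (((Finset.range n).powersetCard k).filter fun S =>
        U F (digits m t x) ⊆ S ∧ Leaf F m (digits m t x) S).card else 0 : ℤ) := by
    intro t
    rw [chainCount, Nat.cast_sum]
    refine Finset.sum_congr rfl fun x _ => ?_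
    rw [leafCount]
    split_ifs <;> norm_num
  simp only [← hcc] at hci
  rw [hci] at h
  constructor
  · intro hne
    have : (((Finset.range n).powersetCard k).filter fun S => ∀ f < m, ¬ F f ⊆ S).card ≠ 0 := by
      omega
    rw [Finset.card_ne_zero] at this
    obtain ⟨S, hS⟩ := this
    exact ⟨S, (Finset.mem_filter.1 hS).1, (Finset.mem_filter.1 hS).2⟩
  · rintro ⟨S, h1, h2⟩ heq
    have : (((Finset.range n).powersetCard k).filter fun S => ∀ f < m, ¬ F f ⊆ S).card = 0 := by
      omega
    rw [Finset.card_eq_zero] at this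
    exact Finset.notMem_empty S (this ▸ Finset.mem_filter.2 ⟨h1, h2⟩)

end ChainExpr

/-! ### Reading an encoded hypergraph. -/

namespace HyperIS

open WordRAM

/-- The list `w` stores the lists `v 0, …, v (m - 1)` of numbers below `n`, each of them without
repetitions, as in the encoding of hypergraphs; the `j`-th one starts at position `off j`. -/
structure Stores (n m : ℕ) (v : ℕ → List ℕ) (off : ℕ → ℕ) (w : List ℕ) : Prop where
  vertices : w.getD 0 0 = n
  edges : w.getD 1 0 = m
  off_zero : off 0 = 2
  off_succ : ∀ j, off (j + 1) = off j + (v j).length + 1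
  length : w.length = off m
  arity : ∀ j < m, w.getD (off j) 0 = (v j).length
  entry : ∀ j < m, ∀ z < (v j).length, w.getD (off j + 1 + z) 0 = (v j).getD z 0
  nodup : ∀ j, (v j).Nodup
  lt : ∀ j, ∀ x ∈ v j, x < n
  le : ∀ x ∈ w, x ≤ n + m

theorem getElem?_flatMap_off {α β : Type*} (L : List α) (f : α → List β) {j : ℕ}
    (hj : j < L.length) {z : ℕ} (hz : z < (f L[j]).length) :
    (L.flatMap f)[((L.take j).map fun e => (f e).length).sum + z]? = (f L[j])[z]? := by
  induction L generalizing j with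
  | nil => simp at hj
  | cons a L ih =>
    rw [List.flatMap_cons]
    cases j with
    | zero => simp at hz ⊢; rw [List.getElem?_append_left hz]
    | succ j =>
      simp only [List.take_succ_cons, List.map_cons, List.sum_cons, List.getElem_cons_succ] at hz ⊢
      rw [List.getElem?_append_right (by omega)]
      rw [← ih (by simpa using hj) hz]
      congr 1; omega

/-- Translates the encoding into indexed lists with explicit addresses, the form in which a machine
uses it. The clause for an arbitrary `P` transports restrictions on the arities, the last one
transports independence. -/
theorem Encodes.stores {n : ℕ} {E : Finset (Finset (Fin n))} {w : List ℕ} (h : Encodes E w) :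
    ∃ v off, Stores n E.card v off w ∧
      (∀ P : ℕ → Prop, (∀ e ∈ E, P e.card) → ∀ j < E.card, P (v j).length) ∧
      ∀ S : Finset (Fin n), (∀ e ∈ E, ¬ e ⊆ S) ↔
        ∀ j < E.card, ¬ (v j).toFinset ⊆ S.image Fin.val := by
  obtain ⟨L, hnd, hL, hE, rfl⟩ := h
  have hm : E.card = L.length := by
    rw [← hE, List.toFinset_card_of_nodup hL, List.length_map]
  set f : List (Fin n) → List ℕ := fun e => e.length :: e.map Fin.val with hf
  have hlen : ∀ e, (f e).length = e.length + 1 := fun e => by simp [hf]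
  set v : ℕ → List ℕ := fun j => (L.getD j []).map Fin.val with hv
  set off : ℕ → ℕ := fun j => 2 + ∑ i ∈ Finset.range j, ((v i).length + 1) with hoff
  have hvj : ∀ j (hj : j < L.length), v j = L[j].map Fin.val := fun j hj => by
    simp [hv, List.getD_eq_getElem?_getD, List.getElem?_eq_getElem hj]
  have hsum : ∀ j ≤ L.length, ((L.take j).map fun e => (f e).length).sum =
      ∑ i ∈ Finset.range j, ((v i).length + 1) := by
    intro j hj
    induction j with
    | zero => simp
    | succ j ih =>
      rw [List.take_succ_eq_append_getElem (by omega), List.map_append, List.sum_append,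
        ih (by omega), Finset.sum_range_succ, hvj j (by omega)]
      simp [hlen]
  have hget : ∀ j (hj : j < L.length) z, z < L[j].length + 1 →
      (n :: L.length :: L.flatMap f).getD (off j + z) 0 = (f L[j]).getD z 0 := by
    intro j hj z hz
    rw [hoff]
    simp only
    rw [add_assoc, add_comm 2, List.getD_cons_succ, List.getD_cons_succ,
      List.getD_eq_getElem?_getD, ← hsum j hj.le, getElem?_flatMap_off L f hj (by rw [hlen]; exact hz),
      List.getD_eq_getElem?_getD]
  have hmem : ∀ j (hj : j < L.length), L[j].toFinset ∈ E := fun j hj => by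
    rw [← hE]; simp only [List.mem_toFinset, List.mem_map]
    exact ⟨L[j], List.getElem_mem hj, rfl⟩
  refine ⟨v, off, ⟨rfl, hm ▸ rfl, by simp [hoff], fun j => ?_, ?_, fun j hj => ?_, fun j hj z hz => ?_,
    fun j => ?_, fun j x hx => ?_, ?_⟩, fun P hP j hj => ?_, fun S => ?_⟩
  · simp only [hoff, Finset.sum_range_succ]; ring
  · rw [hm]
    simp only [hoff, List.length_cons, List.length_flatMap]
    rw [← hsum _ le_rfl, List.take_length]; omega
  · rw [hm] at hj
    have := hget j hj 0 (by omega)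
    rw [add_zero] at this
    rw [this, hvj j hj]; simp [hf]
  · rw [hm] at hj
    rw [hvj j hj, List.length_map] at hz
    have := hget j hj (z + 1) (by omega)
    rw [add_assoc, add_comm 1 z, this, hvj j hj]; simp [hf]
  · rcases lt_or_ge j L.length with hj | hj
    · rw [hvj j hj]
      exact (hnd _ (List.getElem_mem hj)).map Fin.val_injective
    · simp [hv, List.getD_eq_getElem?_getD, List.getElem?_eq_none hj]
  · obtain ⟨y, -, rfl⟩ := List.mem_map.1 hx
    exact y.2
  · intro x hx
    simp only [List.mem_cons, List.mem_flatMap, hf, List.mem_map] at hx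
    rcases hx with rfl | rfl | ⟨e, he, rfl | ⟨y, -, rfl⟩⟩
    · omega
    · omega
    · have := (hnd e he).length_le_card
      simp at this; omega
    · omega
  · rw [hm] at hj
    have := hP _ (hmem j hj)
    rw [List.toFinset_card_of_nodup (hnd _ (List.getElem_mem hj))] at this
    rw [hvj j hj, List.length_map]
    exact this
  · have hsub : ∀ j (hj : j < L.length), (v j).toFinset ⊆ S.image Fin.val ↔ L[j].toFinset ⊆ S := by
      intro j hj
      rw [hvj j hj]
      simp only [Finset.subset_iff, List.mem_toFinset, List.mem_map, Finset.mem_image]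
      constructor
      · intro H x hx
        obtain ⟨y, hy, hxy⟩ := H ⟨x, hx, rfl⟩
        rwa [← Fin.val_injective hxy]
      · rintro H _ ⟨x, hx, rfl⟩
        exact ⟨x, H hx, rfl⟩
    rw [hm]
    constructor
    · exact fun H j hj => fun hs => H _ (hmem j hj) ((hsub j hj).1 hs)
    · intro H e he hs
      rw [← hE] at he
      simp only [List.mem_toFinset, List.mem_map] at he
      obtain ⟨l, hl, rfl⟩ := he
      obtain ⟨j, hj, rfl⟩ := List.getElem_of_mem hl
      exact H j hj ((hsub j hj).2 hs)

theorem hasIndependentSet_iff {n k m : ℕ} {E : Finset (Finset (Fin n))} {v : ℕ → List ℕ}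
    (h : ∀ S : Finset (Fin n), (∀ e ∈ E, ¬ e ⊆ S) ↔ ∀ j < m, ¬ (v j).toFinset ⊆ S.image Fin.val) :
    HasIndependentSet k n E ↔
      ∃ S ∈ (Finset.range n).powersetCard k, ∀ j < m, ¬ (v j).toFinset ⊆ S := by
  constructor
  · rintro ⟨S, hS, hE⟩
    refine ⟨S.image Fin.val, Finset.mem_powersetCard.2 ⟨fun x hx => ?_, ?_⟩, (h S).1 hE⟩
    · obtain ⟨y, -, rfl⟩ := Finset.mem_image.1 hx
      exact Finset.mem_range.2 y.2
    · rw [Finset.card_image_of_injective _ Fin.val_injective, hS]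
  · rintro ⟨S, hS, hE⟩
    obtain ⟨hsub, hcard⟩ := Finset.mem_powersetCard.1 hS
    have himg : (Finset.univ.filter fun x : Fin n => (x : ℕ) ∈ S).image Fin.val = S := by
      ext x
      simp only [Finset.mem_image, Finset.mem_filter, Finset.mem_univ, true_and]
      exact ⟨fun ⟨y, hy, hxy⟩ => hxy ▸ hy, fun hx => ⟨⟨x, Finset.mem_range.1 (hsub hx)⟩, hx, rfl⟩⟩
    refine ⟨Finset.univ.filter fun x => (x : ℕ) ∈ S, ?_, (h _).2 (by rwa [himg])⟩
    rw [← hcard, ← Finset.card_image_of_injective _ Fin.val_injective, himg]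

namespace Stores

variable {n m : ℕ} {v : ℕ → List ℕ} {off : ℕ → ℕ} {w : List ℕ}

theorem length_le (h : Stores n m v off w) (j : ℕ) : (v j).length ≤ n := by
  have : (v j).toFinset ⊆ Finset.range n := fun x hx =>
    Finset.mem_range.2 (h.lt j x (List.mem_toFinset.1 hx))
  have := Finset.card_le_card this
  rwa [List.toFinset_card_of_nodup (h.nodup j), Finset.card_range] at this

theorem off_mono (h : Stores n m v off w) {i j : ℕ} (hij : i ≤ j) : off i ≤ off j := by
  induction j, hij using Nat.le_induction with
  | base => exact le_rfl
  | succ j _ ih => rw [h.off_succ]; omega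

theorem off_le (h : Stores n m v off w) (j : ℕ) : off j ≤ 2 + j * (n + 1) := by
  induction j with
  | zero => rw [h.off_zero]; omega
  | succ j ih => rw [h.off_succ, Nat.succ_mul]; have := h.length_le j; omega

theorem lt_of_lt (h : Stores n m v off w) {j z : ℕ} (hj : j < m) (hz : z ≤ (v j).length) :
    off j + z < 2 + m * (n + 1) := by
  have h1 := h.off_mono (i := j + 1) (j := m) hj
  rw [h.off_succ] at h1
  have := h.off_le m
  omega

theorem beyond (h : Stores n m v off w) {i : ℕ} (hi : 2 + m * (n + 1) ≤ i) : w.getD i 0 = 0 := by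
  rw [List.getD_eq_getElem?_getD, List.getElem?_eq_none]
  · rfl
  · rw [h.length]; exact (h.off_le m).trans hi

end Stores

/-- A statement that can be executed with polynomially bounded values gives an algorithm. -/
theorem decidesInTime_of_tri {S : Stmt} {K Q : HProp} {T : ℕ → ℕ → ℝ} (hd : 1 ≤ S.deg) (E₀ : ℕ)
    (h : ∀ n : ℕ, 0 < n → ∀ E : Finset (Finset (Fin n)), K n E → ∀ v off w, Encodes E w →
      Stores n E.card v off w →
      (∀ P : ℕ → Prop, (∀ e ∈ E, P e.card) → ∀ j < E.card, P (v j).length) →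
      (∀ S : Finset (Fin n), (∀ e ∈ E, ¬ e ⊆ S) ↔
        ∀ j < E.card, ¬ (v j).toFinset ⊆ S.image Fin.val) →
      ∀ X, (n + E.card + 2) ^ E₀ ≤ X → ∃ T', Tri X S (State.init w) T'
        (fun s => s.reg 0 ≠ 0 ↔ Q n E) ∧ (T' : ℝ) ≤ T n E.card) :
    DecidesInTime S.compile K Q T := by
  refine ⟨(E₀ + S.cmax + 1) * S.deg, fun n hn E hK w hw => ?_⟩
  obtain ⟨v, off, hst, hP, hS⟩ := hw.stores
  set B := n + E.card + 2 with hB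
  have hB2 : 2 ≤ B := by omega
  have hpow : ∀ {i j : ℕ}, i ≤ j → B ^ i ≤ B ^ j := fun hij => Nat.pow_le_pow_right (by omega) hij
  obtain ⟨T', ht, hT⟩ := h n hn E hK v off w hw hst hP hS (B ^ (E₀ + S.cmax + 1)) (hpow (by omega))
  have hBX : B ≤ B ^ (E₀ + S.cmax + 1) := Nat.le_self_pow (by omega) B
  -- Constants of the program are absorbed by the exponent of the word bound: `c < 2 ^ c ≤ B ^ c`.
  have hc : S.cmax ≤ B ^ (E₀ + S.cmax + 1) :=
    (Nat.lt_two_pow_self (n := S.cmax)).le.trans ((Nat.pow_le_pow_left hB2 _).trans (hpow (by omega)))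
  obtain ⟨t, s, σ, hr, ht', hrel, hQ⟩ := ht.runs (hB2.trans hBX) hc le_rfl hd fun x hx =>
    (hst.le x hx).trans (le_trans (by omega) hBX)
  refine ⟨t, σ, by rwa [pow_mul], le_trans (by exact_mod_cast ht') hT, ?_⟩
  have := hrel.1 0
  rw [Nat.mul_zero] at this
  rwa [this]

end HyperIS

namespace HyperIS

open WordRAM WordRAM.Expr ChainExpr Triples Sandbox

variable {n m k : ℕ} {v : ℕ → List ℕ} {off : ℕ → ℕ} {w : List ℕ}

/-- The sizes of the input are in the variables `6` and `7`, the variable `8` points behind the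
input, and the variable `9` to the first hyperedge. -/
def start (n m : ℕ) (w : List ℕ) : State :=
  ((((State.init w).setReg 6 n).setReg 7 m).setReg 8 (2 + m * (n + 1))).setReg 9 2

theorem start_reg (n m : ℕ) (w : List ℕ) (r : ℕ) : (start n m w).reg r =
    if r = 9 then 2 else if r = 8 then 2 + m * (n + 1) else if r = 7 then m else
      if r = 6 then n else 0 := by
  simp [start, State.init]

/-! ### Few hyperedges -/

/-- Build a table with the addresses of the hyperedges. -/
def tableS : Stmt :=
  .forL 10 7 (.seq (.store (.var 8 + .var 10) (.var 9))
    (.assign 9 (.var 9 + .load (.var 9) + 1)))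

def fewS (k D e₀ C₀ : ℕ) (pM : Prog) : Stmt :=
  .seq tableS (.seq (.assign 2 (.var 8 + .var 7)) (countS k D e₀ C₀ pM))

/-- The hyperedges have different lengths, so their addresses have to be found by one scan. The
table starts at `2 + m * (n + 1)`, behind the longest possible input, and so never overwrites a
hyperedge. -/
theorem tableS_tri (h : Stores n m v off w) {X : ℕ} (hX : 2 + m * (n + 1) + m ≤ X) :
    Tri X tableS (start n m w) (m * 30 + 6) fun s =>
      (∀ r, r ≠ 9 → r ≠ 10 → s.reg r = (start n m w).reg r) ∧
      ∀ a, s.mem a = if 2 + m * (n + 1) ≤ a ∧ a < 2 + m * (n + 1) + m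
        then off (a - (2 + m * (n + 1))) else w.getD a 0 := by
  set ob := 2 + m * (n + 1) with hob
  refine (Tri.forL (T := 20) (N := m) (fun i s =>
    (∀ r, r ≠ 9 → r ≠ 10 → s.reg r = (start n m w).reg r) ∧ s.reg 9 = off i ∧
      ∀ a, s.mem a = if ob ≤ a ∧ a < ob + i then off (a - ob) else w.getD a 0) (by omega)
    ⟨fun r _ h10 => by rw [State.reg_setReg, if_neg h10], ?_, fun a => ?_⟩ ?_ ?_ ?_).mono (by omega)
    (fun s h => h)
  · rw [State.reg_setReg, if_neg (by omega), start_reg, h.off_zero]; rfl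
  · rw [if_neg (by omega)]; rfl
  · rintro i s ⟨hr, -⟩; rw [hr 7 (by omega) (by omega), start_reg]; rfl
  · rintro i hi s ⟨hr, h9, hm⟩ h10
    have h8 : s.reg 8 = ob := by rw [hr 8 (by omega) (by omega), start_reg]; rfl
    have hlt : off i + (v i).length < ob := h.lt_of_lt hi le_rfl
    have hload : (s.setMem (ob + i) (off i)).mem (off i) = (v i).length := by
      rw [State.mem_setMem, if_neg (by omega), hm, if_neg (by omega), h.arity i hi]
    refine Tri.store_seq (u := ob + i) (v := off i) (by simp [h8, h10]) (by simp [h9]) (by omega)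
      (T₂ := 8) ?_ (by exact (show 3 + 1 + 1 + 8 ≤ 20 by omega))
    refine Tri.assign (v := off (i + 1)) ?_ ?_ (by exact (show 7 ≤ 8 by omega))
      ⟨by simp [h10], fun r h1 h2 => ?_, by simp, fun a => ?_⟩
    · rw [h.off_succ, ← hload]
      simp [h9]
    · rw [h.off_succ]; omega
    · simp [h1.symm, h2.symm, Ne.symm, hr r h1 h2]
    · simp only [State.mem_setReg, State.mem_setMem]
      by_cases ha : a = ob + i
      · subst ha; simp
      · rw [if_neg (ha), hm]
        congr 1
        simp only [eq_iff_iff]; omega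
  · rintro s ⟨hr, h9, hm⟩ _
    exact ⟨hr, hm⟩

theorem fewS_tri {D e₀ C₀ : ℕ} {pM : Prog} {Tm : ℕ → ℕ} (hM : Multiplier pM D e₀ C₀ Tm) (k : ℕ) :
    ∃ A, ∀ (X n m Y : ℕ) (v : ℕ → List ℕ) (off : ℕ → ℕ) (w : List ℕ), Stores n m v off w →
      0 < n → n ≤ Y → m ≤ Y → (∀ i ≤ k, (n ^ i + 2) ^ D ≤ X) →
      (∀ i ≤ k, C₀ * (n ^ i) ^ e₀ ≤ X) → k ≤ X → 2 + m * (n + 1) + m ≤ X →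
      (∑ t ∈ Finset.range (k / 3 + 1), (m ^ t + 1)) * n ^ k + n ^ k ≤ X →
      Tri X (fewS k D e₀ C₀ pM) (start n m w)
        (A * (m + chainTime k Tm n m Y (k / 3 + 1) + 1)) fun s' =>
        (s'.reg 0 ≠ 0 ↔ ∃ S ∈ (Finset.range n).powersetCard k, ∀ j < m, ¬ (v j).toFinset ⊆ S) := by
  obtain ⟨A, hA⟩ := countS_tri hM k
  refine ⟨A + 40, fun X n m Y v off w h hn hY hY' hDX hCX hkX hob hX => ?_⟩
  refine Tri.seq (tableS_tri h hob) (T₂ := 4 + A * (chainTime k Tm n m Y (k / 3 + 1) + 1)) ?_ ?_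
  swap
  · nlinarith [Nat.zero_le (A * m), Nat.zero_le (chainTime k Tm n m Y (k / 3 + 1))]
  rintro s ⟨hr, hm⟩
  set ob := 2 + m * (n + 1) with hobd
  have e8 : s.reg 8 = ob := by rw [hr 8 (by omega) (by omega), start_reg]; rfl
  have e7 : s.reg 7 = m := by rw [hr 7 (by omega) (by omega), start_reg]; rfl
  have e6 : s.reg 6 = n := by rw [hr 6 (by omega) (by omega), start_reg]; rfl
  have hz : ∀ y, y < 6 ∨ 11 ≤ y → s.reg y = 0 := fun y hy => by
    rw [hr y (by omega) (by omega), start_reg, if_neg (by omega), if_neg (by omega),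
      if_neg (by omega), if_neg (by omega)]
  refine Tri.assign_seq (v := ob + m) (by simp [e8, e7]) (by omega)
    (T₂ := A * (chainTime k Tm n m Y (k / 3 + 1) + 1)) ?_ (by exact le_rfl)
  have hoff : ∀ j < m, s.mem (ob + j) = off j := fun j hj => by
    rw [hm, if_pos (by omega), Nat.add_sub_cancel_left]
  have hlow : ∀ j < m, ∀ z ≤ (v j).length, s.mem (off j + z) = w.getD (off j + z) 0 :=
    fun j hj z hz => by
      have := h.lt_of_lt hj hz
      rw [hm, if_neg (by omega)]
  have hlen : ∀ j < m, s.mem (off j) = (v j).length := fun j hj => by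
    have := hlow j hj 0 (Nat.zero_le _)
    rw [add_zero] at this
    rw [this, h.arity j hj]
  set s' := s.setReg 2 (ob + m) with hs'
  have r8 : s'.reg 8 = ob := by simp [hs', e8]
  refine hA X n m (fun j => (v j).toFinset) (ob + m) Y s' ⟨⟨by simp [hs', e6], by simp [hs', e7],
    fun j hj x => ?_, fun j hj => ?_, fun j hj x hx => Finset.mem_range.2 (h.lt j x (by simpa using hx))⟩,
    fun j hj => ?_, by simp [hs'], fun i => ?_, fun r _ => ?_⟩ hn hY hY' hDX hCX hkX
    (by simp [hs', hz]) (by simp [hs', hz]) (by simp [hs', hz]) hX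
  · rw [r8, hs', State.mem_setReg, hoff j hj, hlen j hj, List.mem_toFinset, List.mem_iff_getElem]
    constructor
    · rintro ⟨z, hz, hzx⟩
      rw [add_assoc, hlow j hj _ (by omega), ← add_assoc, h.entry j hj z hz,
        List.getD_eq_getElem _ _ hz] at hzx
      exact ⟨z, hz, hzx⟩
    · rintro ⟨z, hz, hzx⟩
      refine ⟨z, hz, ?_⟩
      rw [add_assoc, hlow j hj _ (by omega), ← add_assoc, h.entry j hj z hz,
        List.getD_eq_getElem _ _ hz, hzx]
  · rw [r8, hs', State.mem_setReg, hoff j hj, hlen j hj]; exact h.length_le j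
  · rw [r8, hs', State.mem_setReg, hoff j hj, hlen j hj]
    exact ⟨by omega, fun z hz => by have := h.lt_of_lt hj hz; omega⟩
  · have : s'.reg 2 = ob + m := by simp [hs']
    rw [this, hs', State.mem_setReg, hm, if_neg (by omega), h.beyond (by omega)]
    exact Nat.zero_le _
  · rw [hs', State.reg_setReg, if_neg (by omega), hz _ (by omega)]

/-! ### Many hyperedges -/

/-- The smaller one of `i` and the last index of the hyperedge at the address in variable `9`. -/
def minE (i : ℕ) : Expr := .ite (ltE (.const i) (.load (.var 9))) (.const i) (.load (.var 9) - 1)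

/-- The code of the hyperedge at the address in variable `9`. -/
def codeE (k : ℕ) : Expr :=
  addE ((List.range k).map fun i => .load (.var 9 + 1 + minE i) * powE (.var 6) i)

/-- Mark the codes of the hyperedges with at most `k` vertices. -/
def markS (k : ℕ) : Stmt :=
  .forL 10 7 (.seq (.ite (ltE (.const k) (.load (.var 9))) .skip (.store (.var 8 + codeE k) 1))
    (.assign 9 (.var 9 + .load (.var 9) + 1)))

/-- The first `k` digits of variable `20` are distinct. -/
def distinctE (k : ℕ) : Expr :=
  allE (((List.finRange k) ×ˢ (List.finRange k)).map fun x =>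
    if x.1 < x.2 then notE (eqE (digE 20 x.1) (digE 20 x.2)) else 1)

/-- Some hyperedge has only vertices among the digits of variable `20`. -/
noncomputable def hitE (k : ℕ) : Expr :=
  anyE ((Finset.univ : Finset (Fin k → Fin k)).toList.map fun f =>
    .load (.var 8 + addE ((List.range k).map fun i =>
      digE 20 (if h : i < k then f ⟨i, h⟩ else 0) * powE (.var 6) i)))

noncomputable def manyS (k : ℕ) : Stmt :=
  .seq (markS k) (.seq (.assign 11 (powE (.var 6) k))
    (.assign 0 (.sum 20 (.var 11) (boolE (andE (distinctE k) (notE (hitE k)))))))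

/-- The code of the `j`-th hyperedge. -/
def code (n k : ℕ) (l : List ℕ) : ℕ := enc n k fun i => l.getD (min i (l.length - 1)) 0

theorem sum_map_range (k : ℕ) (f : ℕ → ℕ) :
    ((List.range k).map f).sum = ∑ i ∈ Finset.range k, f i := by
  induction k with
  | zero => rfl
  | succ k ih => rw [List.range_succ, List.map_append, List.sum_append, ih, Finset.sum_range_succ]; simp

theorem cheap_codeE (s : State) : (codeE k).Cheap 0 0 s := by
  refine cheap_addE ?_
  simp only [List.forall_mem_map]
  intro i _
  exact cheap_mul (cheap_load (cheap_add (cheap_add (cheap_var _) cheap_one) (cheap_ite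
    (cheap_ltE (cheap_const _) (cheap_load (cheap_var _))) (cheap_const _)
    (cheap_sub (cheap_load (cheap_var _)) cheap_one)))) (cheap_powE (cheap_var _) _)

theorem Stores.getD_lt (h : Stores n m v off w) {j z : ℕ} (hz : z < (v j).length) :
    (v j).getD z 0 < n := by
  rw [List.getD_eq_getElem _ _ hz]; exact h.lt j _ (List.getElem_mem hz)

/-- The arity in front of each hyperedge allows a jump to the next one, so even a hyperedge with
many vertices costs constant time and the scan is linear in `m`, not in the length of the input.
Hyperedges with more than `k` vertices cannot lie in a set of size `k` and are left out. -/
theorem markS_tri (h : Stores n m v off w) (ha : ∀ j < m, 2 ≤ (v j).length) {X : ℕ}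
    (hX : 2 + m * (n + 1) ≤ X) :
    Tri X (markS k) (start n m w) (m * ((codeE k).size + 50) + 6) fun s =>
      (∀ r, r ≠ 9 → r ≠ 10 → s.reg r = (start n m w).reg r) ∧
      ∀ c, s.mem (2 + m * (n + 1) + c) ≠ 0 ↔
        ∃ j < m, (v j).length ≤ k ∧ code n k (v j) = c := by
  set ob := 2 + m * (n + 1) with hob
  refine (Tri.forL (T := (codeE k).size + 40) (N := m) (fun i s =>
    (∀ r, r ≠ 9 → r ≠ 10 → s.reg r = (start n m w).reg r) ∧ s.reg 9 = off i ∧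
      (∀ a < ob, s.mem a = w.getD a 0) ∧ ∀ c, s.mem (ob + c) ≠ 0 ↔
        ∃ j < i, (v j).length ≤ k ∧ code n k (v j) = c) (le_trans ?_ hX)
    ⟨fun r _ h10 => by rw [State.reg_setReg, if_neg h10], ?_, fun a _ => rfl, fun c => ?_⟩ ?_ ?_
      ?_).mono (Nat.add_le_add_right (Nat.mul_le_mul_left _ (by omega)) _) (fun s h => h)
  · rw [hob]; nlinarith
  · rw [State.reg_setReg, if_neg (by omega), start_reg, h.off_zero]; rfl
  · constructor
    · intro hc; exact absurd (h.beyond (i := ob + c) (by omega)) hc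
    · rintro ⟨j, hj, -⟩; omega
  · rintro i s ⟨hr, -⟩; rw [hr 7 (by omega) (by omega), start_reg]; rfl
  · rintro i hi s ⟨hr, h9, hm, hc⟩ h10
    have h8 : s.reg 8 = ob := by rw [hr 8 (by omega) (by omega), start_reg]; rfl
    have h6 : s.reg 6 = n := by rw [hr 6 (by omega) (by omega), start_reg]; rfl
    have hlt : off i + (v i).length < ob := h.lt_of_lt hi le_rfl
    have h2 := ha i hi
    have hlen : s.mem (off i) = (v i).length := by rw [hm _ (by omega), h.arity i hi]
    have hmin : ∀ y, (minE y).eval s = min y ((v i).length - 1) := fun y => by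
      rw [minE, eval_ite]
      simp only [holds_ltE, eval_const, eval_load, eval_var, h9, hlen, eval_sub, eval_one]
      split_ifs <;> omega
    have hcode : (codeE k).eval s = code n k (v i) := by
      rw [codeE, eval_addE, List.map_map, sum_map_range, code, enc]
      refine Finset.sum_congr rfl fun y _ => ?_
      simp only [Function.comp, eval_mul, eval_load, eval_add, eval_var, eval_one, h9, hmin,
        eval_powE, h6]
      rw [hm _ (by omega), h.entry i hi _ (by omega)]
    have step : ∀ s' : State, (∀ r, s'.reg r = s.reg r) → (∀ a < ob, s'.mem a = w.getD a 0) →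
        (∀ c, s'.mem (ob + c) ≠ 0 ↔ ∃ j < i + 1, (v j).length ≤ k ∧ code n k (v j) = c) →
        Tri X (.assign 9 (.var 9 + .load (.var 9) + 1)) s' 10 (fun s' => s'.reg 10 = i ∧
          (∀ r, r ≠ 9 → r ≠ 10 → (s'.setReg 10 (i + 1)).reg r = (start n m w).reg r) ∧
          (s'.setReg 10 (i + 1)).reg 9 = off (i + 1) ∧
          (∀ a < ob, (s'.setReg 10 (i + 1)).mem a = w.getD a 0) ∧
          ∀ c, (s'.setReg 10 (i + 1)).mem (ob + c) ≠ 0 ↔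
            ∃ j < i + 1, (v j).length ≤ k ∧ code n k (v j) = c) := by
      intro s' hr' hm' hc'
      refine Tri.assign (v := off (i + 1)) ?_ ?_ (by exact (show 7 ≤ 10 by omega))
        ⟨by simp [hr', h10], fun r h1 h2 => ?_, by simp, hm', hc'⟩
      · simp only [eval_add, eval_var, eval_load, eval_one, hr', h9]
        rw [hm' _ (by omega), h.arity i hi, h.off_succ]
      · rw [h.off_succ]; omega
      · rw [State.reg_setReg, if_neg h2, State.reg_setReg, if_neg h1, hr', hr r h1 h2]
    have hcond : (ltE (.const k) (.load (.var 9))).eval s ≠ 0 ↔ k < (v i).length := by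
      have := holds_ltE (s := s) (a := .const k) (b := .load (.var 9))
      rw [eval_const, eval_load, eval_var, h9, hlen] at this
      exact this
    refine Tri.seq (P := fun s' => (∀ r, s'.reg r = s.reg r) ∧ (∀ a < ob, s'.mem a = w.getD a 0) ∧
      ∀ c, s'.mem (ob + c) ≠ 0 ↔ ∃ j < i + 1, (v j).length ≤ k ∧ code n k (v j) = c)
      (Tri.ite (T₁ := (codeE k).size + 10) (fun hk => Tri.skip (by omega) ⟨fun _ => rfl, hm,
        fun c => ?_⟩) (fun hk => ?_) (le_refl ((3 + 1) + _ + 1)))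
      (fun s' hs' => step s' hs'.1 hs'.2.1 hs'.2.2) (by omega)
    · rw [hc]
      have hk := hcond.1 hk
      constructor
      · rintro ⟨j, hj, h1⟩; exact ⟨j, by omega, h1⟩
      · rintro ⟨j, hj, h1, h2⟩
        refine ⟨j, ?_, h1, h2⟩
        rcases Nat.lt_succ_iff_lt_or_eq.1 hj with hj | rfl
        · exact hj
        · omega
    · have hk : (v i).length ≤ k := not_lt.1 fun hlt => hcond.2 hlt hk
      have hcost := (cheap_codeE (k := k) s).cost_le
      rw [pow_zero, mul_one] at hcost
      refine Tri.store (u := ob + code n k (v i)) (v := 1) (by rw [eval_add, eval_var, h8, hcode])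
        rfl (by omega) ?_ ⟨fun _ => rfl, fun a ha => ?_, fun c => ?_⟩
      · change 1 + (codeE k).cost s + 1 + 1 + 1 ≤ _; omega
      · rw [State.mem_setMem, if_neg (by omega), hm a ha]
      · rw [State.mem_setMem]
        by_cases hcc : c = code n k (v i)
        · subst hcc
          simp only [if_true]
          exact ⟨fun _ => ⟨i, by omega, hk, rfl⟩, fun _ => one_ne_zero⟩
        · rw [if_neg (by omega), hc]
          constructor
          · rintro ⟨j, hj, h1⟩; exact ⟨j, by omega, h1⟩
          · rintro ⟨j, hj, h1, h3⟩
            refine ⟨j, ?_, h1, h3⟩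
            rcases Nat.lt_succ_iff_lt_or_eq.1 hj with hj | rfl
            · exact hj
            · exact absurd h3.symm hcc
  · rintro s ⟨hr, h9, hm, hc⟩ _
    exact ⟨hr, hc⟩

end HyperIS

/-! ### Exhaustive search, and the choice between the two algorithms. -/

namespace HyperIS

open WordRAM WordRAM.Expr ChainExpr Triples Sandbox

variable {n m k : ℕ} {v : ℕ → List ℕ} {off : ℕ → ℕ} {w : List ℕ}

theorem holds_distinctE {s : State} (h6 : s.reg 6 = n) :
    (distinctE k).Holds s ↔ ∀ i j, i < j → j < k → dig n (s.reg 20) i ≠ dig n (s.reg 20) j := by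
  simp only [distinctE, holds_allE, List.forall_mem_map]
  have key : ∀ x : Fin k × Fin k, (if x.1 < x.2 then notE (eqE (digE 20 x.1) (digE 20 x.2))
      else 1 : Expr).Holds s ↔ (x.1 < x.2 → dig n (s.reg 20) x.1 ≠ dig n (s.reg 20) x.2) := by
    intro x
    by_cases hx : x.1 < x.2
    · simp only [hx, if_true, holds_notE, holds_eqE, eval_digE h6, true_imp_iff, ne_eq]
    · simp [hx, Holds]
  simp only [key]
  constructor
  · intro H i j hij hj
    exact H (⟨i, by omega⟩, ⟨j, hj⟩) (by simp) hij
  · rintro H ⟨i, j⟩ _ hij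
    exact H i j hij j.2

theorem holds_hitE {s : State} (h6 : s.reg 6 = n) :
    (hitE k).Holds s ↔ ∃ f : Fin k → Fin k, s.mem (s.reg 8 + enc n k fun i =>
      dig n (s.reg 20) (if h : i < k then f ⟨i, h⟩ else 0)) ≠ 0 := by
  simp only [hitE, holds_anyE, List.mem_map, Finset.mem_toList, Finset.mem_univ, true_and,
    exists_exists_eq_and]
  refine exists_congr fun f => ?_
  rw [Holds, eval_load, eval_add, eval_addE, List.map_map, sum_map_range, eval_var, enc]
  have : ∀ i, ((fun e => e.eval s) ∘ fun i => digE 20 (if h : i < k then f ⟨i, h⟩ else 0 : ℕ) *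
      powE (.var 6) i) i = dig n (s.reg 20) (if h : i < k then f ⟨i, h⟩ else 0 : ℕ) * n ^ i := by
    intro i
    simp only [Function.comp, eval_mul, eval_digE h6, eval_powE, eval_var, h6]
  simp only [this]

/-- A `k`-set is a tuple of distinct digits. A hyperedge lies in it exactly if its code, a `k`-tuple
that repeats the last vertex, arises from the digits by some map of positions; there are `k ^ k`
maps, a constant number. -/
theorem exists_tuple_iff (h : Stores n m v off w) (hn : 0 < n) (ha : ∀ j < m, 2 ≤ (v j).length) :
    (∃ x < n ^ k, (∀ i j, i < j → j < k → dig n x i ≠ dig n x j) ∧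
      ¬ ∃ f : Fin k → Fin k, ∃ j < m, (v j).length ≤ k ∧ code n k (v j) =
        enc n k fun i => dig n x (if h : i < k then f ⟨i, h⟩ else 0)) ↔
    ∃ S ∈ (Finset.range n).powersetCard k, ∀ j < m, ¬ (v j).toFinset ⊆ S := by
  constructor
  · rintro ⟨x, hx, hd, hf⟩
    have hinj : Set.InjOn (dig n x) (Finset.range k) := by
      intro i hi j hj hij
      simp only [Finset.coe_range, Set.mem_Iio] at hi hj
      rcases lt_trichotomy i j with hlt | rfl | hlt
      · exact absurd hij (hd i j hlt hj)
      · rfl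
      · exact absurd hij.symm (hd j i hlt hi)
    refine ⟨(Finset.range k).image (dig n x), Finset.mem_powersetCard.2 ⟨fun y hy => ?_, ?_⟩,
      fun j hj hsub => hf ?_⟩
    · obtain ⟨i, -, rfl⟩ := Finset.mem_image.1 hy
      exact Finset.mem_range.2 (dig_lt hn _ _)
    · rw [Finset.card_image_of_injOn hinj, Finset.card_range]
    · have h2 := ha j hj
      have hlen : (v j).length ≤ k := by
        have := Finset.card_le_card hsub
        rwa [List.toFinset_card_of_nodup (h.nodup j), Finset.card_image_of_injOn hinj,
          Finset.card_range] at this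
      have hex : ∀ i : Fin k, ∃ y : Fin k, dig n x y = (v j).getD (min i ((v j).length - 1)) 0 := by
        intro i
        have hz : min (i : ℕ) ((v j).length - 1) < (v j).length := by omega
        have : (v j).getD (min i ((v j).length - 1)) 0 ∈ (Finset.range k).image (dig n x) := by
          apply hsub
          rw [List.mem_toFinset, List.getD_eq_getElem _ _ hz]
          exact List.getElem_mem hz
        obtain ⟨y, hy, hyx⟩ := Finset.mem_image.1 this
        exact ⟨⟨y, Finset.mem_range.1 hy⟩, hyx⟩
      choose f hf using hex
      refine ⟨f, j, hj, hlen, enc_congr fun i hi => ?_⟩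
      rw [dif_pos hi, hf]
  · rintro ⟨S, hS, hE⟩
    obtain ⟨hsub, hcard⟩ := Finset.mem_powersetCard.1 hS
    have hlt := entry_lt hn hsub
    have hdig : ∀ i < k, dig n (enc n k (entry S)) i = entry S i :=
      fun i hi => dig_enc (fun i _ => hlt i) hi
    refine ⟨enc n k (entry S), enc_lt fun i _ => hlt i, fun i j hij hj => ?_, ?_⟩
    · rw [hdig i (by omega), hdig j hj]
      exact (entry_lt_entry hij (by omega)).ne
    · rintro ⟨f, j, hj, hlen, hcode⟩
      have h2 := ha j hj
      refine hE j hj fun y hy => ?_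
      obtain ⟨z, hz, rfl⟩ := List.mem_iff_getElem.1 (List.mem_toFinset.1 hy)
      have hzk : z < k := by omega
      -- Comparing the codes at digit `z` shows that vertex `z` of the hyperedge is one of the
      -- digits, hence in `S`.
      have h3 := congrArg (fun c => dig n c z) hcode
      simp only [code] at h3
      rw [dig_enc (fun i _ => h.getD_lt (by omega)) hzk, dig_enc (fun i _ => dig_lt hn _ _) hzk,
        dif_pos hzk, hdig _ (f ⟨z, hzk⟩).2, min_eq_left (by omega), List.getD_eq_getElem _ _ hz] at h3
      rw [h3]
      exact entry_mem (by rw [hcard]; exact (f ⟨z, hzk⟩).2)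

theorem cheap_bodyE (s : State) :
    (boolE (andE (distinctE k) (notE (hitE k)))).Cheap 0 0 s := by
  refine cheap_boolE (cheap_andE (cheap_allE ?_) (cheap_notE (cheap_anyE ?_)))
  · simp only [List.forall_mem_map]
    intro x _
    split_ifs
    · exact cheap_notE (cheap_eqE (cheap_digE _ _ _) (cheap_digE _ _ _))
    · exact cheap_one
  · simp only [List.forall_mem_map]
    intro f _
    refine cheap_load (cheap_add (cheap_var _) (cheap_addE ?_))
    simp only [List.forall_mem_map]
    intro i _
    exact cheap_mul (cheap_digE _ _ _) (cheap_powE (cheap_var _) _)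

/-- Each tuple is tested in constant time by lookups in the table of marks, so the time is linear in
`m + n ^ k`. -/
theorem manyS_tri (k : ℕ) :
    ∃ A, ∀ (X n m : ℕ) (v : ℕ → List ℕ) (off : ℕ → ℕ) (w : List ℕ), Stores n m v off w →
      0 < n → (∀ j < m, 2 ≤ (v j).length) → 2 + m * (n + 1) ≤ X → n ^ k ≤ X →
      Tri X (manyS k) (start n m w) (A * (m + n ^ k)) fun s' =>
        (s'.reg 0 ≠ 0 ↔ ∃ S ∈ (Finset.range n).powersetCard k, ∀ j < m, ¬ (v j).toFinset ⊆ S) := by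
  classical
  set B := boolE (andE (distinctE k) (notE (hitE k))) with hB
  refine ⟨(codeE k).size + B.size + 10 * k + 100, fun X n m v off w h hn ha hob hX => ?_⟩
  have hnk : 1 ≤ n ^ k := Nat.pow_pos hn
  refine Tri.seq (markS_tri (k := k) h ha hob)
    (T₂ := (10 * k + 1 + 1) + ((n ^ k * (B.size + 4) + 9) + 1)) ?_ ?_
  swap
  · have e : ((codeE k).size + B.size + 10 * k + 100) * (m + n ^ k) =
      m * ((codeE k).size + 50) + (B.size + 10 * k + 50) * m + (codeE k).size * n ^ k +
        n ^ k * (B.size + 4) + (10 * k + 96) * n ^ k := by ring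
    have := Nat.mul_le_mul_left (10 * k + 96) hnk
    omega
  rintro s ⟨hr, hc⟩
  have e8 : s.reg 8 = 2 + m * (n + 1) := by rw [hr 8 (by omega) (by omega), start_reg]; rfl
  have e6 : s.reg 6 = n := by rw [hr 6 (by omega) (by omega), start_reg]; rfl
  refine Tri.assign_seq (v := n ^ k) (by rw [eval_powE, eval_var, e6]) hX
    (T₂ := (n ^ k * (B.size + 4) + 9) + 1) ?_
    (Nat.add_le_add_right (Nat.succ_le_succ (cost_powE (by exact (show 1 ≤ 9 by omega)) k)) _)
  set s' := s.setReg 11 (n ^ k) with hs'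
  have e11 : (Expr.var 11).eval s' = n ^ k := by simp [hs']
  have hval : (Expr.sum 20 (.var 11) B).eval s' ≤ n ^ k := by
    rw [hB, eval_sum_boolE, e11]
    exact (Finset.card_filter_le _ _).trans (Finset.card_range _).le
  refine Tri.assign rfl (hval.trans hX) ?_ ?_
  · have := cost_sum_le (x := 20) (b := .var 11) (e := B) (s := s') fun i _ =>
      (cheap_bodyE (k := k) _).cost_le
    rw [e11, pow_zero, mul_one, ← hB] at this
    refine Nat.succ_le_succ (this.trans ?_)
    have hc : Expr.cost (.var 11) s' = 1 := rfl
    omega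
  · simp only [State.reg_setReg, if_true]
    have hh : (Expr.sum 20 (.var 11) B).eval s' ≠ 0 ↔ _ := holds_sum (s := s') 20
    rw [hh, e11, ← exists_tuple_iff h hn ha]
    refine exists_congr fun x => and_congr_right fun hx => ?_
    have e6' : (s'.setReg 20 x).reg 6 = n := by simp [hs', e6]
    have e8' : (s'.setReg 20 x).reg 8 = 2 + m * (n + 1) := by simp [hs', e8]
    have e20 : (s'.setReg 20 x).reg 20 = x := by simp
    rw [hB, holds_boolE, holds_andE, holds_notE, holds_distinctE e6', holds_hitE e6', e8', e20]
    refine and_congr_right fun _ => not_congr (exists_congr fun f => ?_)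
    exact hc _

/-- Decide whether there is an independent set of size `k`. -/
noncomputable def solveS (k D e₀ C₀ : ℕ) (pM : Prog) : Stmt :=
  .seq (.assign 6 (.load 0)) <| .seq (.assign 7 (.load 1)) <|
    .seq (.assign 8 (2 + .var 7 * (.var 6 + 1))) <| .seq (.assign 9 2) <|
      .ite (ltE (powE (.var 6) 3) (.var 7)) (manyS k) (fewS k D e₀ C₀ pM)

theorem solveS_tri {D e₀ C₀ : ℕ} {pM : Prog} {Tm : ℕ → ℕ} (hM : Multiplier pM D e₀ C₀ Tm) (k : ℕ) :
    ∃ A, ∀ (X n m : ℕ) (v : ℕ → List ℕ) (off : ℕ → ℕ) (w : List ℕ), Stores n m v off w →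
      0 < n → (∀ j < m, 2 ≤ (v j).length) → (∀ i ≤ k, (n ^ i + 2) ^ D ≤ X) →
      (∀ i ≤ k, C₀ * (n ^ i) ^ e₀ ≤ X) → k ≤ X → 2 + m * (n + 1) + m + n ≤ X →
      (∑ t ∈ Finset.range (k / 3 + 1), (m ^ t + 1)) * n ^ k + n ^ k ≤ X →
      Tri X (solveS k D e₀ C₀ pM) (State.init w)
        (A * (if n ^ 3 < m then m + n ^ k else m + chainTime k Tm n m (n ^ 3) (k / 3 + 1) + 1))
        fun s' =>
        (s'.reg 0 ≠ 0 ↔ ∃ S ∈ (Finset.range n).powersetCard k, ∀ j < m, ¬ (v j).toFinset ⊆ S) := by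
  obtain ⟨A, hA⟩ := manyS_tri k
  obtain ⟨B, hB⟩ := fewS_tri hM k
  refine ⟨A + B + 100, fun X n m v off w h hn ha hDX hCX hkX hob hX => ?_⟩
  have hnk : 1 ≤ n ^ k := Nat.pow_pos hn
  set Z := (if n ^ 3 < m then m + n ^ k else m + chainTime k Tm n m (n ^ 3) (k / 3 + 1) + 1) with hZ
  have hZ1 : 1 ≤ Z := by rw [hZ]; split_ifs <;> omega
  have hcond : (ltE (powE (.var 6) 3) (.var 7)).eval (start n m w) ≠ 0 ↔ n ^ 3 < m := by
    have := holds_ltE (s := start n m w) (a := powE (.var 6) 3) (b := .var 7)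
    rw [eval_powE, eval_var, eval_var, start_reg, start_reg] at this
    exact this
  have e1 : (A + B + 100) * Z = A * Z + B * Z + 100 * Z := by ring
  rw [e1]
  refine Tri.assign_seq (v := n) h.vertices (by omega)
    (T₂ := 3 + (8 + (2 + (9 + (A * Z + B * Z) + 1)))) ?_ (by
      have : Expr.cost (.load 0) (State.init w) = 2 := rfl
      omega)
  refine Tri.assign_seq (v := m) h.edges (by omega) (T₂ := 8 + (2 + (9 + (A * Z + B * Z) + 1))) ?_
    (by exact le_rfl)
  refine Tri.assign_seq (v := 2 + m * (n + 1)) (by simp) (by omega)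
    (T₂ := 2 + (9 + (A * Z + B * Z) + 1)) ?_ (by exact le_rfl)
  refine Tri.assign_seq (v := 2) rfl (by omega) (T₂ := 9 + (A * Z + B * Z) + 1) ?_ (by exact le_rfl)
  refine Tri.ite (T₁ := A * Z + B * Z) (fun hc => ?_) (fun hc => ?_) (by exact le_rfl)
  · have hlt := hcond.1 hc
    have : Z = m + n ^ k := by rw [hZ, if_pos hlt]
    exact (hA X n m v off w h hn ha (by omega) (by omega)).mono (by rw [← this]; omega) fun _ h => h
  · have hlt : ¬ n ^ 3 < m := fun hlt => hcond.2 hlt hc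
    have : Z = m + chainTime k Tm n m (n ^ 3) (k / 3 + 1) + 1 := by rw [hZ, if_neg hlt]
    exact (hB X n m (n ^ 3) v off w h hn (Nat.le_self_pow (by omega) n) (not_lt.1 hlt) hDX hCX hkX
      (by omega) hX).mono (by rw [← this]; omega) fun _ h => h

end HyperIS

/-! ### Running time of the algorithm. -/

namespace ChainExpr

open WordRAM MatMul

/-- Passes from a real time bound to natural numbers. Rounding up constant and exponent gives a
polynomial amount of fuel; the extra `1` in `C₀` makes the inequality strict, as the sandbox
requires. -/
theorem exists_multiplier {δ : ℝ} (hδ : 0 < δ) : ∃ τ < omega + δ, 2 ≤ τ ∧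
    ∃ (pM : Prog) (D e₀ C₀ : ℕ) (Tm : ℕ → ℕ), Multiplier pM D e₀ C₀ Tm ∧
      ∃ C : ℝ, 0 ≤ C ∧ ∀ N : ℕ, 0 < N → (Tm N : ℝ) ≤ C * (N : ℝ) ^ τ := by
  obtain ⟨τ, hτ, h2, p, C, h⟩ := exists_multiplies hδ
  have hC : 1 ≤ C := by simpa using sq_le_time h one_pos
  have hsq := fun N hN => sq_le_time h (n := N) hN
  obtain ⟨D, hD⟩ := h
  have hpos : ∀ N : ℕ, 0 ≤ C * (N : ℝ) ^ τ := fun N => by positivity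
  refine ⟨τ, hτ, h2, p, D, ⌈τ⌉₊, ⌈C⌉₊ + 1, fun N => ⌊C * (N : ℝ) ^ τ⌋₊, ⟨?_, ?_, ?_⟩, C,
    by linarith, fun N _ => Nat.floor_le (hpos N)⟩
  · intro N hN A B hA hB
    obtain ⟨t, s, hr, ht, hs⟩ := hD N hN A B (by simpa using hA) (by simpa using hB)
    exact ⟨t, s, hr, Nat.le_floor ht, hs⟩
  · intro N hN
    exact Nat.le_floor (by push_cast; exact hsq N hN)
  · intro N hN
    have hN1 : (1 : ℝ) ≤ N := by exact_mod_cast hN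
    have h1 : C * (N : ℝ) ^ τ ≤ ⌈C⌉₊ * (N : ℝ) ^ ⌈τ⌉₊ := by
      rw [← Real.rpow_natCast]
      exact mul_le_mul (Nat.le_ceil C) (Real.rpow_le_rpow_of_exponent_le hN1 (Nat.le_ceil τ))
        (by positivity) (by positivity)
    have h2 : (⌊C * (N : ℝ) ^ τ⌋₊ : ℝ) < ((⌈C⌉₊ + 1) * N ^ ⌈τ⌉₊ : ℕ) := by
      refine lt_of_le_of_lt ((Nat.floor_le (hpos N)).trans h1) ?_
      push_cast
      have : (0 : ℝ) < (N : ℝ) ^ ⌈τ⌉₊ := by positivity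
      linarith
    exact_mod_cast h2

/-- Replace the smaller of `x` and `y` by the larger one. It is applied to `x = n ^ ω`, `y = m`, `a
= k / 3`, where the left side is the cost of all chains with `t` entries and the right side is the
target. -/
theorem pow_mul_rpow_le {x y a : ℝ} {t : ℕ} (hx : 1 ≤ x) (hy : 0 ≤ y) (ht : (t : ℝ) ≤ a) :
    y ^ t * x ^ (a - t) ≤ x ^ a + y ^ a := by
  have hx0 : 0 < x := by linarith
  have hxa : 0 < x ^ a := Real.rpow_pos_of_pos hx0 _
  have hya : 0 ≤ y ^ a := Real.rpow_nonneg hy _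
  rcases le_total y x with h | h
  · calc y ^ t * x ^ (a - t) ≤ x ^ t * x ^ (a - t) :=
          mul_le_mul_of_nonneg_right (pow_le_pow_left₀ hy h t) (by positivity)
      _ = x ^ a := by rw [← Real.rpow_natCast, ← Real.rpow_add hx0]; ring_nf
      _ ≤ _ := by linarith
  · have hy0 : 0 < y := by linarith
    calc y ^ t * x ^ (a - t) ≤ y ^ t * y ^ (a - t) :=
          mul_le_mul_of_nonneg_left (Real.rpow_le_rpow hx0.le h (by linarith)) (by positivity)
      _ = y ^ a := by rw [← Real.rpow_natCast, ← Real.rpow_add hy0]; ring_nf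
      _ ≤ _ := by linarith

/-- The exponent `13` is `9 + 4`: the factor `(n ^ 3 + 1) ^ 3` comes from evaluating expressions
over at most `n ^ 3` hyperedges, and `n ^ 4` pays for rounding `k / 3` up and for using `τ` in place
of `ω`. -/
theorem chainTime_le {k : ℕ} (hk : 2 ≤ k) {τ C : ℝ} (hτ : τ < omega + 3 / k) {Tm : ℕ → ℕ}
    (hC : 0 ≤ C) (hT : ∀ N : ℕ, 0 < N → (Tm N : ℝ) ≤ C * (N : ℝ) ^ τ) (h2 : 2 ≤ τ) {n m : ℕ}
    (hn : 0 < n) :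
    (chainTime k Tm n m (n ^ 3) (k / 3 + 1) : ℝ) ≤ (k + 1) * (16 * (C + 1)) * (n : ℝ) ^ (13 : ℝ) *
      ((n : ℝ) ^ (omega * k / 3) + (m : ℝ) ^ ((k : ℝ) / 3)) := by
  have hn1 : (1 : ℝ) ≤ n := by exact_mod_cast hn
  have hn0 : (0 : ℝ) < n := by linarith
  set G := (n : ℝ) ^ (omega * k / 3) + (m : ℝ) ^ ((k : ℝ) / 3) with hG
  have hG0 : 0 ≤ G := by positivity
  have hk0 : (2 : ℝ) ≤ k := by exact_mod_cast hk
  have homega := two_le_omega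
  have homega3 := omega_le_three
  rw [chainTime]
  push_cast
  have hx : (1 : ℝ) ≤ (n : ℝ) ^ omega := Real.one_le_rpow hn1 (by linarith)
  have hxk : ((n : ℝ) ^ omega) ^ ((k : ℝ) / 3) = (n : ℝ) ^ (omega * k / 3) := by
    rw [← Real.rpow_mul hn0.le]; ring_nf
  have hterm : ∀ t ∈ Finset.range (k / 3 + 1),
      ((m : ℝ) ^ t + 1) * ((Tm (n ^ ((k + 2) / 3 - t)) + 1) * ((n : ℝ) ^ 3 + 1) ^ 3) ≤
        16 * (C + 1) * (n : ℝ) ^ (13 : ℝ) * G := by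
    intro t ht
    have ht : t ≤ k / 3 := by simpa [Nat.lt_succ_iff] using ht
    have htk : (t : ℝ) ≤ (k : ℝ) / 3 := by
      rw [le_div_iff₀ (by norm_num)]; exact_mod_cast (by omega : t * 3 ≤ k)
    set p := (k + 2) / 3 - t with hp
    have hpr : (p : ℝ) ≤ (k : ℝ) / 3 + 2 / 3 - t := by
      have : 3 * p + 3 * t ≤ k + 2 := by omega
      have : (3 : ℝ) * p + 3 * t ≤ k + 2 := by exact_mod_cast this
      linarith
    -- Rounding costs `2 / 3 * ω ≤ 2`. The excess of `τ` over `ω` costs at most `(k / 3 + 2 / 3) *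
    -- (3 / k) = 1 + 2 / k ≤ 2`.
    have hexp : p * τ ≤ omega * ((k : ℝ) / 3 - t) + 4 := by
      have h1 : (p : ℝ) * τ ≤ ((k : ℝ) / 3 + 2 / 3 - t) * τ :=
        mul_le_mul_of_nonneg_right hpr (by linarith)
      have h3 : ((k : ℝ) / 3 + 2 / 3 - t) * τ ≤ ((k : ℝ) / 3 + 2 / 3 - t) * (omega + 3 / k) :=
        mul_le_mul_of_nonneg_left hτ.le (by linarith)
      have h4 : (k : ℝ) / 3 * (3 / k) = 1 := by field_simp
      have h5 : (3 : ℝ) / k ≤ 3 / 2 := by gcongr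
      have h6 : 0 ≤ (t : ℝ) * (3 / k) := by positivity
      nlinarith
    have hN : 0 < n ^ p := Nat.pow_pos hn
    have hTm : (Tm (n ^ p) : ℝ) + 1 ≤
        (C + 1) * ((n : ℝ) ^ (omega * ((k : ℝ) / 3 - t)) * (n : ℝ) ^ (4 : ℝ)) := by
      have h1 := hT _ hN
      have h3 : ((n ^ p : ℕ) : ℝ) ^ τ ≤
          (n : ℝ) ^ (omega * ((k : ℝ) / 3 - t)) * (n : ℝ) ^ (4 : ℝ) := by
        rw [← Real.rpow_add hn0]
        push_cast
        rw [← Real.rpow_natCast, ← Real.rpow_mul hn0.le]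
        exact Real.rpow_le_rpow_of_exponent_le hn1 hexp
      have h4 : (1 : ℝ) ≤ ((n ^ p : ℕ) : ℝ) ^ τ :=
        Real.one_le_rpow (by exact_mod_cast hN) (by linarith)
      nlinarith [mul_le_mul_of_nonneg_left h3 hC]
    have hY : ((n : ℝ) ^ 3 + 1) ^ 3 ≤ 8 * (n : ℝ) ^ (9 : ℝ) := by
      have h1 : (1 : ℝ) ≤ (n : ℝ) ^ 3 := one_le_pow₀ hn1
      have : ((n : ℝ) ^ 3 + 1) ^ 3 ≤ (2 * (n : ℝ) ^ 3) ^ 3 :=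
        pow_le_pow_left₀ (by positivity) (by linarith) 3
      refine this.trans (le_of_eq ?_)
      rw [show (9 : ℝ) = ((9 : ℕ) : ℝ) by norm_num, Real.rpow_natCast]; ring
    have hM : ((m : ℝ) ^ t + 1) * (n : ℝ) ^ (omega * ((k : ℝ) / 3 - t)) ≤ 2 * G := by
      have h1 := pow_mul_rpow_le (y := m) hx (by positivity) htk
      rw [← Real.rpow_mul hn0.le, hxk, ← hG] at h1
      have h3 : (n : ℝ) ^ (omega * ((k : ℝ) / 3 - t)) ≤ (n : ℝ) ^ (omega * k / 3) :=
        Real.rpow_le_rpow_of_exponent_le hn1 (by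
          have : 0 ≤ omega * t := by positivity
          nlinarith)
      have h4 : 0 ≤ (m : ℝ) ^ ((k : ℝ) / 3) := by positivity
      linarith
    calc ((m : ℝ) ^ t + 1) * ((Tm (n ^ p) + 1) * ((n : ℝ) ^ 3 + 1) ^ 3)
        ≤ ((m : ℝ) ^ t + 1) * ((C + 1) * ((n : ℝ) ^ (omega * ((k : ℝ) / 3 - t)) *
            (n : ℝ) ^ (4 : ℝ)) * (8 * (n : ℝ) ^ (9 : ℝ))) := by gcongr
      _ = 8 * (C + 1) * ((n : ℝ) ^ (4 : ℝ) * (n : ℝ) ^ (9 : ℝ)) *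
            (((m : ℝ) ^ t + 1) * (n : ℝ) ^ (omega * ((k : ℝ) / 3 - t))) := by ring
      _ ≤ 8 * (C + 1) * ((n : ℝ) ^ (4 : ℝ) * (n : ℝ) ^ (9 : ℝ)) * (2 * G) := by gcongr
      _ = 16 * (C + 1) * (n : ℝ) ^ (13 : ℝ) * G := by
          rw [← Real.rpow_add hn0]; norm_num; ring
  refine (Finset.sum_le_card_nsmul _ _ _ hterm).trans ?_
  rw [Finset.card_range, nsmul_eq_mul]
  have h3 : ((k / 3 + 1 : ℕ) : ℝ) ≤ k + 1 := by
    have : k / 3 + 1 ≤ k + 1 := by omega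
    exact_mod_cast this
  calc ((k / 3 + 1 : ℕ) : ℝ) * (16 * (C + 1) * (n : ℝ) ^ (13 : ℝ) * G)
      ≤ (k + 1) * (16 * (C + 1) * (n : ℝ) ^ (13 : ℝ) * G) := by gcongr
    _ = _ := by ring

end ChainExpr

namespace HyperIS

open WordRAM ChainExpr MatMul

/-- Since `n ^ k = (n ^ 3) ^ (k / 3)`, the threshold `m = n ^ 3` is where `m ^ (k / 3)` overtakes
exhaustive search. -/
theorem timeBound_of_lt {k n m : ℕ} (h : n ^ 3 ≤ m) : timeBound k n m = (n : ℝ) ^ k := by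
  refine min_eq_right ?_
  have h1 : (n : ℝ) ^ k = ((n : ℝ) ^ 3) ^ ((k : ℝ) / 3) := by
    rw [← Real.rpow_natCast, ← Real.rpow_natCast, ← Real.rpow_mul (by positivity)]
    congr 1; push_cast; ring
  have h2 : ((n : ℝ) ^ 3) ^ ((k : ℝ) / 3) ≤ (m : ℝ) ^ ((k : ℝ) / 3) :=
    Real.rpow_le_rpow (by positivity) (by exact_mod_cast h) (by positivity)
  have : 0 ≤ (n : ℝ) ^ (omega * k / 3) := by positivity
  linarith

/-- Below the threshold both summands are at most `n ^ k`, the first one because `ω ≤ 3`; so the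
minimum loses at most a factor `2`. -/
theorem le_two_mul_timeBound {k n m : ℕ} (hn : 0 < n) (h : m ≤ n ^ 3) :
    (n : ℝ) ^ (omega * k / 3) + (m : ℝ) ^ ((k : ℝ) / 3) ≤ 2 * timeBound k n m := by
  have hn1 : (1 : ℝ) ≤ n := by exact_mod_cast hn
  have h1 : (n : ℝ) ^ (omega * k / 3) ≤ (n : ℝ) ^ k := by
    rw [← Real.rpow_natCast]
    exact Real.rpow_le_rpow_of_exponent_le hn1 (by
      have : omega * k ≤ 3 * k := mul_le_mul_of_nonneg_right omega_le_three (by positivity)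
      linarith)
  have h2 : (m : ℝ) ^ ((k : ℝ) / 3) ≤ (n : ℝ) ^ k := by
    calc (m : ℝ) ^ ((k : ℝ) / 3) ≤ ((n : ℝ) ^ 3) ^ ((k : ℝ) / 3) :=
          Real.rpow_le_rpow (by positivity) (by exact_mod_cast h) (by positivity)
      _ = (n : ℝ) ^ k := by
          rw [← Real.rpow_natCast, ← Real.rpow_natCast, ← Real.rpow_mul (by positivity)]
          congr 1; push_cast; ring
  have h3 : 0 ≤ (n : ℝ) ^ (omega * k / 3) + (m : ℝ) ^ ((k : ℝ) / 3) := by positivity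
  rw [timeBound]
  rcases min_choice ((n : ℝ) ^ (omega * k / 3) + (m : ℝ) ^ ((k : ℝ) / 3)) ((n : ℝ) ^ k)
    with h | h <;> rw [h] <;> linarith

theorem one_le_timeBound {k n m : ℕ} (hn : 0 < n) : 1 ≤ timeBound k n m := by
  have hn1 : (1 : ℝ) ≤ n := by exact_mod_cast hn
  refine le_min ?_ (one_le_pow₀ hn1)
  have h1 : (1 : ℝ) ≤ (n : ℝ) ^ (omega * k / 3) :=
    Real.one_le_rpow hn1 (by have := two_le_omega; positivity)
  have : 0 ≤ (m : ℝ) ^ ((k : ℝ) / 3) := by positivity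
  linarith

theorem solveS_bounds {B D e₀ C₀ k n m : ℕ} (hn : 0 < n) (hB : B = n + m + 2) {X : ℕ}
    (hX : B ^ ((k + 2) * D + C₀ + k * e₀ + 3 * k + 10) ≤ X) :
    (∀ i ≤ k, (n ^ i + 2) ^ D ≤ X) ∧ (∀ i ≤ k, C₀ * (n ^ i) ^ e₀ ≤ X) ∧ k ≤ X ∧
      2 + m * (n + 1) + m + n ≤ X ∧
      (∑ t ∈ Finset.range (k / 3 + 1), (m ^ t + 1)) * n ^ k + n ^ k ≤ X := by
  have hB2 : 2 ≤ B := by omega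
  have mono : ∀ {i j : ℕ}, i ≤ j → B ^ i ≤ B ^ j := fun hij => Nat.pow_le_pow_right (by omega) hij
  have hle : ∀ {i : ℕ}, i ≤ (k + 2) * D + C₀ + k * e₀ + 3 * k + 10 → B ^ i ≤ X :=
    fun hij => (mono hij).trans hX
  have hni : ∀ i ≤ k, n ^ i ≤ B ^ k := fun i hi =>
    (Nat.pow_le_pow_left (by omega) i).trans (mono hi)
  have hself : ∀ c, c ≤ B ^ c := fun c => Nat.lt_two_pow_self.le.trans (Nat.pow_le_pow_left hB2 c)
  have hk1 : 1 ≤ B ^ k := Nat.one_le_pow _ _ (by omega)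
  refine ⟨fun i hi => ?_, fun i hi => ?_, (hself k).trans (hle (by nlinarith)), ?_, ?_⟩
  · have h1 : n ^ i + 2 ≤ B ^ (k + 2) := by
      have := hni i hi
      have h4 : 4 ≤ B ^ 2 := by nlinarith
      have := Nat.mul_le_mul_left (B ^ k) h4
      rw [pow_add]; omega
    exact (Nat.pow_le_pow_left h1 D).trans (by rw [← pow_mul]; exact hle (by omega))
  · calc C₀ * (n ^ i) ^ e₀ ≤ B ^ C₀ * (B ^ k) ^ e₀ :=
          Nat.mul_le_mul (hself C₀) (Nat.pow_le_pow_left (hni i hi) _)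
      _ = B ^ (C₀ + k * e₀) := by rw [← pow_mul, ← pow_add]
      _ ≤ X := hle (by omega)
  · refine le_trans ?_ (hle (i := 2) (by omega))
    rw [hB]; nlinarith
  · have h1 : ∑ t ∈ Finset.range (k / 3 + 1), (m ^ t + 1) ≤ (k / 3 + 1) * (B ^ k + 1) := by
      refine (Finset.sum_le_card_nsmul _ _ (B ^ k + 1) fun t ht => ?_).trans (by simp)
      have := Finset.mem_range.1 ht
      exact Nat.succ_le_succ ((Nat.pow_le_pow_left (by omega) t).trans (mono (by omega)))
    have h2 : k / 3 + 1 ≤ B ^ (k + 1) := le_trans (by omega) (hself (k + 1))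
    calc (∑ t ∈ Finset.range (k / 3 + 1), (m ^ t + 1)) * n ^ k + n ^ k
        ≤ B ^ (k + 1) * (B ^ k + 1) * B ^ k + B ^ k :=
          Nat.add_le_add (Nat.mul_le_mul (h1.trans (Nat.mul_le_mul_right _ h2)) (hni k le_rfl))
            (hni k le_rfl)
      _ ≤ B ^ (k + 1) * (B ^ k + B ^ k) * B ^ k + B ^ k := by gcongr
      _ ≤ B * B * (B ^ k * B ^ k * B ^ k) + B * B * (B ^ k * B ^ k * B ^ k) := by
          refine Nat.add_le_add (le_of_eq_of_le (b := 2 * B * (B ^ k * B ^ k * B ^ k)) (by ring)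
            (Nat.mul_le_mul_right _ (Nat.mul_le_mul_right _ hB2))) ?_
          calc B ^ k = 1 * (1 * 1 * B ^ k) := by ring
            _ ≤ _ := Nat.mul_le_mul (by nlinarith) (Nat.mul_le_mul_right _ (Nat.mul_le_mul hk1 hk1))
      _ = 2 * B ^ (3 * k + 2) := by ring
      _ ≤ B * B ^ (3 * k + 2) := Nat.mul_le_mul_right _ hB2
      _ = B ^ (3 * k + 3) := by ring
      _ ≤ X := hle (by omega)

theorem exists_algorithm {c : ℝ} (hc : 13 ≤ c) {k : ℕ} (hk : 2 ≤ k) (b : ℝ) :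
    ∃ (p : Prog) (C : ℝ), DecidesInTime p (MixedArity k b) (HasIndependentSet k)
      fun n m => C * (n : ℝ) ^ c * timeBound k n m := by
  have hk0 : (0 : ℝ) < k := by exact_mod_cast (by omega : 0 < k)
  -- With the excess `3 / k` over `ω`, an exponent of about `k / 3` costs only a fixed power of `n`,
  -- whatever `k` is.
  obtain ⟨τ, hτ, h2, pM, D, e₀, C₀, Tm, hM, C, hC, hT⟩ :=
    exists_multiplier (δ := 3 / (k : ℝ)) (by positivity)
  obtain ⟨A, hA⟩ := solveS_tri hM k
  refine ⟨(solveS k D e₀ C₀ pM).compile, A * (|b| + 1 + 3 + 2 * ((k + 1) * (16 * (C + 1)))),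
    decidesInTime_of_tri (Stmt.deg_pos _) ((k + 2) * D + C₀ + k * e₀ + 3 * k + 10)
      fun n hn E hE v off w _ hst hP hS X hX => ?_⟩
  obtain ⟨hX1, hX2, hX3, hX4, hX5⟩ := solveS_bounds hn rfl hX
  refine ⟨_, (hA X n E.card v off w hst hn (hP (fun a => 2 ≤ a) hE.1) hX1 hX2 hX3 hX4 hX5).mono
    le_rfl fun s hs => hs.trans (hasIndependentSet_iff hS).symm, ?_⟩
  set m := E.card
  have hn1 : (1 : ℝ) ≤ n := by exact_mod_cast hn
  have hnc : (n : ℝ) ^ (13 : ℝ) ≤ (n : ℝ) ^ c := Real.rpow_le_rpow_of_exponent_le hn1 hc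
  have hn13 : (1 : ℝ) ≤ (n : ℝ) ^ (13 : ℝ) := Real.one_le_rpow hn1 (by norm_num)
  have hf := one_le_timeBound (k := k) (m := m) hn
  set f := timeBound k n m with hfdef
  set K := (k + 1) * (16 * (C + 1)) with hK
  have hK0 : 0 ≤ K := by positivity
  have hnf : 1 ≤ (n : ℝ) ^ c * f := by nlinarith
  have main : ((if n ^ 3 < m then m + n ^ k else
      m + chainTime k Tm n m (n ^ 3) (k / 3 + 1) + 1 : ℕ) : ℝ) ≤
      (|b| + 1 + 3 + 2 * K) * ((n : ℝ) ^ c * f) := by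
    split_ifs with hlt
    · have hfk : f = (n : ℝ) ^ k := timeBound_of_lt hlt.le
      -- The only place where `m ≤ b * n ^ k` is used: reading the hyperedges must not take longer
      -- than the search. The absolute value covers negative `b`.
      have h1 : (m : ℝ) ≤ |b| * f := by
        rw [hfk]
        exact hE.2.trans (mul_le_mul_of_nonneg_right (le_abs_self b) (by positivity))
      push_cast
      rw [← hfk]
      have h3 : (|b| + 1) * f ≤ (|b| + 1) * ((n : ℝ) ^ c * f) :=
        mul_le_mul_of_nonneg_left (by nlinarith) (by positivity)
      nlinarith
    · have hle : m ≤ n ^ 3 := not_lt.1 hlt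
      have h1 := chainTime_le hk hτ hC hT h2 (m := m) hn
      have h3 := le_two_mul_timeBound (k := k) hn hle
      rw [← hfdef] at h3
      rw [← hK] at h1
      have h4 : (m : ℝ) ≤ (n : ℝ) ^ c := by
        calc (m : ℝ) ≤ (n : ℝ) ^ 3 := by exact_mod_cast hle
          _ = (n : ℝ) ^ (3 : ℝ) := by
              rw [show (3 : ℝ) = ((3 : ℕ) : ℝ) by norm_num, Real.rpow_natCast]
          _ ≤ _ := Real.rpow_le_rpow_of_exponent_le hn1 (by linarith)
      have h5 : K * (n : ℝ) ^ (13 : ℝ) *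
          ((n : ℝ) ^ (omega * k / 3) + (m : ℝ) ^ ((k : ℝ) / 3)) ≤ K * (n : ℝ) ^ c * (2 * f) := by
        gcongr
      have h6 : (m : ℝ) ≤ (n : ℝ) ^ c * f := h4.trans (le_mul_of_one_le_right (by positivity) hf)
      have h7 : 0 ≤ |b| := abs_nonneg b
      push_cast
      nlinarith
  push_cast at main ⊢
  calc _ ≤ (A : ℝ) * ((|b| + 1 + 3 + 2 * K) * ((n : ℝ) ^ c * f)) :=
        mul_le_mul_of_nonneg_left main (by positivity)
    _ = _ := by ring

end HyperIS

/-! ### Positions in concatenated lists of selected records. -/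

open Classical in
theorem List.length_filter_range (K : ℕ → Prop) (T : ℕ) :
    ((List.range T).filter fun u => K u).length = ((Finset.range T).filter K).card := by
  induction T with
  | zero => rfl
  | succ T ih =>
    rw [List.range_succ, List.filter_append, List.length_append, ih, Finset.range_add_one,
      Finset.filter_insert]
    by_cases h : K T <;> simp [h]

-- At most one `u` satisfies the condition, the one with exactly `q` selected predecessors. In this
-- form the entry can be computed by sums alone, without storing the list.
open Classical in
theorem List.getD_map_filter_range (K : ℕ → Prop) (f : ℕ → ℕ) (T q : ℕ) :
    (((List.range T).filter fun u => K u).map f).getD q 0 = ∑ u ∈ Finset.range T,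
      if K u ∧ ((Finset.range u).filter K).card = q then f u else 0 := by
  have hlen := List.length_filter_range K
  induction T with
  | zero => simp
  | succ T ih =>
    rw [List.range_succ, List.filter_append, List.map_append, Finset.sum_range_succ, ← ih]
    by_cases h : K T
    · simp only [h, true_and, List.filter_cons, decide_true, if_true, List.filter_nil, List.map_cons,
        List.map_nil]
      rcases lt_trichotomy q ((Finset.range T).filter K).card with hq | hq | hq
      · rw [List.getD_append _ _ _ _ (by rw [List.length_map, hlen]; exact hq), if_neg hq.ne', add_zero]
      · rw [List.getD_append_right _ _ _ _ (by rw [List.length_map, hlen]; exact hq.ge), if_pos hq.symm,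
          List.length_map, hlen, hq, Nat.sub_self,
          (List.getD_eq_default _ _ (by rw [List.length_map, hlen]) :
            (((List.range T).filter fun u => K u).map f).getD
              ((Finset.range T).filter K).card 0 = 0), zero_add]
        rfl
      · rw [List.getD_append_right _ _ _ _ (by rw [List.length_map, hlen]; exact hq.le),
          List.length_map, hlen, if_neg hq.ne, List.getD_eq_default, List.getD_eq_default]
        · rw [List.length_map, hlen]; exact hq.le
        · simp; omega
    · simp [h]

-- Every candidate gets a slot of four cells, of which a description with arity `ar j` uses the
-- first `ar j + 1`. So concatenating variable-length records becomes selecting cells from a fixed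
-- grid.
open Classical in
theorem List.flatMap_filter_range (K : ℕ → Prop) (ar : ℕ → ℕ) (har : ∀ j, ar j ≤ 3)
    (val : ℕ → ℕ → ℕ) (T : ℕ) :
    (((List.range T).filter fun j => K j).flatMap fun j => (List.range (ar j + 1)).map (val j)) =
      ((List.range (4 * T)).filter fun u => K (u / 4) ∧ u % 4 ≤ ar (u / 4)).map
        fun u => val (u / 4) (u % 4) := by
  induction T with
  | zero => rfl
  | succ T ih =>
    rw [List.range_succ, List.filter_append, List.flatMap_append, ih, Nat.mul_succ, List.range_add,
      List.filter_append, List.map_append]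
    congr 1
    have h4 : List.map (fun x => 4 * T + x) (List.range 4) = [4 * T, 4 * T + 1, 4 * T + 2, 4 * T + 3] := rfl
    have d0 : 4 * T / 4 = T := by omega
    have d1 : (4 * T + 1) / 4 = T := by omega
    have d2 : (4 * T + 2) / 4 = T := by omega
    have d3 : (4 * T + 3) / 4 = T := by omega
    have m0 : 4 * T % 4 = 0 := by omega
    have m1 : (4 * T + 1) % 4 = 1 := by omega
    have m2 : (4 * T + 2) % 4 = 2 := by omega
    have m3 : (4 * T + 3) % 4 = 3 := by omega
    rw [h4]
    by_cases h : K T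
    · have := har T
      generalize hA : ar T = A at this
      interval_cases A <;>
        simp [h, hA, d0, d1, d2, d3, m0, m1, m2, m3, List.range_succ]
    · simp [h, d0, d1, d2, d3]

namespace HyperIS

/-- Lists of numbers below `n` describe a hypergraph. -/
theorem encodes_of_lists {n : ℕ} (hn : 0 < n) (LL : List (List ℕ)) (hlt : ∀ l ∈ LL, ∀ x ∈ l, x < n)
    (hnd : ∀ l ∈ LL, l.Nodup) (hL : (LL.map List.toFinset).Nodup) (k : ℕ) :
    ∃ E : Finset (Finset (Fin n)),
      Encodes E (n :: LL.length :: LL.flatMap fun l => l.length :: l) ∧ E.card = LL.length ∧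
      (∀ Q : ℕ → Prop, (∀ l ∈ LL, Q l.length) → ∀ e ∈ E, Q e.card) ∧
      (HasIndependentSet k n E ↔
        ∃ S ∈ (Finset.range n).powersetCard k, ∀ l ∈ LL, ¬ l.toFinset ⊆ S) := by
  set g : ℕ → Fin n := fun x => ⟨x % n, Nat.mod_lt _ hn⟩ with hg
  have hval : ∀ l ∈ LL, (l.map g).map Fin.val = l := by
    intro l hl
    rw [List.map_map]
    conv_rhs => rw [← List.map_id l]
    exact List.map_congr_left fun x hx => Nat.mod_eq_of_lt (hlt l hl x hx)
  have himg : ∀ l ∈ LL, (l.map g).toFinset.image Fin.val = l.toFinset := by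
    intro l hl
    conv_rhs => rw [← hval l hl]
    ext x; simp
  have hndg : ∀ l ∈ LL, (l.map g).Nodup := fun l hl =>
    List.Nodup.of_map Fin.val (by rw [hval l hl]; exact hnd l hl)
  set L := LL.map fun l => l.map g with hLdef
  have hLnd : (L.map List.toFinset).Nodup := by
    refine List.Nodup.of_map (fun e : Finset (Fin n) => e.image Fin.val) ?_
    rw [hLdef, List.map_map, List.map_map]
    convert hL using 1
    exact List.map_congr_left fun l hl => himg l hl
  have henc : Encodes (L.map List.toFinset).toFinset
      (n :: LL.length :: LL.flatMap fun l => l.length :: l) := by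
    refine ⟨L, ?_, hLnd, rfl, ?_⟩
    · intro e he
      obtain ⟨l, hl, rfl⟩ := List.mem_map.1 he
      exact hndg l hl
    · rw [hLdef, List.length_map, List.flatMap_map]
      congr 2
      refine List.flatMap_congr fun l hl => ?_
      rw [List.length_map, hval l hl]
  refine ⟨_, henc, ?_, ?_, ?_⟩
  · rw [List.toFinset_card_of_nodup hLnd, List.length_map, hLdef, List.length_map]
  · intro Q hQ e he
    simp only [List.mem_toFinset, List.mem_map, hLdef, exists_exists_and_eq_and] at he
    obtain ⟨l, hl, rfl⟩ := he
    rw [List.toFinset_card_of_nodup (hndg l hl), List.length_map]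
    exact hQ l hl
  · have hsub : ∀ l ∈ LL, ∀ S : Finset (Fin n), (l.map g).toFinset ⊆ S ↔
        l.toFinset ⊆ S.image Fin.val := by
      intro l hl S
      rw [← himg l hl, Finset.image_subset_image_iff Fin.val_injective]
    have hall : ∀ S : Finset (Fin n), (∀ e ∈ (L.map List.toFinset).toFinset, ¬ e ⊆ S) ↔
        ∀ l ∈ LL, ¬ l.toFinset ⊆ S.image Fin.val := by
      intro S
      simp only [List.mem_toFinset, List.mem_map, hLdef, exists_exists_and_eq_and,
        forall_exists_index, and_imp, forall_apply_eq_imp_iff₂]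
      exact forall₂_congr fun l hl => not_congr (hsub l hl S)
    have h2 := hasIndependentSet_iff (k := k) (n := n) (m := LL.length)
      (E := (L.map List.toFinset).toFinset) (v := fun j => LL.getD j []) (fun S => by
        rw [hall S]
        constructor
        · intro H j hj
          simp only [List.getD_eq_getElem _ _ hj]
          exact H _ (List.getElem_mem hj)
        · intro H l hl
          obtain ⟨j, hj, rfl⟩ := List.getElem_of_mem hl
          have := H j hj
          simpa only [List.getD_eq_getElem _ _ hj] using this)
    rw [h2]
    refine exists_congr fun S => and_congr_right fun _ => ?_
    constructor
    · intro H l hl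
      obtain ⟨j, hj, rfl⟩ := List.getElem_of_mem hl
      have := H j hj
      simpa only [List.getD_eq_getElem _ _ hj] using this
    · intro H j hj
      simp only [List.getD_eq_getElem _ _ hj]
      exact H _ (List.getElem_mem hj)

end HyperIS

/-! ## Padded instances -/

namespace Padded

open Triples

variable (N n P k d M : ℕ) (V : ℕ → Finset ℕ) (Del : Finset ℕ)

/-- Some hyperedge is contained in `T`. -/
def Edge (T : Finset ℕ) : Prop := ∃ j < M, V j ⊆ T

/-- No vertex is deleted and the vertices form a hyperedge. -/
def Alive (x y z : ℕ) : Prop := (x ∉ Del ∧ y ∉ Del ∧ z ∉ Del) ∧ Edge M V {x, y, z}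

/-- The pair `{x, y}` (if `y = z`) or the triple `{x, y, z}` is a hyperedge of the instance. -/
def Keep (x y z : ℕ) : Prop :=
  x < y ∧ ((y = z ∧ N ≤ y) ∨ (z < N ∧ (if d = 2 then y = z else y < z) ∧ ¬ Alive M V Del x y z))

/-- There is a hyperclique without deleted vertices. -/
def Clq : Prop := ∃ S ∈ (Finset.range N \ Del).powersetCard k, ∀ T ⊆ S, T.card = d → Edge M V T

/-- The slot number `j` encodes three vertices `x`, `y`, `z` in base `n`; a slot with `y = z` stands
for the pair `{x, y}`. -/
def slotList (j : ℕ) : List ℕ :=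
  if j / n % n = j % n then [j / (n * n), j / n % n] else [j / (n * n), j / n % n, j % n]

/-- One vertex from each of `k` disjoint blocks of `N` dummy vertices, chosen by the digits of `q`;
this gives up to `N ^ k` different sets that affect no set of original vertices. -/
def padList (q : ℕ) : List ℕ := (List.range k).map fun l => N + l * N + dig N q l

def KeepSlot (j : ℕ) : Prop := Keep N d M V Del (j / (n * n)) (j / n % n) (j % n)

open Classical in
noncomputable def slots : List ℕ := (List.range (n ^ 3)).filter fun j => KeepSlot N n d M V Del j

/-- The hyperedges of the instance. -/
noncomputable def records : List (List ℕ) :=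
  (slots N n d M V Del).map (slotList n) ++ (List.range P).map (padList N k)

variable {N n P k d M V Del}

theorem mem_slots {j : ℕ} : j ∈ slots N n d M V Del ↔ j < n ^ 3 ∧ KeepSlot N n d M V Del j := by
  simp [slots]

theorem Keep.lt_le {x y z : ℕ} (h : Keep N d M V Del x y z) : x < y ∧ y ≤ z := by
  obtain ⟨h1, ⟨h2, -⟩ | ⟨-, h2, -⟩⟩ := h
  · exact ⟨h1, h2.le⟩
  · split_ifs at h2 with hd
    exacts [⟨h1, h2.le⟩, ⟨h1, h2.le⟩]

theorem toFinset_slotList (j : ℕ) :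
    (slotList n j).toFinset = {j / (n * n), j / n % n, j % n} := by
  rw [slotList]; split_ifs with h
  · rw [← h]; ext; simp
  · ext; simp

theorem slot_lt (hn : 0 < n) {j : ℕ} (hj : j < n ^ 3) :
    j / (n * n) < n ∧ j / n % n < n ∧ j % n < n := by
  refine ⟨Nat.div_lt_of_lt_mul ?_, Nat.mod_lt _ hn, Nat.mod_lt _ hn⟩
  calc j < n ^ 3 := hj
    _ = n * n * n := by ring

theorem slot_code (n j : ℕ) : j = j / (n * n) * (n * n) + j / n % n * n + j % n := by
  have h1 := Nat.div_add_mod j n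
  have h2 := Nat.div_add_mod (j / n) n
  rw [Nat.div_div_eq_div_mul] at h2
  nlinarith

theorem exists_slot {x y z : ℕ} (hx : x < n) (hy : y < n) (hz : z < n) :
    ∃ j < n ^ 3, j / (n * n) = x ∧ j / n % n = y ∧ j % n = z := by
  have e1 : (x * (n * n) + y * n + z) / n = x * n + y := by
    rw [show x * (n * n) + y * n + z = z + n * (x * n + y) by ring,
      Nat.add_mul_div_left _ _ (by omega), Nat.div_eq_of_lt hz, zero_add]
  refine ⟨x * (n * n) + y * n + z, ?_, ?_, ?_, ?_⟩
  · have h1 : (x + 1) * (n * n) ≤ n * (n * n) := Nat.mul_le_mul_right _ hx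
    have h2 : (y + 1) * n ≤ n * n := Nat.mul_le_mul_right _ hy
    have h3 : n ^ 3 = n * (n * n) := by ring
    rw [h3]; nlinarith
  · rw [← Nat.div_div_eq_div_mul, e1, mul_comm x, Nat.mul_add_div (by omega), Nat.div_eq_of_lt hy,
      add_zero]
  · rw [e1, mul_comm x, Nat.mul_add_mod, Nat.mod_eq_of_lt hy]
  · rw [show x * (n * n) + y * n + z = n * (x * n + y) + z by ring, Nat.mul_add_mod,
      Nat.mod_eq_of_lt hz]

theorem mem_records_lt (hn : 0 < n) (hN : (k + 1) * N ≤ n) (hN0 : 0 < N) {l : List ℕ}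
    (hl : l ∈ records N n P k d M V Del) : ∀ x ∈ l, x < n := by
  rw [records, List.mem_append, List.mem_map, List.mem_map] at hl
  rcases hl with ⟨j, hj, rfl⟩ | ⟨q, -, rfl⟩
  · intro x hx
    have h := slot_lt hn (mem_slots.1 hj).1
    have hx := List.mem_toFinset.2 hx
    rw [toFinset_slotList] at hx
    simp only [Finset.mem_insert, Finset.mem_singleton] at hx
    rcases hx with rfl | rfl | rfl
    exacts [h.1, h.2.1, h.2.2]
  · intro x hx
    obtain ⟨i, hi, rfl⟩ := List.mem_map.1 hx
    have hi := List.mem_range.1 hi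
    have := dig_lt hN0 q i
    have h1 : (i + 1) * N ≤ k * N := Nat.mul_le_mul_right _ hi
    nlinarith

theorem padList_inj {q q' i i' : ℕ} (hN0 : 0 < N)
    (h : N + i * N + dig N q i = N + i' * N + dig N q' i') :
    i = i' ∧ dig N q i = dig N q' i' := by
  have h1 := dig_lt hN0 q i
  have h2 := dig_lt hN0 q' i'
  have : i = i' := by
    rcases lt_trichotomy i i' with hlt | rfl | hlt
    · have : (i + 1) * N ≤ i' * N := Nat.mul_le_mul_right _ hlt
      nlinarith
    · rfl
    · have : (i' + 1) * N ≤ i * N := Nat.mul_le_mul_right _ hlt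
      nlinarith
  subst this
  exact ⟨rfl, by omega⟩

theorem nodup_of_mem_records (hN0 : 0 < N) {l : List ℕ}
    (hl : l ∈ records N n P k d M V Del) : l.Nodup := by
  rw [records, List.mem_append, List.mem_map, List.mem_map] at hl
  rcases hl with ⟨j, hj, rfl⟩ | ⟨q, -, rfl⟩
  · have h := (mem_slots.1 hj).2.lt_le
    rw [slotList]
    split_ifs with he
    · simp; omega
    · simp; omega
  · exact List.nodup_range.map fun i i' h => (padList_inj hN0 h).1

theorem card_of_mem_records {Q : ℕ → Prop} (h2 : Q 2) (h3 : d ≠ 2 → Q 3) (hk : Q k)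
    {l : List ℕ} (hl : l ∈ records N n P k d M V Del) : Q l.length := by
  rw [records, List.mem_append, List.mem_map, List.mem_map] at hl
  rcases hl with ⟨j, hj, rfl⟩ | ⟨q, -, rfl⟩
  · have h := (mem_slots.1 hj).2
    rw [slotList]
    split_ifs with he
    · exact h2
    · refine h3 fun hd => ?_
      obtain ⟨-, ⟨h4, -⟩ | ⟨-, h4, -⟩⟩ := h
      · exact he h4
      · rw [if_pos hd] at h4; exact he h4
  · rwa [padList, List.length_map, List.length_range]

/-- Slots are recovered from their vertex sets because `x < y ≤ z`. A padding set determines its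
first `k` digits and thus `q < N ^ k`. Slots have at most three vertices and padding sets have `k >
3`, so the two kinds differ. -/
theorem nodup_records (hN0 : 0 < N) (hk : 3 < k) (hP : P ≤ N ^ k) :
    ((records N n P k d M V Del).map List.toFinset).Nodup := by
  have hpadnd : ∀ q, (padList N k q).Nodup := fun q =>
    List.nodup_range.map fun i i' h => (padList_inj hN0 h).1
  rw [records, List.map_append, List.map_map, List.map_map]
  refine List.Nodup.append ?_ ?_ ?_
  · refine List.Nodup.map_on (fun j hj j' hj' h => ?_) ((List.nodup_range).filter _)
    simp only [Function.comp, toFinset_slotList] at h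
    have h1 := (mem_slots.1 hj).2.lt_le
    have h2 := (mem_slots.1 hj').2.lt_le
    rw [slot_code n j, slot_code n j']
    generalize j / (n * n) = x at *
    generalize j / n % n = y at *
    generalize j % n = z at *
    generalize j' / (n * n) = x' at *
    generalize j' / n % n = y' at *
    generalize j' % n = z' at *
    have a1 : x ∈ ({x', y', z'} : Finset ℕ) := by rw [← h]; simp
    have a2 : y ∈ ({x', y', z'} : Finset ℕ) := by rw [← h]; simp
    have a3 : z ∈ ({x', y', z'} : Finset ℕ) := by rw [← h]; simp
    have b1 : x' ∈ ({x, y, z} : Finset ℕ) := by rw [h]; simp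
    have b2 : y' ∈ ({x, y, z} : Finset ℕ) := by rw [h]; simp
    have b3 : z' ∈ ({x, y, z} : Finset ℕ) := by rw [h]; simp
    simp only [Finset.mem_insert, Finset.mem_singleton] at a1 a2 a3 b1 b2 b3
    obtain ⟨rfl, rfl, rfl⟩ : x = x' ∧ y = y' ∧ z = z' := by omega
    rfl
  · refine List.Nodup.map_on (fun q hq q' hq' h => ?_) List.nodup_range
    simp only [Function.comp] at h
    rw [List.mem_range] at hq hq'
    rw [← enc_dig (hq.trans_le hP), ← enc_dig (hq'.trans_le hP)]
    refine enc_congr fun i hi => ?_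
    have : N + i * N + dig N q i ∈ (padList N k q').toFinset := by
      rw [← h]; simp only [padList, List.mem_toFinset, List.mem_map, List.mem_range]
      exact ⟨i, hi, rfl⟩
    simp only [padList, List.mem_toFinset, List.mem_map, List.mem_range] at this
    obtain ⟨i', -, h'⟩ := this
    obtain ⟨rfl, h4⟩ := padList_inj hN0 h'
    exact h4.symm
  · rw [List.disjoint_left]
    intro e h1 h2
    obtain ⟨j, -, rfl⟩ := List.mem_map.1 h1
    obtain ⟨q, -, h4⟩ := List.mem_map.1 h2
    simp only [Function.comp, toFinset_slotList] at h4
    have h5 := congrArg Finset.card h4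
    rw [List.toFinset_card_of_nodup (hpadnd q), padList, List.length_map, List.length_range] at h5
    have : ({j / (n * n), j / n % n, j % n} : Finset ℕ).card ≤ 3 := Finset.card_le_three
    omega

theorem Clq.anti {Del' : Finset ℕ} (h : Clq N k d M V Del) (hsub : Del' ⊆ Del) :
    Clq N k d M V Del' := by
  obtain ⟨S, hS, hE⟩ := h
  rw [Finset.mem_powersetCard] at hS
  exact ⟨S, Finset.mem_powersetCard.2 ⟨hS.1.trans (Finset.sdiff_subset_sdiff le_rfl hsub), hS.2⟩, hE⟩

/-- Without hyperedges of the instance, the sets of size `d` are hyperedges of the given hypergraph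
without deleted vertices. -/
theorem edge_of_not_keep (hd : d = 2 ∨ d = 3) {S : Finset ℕ} (hreal : ∀ y ∈ S, y < N)
    (hkeep : ∀ x ∈ S, ∀ y ∈ S, ∀ z ∈ S, ¬ Keep N d M V Del x y z) {T : Finset ℕ} (hT : T ⊆ S)
    (hTd : T.card = d) : (∀ x ∈ T, x ∉ Del) ∧ Edge M V T := by
  have h01 : entry T 0 < entry T 1 := entry_lt_entry (by omega) (by omega)
  have hm : ∀ i < d, entry T i ∈ S := fun i hi => hT (entry_mem (by omega))
  have hTeq : T = {entry T 0, entry T 1, entry T (d - 1)} := by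
    conv_lhs => rw [← image_entry T, hTd]
    ext u
    rcases hd with rfl | rfl <;> simp [Finset.range_add_one] <;> tauto
  have hk' := hkeep _ (hm 0 (by omega)) _ (hm 1 (by omega)) _ (hm (d - 1) (by omega))
  have hA : Alive M V Del (entry T 0) (entry T 1) (entry T (d - 1)) := by
    by_contra hA
    refine hk' ⟨h01, Or.inr ⟨hreal _ (hm _ (by omega)), ?_, hA⟩⟩
    rcases hd with rfl | rfl
    · simp
    · simp only [Nat.reduceEqDiff, if_false]
      exact entry_lt_entry (by omega) (by omega)
  obtain ⟨⟨n0, n1, n2⟩, hedge⟩ := hA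
  rw [← hTeq] at hedge
  refine ⟨fun x hx => ?_, hedge⟩
  rw [hTeq] at hx
  simp only [Finset.mem_insert, Finset.mem_singleton] at hx
  rcases hx with rfl | rfl | rfl <;> assumption

theorem not_keep_of_edge (hd : d = 2 ∨ d = 3) {x y z : ℕ} (hx : x ∉ Del) (hy : y < N ∧ y ∉ Del)
    (hz : z ∉ Del) (hE : ({x, y, z} : Finset ℕ).card = d → Edge M V {x, y, z}) :
    ¬ Keep N d M V Del x y z := by
  rintro ⟨hxy, ⟨-, h⟩ | ⟨-, hp, hA⟩⟩
  · omega
  · refine hA ⟨⟨hx, hy.2, hz⟩, hE ?_⟩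
    rcases hd with rfl | rfl
    · rw [if_pos rfl] at hp
      rw [hp, Finset.insert_eq_of_mem (a := z) (by simp : z ∈ ({z} : Finset ℕ)),
        Finset.card_pair (by omega)]
    · rw [if_neg (by omega)] at hp
      rw [Finset.card_eq_three]
      exact ⟨_, _, _, by omega, by omega, by omega, rfl⟩

/-- The independent sets of size `k` of the instance are the hypercliques without deleted vertices. -/
theorem exists_independent_iff (hd : d = 2 ∨ d = 3) (hk : 3 < k) (hN : (k + 1) * N ≤ n) :
    (∃ S ∈ (Finset.range n).powersetCard k, ∀ l ∈ records N n P k d M V Del, ¬ l.toFinset ⊆ S) ↔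
      Clq N k d M V Del := by
  have hNn : N ≤ n := by nlinarith
  constructor
  · rintro ⟨S, hS, hE⟩
    obtain ⟨hsub, hcard⟩ := Finset.mem_powersetCard.1 hS
    have hlt : ∀ x ∈ S, x < n := fun x hx => Finset.mem_range.1 (hsub hx)
    have hkeep : ∀ x ∈ S, ∀ y ∈ S, ∀ z ∈ S, ¬ Keep N d M V Del x y z := by
      intro x hx y hy z hz hK
      obtain ⟨j, hj, rfl, rfl, rfl⟩ := exists_slot (hlt x hx) (hlt y hy) (hlt z hz)
      refine hE (slotList n j) ?_ ?_
      · rw [records, List.mem_append]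
        exact Or.inl (List.mem_map.2 ⟨j, mem_slots.2 ⟨hj, hK⟩, rfl⟩)
      · rw [toFinset_slotList]
        intro u hu
        simp only [Finset.mem_insert, Finset.mem_singleton] at hu
        rcases hu with rfl | rfl | rfl <;> assumption
    -- All pairs with a dummy vertex are hyperedges, so an independent set with at least two
    -- vertices avoids the dummies.
    have hreal : ∀ y ∈ S, y < N := by
      intro y hy
      by_contra hyN
      obtain ⟨x, hx, hxy⟩ := Finset.exists_mem_ne (by omega : 1 < S.card) y
      rcases lt_or_gt_of_ne hxy with hlt' | hlt'
      · exact hkeep x hx y hy y hy ⟨hlt', Or.inl ⟨rfl, by omega⟩⟩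
      · exact hkeep y hy x hx x hx ⟨hlt', Or.inl ⟨rfl, by omega⟩⟩
    refine ⟨S, Finset.mem_powersetCard.2 ⟨fun x hx => ?_, hcard⟩, fun T hT hTd =>
      (edge_of_not_keep hd hreal hkeep hT hTd).2⟩
    rw [Finset.mem_sdiff, Finset.mem_range]
    refine ⟨hreal x hx, ?_⟩
    -- A deleted vertex spoils every `d`-set through it, and some `d`-set through `x` exists in `S`
    -- since `d < k`.
    obtain ⟨T, hxT, hTS, hTd⟩ := Finset.exists_subsuperset_card_eq
      (Finset.singleton_subset_iff.2 hx) (n := d) (by rw [Finset.card_singleton]; omega) (by omega)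
    exact (edge_of_not_keep hd hreal hkeep hTS hTd).1 x (hxT (Finset.mem_singleton_self x))
  · rintro ⟨S, hS, hE⟩
    obtain ⟨hsub, hcard⟩ := Finset.mem_powersetCard.1 hS
    have hmem : ∀ x ∈ S, x < N ∧ x ∉ Del := fun x hx => by
      have := hsub hx
      rwa [Finset.mem_sdiff, Finset.mem_range] at this
    refine ⟨S, Finset.mem_powersetCard.2 ⟨fun x hx => Finset.mem_range.2 (by
      have := (hmem x hx).1; omega), hcard⟩, fun l hl hlS => ?_⟩
    rw [records, List.mem_append, List.mem_map, List.mem_map] at hl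
    rcases hl with ⟨j, hj, rfl⟩ | ⟨q, -, rfl⟩
    · have hK := (mem_slots.1 hj).2
      rw [toFinset_slotList] at hlS
      have hx := hlS (show j / (n * n) ∈ _ by simp)
      have hy := hlS (show j / n % n ∈ _ by simp)
      have hz := hlS (show j % n ∈ _ by simp)
      exact not_keep_of_edge hd (hmem _ hx).2 (hmem _ hy) (hmem _ hz).2 (hE _ hlS) hK
    -- A padding set contains a dummy vertex, here from the first block, and a hyperclique does not.
    · have : N + 0 * N + dig N q 0 ∈ S := hlS (by
        simp only [padList, List.mem_toFinset, List.mem_map, List.mem_range]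
        exact ⟨0, by omega, rfl⟩)
      have := (hmem _ this).1
      omega

end Padded

/-! ### The cells of the padded instance as expressions -/

namespace Padded

open WordRAM WordRAM.Expr ChainExpr Triples

/-- The arity of the hyperedge in slot `j`. -/
def slotArity (n j : ℕ) : ℕ := if j / n % n = j % n then 2 else 3

/-- The word at position `p` of the description of the hyperedge in slot `j`. -/
def slotWord (n j p : ℕ) : ℕ :=
  if p = 0 then slotArity n j else if p = 1 then j / (n * n) else if p = 2 then j / n % n else j % n

theorem slotList_words (n j : ℕ) :
    (slotList n j).length :: slotList n j = (List.range (slotArity n j + 1)).map (slotWord n j) := by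
  rw [slotList, slotArity]
  split_ifs with h <;> simp [List.range_succ, slotWord, slotArity, h]

theorem slotArity_le (n j : ℕ) : slotArity n j ≤ 3 := by rw [slotArity]; split_ifs <;> omega

variable (N n P k d M : ℕ) (V : ℕ → Finset ℕ) (Del : Finset ℕ)

/-- Cell `u` belongs to the description of a hyperedge. -/
def KeepCell (u : ℕ) : Prop := KeepSlot N n d M V Del (u / 4) ∧ u % 4 ≤ slotArity n (u / 4)

open Classical in
noncomputable def cellCount : ℕ := ((Finset.range (4 * n ^ 3)).filter (KeepCell N n d M V Del)).card

open Classical in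
noncomputable def rankedCell (q : ℕ) : ℕ := ∑ u ∈ Finset.range (4 * n ^ 3),
  if KeepCell N n d M V Del u ∧ ((Finset.range u).filter (KeepCell N n d M V Del)).card = q
    then slotWord n (u / 4) (u % 4) else 0

def padWord (q p : ℕ) : ℕ := if p = 0 then k else N + (p - 1) * N + dig N q (p - 1)

/-- The description of the instance. -/
noncomputable def input : List ℕ :=
  n :: (records N n P k d M V Del).length ::
    (records N n P k d M V Del).flatMap fun l => l.length :: l

-- Random access to the description of the instance: the header, then the selected cells of the slot
-- grid, then padding records of constant length `k + 1`, located by division.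
open Classical in
theorem input_getD (a : ℕ) : (input N n P k d M V Del).getD a 0 =
    if a = 0 then n else if a = 1 then (slots N n d M V Del).length + P else
    if a < 2 + cellCount N n d M V Del then rankedCell N n d M V Del (a - 2) else
    if a < 2 + cellCount N n d M V Del + P * (k + 1) then
      padWord N k ((a - 2 - cellCount N n d M V Del) / (k + 1))
        ((a - 2 - cellCount N n d M V Del) % (k + 1)) else 0 := by
  rcases a with _ | _ | a
  · rfl
  · simp [input, records]
  rw [if_neg (by omega), if_neg (by omega), input, List.getD_cons_succ, List.getD_cons_succ, records,
    List.flatMap_append, List.flatMap_map, List.flatMap_map]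
  simp only [slotList_words]
  have h1 : ((slots N n d M V Del).flatMap fun j =>
      (List.range (slotArity n j + 1)).map (slotWord n j)) =
      ((List.range (4 * n ^ 3)).filter fun u => KeepCell N n d M V Del u).map
        fun u => slotWord n (u / 4) (u % 4) := by
    refine (List.flatMap_filter_range (KeepSlot N n d M V Del) (slotArity n) (slotArity_le n)
      (slotWord n) (n ^ 3)).trans ?_
    congr 2
    funext u
    exact decide_eq_decide.2 Iff.rfl
  have h2 := List.getD_map_filter_range (KeepCell N n d M V Del)
    (fun u => slotWord n (u / 4) (u % 4)) (4 * n ^ 3) a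
  have h3 : ((List.range (4 * n ^ 3)).filter fun u => KeepCell N n d M V Del u).length =
    cellCount N n d M V Del := List.length_filter_range _ _
  rw [h1]
  have h4 : ((List.range P).flatMap fun q => (padList N k q).length :: padList N k q) =
      (List.range P).flatMap fun q => (List.range (k + 1)).map (padWord N k q) := by
    refine List.flatMap_congr fun q _ => ?_
    rw [padList, List.length_map, List.length_range, List.range_succ_eq_map, List.map_cons,
      List.map_map]
    rfl
  rw [h4]
  by_cases ha : a < cellCount N n d M V Del
  · rw [if_pos (by omega), List.getD_append _ _ _ _ (by
      rw [List.length_map, h3]; exact ha), h2]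
    rfl
  · rw [if_neg (by omega), List.getD_append_right _ _ _ _ (by
      rw [List.length_map, h3]; exact not_lt.1 ha), List.length_map, h3]
    rw [show a + 1 + 1 - 2 - cellCount N n d M V Del = a - cellCount N n d M V Del by omega]
    have e1 : a + 1 + 1 < 2 + cellCount N n d M V Del + P * (k + 1) ↔
        a - cellCount N n d M V Del < P * (k + 1) := by omega
    simp only [e1]
    generalize a - cellCount N n d M V Del = b
    have hl : ∀ q ∈ List.range P, ((List.range (k + 1)).map (padWord N k q)).length = k + 1 :=
      fun q _ => by simp
    rw [List.getD_eq_getElem?_getD]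
    split_ifs with hb
    · have hq : b / (k + 1) < P := Nat.div_lt_of_lt_mul (by rwa [mul_comm])
      have hp := Nat.mod_lt b (Nat.succ_pos k)
      conv_lhs => rw [← Nat.div_add_mod' b (k + 1)]
      rw [List.getElem?_flatMap_const _ hl (by simpa using hq) hp]
      simp [hp]
    · rw [List.getElem?_eq_none]
      · rfl
      · rw [List.length_flatMap_const _ hl, List.length_range]; exact not_lt.1 hb

/-! The number of vertices and of hyperedges of the given hypergraph is in the variables `6` and `7`,
the table of deleted vertices starts at the address in variable `8`; the number of vertices of the
instance, the number of its padding hyperedges, the number of cells for the other hyperedges and the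
number of all hyperedges is in the variables `9`, `10`, `12` and `13`. -/

/-- In a uniform hypergraph all records have `d + 1` words, so no table of addresses is needed: the
vertices of hyperedge `e` begin at `(d + 1) * e + 3`, behind header and arity. -/
def edgeE : Expr := .sum 20 (.var 7) <| boolE <| allE <| (List.range d).map fun i =>
  anyE <| [21, 22, 23].map fun x => eqE (.load (.const (d + 1) * .var 20 + .const (3 + i))) (.var x)

def aliveE : Expr :=
  andE (allE <| [21, 22, 23].map fun x => notE (.load (.var 8 + .var x))) (edgeE d)

def keepE : Expr :=
  andE (ltE (.var 21) (.var 22)) <| orE (andE (eqE (.var 22) (.var 23)) (notE (ltE (.var 22) (.var 6)))) <|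
    andE (ltE (.var 23) (.var 6)) <|
      andE (if d = 2 then eqE (.var 22) (.var 23) else ltE (.var 22) (.var 23)) (notE (aliveE d))

/-- Evaluate `b` for the slot `e`. -/
def slotE (e b : Expr) : Expr :=
  .letE 21 (e / (.var 9 * .var 9)) <| .letE 22 (e / .var 9 % .var 9) <| .letE 23 (e % .var 9) b

def arityE : Expr := .ite (eqE (.var 22) (.var 23)) 2 3

def keepCellE (x : ℕ) : Expr :=
  slotE (.var x / 4) (andE (keepE d) (notE (ltE arityE (.var x % 4))))

def wordE : Expr := slotE (.var 24 / 4) <| .ite (eqE (.var 24 % 4) 0) arityE <|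
  .ite (eqE (.var 24 % 4) 1) (.var 21) <| .ite (eqE (.var 24 % 4) 2) (.var 22) (.var 23)

/-- The rank of a cell is recounted for each candidate. This is wasteful, but the cost is a fixed
power of `N` independent of `k`, which the constant of the theorem absorbs. -/
def rankedE : Expr := .sum 24 (4 * powE (.var 9) 3) <|
  .ite (andE (keepCellE d 24) (eqE (.sum 25 (.var 24) (boolE (keepCellE d 25))) (.var 5 - 2))) wordE 0

def padE : Expr := .letE 24 ((.var 5 - 2 - .var 12) / .const (k + 1)) <|
  .letE 25 ((.var 5 - 2 - .var 12) % .const (k + 1)) <|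
  .ite (eqE (.var 25) 0) (.const k) <| addE <| (List.range k).map fun i =>
    .ite (eqE (.var 25) (.const (i + 1))) (.var 6 + .const i * .var 6 + digE 24 i) 0

def cellE : Expr :=
  .ite (eqE (.var 5) 0) (.var 9) <| .ite (eqE (.var 5) 1) (.var 13) <|
  .ite (ltE (.var 5) (2 + .var 12)) (rankedE d) <|
  .ite (ltE (.var 5) (2 + .var 12 + .var 10 * .const (k + 1))) (padE k) 0

def cellCountE : Expr := .sum 24 (4 * powE (.var 9) 3) (boolE (keepCellE d 24))

def edgeCountE : Expr := .sum 24 (powE (.var 9) 3) (boolE (slotE (.var 24) (keepE d))) + .var 10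

/-- The state describes the parameters of the padded instance, except for `n` and `P`. -/
structure Ctx (N d M A : ℕ) (L : ℕ → List ℕ) (Del : Finset ℕ) (s : State) : Prop where
  six : s.reg 6 = N
  seven : s.reg 7 = M
  eight : s.reg 8 = A
  room : 2 + (d + 1) * M ≤ A
  arity : ∀ e < M, (L e).length = d
  entry : ∀ e < M, ∀ i < d, s.mem ((d + 1) * e + (3 + i)) = (L e).getD i 0
  deleted : ∀ v < N, s.mem (A + v) ≠ 0 ↔ v ∈ Del

variable {N n P k d M Del} {A : ℕ} {L : ℕ → List ℕ} {s s' : State}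

namespace Ctx

theorem setReg (h : Ctx N d M A L Del s) {y v : ℕ} (hy : y < 6 ∨ 9 ≤ y) :
    Ctx N d M A L Del (s.setReg y v) := by
  refine ⟨?_, ?_, ?_, h.room, h.arity, h.entry, h.deleted⟩ <;>
    rw [State.reg_setReg, if_neg (by omega)]
  exacts [h.six, h.seven, h.eight]

theorem congr (h : Ctx N d M A L Del s) (hr : ∀ r, 6 ≤ r → r < 9 → s'.reg r = s.reg r)
    (hm : ∀ a < A + N, s'.mem a = s.mem a) : Ctx N d M A L Del s' := by
  refine ⟨(hr _ (by omega) (by omega)).trans h.six, (hr _ (by omega) (by omega)).trans h.seven,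
    (hr _ (by omega) (by omega)).trans h.eight, h.room, h.arity, fun e he i hi => ?_, fun v hv => ?_⟩
  · have h1 : (d + 1) * (e + 1) ≤ (d + 1) * M := Nat.mul_le_mul_left _ he
    rw [mul_add] at h1
    have := h.room
    rw [hm _ (by omega), h.entry e he i hi]
  · rw [hm _ (by omega), h.deleted v hv]

end Ctx

theorem holds_edgeE (h : Ctx N d M A L Del s) :
    (edgeE d).Holds s ↔ Edge M (fun j => (L j).toFinset) {s.reg 21, s.reg 22, s.reg 23} := by
  simp only [edgeE, holds_sum, eval_var, h.seven, holds_boolE, holds_allE, List.forall_mem_map, Edge]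
  refine exists_congr fun e => and_congr_right fun he => ?_
  simp only [List.mem_range, holds_anyE, List.map_cons, List.map_nil, List.exists_mem_cons_iff,
    holds_eqE, eval_load, eval_add, eval_mul, eval_const, eval_var, State.reg_setReg,
    State.mem_setReg, List.not_mem_nil]
  norm_num
  rw [Finset.subset_iff]
  constructor
  · intro H x hx
    rw [List.mem_toFinset] at hx
    obtain ⟨i, hi, rfl⟩ := List.getElem_of_mem hx
    have := H i (by rw [← h.arity e he]; exact hi)
    rw [h.entry e he i (by rw [← h.arity e he]; exact hi), List.getD_eq_getElem _ _ hi] at this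
    simpa using this
  · intro H i hi
    rw [h.entry e he i hi, List.getD_eq_getElem _ _ (by rw [h.arity e he]; exact hi)]
    simpa using H (List.mem_toFinset.2 (List.getElem_mem (by rw [h.arity e he]; exact hi)))

theorem holds_aliveE (h : Ctx N d M A L Del s) (hx : s.reg 21 < N) (hy : s.reg 22 < N)
    (hz : s.reg 23 < N) : (aliveE d).Holds s ↔
      Alive M (fun j => (L j).toFinset) Del (s.reg 21) (s.reg 22) (s.reg 23) := by
  have hl : ∀ x, (Expr.load (.var 8 + .var x)).Holds s ↔ s.mem (A + s.reg x) ≠ 0 := fun x => by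
    rw [Holds, eval_load, eval_add, eval_var, eval_var, h.eight]
  simp only [aliveE, holds_andE, holds_allE, List.forall_mem_map, holds_edgeE h, Alive,
    List.forall_mem_cons, holds_notE, hl, h.deleted _ hx, h.deleted _ hy, h.deleted _ hz]
  simp

theorem holds_keepE (h : Ctx N d M A L Del s) : (keepE d).Holds s ↔
    Keep N d M (fun j => (L j).toFinset) Del (s.reg 21) (s.reg 22) (s.reg 23) := by
  have hpat : (if d = 2 then eqE (.var 22) (.var 23) else ltE (.var 22) (.var 23) : Expr).Holds s ↔
      if d = 2 then s.reg 22 = s.reg 23 else s.reg 22 < s.reg 23 := by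
    split_ifs <;> simp
  simp only [keepE, holds_andE, holds_orE, hpat, holds_notE, holds_ltE, holds_eqE, eval_var, Keep,
    h.six, not_lt]
  -- The table of deletions describes only vertices below `N`; the tests made before it is consulted
  -- guarantee `x < y ≤ z < N`.
  refine and_congr_right fun hxy => or_congr_right (and_congr_right fun hz => and_congr_right fun hp =>
    not_congr (holds_aliveE h ?_ ?_ hz))
  all_goals split_ifs at hp <;> omega

/-- The state that `slotE` creates for slot `j`. -/
def slotState (n j : ℕ) (s : State) : State :=
  ((s.setReg 21 (j / (n * n))).setReg 22 (j / n % n)).setReg 23 (j % n)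

theorem Ctx.slotState (h : Ctx N d M A L Del s) (j : ℕ) :
    Ctx N d M A L Del (slotState n j s) :=
  ((h.setReg (by omega)).setReg (by omega)).setReg (by omega)

/-- The value of the expression does not depend on the bound variables `21`, `22`, `23`. -/
def Steady (e : Expr) : Prop := ∀ s x v, (x = 21 ∨ x = 22 ∨ x = 23) → e.eval (s.setReg x v) = e.eval s

theorem eval_slotE (h9 : s.reg 9 = n) {e : Expr} (he : Steady e) (b : Expr) :
    (slotE e b).eval s = b.eval (slotState n (e.eval s) s) := by
  have h1 := fun s v => he s 21 v (by omega)
  have h2 := fun s v => he s 22 v (by omega)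
  simp [slotE, h1, h2, h9, slotState]

theorem steady_var {x : ℕ} (hx : 24 ≤ x) : Steady (.var x) := fun s y v hy => by
  simp only [eval_var, State.reg_setReg]; rw [if_neg (by omega)]

theorem steady_cell {x : ℕ} (hx : 24 ≤ x) : Steady (.var x / 4) := fun s y v hy => by
  simp only [eval_div, steady_var hx s y v hy]; rfl

theorem eval_arityE (n j : ℕ) (s : State) : arityE.eval (slotState n j s) = slotArity n j := by
  rw [arityE, eval_ite]
  simp [slotState, slotArity]

theorem holds_keepCellE (h : Ctx N d M A L Del s) (h9 : s.reg 9 = n) {x : ℕ} (hx : 24 ≤ x) :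
    (keepCellE d x).Holds s ↔ KeepCell N n d M (fun j => (L j).toFinset) Del (s.reg x) := by
  have hv : ∀ j, (slotState n j s).reg x = s.reg x := fun j => by
    simp only [slotState, State.reg_setReg]; rw [if_neg (by omega), if_neg (by omega), if_neg (by omega)]
  rw [Holds, keepCellE, eval_slotE h9 (steady_cell hx), ← Holds, holds_andE,
    holds_keepE (h.slotState _), holds_notE, holds_ltE, eval_arityE, KeepCell]
  simp only [eval_mod, eval_div, eval_var, eval_ofNat, hv, not_lt]
  simp [slotState, KeepSlot]

theorem eval_cellCountE (h : Ctx N d M A L Del s) (h9 : s.reg 9 = n) :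
    (cellCountE d).eval s = cellCount N n d M (fun j => (L j).toFinset) Del := by
  classical
  rw [cellCountE, eval_sum_boolE, cellCount]
  simp only [eval_mul, eval_ofNat, eval_powE, eval_var, h9]
  congr 1
  refine Finset.filter_congr fun u _ => ?_
  rw [holds_keepCellE (h.setReg (by omega)) (by simpa using h9) le_rfl]
  simp

theorem eval_edgeCountE (h : Ctx N d M A L Del s) (h9 : s.reg 9 = n) (h10 : s.reg 10 = P) :
    (edgeCountE d).eval s = (slots N n d M (fun j => (L j).toFinset) Del).length + P := by
  classical
  rw [edgeCountE, eval_add, eval_sum_boolE, eval_var, h10, slots, ← List.countP_eq_length_filter]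
  congr 1
  simp only [eval_powE, eval_var, h9]
  rw [Finset.card_def, Finset.filter_val, Finset.range_val, ← Multiset.countP_eq_card_filter]
  simp only [Multiset.range, Multiset.coe_countP]
  refine List.countP_congr fun j _ => ?_
  simp only [decide_eq_true_eq]
  rw [Holds, eval_slotE (by simpa using h9) (steady_var le_rfl), ← Holds,
    holds_keepE ((h.setReg (by omega)).slotState _)]
  simp [slotState, KeepSlot]

theorem eval_wordE (h9 : s.reg 9 = n) :
    wordE.eval s = slotWord n (s.reg 24 / 4) (s.reg 24 % 4) := by
  have hv : ∀ j, (slotState n j s).reg 24 = s.reg 24 := fun j => by simp [slotState]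
  rw [wordE, eval_slotE h9 (steady_cell le_rfl), eval_ite, eval_ite, eval_ite, eval_arityE]
  simp only [holds_eqE, eval_mod, eval_div, eval_var, eval_ofNat, hv, slotWord]
  simp [slotState]

theorem eval_rankedE (h : Ctx N d M A L Del s) (h9 : s.reg 9 = n) :
    (rankedE d).eval s = rankedCell N n d M (fun j => (L j).toFinset) Del (s.reg 5 - 2) := by
  classical
  rw [rankedE, eval_sum, rankedCell]
  simp only [eval_mul, eval_ofNat, eval_powE, eval_var, h9]
  refine Finset.sum_congr rfl fun u _ => ?_
  have h' : Ctx N d M A L Del (s.setReg 24 u) := h.setReg (by omega)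
  rw [eval_ite, holds_andE, holds_keepCellE h' (by simpa using h9) le_rfl, holds_eqE, eval_sum_boolE,
    eval_wordE (by simpa using h9)]
  have : ((Finset.range ((Expr.var 24).eval (s.setReg 24 u))).filter fun i =>
      (keepCellE d 25).Holds ((s.setReg 24 u).setReg 25 i)) =
      (Finset.range u).filter (KeepCell N n d M (fun j => (L j).toFinset) Del) := by
    simp only [eval_var, State.reg_setReg, if_true]
    refine Finset.filter_congr fun i _ => ?_
    rw [holds_keepCellE (h'.setReg (by omega)) (by simpa using h9) (by omega)]
    simp
  rw [this]
  simp

theorem eval_padE (h : Ctx N d M A L Del s) {R : ℕ} (h12 : s.reg 12 = R) :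
    (padE k).eval s = padWord N k ((s.reg 5 - 2 - R) / (k + 1)) ((s.reg 5 - 2 - R) % (k + 1)) := by
  simp only [padE, eval_letE, eval_div, eval_mod, eval_sub, eval_var, eval_ofNat, eval_const,
    State.reg_setReg, h12]
  norm_num
  set b := s.reg 5 - 2 - R
  have hp : b % (k + 1) < k + 1 := Nat.mod_lt b (Nat.succ_pos k)
  rw [eval_ite]
  simp only [holds_eqE, eval_var, eval_zero, State.reg_setReg, if_true, padWord, eval_const, eval_addE,
    List.map_map]
  split_ifs with h0
  · rfl
  -- Digit positions are constants of the program, so all `k` possibilities are listed and the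
  -- equality test leaves the one that is wanted; position `0` of a record is the arity, hence the
  -- shift by `1`.
  rw [HyperIS.sum_map_range, Finset.sum_eq_single (b % (k + 1) - 1)]
  · simp only [Function.comp]
    rw [eval_ite, if_pos (by simp; omega), eval_add, eval_add, eval_mul,
      eval_digE (n := N) (by simpa using h.six)]
    simp [h.six]
  · intro i _ hi
    simp only [Function.comp]
    rw [eval_ite, if_neg (by simp; omega)]; rfl
  · intro hi; simp at hi; omega

theorem eval_cellE (h : Ctx N d M A L Del s) (h9 : s.reg 9 = n) (h10 : s.reg 10 = P)
    (h12 : s.reg 12 = cellCount N n d M (fun j => (L j).toFinset) Del)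
    (h13 : s.reg 13 = (slots N n d M (fun j => (L j).toFinset) Del).length + P) :
    (cellE k d).eval s = (input N n P k d M (fun j => (L j).toFinset) Del).getD (s.reg 5) 0 := by
  classical
  rw [input_getD, cellE, eval_ite, eval_ite, eval_ite, eval_ite, eval_rankedE h h9, eval_padE h h12]
  simp only [holds_eqE, holds_ltE, eval_var, eval_add, eval_ofNat, eval_mul,
    eval_const, h9, h10, h12, h13]

section Cheap

variable {Y : ℕ}

theorem cheap_edgeE (h7 : s.reg 7 ≤ Y) : (edgeE d).Cheap Y 1 s := by
  have hb : ∀ s, (boolE <| allE <| (List.range d).map fun i => anyE <| [21, 22, 23].map fun x =>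
      eqE (.load (.const (d + 1) * .var 20 + .const (3 + i))) (.var x)).Cheap Y 0 s := fun s => by
    refine cheap_boolE (cheap_allE ?_)
    simp only [List.forall_mem_map]
    intro i _
    refine cheap_anyE ?_
    simp only [List.forall_mem_map]
    exact fun x _ => cheap_eqE (cheap_load (cheap_add (cheap_mul (cheap_const _) (cheap_var _))
      (cheap_const _))) (cheap_var _)
  exact cheap_sum (cheap_var _) h7 (fun _ _ => hb _) (hb s).2

theorem cheap_keepE (h7 : s.reg 7 ≤ Y) : (keepE d).Cheap Y 1 s := by
  have hl : (allE <| [21, 22, 23].map fun x => notE (.load (.var 8 + .var x)) : Expr).Cheap Y 1 s := by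
    refine cheap_allE ?_
    simp only [List.forall_mem_map]
    exact fun x _ => cheap_notE (cheap_load (cheap_add (cheap_var _) (cheap_var _)))
  refine cheap_andE (cheap_ltE (cheap_var _) (cheap_var _)) (cheap_orE
    (cheap_andE (cheap_eqE (cheap_var _) (cheap_var _)) (cheap_notE (cheap_ltE (cheap_var _) (cheap_var _))))
    (cheap_andE (cheap_ltE (cheap_var _) (cheap_var _)) (cheap_andE ?_
      (cheap_notE (cheap_andE hl (cheap_edgeE h7))))))
  split_ifs
  exacts [cheap_eqE (cheap_var _) (cheap_var _), cheap_ltE (cheap_var _) (cheap_var _)]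

theorem cheap_slotE {D : ℕ} {e b : Expr} (he : ∀ s, e.Cheap Y D s) (hb : ∀ j, b.Cheap Y D (slotState n j s))
    (h9 : s.reg 9 = n) (hs : Steady e) : (slotE e b).Cheap Y D s := by
  refine cheap_letE (cheap_div (he _) (cheap_mul (cheap_var _) (cheap_var _))) (cheap_letE
    (cheap_mod (cheap_div (he _) (cheap_var _)) (cheap_var _)) (cheap_letE
    (cheap_mod (he _) (cheap_var _)) ?_))
  have h1 := fun s v => hs s 21 v (by omega)
  have h2 := fun s v => hs s 22 v (by omega)
  simpa [h1, h2, h9, slotState] using hb (e.eval s)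

theorem cheap_arityE {D : ℕ} : arityE.Cheap Y D s :=
  cheap_ite (cheap_eqE (cheap_var _) (cheap_var _)) (cheap_ofNat _) (cheap_ofNat _)

theorem cheap_keepCellE (h7 : s.reg 7 ≤ Y) {x : ℕ} (hx : 24 ≤ x) : (keepCellE d x).Cheap Y 1 s :=
  cheap_slotE (fun _ => cheap_div (cheap_var _) (cheap_ofNat _)) (fun j => cheap_andE
    (cheap_keepE (by simpa [slotState] using h7)) (cheap_notE (cheap_ltE cheap_arityE
      (cheap_mod (cheap_var _) (cheap_ofNat _))))) rfl (steady_cell hx)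

theorem cheap_cellCountE (h7 : s.reg 7 ≤ Y) (h9 : 4 * s.reg 9 ^ 3 ≤ Y) : (cellCountE d).Cheap Y 2 s :=
  cheap_sum (cheap_mul (cheap_ofNat _) (cheap_powE (cheap_var _) _)) (by simpa using h9)
    (fun i _ => cheap_boolE (cheap_keepCellE (by simpa using h7) le_rfl))
    (cheap_boolE (cheap_keepCellE (s := s) h7 le_rfl)).2

theorem cheap_edgeCountE (h7 : s.reg 7 ≤ Y) (h9 : 4 * s.reg 9 ^ 3 ≤ Y) :
    (edgeCountE d).Cheap Y 2 s := by
  have hb : ∀ s : State, s.reg 7 ≤ Y → (boolE (slotE (.var 24) (keepE d))).Cheap Y 1 s := fun s h7 =>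
    cheap_boolE (cheap_slotE (fun _ => cheap_var _) (fun j => cheap_keepE
      (by simpa [slotState] using h7)) rfl (steady_var le_rfl))
  exact cheap_add (cheap_sum (cheap_powE (cheap_var _) _) (by simp; omega)
    (fun i _ => hb _ (by simpa using h7)) (hb s h7).2) (cheap_var _)

theorem cheap_cellE (h7 : s.reg 7 ≤ Y) (h9 : 4 * s.reg 9 ^ 3 ≤ Y) : (cellE k d).Cheap Y 3 s := by
  have hw : ∀ {D} (s : State), wordE.Cheap Y D s := fun s =>
    cheap_slotE (fun _ => cheap_div (cheap_var _) (cheap_ofNat _)) (fun j => cheap_ite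
      (cheap_eqE (cheap_mod (cheap_var _) (cheap_ofNat _)) cheap_zero) cheap_arityE (cheap_ite
      (cheap_eqE (cheap_mod (cheap_var _) (cheap_ofNat _)) cheap_one) (cheap_var _) (cheap_ite
      (cheap_eqE (cheap_mod (cheap_var _) (cheap_ofNat _)) (cheap_ofNat _)) (cheap_var _)
      (cheap_var _)))) rfl (steady_cell le_rfl)
  have hi : ∀ s : State, s.reg 7 ≤ Y → s.reg 24 ≤ Y →
      (Expr.ite (andE (keepCellE d 24) (eqE (.sum 25 (.var 24) (boolE (keepCellE d 25))) (.var 5 - 2)))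
        wordE 0).Cheap Y 2 s := fun s h7 h24 =>
    cheap_ite (cheap_andE ((cheap_keepCellE h7 le_rfl).mono (by omega)) (cheap_eqE
      (cheap_sum (cheap_var _) h24 (fun i _ => cheap_boolE (cheap_keepCellE (by simpa using h7)
        (by omega))) (cheap_boolE (cheap_keepCellE (s := s) h7 (by omega))).2)
      (cheap_sub (cheap_var _) (cheap_ofNat _)))) (hw s) cheap_zero
  have hp : (padE k).Cheap Y 3 s := by
    refine cheap_letE (cheap_div (cheap_sub (cheap_sub (cheap_var _) (cheap_ofNat _)) (cheap_var _))
      (cheap_const _)) (cheap_letE (cheap_mod (cheap_sub (cheap_sub (cheap_var _) (cheap_ofNat _))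
      (cheap_var _)) (cheap_const _)) (cheap_ite (cheap_eqE (cheap_var _) cheap_zero) (cheap_const _)
      (cheap_addE ?_)))
    simp only [List.forall_mem_map]
    exact fun i _ => cheap_ite (cheap_eqE (cheap_var _) (cheap_const _)) (cheap_add (cheap_add
      (cheap_var _) (cheap_mul (cheap_const _) (cheap_var _))) (cheap_mod (cheap_div (cheap_var _)
      (cheap_powE (cheap_var _) _)) (cheap_var _))) cheap_zero
  refine cheap_ite (cheap_eqE (cheap_var _) cheap_zero) (cheap_var _) (cheap_ite
    (cheap_eqE (cheap_var _) cheap_one) (cheap_var _) (cheap_ite (cheap_ltE (cheap_var _)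
    (cheap_add (cheap_ofNat _) (cheap_var _))) (cheap_sum (cheap_mul (cheap_ofNat _)
    (cheap_powE (cheap_var _) _)) (by simpa using h9) (fun i hi' => hi _ (by simpa using h7) ?_)
    (hi (s.setReg 24 0) (by simpa using h7) (by simp)).2)
    (cheap_ite (cheap_ltE (cheap_var _) (cheap_add (cheap_add
    (cheap_ofNat _) (cheap_var _)) (cheap_mul (cheap_var _) (cheap_const _)))) hp cheap_zero)))
  simp at hi' ⊢; omega

end Cheap

end Padded

/-! ### Solving the padded instances -/

namespace Padded

open WordRAM WordRAM.Expr WordRAM.Sandbox ChainExpr Triples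

variable {N n P k d M : ℕ} {Del : Finset ℕ} {A : ℕ} {L : ℕ → List ℕ} {s : State} {p : Prog}

/-- With words up to `(n + m + 2) ^ D`, the program `p` solves the padded instances in less than `F`
steps. -/
def Works (p : Prog) (D F N n P k d M : ℕ) (V : ℕ → Finset ℕ) : Prop :=
  ∀ Del ⊆ Finset.range N, ∃ (t : ℕ) (s : State),
    Runs ((n + ((slots N n d M V Del).length + P) + 2) ^ D) p (input N n P k d M V Del) t s ∧
      t < F ∧ (s.reg 0 ≠ 0 ↔ Clq N k d M V Del)

structure Setup (N d M A : ℕ) (L : ℕ → List ℕ) (Del : Finset ℕ) (p : Prog) (s : State) : Prop where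
  ctx : Ctx N d M A L Del s
  base : s.reg 2 = A + N
  ready : Ready p s

namespace Setup

theorem setReg (h : Setup N d M A L Del p s) {y v : ℕ}
    (hy : y ≠ 1 ∧ y ≠ 2 ∧ y < 100 ∧ (y < 6 ∨ 9 ≤ y)) : Setup N d M A L Del p (s.setReg y v) :=
  ⟨h.ctx.setReg hy.2.2.2, by rw [State.reg_setReg, if_neg (Ne.symm hy.2.1)]; exact h.base,
    h.ready.setReg hy.1 hy.2.1 hy.2.2.1⟩

theorem store (h : Setup N d M A L Del p s) {v b : ℕ} (hv : v < N) {Del' : Finset ℕ}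
    (hD : ∀ u < N, u ∈ Del' ↔ if u = v then b ≠ 0 else u ∈ Del) :
    Setup N d M A L Del' p (s.setMem (A + v) b) := by
  refine ⟨⟨h.ctx.six, h.ctx.seven, h.ctx.eight, h.ctx.room, h.ctx.arity, fun e he i hi => ?_,
    fun u hu => ?_⟩, h.base, ⟨fun i => ?_, h.ready.rest⟩⟩
  · have h1 : (d + 1) * (e + 1) ≤ (d + 1) * M := Nat.mul_le_mul_left _ he
    rw [mul_add] at h1
    have := h.ctx.room
    rw [State.mem_setMem, if_neg (by omega), h.ctx.entry e he i hi]
  · rw [State.mem_setMem, hD u hu]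
    by_cases huv : u = v
    · simp [huv]
    · rw [if_neg (by omega), if_neg huv, h.ctx.deleted u hu]
  · have := h.ready.stamp i
    have hb := h.base
    rw [State.mem_setMem, if_neg]
    · exact this
    · change ¬ s.reg 2 + 2 * i = A + v
      omega

end Setup

theorem slots_length_le (V : ℕ → Finset ℕ) : (slots N n d M V Del).length ≤ n ^ 3 :=
  (List.length_filter_le _ _).trans (by simp)

theorem cellCount_le (V : ℕ → Finset ℕ) : cellCount N n d M V Del ≤ 4 * n ^ 3 := by
  classical
  exact (Finset.card_filter_le _ _).trans (by simp)

/-- Run `p` on the padded instance. -/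
def runS (k d D e F : ℕ) (p : Prog) : Stmt :=
  .seq (.assign 12 (cellCountE d)) <| .seq (.assign 13 (edgeCountE d)) <|
  .seq (.assign 3 (powE (.var 9 + .var 13 + 2) D)) <|
  .seq (.assign 4 (.const F * powE (.var 6) e)) (run (cellE k d) p)

/-- The run is cut off by its fuel for every padding, so time bound and frame need no assumption on
`p`. Only the meaning of the answer, in virtual register `0`, depends on `Works`. -/
theorem runS_tri (k d D e F : ℕ) (p : Prog) : ∃ C, ∀ (X N n P M A Y : ℕ) (L : ℕ → List ℕ)
    (Del : Finset ℕ) (s : State), Setup N d M A L Del p s → Del ⊆ Finset.range N → s.reg 9 = n →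
    s.reg 10 = P → M ≤ Y → 4 * n ^ 3 ≤ Y → Y ≤ X → (n + (n ^ 3 + P) + 2) ^ D ≤ X →
    n ^ 3 + P ≤ X → F * N ^ e ≤ X → s.reg 1 + 1 ≤ X →
    Tri X (runS k d D e F p) s (C * ((F * N ^ e + 1) * (Y + 1) ^ 4)) fun s' =>
      Setup N d M A L Del p s' ∧
      (∀ r < 100, r ≠ 1 → r ≠ 3 → r ≠ 4 → r ≠ 5 → r ≠ 12 → r ≠ 13 → s'.reg r = s.reg r) ∧
      s'.reg 1 = s.reg 1 + 1 ∧
      (Works p D (F * N ^ e) N n P k d M (fun j => (L j).toFinset) →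
        (s'.reg 100 ≠ 0 ↔ Clq N k d M (fun j => (L j).toFinset) Del)) := by
  obtain ⟨C, hC⟩ := run_tri p
  refine ⟨(cellCountE d).size + (edgeCountE d).size + (powE (.var 9 + .var 13 + 2) D).size +
    (Expr.const F * powE (.var 6) e).size + 4 + C * (60 + 3 * (cellE k d).size),
    fun X N n P M A Y L Del s hs hDel h9 h10 hM hn hY hDX hPX hF h1 => ?_⟩
  set V := fun j => (L j).toFinset with hV
  set R := cellCount N n d M V Del with hR
  set m := (slots N n d M V Del).length + P with hm
  have hmle : m ≤ n ^ 3 + P := Nat.add_le_add_right (slots_length_le V) _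
  set Q := (Y + 1) ^ 4 with hQ
  have hQ1 : 1 ≤ Q := Nat.one_le_pow _ _ (Nat.succ_pos Y)
  set G := F * N ^ e + 1 with hG
  have hGQ : Q ≤ G * Q := Nat.le_mul_of_pos_left _ (by omega)
  set s₁ := s.setReg 12 R with hs₁
  set s₂ := s₁.setReg 13 m with hs₂
  set s₃ := s₂.setReg 3 ((n + m + 2) ^ D) with hs₃
  set s₄ := s₃.setReg 4 (F * N ^ e) with hs₄
  have t₁ : Setup N d M A L Del p s₁ := hs.setReg (by omega)
  have t₂ : Setup N d M A L Del p s₂ := t₁.setReg (by omega)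
  have t₃ : Setup N d M A L Del p s₃ := t₂.setReg (by omega)
  have t₄ : Setup N d M A L Del p s₄ := t₃.setReg (by omega)
  have c₁ := ((cheap_cellCountE (d := d) (s := s) (hs.ctx.seven.le.trans hM)
    (by rw [h9]; exact hn)).mono (show 2 ≤ 4 by omega)).cost_le
  have c₂ := ((cheap_edgeCountE (d := d) (s := s₁) (t₁.ctx.seven.le.trans hM)
    (by simp only [hs₁, State.reg_setReg]; simpa [h9] using hn)).mono (show 2 ≤ 4 by omega)).cost_le
  have c₃ : (powE (.var 9 + .var 13 + 2) D).cost s₂ ≤ _ * Q := (cheap_powE (cheap_add (cheap_add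
    (cheap_var _) (cheap_var _)) (cheap_ofNat _)) D).cost_le
  have c₄ : (Expr.const F * powE (.var 6) e).cost s₃ ≤ _ * Q := (cheap_mul (cheap_const _) (cheap_powE
    (cheap_var _) e)).cost_le
  have hDX' : (n + m + 2) ^ D ≤ X := (Nat.pow_le_pow_left (by omega) D).trans hDX
  have hsame : ∀ r, r ≠ 3 → r ≠ 4 → r ≠ 12 → r ≠ 13 → s₄.reg r = s.reg r := fun r a b c f => by
    simp only [hs₄, hs₃, hs₂, hs₁, State.reg_setReg]
    rw [if_neg b, if_neg a, if_neg f, if_neg c]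
  have e3 : s₄.reg 3 = (n + m + 2) ^ D := by simp [hs₄, hs₃]
  have e4 : s₄.reg 4 = F * N ^ e := by simp [hs₄]
  have e12 : s₄.reg 12 = R := by simp [hs₄, hs₃, hs₂, hs₁]
  have e13 : s₄.reg 13 = m := by simp [hs₄, hs₃, hs₂]
  have e1 := hsame 1 (by omega) (by omega) (by omega) (by omega)
  have e9 := hsame 9 (by omega) (by omega) (by omega) (by omega)
  have e10 := hsame 10 (by omega) (by omega) (by omega) (by omega)
  have hctx : ∀ s', Frame s₄ s' → Ctx N d M A L Del s' := fun s' hf =>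
    t₄.ctx.congr (fun r a b => hf.1 r (by omega) (by omega) (by omega) (by omega))
      fun a ha => hf.2 a (by rw [t₄.base]; exact ha)
  have hfr : ∀ s', Frame s₄ s' → ∀ r < 100, r ≠ 1 → r ≠ 4 → r ≠ 5 → s'.reg r = s₄.reg r :=
    fun s' hf => hf.1
  set cell : ℕ → ℕ := fun a => (input N n P k d M V Del).getD a 0 with hcell
  have hrun := (hC X s₄ cell (cellE k d) ((cellE k d).size * Q) (by omega) (by omega) (by omega)
    t₄.ready fun s' hf => ⟨?_, ?_⟩).1
  rotate_left
  · exact eval_cellE (hctx s' hf) ((hf.1 9 (by omega) (by omega) (by omega) (by omega)).trans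
      (e9.trans h9)) ((hf.1 10 (by omega) (by omega) (by omega) (by omega)).trans (e10.trans h10))
      ((hf.1 12 (by omega) (by omega) (by omega) (by omega)).trans e12)
      ((hf.1 13 (by omega) (by omega) (by omega) (by omega)).trans e13)
  · refine ((cheap_cellE ((hctx s' hf).seven.le.trans hM) ?_).mono (by omega)).cost_le
    rw [hf.1 9 (by omega) (by omega) (by omega) (by omega), e9, h9]; exact hn
  have hT : C * (s₄.reg 4 + 1) * (60 + 3 * ((cellE k d).size * Q)) ≤
      C * (60 + 3 * (cellE k d).size) * (G * Q) := by
    rw [e4, ← hG]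
    calc C * G * (60 + 3 * ((cellE k d).size * Q)) ≤ C * G * ((60 + 3 * (cellE k d).size) * Q) :=
          Nat.mul_le_mul_left _ (by nlinarith)
      _ = _ := by ring
  have h4 : s₃.reg 6 = N := t₃.ctx.six
  set z₁ := (cellCountE d).size
  set z₂ := (edgeCountE d).size
  set z₃ := (powE (.var 9 + .var 13 + 2) D).size
  set z₄ := (Expr.const F * powE (.var 6) e).size
  have hz₁ := Nat.mul_le_mul_left z₁ hGQ
  have hz₂ := Nat.mul_le_mul_left z₂ hGQ
  have hz₃ := Nat.mul_le_mul_left z₃ hGQ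
  have hz₄ := Nat.mul_le_mul_left z₄ hGQ
  have hGQ1 : 1 ≤ G * Q := hQ1.trans hGQ
  refine Tri.mono (T := z₁ * Q + 1 + (z₂ * Q + 1 + (z₃ * Q + 1 + (z₄ * Q + 1 +
    C * (60 + 3 * (cellE k d).size) * (G * Q))))) ?_ ?_ fun s h => h
  · refine Tri.assign_seq (v := R) (eval_cellCountE hs.ctx h9)
      ((cellCount_le V).trans (hn.trans hY)) ?_ (Nat.add_le_add_right (Nat.add_le_add_right c₁ 1) _)
    refine Tri.assign_seq (v := m) (eval_edgeCountE t₁.ctx (by simpa [hs₁] using h9)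
      (by simpa [hs₁] using h10)) (hmle.trans hPX) ?_
      (Nat.add_le_add_right (Nat.add_le_add_right c₂ 1) _)
    refine Tri.assign_seq (v := (n + m + 2) ^ D) ?_ hDX' ?_
      (Nat.add_le_add_right (Nat.add_le_add_right c₃ 1) _)
    · rw [eval_powE]; simp [h9]
    refine Tri.assign_seq (v := F * N ^ e) ?_ hF ?_
      (Nat.add_le_add_right (Nat.add_le_add_right c₄ 1) _)
    · rw [eval_mul, eval_const, eval_powE, eval_var, h4]
    refine hrun.mono hT ?_
    rintro s' ⟨hf, h1', hready, hsim⟩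
    refine ⟨⟨hctx s' hf, (hf.1 2 (by omega) (by omega) (by omega) (by omega)).trans t₄.base, hready⟩,
      fun r hr a b c f g h => (hf.1 r hr a c f).trans (hsame r b c g h), h1'.trans (by rw [e1]),
      fun hW => ?_⟩
    obtain ⟨t₀, v, hruns, ht₀, hv⟩ := hW Del hDel
    rw [e3, e4] at hsim
    have := (hsim t₀ v (State.init_bdd hruns.1).2 hruns.2 ht₀).2
    rw [← hv, ← this]; rfl
  · have : (z₁ + z₂ + z₃ + z₄ + 4 + C * (60 + 3 * (cellE k d).size)) * (G * Q) = z₁ * (G * Q) +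
      z₂ * (G * Q) + z₃ * (G * Q) + z₄ * (G * Q) + 4 * (G * Q) +
        C * (60 + 3 * (cellE k d).size) * (G * Q) := by ring
    omega

end Padded

/-! ### Finding a hyperclique with one padding -/

namespace Padded

open WordRAM WordRAM.Expr WordRAM.Sandbox ChainExpr Triples

variable {N n P k d M : ℕ} {Del : Finset ℕ} {A : ℕ} {L : ℕ → List ℕ} {s : State} {p : Prog}

/-- Delete as many vertices as possible. -/
def reduceS (k d D e F : ℕ) (p : Prog) : Stmt :=
  .forL 16 6 <| .seq (.store (.var 8 + .var 16) 1) <| .seq (runS k d D e F p) <|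
    .ite (.var 100) .skip (.store (.var 8 + .var 16) 0)

/-- The remaining vertices are a hyperclique with `k` vertices. -/
def checkE (k d : ℕ) : Expr :=
  andE (eqE (.sum 24 (.var 6) (boolE (notE (.load (.var 8 + .var 24))))) (.const k)) <|
    notE <| .sum 21 (.var 6) <| .sum 22 (.var 6) <| .sum 23 (.var 6) <| boolE <|
      andE (allE <| [21, 22, 23].map fun x => notE (.load (.var 8 + .var x))) (keepE d)

def trialS (k d D e F : ℕ) (p : Prog) : Stmt :=
  .seq (reduceS k d D e F p) <| .seq (.ite (checkE k d) (.assign 0 1) .skip) <|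
    .forL 16 6 (.store (.var 8 + .var 16) 0)

/-- The test reuses `keepE`: by `edge_of_not_keep` and `not_keep_of_edge`, undeleted vertices form a
hyperclique exactly if no hyperedge of the instance is among them. -/
theorem holds_checkE (hd : d = 2 ∨ d = 3) (h : Ctx N d M A L Del s) : (checkE k d).Holds s ↔
    (Finset.range N \ Del).card = k ∧
      ∀ T ⊆ Finset.range N \ Del, T.card = d → Edge M (fun j => (L j).toFinset) T := by
  classical
  have hmem : ∀ x, x ∈ Finset.range N \ Del ↔ x < N ∧ x ∉ Del := fun x => by simp
  have hcard : ((Finset.range (s.reg 6)).filter fun i =>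
      (notE (.load (.var 8 + .var 24))).Holds (s.setReg 24 i)) = Finset.range N \ Del := by
    ext x
    rw [h.six, Finset.mem_filter, Finset.mem_range, hmem, holds_notE]
    refine and_congr_right fun hx => not_congr ?_
    rw [← h.deleted x hx]
    simp [Holds, h.eight]
  rw [checkE, holds_andE, holds_eqE, eval_sum_boolE, eval_const, eval_var, hcard]
  refine and_congr_right fun _ => ?_
  rw [holds_notE]
  simp only [holds_sum, holds_boolE, eval_var, State.reg_setReg]
  norm_num
  rw [h.six]
  have hctx : ∀ x y z, Ctx N d M A L Del (((s.setReg 21 x).setReg 22 y).setReg 23 z) := fun x y z =>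
    ((h.setReg (by omega)).setReg (by omega)).setReg (by omega)
  have hk : ∀ x y z, (keepE d).Holds (((s.setReg 21 x).setReg 22 y).setReg 23 z) ↔
      Keep N d M (fun j => (L j).toFinset) Del x y z := fun x y z => by
    rw [holds_keepE (hctx x y z)]; simp
  have hl : ∀ x y z u, u < N → ∀ r, (((s.setReg 21 x).setReg 22 y).setReg 23 z).reg r = u →
      ((Expr.load (.var 8 + .var r)).Holds (((s.setReg 21 x).setReg 22 y).setReg 23 z) ↔ u ∈ Del) := by
    intro x y z u hu r hr
    rw [Holds, eval_load, eval_add, eval_var, eval_var, hr, (hctx x y z).eight]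
    exact h.deleted u hu
  constructor
  · intro H T hT hTd
    refine (edge_of_not_keep hd (Del := Del) (fun y hy => ((hmem y).1 hy).1) ?_ hT hTd).2
    intro x hx y hy z hz hK
    rw [hmem] at hx hy hz
    refine H x hx.1 y hy.1 z hz.1 ?_ ?_ ?_ ((hk x y z).2 hK)
    · rw [hl x y z x hx.1 21 (by simp)]; exact hx.2
    · rw [hl x y z y hy.1 22 (by simp)]; exact hy.2
    · rw [hl x y z z hz.1 23 (by simp)]; exact hz.2
  · intro H x hx y hy z hz h1 h2 h3 hK
    rw [hl x y z x hx 21 (by simp)] at h1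
    rw [hl x y z y hy 22 (by simp)] at h2
    rw [hl x y z z hz 23 (by simp)] at h3
    refine not_keep_of_edge hd h1 ⟨hy, h2⟩ h3 (fun hc => H _ ?_ hc) ((hk x y z).1 hK)
    intro u hu
    rw [hmem]
    simp only [Finset.mem_insert, Finset.mem_singleton] at hu
    rcases hu with rfl | rfl | rfl
    exacts [⟨hx, h1⟩, ⟨hy, h2⟩, ⟨hz, h3⟩]

theorem cheap_checkE {Y : ℕ} (h6 : s.reg 6 ≤ Y) (h7 : s.reg 7 ≤ Y) : (checkE k d).Cheap Y 4 s := by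
  have hl : ∀ (x : ℕ) {D : ℕ} (s : State), (notE (.load (.var 8 + .var x))).Cheap Y D s :=
    fun x D s => cheap_notE (cheap_load (cheap_add (cheap_var _) (cheap_var _)))
  have h3 : ∀ s : State, s.reg 7 ≤ Y → (boolE <| andE (allE <| [21, 22, 23].map fun x =>
      notE (.load (.var 8 + .var x))) (keepE d)).Cheap Y 1 s := fun s h7 =>
    cheap_boolE (cheap_andE (cheap_allE (by
      simp only [List.forall_mem_map]; exact fun x _ => hl x s)) (cheap_keepE h7))
  have h2 : ∀ s : State, s.reg 6 ≤ Y → s.reg 7 ≤ Y → (Expr.sum 23 (.var 6) <| boolE <|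
      andE (allE <| [21, 22, 23].map fun x => notE (.load (.var 8 + .var x))) (keepE d)).Cheap Y 2 s :=
    fun s h6 h7 => cheap_sum (cheap_var _) h6 (fun _ _ => h3 _ (by simpa using h7)) (h3 s h7).2
  have h1 : ∀ s : State, s.reg 6 ≤ Y → s.reg 7 ≤ Y → (Expr.sum 22 (.var 6) <| .sum 23 (.var 6) <|
      boolE <| andE (allE <| [21, 22, 23].map fun x => notE (.load (.var 8 + .var x)))
        (keepE d)).Cheap Y 3 s :=
    fun s h6 h7 => cheap_sum (cheap_var _) h6 (fun _ _ => h2 _ (by simpa using h6) (by simpa using h7))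
      (h2 s h6 h7).2
  exact cheap_andE (cheap_eqE ((cheap_sum (D := 0) (cheap_var _) h6 (fun _ _ => cheap_boolE (hl _ _))
    (cheap_boolE (hl 24 s)).2).mono (by omega)) (cheap_const _)) (cheap_notE (cheap_sum (cheap_var _) h6
    (fun _ _ => h1 _ (by simpa using h6) (by simpa using h7)) (h1 s h6 h7).2))

/-- Self-reduction from decision to search: a vertex stays deleted if the program still reports a
hyperclique. If the program is right, what remains at the end is a hyperclique and nothing else; if
not, the deletions are arbitrary but the time is still bounded. -/
theorem reduceS_tri (k d D e F : ℕ) (p : Prog) : ∃ C, ∀ (X N n P M A Y : ℕ) (L : ℕ → List ℕ)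
    (s : State), Setup N d M A L ∅ p s → s.reg 9 = n →
    s.reg 10 = P → M ≤ Y → 4 * n ^ 3 ≤ Y → Y ≤ X → (n + (n ^ 3 + P) + 2) ^ D ≤ X →
    n ^ 3 + P ≤ X → F * N ^ e ≤ X → s.reg 1 + N ≤ X → A + N ≤ X →
    Tri X (reduceS k d D e F p) s (N * (C * ((F * N ^ e + 1) * (Y + 1) ^ 4)) + 6) fun s' =>
      ∃ Del, Setup N d M A L Del p s' ∧ Del ⊆ Finset.range N ∧
      (∀ r < 100, r ≠ 1 → r ≠ 3 → r ≠ 4 → r ≠ 5 → r ≠ 12 → r ≠ 13 → r ≠ 16 → s'.reg r = s.reg r) ∧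
      s'.reg 1 = s.reg 1 + N ∧
      (Works p D (F * N ^ e) N n P k d M (fun j => (L j).toFinset) →
        Clq N k d M (fun j => (L j).toFinset) ∅ →
          (Finset.range N \ Del).card = k ∧ ∀ T ⊆ Finset.range N \ Del, T.card = d →
            Edge M (fun j => (L j).toFinset) T) := by
  obtain ⟨C, hC⟩ := runS_tri k d D e F p
  refine ⟨C + 30, fun X N n P M A Y L s hs h9 h10 hM hn hY hDX hPX hF h1 hAX => ?_⟩
  set V := fun j => (L j).toFinset with hV
  set W := Works p D (F * N ^ e) N n P k d M V with hW
  set Z := (F * N ^ e + 1) * (Y + 1) ^ 4 with hZ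
  have hZ1 : 1 ≤ Z := Nat.mul_pos (by omega) (by positivity)
  refine (Tri.forL (T := C * Z + 20) (N := N) (fun i s' => ∃ Del, Setup N d M A L Del p s' ∧
      Del ⊆ Finset.range i ∧
      (∀ r < 100, r ≠ 1 → r ≠ 3 → r ≠ 4 → r ≠ 5 → r ≠ 12 → r ≠ 13 → r ≠ 16 → s'.reg r = s.reg r) ∧
      s'.reg 1 = s.reg 1 + i ∧ (W → Clq N k d M V ∅ → Clq N k d M V Del ∧
        ∀ v < i, v ∉ Del → ¬ Clq N k d M V (insert v Del))) (by omega)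
    ⟨∅, hs.setReg (by omega), by simp, fun r hr _ _ _ _ _ _ a => ?_, by simp, fun _ h => ⟨h, by simp⟩⟩
    ?_ ?_ ?_).mono ?_ fun s h => h
  · rw [State.reg_setReg, if_neg a]
  · rintro i s' ⟨Del, h, -⟩; exact h.ctx.six
  · rintro i hi s' ⟨Del, h, hDel, hr, hr1, hclq⟩ h16
    have hiD : i ∉ Del := fun hmem => by simpa using hDel hmem
    have hsub : insert i Del ⊆ Finset.range (i + 1) :=
      Finset.insert_subset (by simp) (hDel.trans (Finset.range_mono (by omega)))
    have haddr : ∀ s : State, s.reg 8 = A → s.reg 16 = i → (Expr.var 8 + .var 16).eval s = A + i :=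
      fun s h8 h16 => by rw [eval_add, eval_var, eval_var, h8, h16]
    have hst : Setup N d M A L (insert i Del) p (s'.setMem (A + i) 1) :=
      h.store hi fun u _ => by rw [Finset.mem_insert]; split_ifs <;> simp [*]
    refine Tri.store_seq (u := A + i) (v := 1) (haddr _ h.ctx.eight h16) rfl (by omega)
      (T₂ := C * Z + 12) ?_ (show 3 + 1 + 1 + (C * Z + 12) ≤ _ by omega)
    refine Tri.seq (hC X N n P M A Y L _ _ hst (hsub.trans (Finset.range_mono hi))
      ((hr 9 (by omega) (by omega) (by omega) (by omega) (by omega) (by omega) (by omega)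
        (by omega)).trans h9)
      ((hr 10 (by omega) (by omega) (by omega) (by omega) (by omega) (by omega) (by omega)
        (by omega)).trans h10) hM hn hY hDX hPX hF
      (by rw [State.reg_setMem, hr1]; omega)) (T₂ := 12) ?_ (le_refl (C * Z + 12))
    rintro s'' ⟨h', hr', hr1', hans⟩
    have h16' : s''.reg 16 = i := (hr' 16 (by omega) (by omega) (by omega) (by omega) (by omega)
      (by omega) (by omega)).trans h16
    have hrr : ∀ r < 100, r ≠ 1 → r ≠ 3 → r ≠ 4 → r ≠ 5 → r ≠ 12 → r ≠ 13 → r ≠ 16 →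
        s''.reg r = s.reg r := fun r hr0 a b c f g j l =>
      (hr' r hr0 a b c f g j).trans (hr r hr0 a b c f g j l)
    have hr1'' : s''.reg 1 = s.reg 1 + (i + 1) := by rw [hr1', State.reg_setMem, hr1]; omega
    refine Tri.ite (T₁ := 8) (fun h100 => ?_) (fun h100 => ?_) (show 1 + 8 + 1 ≤ 12 by omega)
    · refine Tri.skip (by omega) ⟨h16', insert i Del, h'.setReg (by omega), hsub, ?_, ?_, ?_⟩
      · intro r hr0 a b c f g j l
        rw [State.reg_setReg, if_neg l]; exact hrr r hr0 a b c f g j l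
      · rw [State.reg_setReg, if_neg (by omega)]; exact hr1''
      · intro hw hc
        refine ⟨(hans hw).1 h100, fun v hv hvD hcl => ?_⟩
        rw [Finset.mem_insert, not_or] at hvD
        -- A vertex that was indispensable when tested remains so after further deletions.
        exact (hclq hw hc).2 v (by omega) hvD.2 (hcl.anti
          (Finset.insert_subset_insert _ (Finset.subset_insert _ _)))
    · refine Tri.store (u := A + i) (v := 0) (haddr _ h'.ctx.eight h16') rfl (Nat.zero_le _)
        (show 3 + 1 + 1 ≤ 8 by omega) ⟨h16', Del, Setup.setReg (h'.store hi fun u _ => ?_) (by omega),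
          hDel.trans (Finset.range_mono (by omega)), ?_, ?_, ?_⟩
      · rw [Finset.mem_insert]; split_ifs with hu
        · rw [hu]; simpa using hiD
        · simp [hu]
      · intro r hr0 a b c f g j l
        rw [State.reg_setReg, if_neg l]; exact hrr r hr0 a b c f g j l
      · rw [State.reg_setReg, if_neg (by omega)]; exact hr1''
      · intro hw hc
        refine ⟨(hclq hw hc).1, fun v hv hvD => ?_⟩
        rcases Nat.lt_succ_iff_lt_or_eq.1 hv with hv | rfl
        · exact (hclq hw hc).2 v hv hvD
        · exact fun hcl => (hans hw).2 hcl h100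
  · rintro s' ⟨Del, h, hDel, hr, hr1, hclq⟩ -
    refine ⟨Del, h, hDel, hr, hr1, fun hw hc => ?_⟩
    obtain ⟨⟨S, hS, hE⟩, hmin⟩ := hclq hw hc
    obtain ⟨hSD, hSk⟩ := Finset.mem_powersetCard.1 hS
    -- A remaining vertex outside `S` could have been deleted without destroying `S`, contrary to
    -- what the invariant says of all vertices below `N`.
    have : Finset.range N \ Del = S := by
      refine Finset.Subset.antisymm (fun v hv => ?_) hSD
      by_contra hvS
      rw [Finset.mem_sdiff, Finset.mem_range] at hv
      refine hmin v hv.1 hv.2 ⟨S, Finset.mem_powersetCard.2 ⟨fun x hx => ?_, hSk⟩, hE⟩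
      have := hSD hx
      rw [Finset.mem_sdiff] at this ⊢
      rw [Finset.mem_insert, not_or]
      exact ⟨this.1, fun hxv => hvS (hxv ▸ hx), this.2⟩
    rw [this]
    exact ⟨hSk, hE⟩
  · refine Nat.add_le_add_right (Nat.mul_le_mul_left _ ?_) _
    nlinarith

/-- The explicit check makes a positive answer trustworthy whatever the program does; completeness
is claimed only if it works for this padding. Clearing the deletions afterwards makes trials
repeatable. -/
theorem trialS_tri (hd : d = 2 ∨ d = 3) (k D e F : ℕ) (p : Prog) : ∃ C, ∀ (X N n P M A Y : ℕ) (L : ℕ → List ℕ)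
    (s : State), Setup N d M A L ∅ p s → s.reg 9 = n →
    s.reg 10 = P → 0 < N → N ≤ Y → M ≤ Y → 4 * n ^ 3 ≤ Y → Y ≤ X → (n + (n ^ 3 + P) + 2) ^ D ≤ X →
    n ^ 3 + P ≤ X → F * N ^ e ≤ X → s.reg 1 + N ≤ X → A + N ≤ X →
    Tri X (trialS k d D e F p) s (C * (N * ((F * N ^ e + 1) * (Y + 1) ^ 4))) fun s' =>
      Setup N d M A L ∅ p s' ∧
      (∀ r < 100, r ≠ 0 → r ≠ 1 → r ≠ 3 → r ≠ 4 → r ≠ 5 → r ≠ 12 → r ≠ 13 → r ≠ 16 →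
        s'.reg r = s.reg r) ∧
      s'.reg 1 = s.reg 1 + N ∧ (s.reg 0 ≠ 0 → s'.reg 0 ≠ 0) ∧
      (s'.reg 0 ≠ 0 → s.reg 0 ≠ 0 ∨ Clq N k d M (fun j => (L j).toFinset) ∅) ∧
      (Works p D (F * N ^ e) N n P k d M (fun j => (L j).toFinset) →
        Clq N k d M (fun j => (L j).toFinset) ∅ → s'.reg 0 ≠ 0) := by
  obtain ⟨C, hC⟩ := reduceS_tri k d D e F p
  refine ⟨C + (checkE k d).size + 50,
    fun X N n P M A Y L s hs h9 h10 hN hNY hM hn hY hDX hPX hF h1 hAX => ?_⟩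
  set V := fun j => (L j).toFinset with hV
  set Q := (Y + 1) ^ 4 with hQ
  have hQ1 : 1 ≤ Q := Nat.one_le_pow _ _ (Nat.succ_pos Y)
  set Z := (F * N ^ e + 1) * Q with hZ
  have hQZ : Q ≤ Z := Nat.le_mul_of_pos_left _ (by omega)
  have hZN : Z ≤ N * Z := Nat.le_mul_of_pos_left _ hN
  have hNZ : N ≤ N * Z := Nat.le_mul_of_pos_right _ (by omega)
  refine Tri.seq (hC X N n P M A Y L s hs h9 h10 hM hn hY hDX hPX hF h1 hAX)
    (T₂ := (checkE k d).size * Z + 4 + (N * (8 + 8) + 6)) ?_ ?_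
  swap
  · have h2 := Nat.mul_le_mul_left (checkE k d).size hZN
    have h3 : (C + (checkE k d).size + 50) * (N * Z) =
      N * (C * Z) + (checkE k d).size * (N * Z) + 50 * (N * Z) := by ring
    change N * (C * Z) + 6 + _ ≤ _
    omega
  rintro s₁ ⟨Del, h₁, hDel, hr₁, hr1₁, hfin⟩
  have hchk := holds_checkE (k := k) hd h₁.ctx
  have hcost := (cheap_checkE (k := k) (d := d) (s := s₁) (h₁.ctx.six.le.trans hNY)
    (h₁.ctx.seven.le.trans hM)).cost_le
  refine Tri.seq (P := fun s₂ => Setup N d M A L Del p s₂ ∧ (∀ r, r ≠ 0 → s₂.reg r = s₁.reg r) ∧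
    (s₂.reg 0 ≠ 0 ↔ s₁.reg 0 ≠ 0 ∨ (checkE k d).Holds s₁))
    (T₁ := (checkE k d).size * Z + 4) (Tri.ite (T₁ := 2) (fun hc => ?_) (fun hc => ?_) ?_)
    (T₂ := N * (8 + 8) + 6) ?_ le_rfl
  · refine Tri.assign (v := 1) rfl (by omega) le_rfl ⟨h₁.setReg (by omega), fun r hr => ?_, ?_⟩
    · rw [State.reg_setReg, if_neg hr]
    · rw [State.reg_setReg, if_pos rfl]; exact ⟨fun _ => Or.inr hc, fun _ => one_ne_zero⟩
  · refine Tri.skip (by omega) ⟨h₁, fun _ _ => rfl, ?_⟩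
    rw [or_iff_left]; exact fun h => h hc
  · have := hcost.trans (Nat.mul_le_mul_left _ hQZ)
    omega
  rintro s₂ ⟨h₂, hr₂, hans⟩
  have h0 : s₁.reg 0 = s.reg 0 := hr₁ 0 (by omega) (by omega) (by omega) (by omega) (by omega) (by omega)
    (by omega) (by omega)
  rw [h0] at hans
  refine (Tri.forL (T := 8) (N := N) (fun i s' => ∃ Del', Setup N d M A L Del' p s' ∧
      (∀ v ∈ Del', i ≤ v ∧ v < N) ∧ (∀ r, r ≠ 16 → s'.reg r = s₂.reg r)) (by omega)
    ⟨Del, h₂.setReg (by omega), fun v hv => ⟨Nat.zero_le v, Finset.mem_range.1 (hDel hv)⟩,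
      fun r hr => by rw [State.reg_setReg, if_neg hr]⟩ ?_ ?_ ?_)
  · rintro i s' ⟨Del, h, -⟩; exact h.ctx.six
  · rintro i hi s' ⟨Del', h, hD, hr⟩ h16
    refine Tri.store (u := A + i) (v := 0) ?_ rfl (Nat.zero_le _) (show 3 + 1 + 1 ≤ 8 by omega)
      ⟨h16, Del'.erase i, Setup.setReg (h.store hi fun u _ => ?_) (by omega), ?_, ?_⟩
    · rw [eval_add, eval_var, eval_var, h.ctx.eight, h16]
    · rw [Finset.mem_erase]; split_ifs with hu <;> simp [hu]
    · intro v hv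
      rw [Finset.mem_erase] at hv
      have := hD v hv.2
      omega
    · intro r hr'
      rw [State.reg_setReg, if_neg hr', State.reg_setMem]; exact hr r hr'
  · rintro s' ⟨Del', h, hD, hr⟩ -
    obtain rfl : Del' = ∅ := Finset.eq_empty_of_forall_notMem fun v hv => by
      have := hD v hv; omega
    have h00 : s'.reg 0 = s₂.reg 0 := hr 0 (by omega)
    refine ⟨h, fun r hr0 a b c f g i j l => ?_, ?_, fun h0 => ?_, fun h0 => ?_, fun hw hc => ?_⟩
    · rw [hr r l, hr₂ r a, hr₁ r hr0 b c f g i j l]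
    · rw [hr 1 (by omega), hr₂ 1 (by omega), hr1₁]
    · rw [h00]; exact hans.2 (Or.inl h0)
    · rw [h00] at h0
      refine (hans.1 h0).imp_right fun hh => ?_
      obtain ⟨hcard, hE⟩ := hchk.1 hh
      refine ⟨Finset.range N \ Del, Finset.mem_powersetCard.2 ⟨?_, hcard⟩, hE⟩
      rw [Finset.sdiff_empty]; exact Finset.sdiff_subset
    · rw [h00]; exact hans.2 (Or.inr (hchk.2 (hfin hw hc)))

end Padded

/-! ### From an algorithm for independent sets to one for hypercliques -/

namespace Padded

open WordRAM WordRAM.Expr WordRAM.Sandbox ChainExpr Triples HyperIS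

variable {N n P k d M : ℕ} {Del : Finset ℕ} {A : ℕ} {L : ℕ → List ℕ} {s : State} {p : Prog}

/-- Try all paddings. -/
def searchS (k d D e F g : ℕ) (p : Prog) : Stmt :=
  .seq (.assign 6 (.load 0)) <| .seq (.assign 7 (.load 1)) <|
  .seq (.assign 8 (2 + .const (d + 1) * .var 7)) <| .seq (.assign 2 (.var 8 + .var 6)) <|
  .seq (.assign 17 (.var 6 * (.var 6 * .var 6 + 1))) <|
  .forL 14 17 <| .seq (.assign 9 (.const (k + 1) * .var 6 + .var 14 / .var 6)) <|
    .seq (.assign 10 (powE (.var 6) g * (.var 14 % .var 6 + 1))) (trialS k d D e F p)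

theorem clq_iff {E : Finset (Finset (Fin N))} {v : ℕ → List ℕ} (hE : ∀ e ∈ E, e.card = d)
    (h : ∀ S : Finset (Fin N), (∀ e ∈ E, ¬ e ⊆ S) ↔
      ∀ j < M, ¬ (v j).toFinset ⊆ S.image Fin.val) :
    Clq N k d M (fun j => (v j).toFinset) ∅ ↔ HasHyperclique d k N E := by
  have hedge : ∀ T : Finset (Fin N), T.card = d →
      (T ∈ E ↔ Edge M (fun j => (v j).toFinset) (T.image Fin.val)) := by
    intro T hT
    have h1 := not_congr (h T)
    push Not at h1
    rw [Edge, ← h1]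
    refine ⟨fun hTE => ⟨T, hTE, subset_rfl⟩, ?_⟩
    rintro ⟨e, he, hs⟩
    rwa [← Finset.eq_of_subset_of_card_le hs (by rw [hT, hE e he])]
  constructor
  · rintro ⟨S, hS, hcl⟩
    obtain ⟨hSN, hSk⟩ := Finset.mem_powersetCard.1 hS
    rw [Finset.sdiff_empty] at hSN
    have himg : (Finset.univ.filter fun x : Fin N => (x : ℕ) ∈ S).image Fin.val = S := by
      ext x
      simp only [Finset.mem_image, Finset.mem_filter, Finset.mem_univ, true_and]
      refine ⟨?_, fun hx => ⟨⟨x, Finset.mem_range.1 (hSN hx)⟩, hx, rfl⟩⟩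
      rintro ⟨y, hy, rfl⟩; exact hy
    refine ⟨Finset.univ.filter fun x : Fin N => (x : ℕ) ∈ S, ?_, fun T hT hTd => ?_⟩
    · rw [← hSk, ← himg, Finset.card_image_of_injective _ Fin.val_injective, himg]
    · rw [hedge T hTd]
      refine hcl _ ?_ (by rw [Finset.card_image_of_injective _ Fin.val_injective, hTd])
      rw [← himg]; exact Finset.image_subset_image hT
  · rintro ⟨S, hSk, hcl⟩
    refine ⟨S.image Fin.val, Finset.mem_powersetCard.2 ⟨?_, ?_⟩, fun T hT hTd => ?_⟩
    · rw [Finset.sdiff_empty]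
      intro x hx
      obtain ⟨y, -, rfl⟩ := Finset.mem_image.1 hx
      simp
    · rw [Finset.card_image_of_injective _ Fin.val_injective, hSk]
    · obtain ⟨T', hT', rfl⟩ := Finset.subset_image_iff.1 hT
      rw [Finset.card_image_of_injective _ Fin.val_injective] at hTd
      exact (hedge T' hTd).1 (hcl T' hT' hTd)

/-- The number `i` encodes a padding: `i / N` extra vertices and `i % N + 1` as the leading factor
of the number of padding sets. One good padding is enough, since trials with bad ones are sound. -/
theorem searchS_tri (hd : d = 2 ∨ d = 3) (k D e F g : ℕ) (p : Prog) : ∃ C, ∀ (X N M Y : ℕ)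
    (v : ℕ → List ℕ) (off : ℕ → ℕ) (w : List ℕ), 0 < N → Stores N M v off w →
    (∀ j < M, (v j).length = d) → N ≤ Y → M ≤ Y → 4 * ((k + 2) * N ^ 2) ^ 3 ≤ Y → Y ≤ X →
    ((k + 2) * N ^ 2 + (((k + 2) * N ^ 2) ^ 3 + N ^ (g + 1)) + 2) ^ D ≤ X →
    ((k + 2) * N ^ 2) ^ 3 + N ^ (g + 1) ≤ X → F * N ^ e ≤ X → N * (N * N + 1) * N ≤ X →
    2 + (d + 1) * M + N ≤ X →
    (∃ i < N * (N * N + 1), Works p D (F * N ^ e) N ((k + 1) * N + i / N) (N ^ g * (i % N + 1)) k d M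
      (fun j => (v j).toFinset)) →
    Tri X (searchS k d D e F g p) (State.init w)
      (C * (N * (N * N + 1) * (N * ((F * N ^ e + 1) * (Y + 1) ^ 4)))) fun s =>
      (s.reg 0 ≠ 0 ↔ Clq N k d M (fun j => (v j).toFinset) ∅) := by
  obtain ⟨C, hC⟩ := trialS_tri hd k D e F p
  refine ⟨C + 10 * g + 200, fun X N M Y v off w hN hst har hNY hMY hY hYX hDX hPX hF hrX hAX hW => ?_⟩
  set V := fun j => (v j).toFinset with hV
  set Z := N * ((F * N ^ e + 1) * (Y + 1) ^ 4) with hZ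
  have hZ1 : 1 ≤ Z := Nat.mul_pos hN (Nat.mul_pos (by omega) (by positivity))
  set R := N * (N * N + 1) with hR
  have hR1 : 1 ≤ R := Nat.mul_pos hN (by omega)
  set A := 2 + (d + 1) * M with hA
  have hoff : ∀ j ≤ M, off j = 2 + (d + 1) * j := by
    intro j hj
    induction j with
    | zero => rw [hst.off_zero]; rfl
    | succ j ih => rw [hst.off_succ, ih (by omega), har j hj]; ring
  have hzero : ∀ a, A ≤ a → w.getD a 0 = 0 := fun a ha =>
    List.getD_eq_default _ _ (by rw [hst.length, hoff M le_rfl]; exact ha)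
  set s₅ := (((((State.init w).setReg 6 N).setReg 7 M).setReg 8 A).setReg 2 (A + N)).setReg 17 R with hs₅
  have hreg : ∀ r, r ≠ 6 → r ≠ 7 → r ≠ 8 → r ≠ 2 → r ≠ 17 → s₅.reg r = 0 := fun r a b c f g => by
    simp only [hs₅, State.reg_setReg]
    rw [if_neg g, if_neg f, if_neg c, if_neg b, if_neg a]; rfl
  have h17 : s₅.reg 17 = R := by simp [hs₅]
  have hset : Setup N d M A v ∅ p s₅ := by
    refine ⟨⟨by simp [hs₅], by simp [hs₅], by simp [hs₅], le_rfl, har, fun e he i hi => ?_,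
      fun u _ => ?_⟩, by simp [hs₅], ⟨fun i => ?_, fun r _ => hreg _ (by omega) (by omega) (by omega)
        (by omega) (by omega)⟩⟩
    · have := hst.entry e he i (by rw [har e he]; exact hi)
      rw [hoff e he.le] at this
      rw [← this]
      change w.getD _ 0 = _
      congr 1; ring
    · have := hzero (A + u) (by omega)
      change w.getD _ 0 ≠ 0 ↔ _
      rw [this]; simp
    · have := hzero (A + N + 2 * i) (by omega)
      have h2 : s₅.reg 2 = A + N := by simp [hs₅]
      rw [h2]
      change w.getD _ 0 ≤ _
      rw [this]; exact Nat.zero_le _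
  have hAX' : A + N ≤ X := hAX
  have hN2 : N ≤ N * N := Nat.le_mul_of_pos_left _ hN
  have hRX : R ≤ X := (Nat.le_mul_of_pos_right _ hN).trans hrX
  have hMA : M ≤ A := by rw [hA]; nlinarith
  have hloop : Tri X (.forL 14 17 <| .seq (.assign 9 (.const (k + 1) * .var 6 + .var 14 / .var 6)) <|
    .seq (.assign 10 (powE (.var 6) g * (.var 14 % .var 6 + 1))) (trialS k d D e F p)) s₅
      (R * ((C * Z + 10 * g + 20) + 8) + 6) fun s =>
      (s.reg 0 ≠ 0 ↔ Clq N k d M V ∅) := by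
    refine Tri.forL (N := R) (fun i s => Setup N d M A v ∅ p s ∧ s.reg 17 = R ∧ s.reg 1 = i * N ∧
      (s.reg 0 ≠ 0 → Clq N k d M V ∅) ∧ (Clq N k d M V ∅ →
        (∃ j < i, Works p D (F * N ^ e) N ((k + 1) * N + j / N) (N ^ g * (j % N + 1)) k d M V) →
        s.reg 0 ≠ 0)) hRX ⟨hset.setReg (by omega), ?_, ?_, ?_, ?_⟩ (fun i s h => h.2.1) ?_ ?_
    · rw [State.reg_setReg, if_neg (by omega), h17]
    · rw [State.reg_setReg, if_neg (by omega), hreg 1 (by omega) (by omega) (by omega) (by omega)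
        (by omega), zero_mul]
    · rw [State.reg_setReg, if_neg (by omega), hreg 0 (by omega) (by omega) (by omega) (by omega)
        (by omega)]
      exact fun h => absurd rfl h
    · rintro - ⟨j, hj, -⟩; omega
    · rintro i hi s ⟨hs, hs17, hs1, hsound, hcomp⟩ hs14
      set n := (k + 1) * N + i / N with hn
      set P := N ^ g * (i % N + 1) with hP
      have hdiv : i / N ≤ N * N := Nat.lt_succ_iff.1 (Nat.div_lt_of_lt_mul hi)
      have hmod : i % N + 1 ≤ N := Nat.mod_lt _ hN
      have hnle : n ≤ (k + 2) * N ^ 2 := by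
        have := Nat.mul_le_mul_left (k + 1) hN2
        nlinarith
      have hPle : P ≤ N ^ (g + 1) := Nat.mul_le_mul_left _ hmod
      have hn3 : n ^ 3 ≤ ((k + 2) * N ^ 2) ^ 3 := Nat.pow_le_pow_left hnle 3
      have hn3' : n ≤ n ^ 3 := Nat.le_self_pow (by omega) n
      have hs6 := hs.ctx.six
      set s₁ := s.setReg 9 n with hs₁
      set s₂ := s₁.setReg 10 P with hs₂
      have ht : Setup N d M A v ∅ p s₂ := (hs.setReg (by omega)).setReg (by omega)
      have e1 : s₂.reg 1 = i * N := by simp [hs₂, hs₁, hs1]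
      have e0 : s₂.reg 0 = s.reg 0 := by simp [hs₂, hs₁]
      have e14 : s₂.reg 14 = i := by simp [hs₂, hs₁, hs14]
      have e17 : s₂.reg 17 = R := by simp [hs₂, hs₁, hs17]
      refine Tri.assign_seq (v := n) ?_ (by omega) (T₂ := C * Z + 10 * g + 12) ?_
        (show 3 + 3 + 1 + 1 + (C * Z + 10 * g + 12) ≤ _ by omega)
      · simp [hs6, hs14, hn]
      refine Tri.assign_seq (v := P) ?_ (by omega) (T₂ := C * Z) ?_ ?_
      · simp [hs6, hs14, hP]
      · have h1X : s₂.reg 1 + N ≤ X := by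
          rw [e1]
          have : (i + 1) * N ≤ R * N := Nat.mul_le_mul_right _ hi
          rw [add_mul, one_mul] at this
          omega
        refine (hC X N n P M A Y v s₂ ht (by simp [hs₂, hs₁]) (by simp [hs₂]) hN hNY hMY (by omega) hYX
          ((Nat.pow_le_pow_left (by omega) D).trans hDX) (by omega) hF h1X hAX').mono le_rfl ?_
        rintro s' ⟨h', hr', hr1', ha, hb, hc⟩
        have f14 : s'.reg 14 = i := (hr' 14 (by omega) (by omega) (by omega) (by omega) (by omega)
          (by omega) (by omega) (by omega) (by omega)).trans e14
        have f17 : s'.reg 17 = R := (hr' 17 (by omega) (by omega) (by omega) (by omega) (by omega)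
          (by omega) (by omega) (by omega) (by omega)).trans e17
        rw [e0] at ha hb
        have g0 : (s'.setReg 14 (i + 1)).reg 0 = s'.reg 0 := by simp
        refine ⟨f14, h'.setReg (by omega), by simpa using f17, ?_, ?_, ?_⟩
        · rw [State.reg_setReg, if_neg (by omega), hr1', e1]; ring
        · rw [g0]; exact fun h => (hb h).elim hsound id
        · rw [g0]
          rintro hcl ⟨j, hj, hw⟩
          rcases Nat.lt_succ_iff_lt_or_eq.1 hj with hj | rfl
          · exact ha (hcomp hcl ⟨j, hj, hw⟩)
          · exact hc hw hcl
      · have := cost_powE (e := .var 6) (s := s₁) (show (1 : ℕ) ≤ 9 by omega) g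
        change (powE (.var 6) g).cost s₁ + 5 + 1 + 1 + C * Z ≤ _
        omega
    · rintro s ⟨-, -, -, hsound, hcomp⟩ -
      exact ⟨hsound, fun hcl => hcomp hcl hW⟩
  refine Tri.mono (T := 30 + (R * ((C * Z + 10 * g + 20) + 8) + 6)) ?_ ?_ fun s h => h
  · refine Tri.assign_seq (v := N) (by rw [← hst.vertices]; rfl) (by omega)
      (T₂ := 27 + (R * ((C * Z + 10 * g + 20) + 8) + 6)) ?_
      (show 1 + 1 + 1 + _ ≤ _ by omega)
    refine Tri.assign_seq (v := M) (by rw [← hst.edges]; rfl) (by omega)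
      (T₂ := 24 + (R * ((C * Z + 10 * g + 20) + 8) + 6)) ?_
      (show 1 + 1 + 1 + _ ≤ _ by omega)
    refine Tri.assign_seq (v := A) (by simp [hA]) (by omega)
      (T₂ := 18 + (R * ((C * Z + 10 * g + 20) + 8) + 6)) ?_
      (show 1 + (1 + 1 + 1) + 1 + 1 + _ ≤ _ by omega)
    refine Tri.assign_seq (v := A + N) (by simp) (by omega)
      (T₂ := 14 + (R * ((C * Z + 10 * g + 20) + 8) + 6)) ?_
      (show 1 + 1 + 1 + 1 + _ ≤ _ by omega)
    exact Tri.assign_seq (v := R) (by simp [hR]) hRX hloop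
      (show 1 + ((1 + 1 + 1) + 1 + 1) + 1 + 1 + _ ≤ _ by omega)
  · have hRZ : R ≤ R * Z := Nat.le_mul_of_pos_right _ hZ1
    have h1 : R * (C * Z + 10 * g + 20 + 8) = C * (R * Z) + (10 * g) * R + 28 * R := by ring
    have h2 := Nat.mul_le_mul_left (10 * g) hRZ
    have h3 : (C + 10 * g + 200) * (R * Z) = C * (R * Z) + (10 * g) * (R * Z) + 200 * (R * Z) := by ring
    omega

/-- The exponent `28` collects `N ^ 3` paddings, `N` deletions each, and `(N ^ 6) ^ 4` for computing
words of an instance with up to `O(N ^ 2)` vertices and hence `O(N ^ 6)` slots. -/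
theorem searchTime_le (C F e K : ℕ) {N : ℕ} (hN : 0 < N) :
    C * (N * (N * N + 1) * (N * ((F * N ^ e + 1) * (K * N ^ 6 + 1) ^ 4))) ≤
      C * (2 * ((F + 1) * (K + 1) ^ 4)) * N ^ (e + 28) := by
  have h1 : N * (N * N + 1) ≤ 2 * N ^ 3 := by
    have := Nat.pow_le_pow_right hN (show 1 ≤ 3 by omega)
    nlinarith
  have h2 : F * N ^ e + 1 ≤ (F + 1) * N ^ e := by
    have := Nat.one_le_pow e N hN
    nlinarith
  have h3 : (K * N ^ 6 + 1) ^ 4 ≤ ((K + 1) * N ^ 6) ^ 4 := by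
    refine Nat.pow_le_pow_left ?_ 4
    have := Nat.one_le_pow 6 N hN
    nlinarith
  calc _ ≤ C * (2 * N ^ 3 * (N * ((F + 1) * N ^ e * ((K + 1) * N ^ 6) ^ 4))) :=
        Nat.mul_le_mul_left _ (Nat.mul_le_mul h1 (Nat.mul_le_mul_left _ (Nat.mul_le_mul h2 h3)))
    _ = _ := by ring

/-- If a program solves the padded instances for some padding, hypercliques can be detected. -/
theorem exists_hyperclique_algorithm (hd : d = 2 ∨ d = 3) (k D e F g : ℕ) (p : Prog)
    (hW : ∀ N : ℕ, 0 < N → ∀ M ≤ N ^ 3, ∀ V : ℕ → Finset ℕ, ∃ i < N * (N * N + 1),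
      Works p D (F * N ^ e) N ((k + 1) * N + i / N) (N ^ g * (i % N + 1)) k d M V) :
    ∃ (p' : Prog) (C : ℕ), DecidesInTime p' (Uniform d) (HasHyperclique d k)
      fun n _ => (C : ℝ) * (n : ℝ) ^ (e + 28) := by
  obtain ⟨C, hC⟩ := searchS_tri hd k D e F g p
  set K := 4 * (k + 2) ^ 3 with hK
  refine ⟨(searchS k d D e F g p).compile, C * (2 * ((F + 1) * (K + 1) ^ 4)),
    decidesInTime_of_tri (Stmt.deg_pos _) (K + 6 + (3 * k + g + 15) * (D + 1) + (F + e) + 8) ?_⟩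
  intro N hN E hE v off w _ hst hP hS X hX
  set M := E.card with hM
  have hM3 : M ≤ N ^ 3 := by
    have : E ⊆ Finset.univ.powersetCard d := fun x hx =>
      Finset.mem_powersetCard.2 ⟨Finset.subset_univ _, hE x hx⟩
    have := Finset.card_le_card this
    rw [Finset.card_powersetCard, Finset.card_univ, Fintype.card_fin] at this
    exact this.trans ((Nat.choose_le_pow _ _).trans (Nat.pow_le_pow_right hN (by omega)))
  have har : ∀ j < M, (v j).length = d := hP (fun l => l = d) hE
  set B := N + M + 2 with hB
  have hB2 : 2 ≤ B := by omega
  have hpow : ∀ {i j : ℕ}, i ≤ j → B ^ i ≤ B ^ j := fun h => Nat.pow_le_pow_right (by omega) h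
  have hconst : ∀ c, c ≤ B ^ c := fun c =>
    (Nat.lt_two_pow_self (n := c)).le.trans (Nat.pow_le_pow_left hB2 c)
  have hNB : ∀ i, N ^ i ≤ B ^ i := fun i => Nat.pow_le_pow_left (by omega) i
  have hYN : 4 * ((k + 2) * N ^ 2) ^ 3 = K * N ^ 6 := by rw [hK]; ring
  have hKB : K * N ^ 6 ≤ B ^ (K + 6) := by
    rw [pow_add]; exact Nat.mul_le_mul (hconst _) (hNB _)
  have hK1 : 1 ≤ K := Nat.mul_pos (by omega) (by positivity)
  have hN6 : N ^ 3 ≤ K * N ^ 6 :=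
    (Nat.pow_le_pow_right hN (by omega)).trans (Nat.le_mul_of_pos_left _ hK1)
  have hn : (k + 2) * N ^ 2 ≤ B ^ (k + 4) := by
    rw [show k + 4 = (k + 2) + 2 by rfl, pow_add]; exact Nat.mul_le_mul (hconst _) (hNB _)
  have hn3 : ((k + 2) * N ^ 2) ^ 3 ≤ B ^ (3 * k + g + 13) :=
    (Nat.pow_le_pow_left hn 3).trans (by rw [← pow_mul]; exact hpow (by omega))
  have hsum : (k + 2) * N ^ 2 + (((k + 2) * N ^ 2) ^ 3 + N ^ (g + 1)) + 2 ≤ B ^ (3 * k + g + 15) := by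
    have h1 := hn.trans (hpow (show k + 4 ≤ 3 * k + g + 13 by omega))
    have h2 := (hNB (g + 1)).trans (hpow (show g + 1 ≤ 3 * k + g + 13 by omega))
    have h3 : 2 ≤ B ^ (3 * k + g + 13) := hB2.trans (Nat.le_self_pow (by omega) B)
    have h4 : B ^ (3 * k + g + 15) = B ^ (3 * k + g + 13) * B ^ 2 := by rw [← pow_add]
    have h5 : 4 ≤ B ^ 2 := Nat.pow_le_pow_left hB2 2
    have h6 := Nat.mul_le_mul_left (B ^ (3 * k + g + 13)) h5
    omega
  have hle : ∀ i, i ≤ K + 6 + (3 * k + g + 15) * (D + 1) + (F + e) + 8 → B ^ i ≤ X := fun i hi =>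
    (hpow hi).trans hX
  have hexp : (3 * k + g + 15) * (D + 1) = (3 * k + g + 15) * D + (3 * k + g + 15) := by ring
  have hd3 : d ≤ 3 := by omega
  refine ⟨_, (hC X N M (K * N ^ 6) v off w hN hst har ?_ (hM3.trans hN6) hYN.le
    (hKB.trans (hle _ (by omega))) ?_ ?_ ?_ ?_ ?_ (hW N hN M hM3 _)).mono le_rfl
    (fun s h => h.trans (clq_iff hE hS)), ?_⟩
  · exact (Nat.le_self_pow (by omega) N).trans hN6
  · refine (Nat.pow_le_pow_left hsum D).trans ?_
    rw [← pow_mul]; exact hle _ (by omega)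
  · exact (Nat.le_trans (by omega) hsum).trans (hle _ (by omega))
  · refine le_trans ?_ (hle (F + e) (by omega))
    rw [pow_add]; exact Nat.mul_le_mul (hconst _) (hNB _)
  · refine le_trans ?_ (hle 8 (by omega))
    have h1 : N * (N * N + 1) * N ≤ 2 * N ^ 4 := by
      have := Nat.pow_le_pow_right hN (show 2 ≤ 4 by omega)
      nlinarith
    have h2 : B ^ 8 = B ^ 4 * B ^ 4 := by rw [← pow_add]
    have h3 : 2 ≤ B ^ 4 := hB2.trans (Nat.le_self_pow (by omega) B)
    rw [h2]
    exact h1.trans (Nat.mul_le_mul h3 (hNB 4))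
  · refine le_trans ?_ (hle 3 (by omega))
    have h1 : B ^ 3 = B ^ 2 * B := by ring
    have h2 : 4 ≤ B ^ 2 := Nat.pow_le_pow_left hB2 2
    have h3 := Nat.mul_le_mul_right B h2
    have h4 : (d + 1) * M ≤ 4 * M := Nat.mul_le_mul_right _ (by omega)
    omega
  · exact_mod_cast searchTime_le C F e K hN

end Padded

/-! ### Density and time estimates for the lower bound. -/

namespace HyperIS

open WordRAM

theorem DecidesInTime.mono {p : Prog} {K Q : HProp} {T T' : ℕ → ℕ → ℝ} (h : DecidesInTime p K Q T)
    (hT : ∀ n m, 0 < n → T n m ≤ T' n m) : DecidesInTime p K Q T' := by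
  obtain ⟨D, hD⟩ := h
  refine ⟨D, fun n hn E hE w hw => ?_⟩
  obtain ⟨t, s, hr, ht, hs⟩ := hD n hn E hE w hw
  exact ⟨t, s, hr, ht.trans (hT _ _ hn), hs⟩

theorem exists_encodes {n : ℕ} (E : Finset (Finset (Fin n))) : ∃ w, Encodes E w := by
  have h : (E.toList.map Finset.toList).map List.toFinset = E.toList := by
    rw [List.map_map]
    conv_rhs => rw [← List.map_id E.toList]
    exact List.map_congr_left fun e _ => Finset.toList_toFinset e
  refine ⟨_, E.toList.map Finset.toList, ?_, ?_, ?_, rfl⟩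
  · intro l hl
    obtain ⟨e, -, rfl⟩ := List.mem_map.1 hl
    exact e.nodup_toList
  · rw [h]; exact E.nodup_toList
  · rw [h]; exact E.toList_toFinset

/-- There is no algorithm whose running time tends to `0`. -/
theorem not_decidesInTime_of_lt {k : ℕ} {c γ : ℝ} (hc : (k : ℝ) < c) (hγ : 0 ≤ γ) (hγk : γ ≤ k) :
    ∃ a b : ℝ, 0 < a ∧ ∀ (Q : HProp) (p : Prog) (C : ℝ), 2 ≤ k →
      ¬ DecidesInTime p (OfDensity k γ a b) Q fun n m => C * (n : ℝ) ^ (-c) * timeBound k n m := by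
  -- For `n ≥ 2 * k + 1` there are at least `(n / 2) ^ k / k!` sets of size `k`, enough to choose `a
  -- * n ^ γ` of them as hyperedges; so the class is not empty for large `n`.
  set a : ℝ := 1 / (2 ^ k * k.factorial) with ha
  have hden : (0 : ℝ) < 2 ^ k * k.factorial := by positivity
  have ha0 : 0 < a := by positivity
  have ha1 : a ≤ 1 := by
    rw [ha, div_le_one hden]
    exact_mod_cast Nat.mul_pos (Nat.pow_pos (by omega)) (Nat.factorial_pos k)
  refine ⟨a, 2, ha0, fun Q p C hk ⟨D, hD⟩ => ?_⟩
  have hlim : Filter.Tendsto (fun n : ℕ => |C| * (n : ℝ) ^ (-(c - k))) Filter.atTop (nhds 0) := by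
    have := ((tendsto_rpow_neg_atTop (sub_pos.2 hc)).comp tendsto_natCast_atTop_atTop).const_mul |C|
    rwa [mul_zero] at this
  obtain ⟨n, hn1, hn2⟩ := ((hlim.eventually (gt_mem_nhds one_pos)).and
    (Filter.eventually_ge_atTop (2 * k + 1))).exists
  have hn0 : 0 < n := by omega
  have hnR : (1 : ℝ) ≤ n := by exact_mod_cast hn0
  set m := ⌈a * (n : ℝ) ^ γ⌉₊ with hm
  have hmle : m ≤ n.choose k := by
    rw [hm, Nat.ceil_le]
    have h1 : ((n : ℝ) / 2) ^ k ≤ k.factorial * n.choose k := by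
      have h3 : (((n + 1 - k) ^ k : ℕ) : ℝ) ≤ (k.factorial * n.choose k : ℕ) :=
        Nat.cast_le.2 ((Nat.pow_sub_le_descFactorial n k).trans
          (Nat.descFactorial_eq_factorial_mul_choose n k).le)
      rw [Nat.cast_pow, Nat.cast_mul, Nat.cast_sub (by omega), Nat.cast_add] at h3
      refine le_trans (pow_le_pow_left₀ (by positivity) ?_ k) h3
      have : (2 * k + 1 : ℝ) ≤ n := by exact_mod_cast hn2
      push_cast; linarith
    have h2 : (n : ℝ) ^ γ ≤ (n : ℝ) ^ k := by
      rw [← Real.rpow_natCast]; exact Real.rpow_le_rpow_of_exponent_le hnR hγk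
    rw [div_pow] at h1
    calc a * (n : ℝ) ^ γ ≤ a * (n : ℝ) ^ k := mul_le_mul_of_nonneg_left h2 ha0.le
      _ = (n : ℝ) ^ k / 2 ^ k / k.factorial := by rw [ha]; field_simp
      _ ≤ n.choose k := by
        rw [div_le_iff₀ (by positivity)]; linarith
  obtain ⟨E, hEsub, hEcard⟩ := Finset.exists_subset_card_eq
    (s := (Finset.univ : Finset (Fin n)).powersetCard k) (n := m)
    (by rw [Finset.card_powersetCard, Finset.card_univ, Fintype.card_fin]; exact hmle)
  obtain ⟨w, hw⟩ := exists_encodes E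
  have hpow : 1 ≤ (n : ℝ) ^ γ := Real.one_le_rpow hnR hγ
  have hE : OfDensity k γ a 2 n E := by
    refine ⟨fun e he => ?_, ?_, ?_⟩
    · have := (Finset.mem_powersetCard.1 (hEsub he)).2
      omega
    · rw [hEcard]; exact Nat.le_ceil _
    · rw [hEcard]
      have := Nat.ceil_lt_add_one (show 0 ≤ a * (n : ℝ) ^ γ by positivity)
      have h2 := mul_le_mul_of_nonneg_right ha1 (show 0 ≤ (n : ℝ) ^ γ by positivity)
      rw [← hm] at this
      linarith
  obtain ⟨t, s, hr, ht, -⟩ := hD n hn0 E hE w hw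
  -- Every run takes at least one step, whereas the bound is at most `|C| * n ^ (k - c)` and `n` was
  -- chosen to make this less than `1`.
  have h1 : (1 : ℝ) ≤ t := by exact_mod_cast hr.2.time_pos
  have hx : (n : ℝ) ^ (-c) * (n : ℝ) ^ k = (n : ℝ) ^ (-(c - k)) := by
    rw [← Real.rpow_natCast, ← Real.rpow_add (by linarith)]; congr 1; ring
  have h2 : C * (n : ℝ) ^ (-c) * timeBound k n E.card ≤ |C| * (n : ℝ) ^ (-(c - k)) := by
    rw [← hx, mul_assoc]
    have hnn : 0 ≤ (n : ℝ) ^ (-c) := by positivity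
    have htb : 0 ≤ timeBound k n E.card := le_min (by positivity) (by positivity)
    exact mul_le_mul (le_abs_self C) (mul_le_mul_of_nonneg_left (min_le_right _ _) hnn)
      (mul_nonneg hnn htb) (abs_nonneg C)
  have h3 : |C| * (n : ℝ) ^ (-(c - k)) < 1 := hn1
  linarith

/-- A bound for the time in terms of `N` for `O (N ^ σ)` vertices. -/
theorem timeBound_le_of_le {k n m : ℕ} {N c₀ σ γ x : ℝ} (hN : 1 ≤ N) (hc₀ : 1 ≤ c₀) (hγ : 0 ≤ γ)
    (hn : (n : ℝ) ≤ c₀ * N ^ σ) (hm : (m : ℝ) ≤ 4 * (n : ℝ) ^ γ)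
    (h1 : σ * (MatMul.omega * k / 3) ≤ x) (h2 : σ * γ * (k / 3) ≤ x) :
    timeBound k n m ≤ (c₀ ^ (MatMul.omega * k / 3) + (4 * c₀ ^ γ) ^ ((k : ℝ) / 3)) * N ^ x := by
  have hN0 : 0 < N := by linarith
  have hω : 0 ≤ MatMul.omega * k / 3 := by have := MatMul.two_le_omega; positivity
  refine (min_le_left _ _).trans ?_
  rw [add_mul]
  refine add_le_add ?_ ?_
  · calc (n : ℝ) ^ (MatMul.omega * k / 3) ≤ (c₀ * N ^ σ) ^ (MatMul.omega * k / 3) :=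
          Real.rpow_le_rpow (by positivity) hn hω
      _ = c₀ ^ (MatMul.omega * k / 3) * N ^ (σ * (MatMul.omega * k / 3)) := by
          rw [Real.mul_rpow (by positivity) (by positivity), ← Real.rpow_mul hN0.le]
      _ ≤ _ := mul_le_mul_of_nonneg_left (Real.rpow_le_rpow_of_exponent_le hN h1) (by positivity)
  · calc (m : ℝ) ^ ((k : ℝ) / 3) ≤ (4 * c₀ ^ γ * N ^ (σ * γ)) ^ ((k : ℝ) / 3) := by
          refine Real.rpow_le_rpow (by positivity) (hm.trans ?_) (by positivity)
          rw [mul_assoc, Real.rpow_mul hN0.le, ← Real.mul_rpow (by positivity) (by positivity)]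
          exact mul_le_mul_of_nonneg_left (Real.rpow_le_rpow (by positivity) hn hγ) (by norm_num)
      _ = (4 * c₀ ^ γ) ^ ((k : ℝ) / 3) * N ^ (σ * γ * (k / 3)) := by
          rw [Real.mul_rpow (by positivity) (by positivity), ← Real.rpow_mul hN0.le]
      _ ≤ _ := mul_le_mul_of_nonneg_left (Real.rpow_le_rpow_of_exponent_le hN h2) (by positivity)

end HyperIS

namespace Padded

open WordRAM HyperIS

variable {N n P k d M : ℕ} {V : ℕ → Finset ℕ} {Del : Finset ℕ}

theorem length_records :
    (records N n P k d M V Del).length = (slots N n d M V Del).length + P := by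
  simp [records]

/-- A slot for a pair is determined by its two vertices. Proper triples occur only for `d = 3`, and
then only among the first `N` vertices. -/
theorem slots_length_le_sq :
    (slots N n d M V Del).length ≤ n ^ 2 + if d = 2 then 0 else N ^ 3 := by
  classical
  have hnd : (slots N n d M V Del).Nodup := List.nodup_range.filter _
  rw [← List.toFinset_card_of_nodup hnd]
  set B : Finset ℕ := if d = 2 then ∅ else ((Finset.range N ×ˢ Finset.range N) ×ˢ Finset.range N).image
    fun x => x.1.1 * (n * n) + x.1.2 * n + x.2 with hB
  have hsub : (slots N n d M V Del).toFinset ⊆ ((Finset.range n ×ˢ Finset.range n).image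
      fun x => x.1 * (n * n) + x.2 * n + x.2) ∪ B := by
    intro j hj
    rw [List.mem_toFinset, mem_slots] at hj
    have hn : 0 < n := Nat.pos_of_ne_zero fun h => by rw [h] at hj; simp at hj
    have hlt := slot_lt hn hj.1
    have hcode := slot_code n j
    obtain ⟨hxy, hyz⟩ := hj.2.lt_le
    rw [Finset.mem_union]
    by_cases hyz' : j / n % n = j % n
    · left
      refine Finset.mem_image.2 ⟨(j / (n * n), j / n % n), by simp [hlt], ?_⟩
      conv_rhs => rw [hcode, ← hyz']
    · right
      obtain ⟨-, ⟨h, -⟩ | ⟨hz, hp, -⟩⟩ := hj.2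
      · exact absurd h hyz'
      · by_cases hd : d = 2
        · rw [if_pos hd] at hp; exact absurd hp hyz'
        · rw [hB, if_neg hd]
          refine Finset.mem_image.2 ⟨((j / (n * n), j / n % n), j % n), ?_, hcode.symm⟩
          simp only [Finset.mem_product, Finset.mem_range]
          omega
  refine (Finset.card_le_card hsub).trans ((Finset.card_union_le _ _).trans (add_le_add ?_ ?_))
  · refine Finset.card_image_le.trans ?_
    rw [Finset.card_product, Finset.card_range, sq]
  · rw [hB]
    split_ifs
    · simp
    · refine Finset.card_image_le.trans ?_
      rw [Finset.card_product, Finset.card_product, Finset.card_range]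
      exact le_of_eq (by ring)

/-- A program for independent sets solves the padded instances of the right density. -/
theorem works_of_run {p : Prog} {D F : ℕ} {γ a b : ℝ} {T : ℕ → ℕ → ℝ} (hd : d = 2 ∨ d = 3) (hk : 3 < k)
    (hN0 : 0 < N) (hN : (k + 1) * N ≤ n) (hP : P ≤ N ^ k)
    (hD : ∀ E : Finset (Finset (Fin n)), OfDensity k γ a b n E → ∀ w : List ℕ, Encodes E w →
      ∃ (t : ℕ) (s : State), Runs ((n + E.card + 2) ^ D) p w t s ∧
        (t : ℝ) ≤ T n E.card ∧ (s.reg 0 ≠ 0 ↔ HasIndependentSet k n E))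
    (hdens : ∀ Del, a * (n : ℝ) ^ γ ≤ ((slots N n d M V Del).length + P : ℕ) ∧
      (((slots N n d M V Del).length + P : ℕ) : ℝ) ≤ b * (n : ℝ) ^ γ)
    (hT : ∀ m : ℕ, (m : ℝ) ≤ b * (n : ℝ) ^ γ → T n m < F) : Works p D F N n P k d M V := by
  intro Del _
  have hn : 0 < n := by nlinarith
  obtain ⟨E, hE, hcard, har, hiff⟩ := encodes_of_lists hn (records N n P k d M V Del)
    (fun l hl => mem_records_lt hn hN hN0 hl) (fun l hl => nodup_of_mem_records hN0 hl)
    (nodup_records hN0 hk hP) k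
  rw [length_records] at hcard
  have hden := hdens Del
  obtain ⟨t, s, hr, ht, hs⟩ := hD E ⟨har (fun l => 2 ≤ l ∧ l ≤ k) fun l hl =>
    card_of_mem_records (Q := fun l => 2 ≤ l ∧ l ≤ k) ⟨le_rfl, by omega⟩ (fun _ => ⟨by omega, by omega⟩)
      ⟨by omega, le_rfl⟩ hl, by rw [hcard]; exact hden.1, by rw [hcard]; exact hden.2⟩ _ hE
  rw [hcard] at hr ht
  refine ⟨t, s, hr, ?_, hs.trans (hiff.trans (exists_independent_iff hd hk hN))⟩
  exact_mod_cast ht.trans_lt (hT _ hden.2)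

end Padded

/-! ### Choice of the padding, and the three ranges of the density. -/

namespace Padded

open WordRAM HyperIS

/-- Take `n` of order `N ^ σ` and about `N ^ (σ * γ)` padding sets, which is of order `n ^ γ`. The
other hyperedges do not spoil the density: pairs number at most `n ^ 2 ≤ n ^ γ`, triples at most `N
^ 3 ≤ N ^ (σ * γ)`. The condition `σ * γ ≤ k` ensures that there are enough different padding sets.
The bounds hold for every set of deletions, so one padding serves a whole self-reduction. -/
theorem exists_padding {N k d : ℕ} {σ γ : ℝ} (hN : 0 < N) (hd : d = 2 ∨ d = 3) (hσ : 1 ≤ σ)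
    (hσ2 : σ ≤ 2) (hγ : 2 ≤ γ) (hρ : σ * γ ≤ k) (hρ3 : d = 3 → 3 ≤ σ * γ) :
    ∃ i < N * (N * N + 1), (((k + 1) * N + i / N : ℕ) : ℝ) ≤ (k + 3) * (N : ℝ) ^ σ ∧
      N ^ (⌈σ * γ⌉₊ - 1) * (i % N + 1) ≤ N ^ k ∧ ∀ M V Del,
      1 / ((k : ℝ) + 3) ^ γ * (((k + 1) * N + i / N : ℕ) : ℝ) ^ γ ≤
        ((slots N ((k + 1) * N + i / N) d M V Del).length +
          N ^ (⌈σ * γ⌉₊ - 1) * (i % N + 1) : ℕ) ∧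
      (((slots N ((k + 1) * N + i / N) d M V Del).length +
          N ^ (⌈σ * γ⌉₊ - 1) * (i % N + 1) : ℕ) : ℝ) ≤
        4 * (((k + 1) * N + i / N : ℕ) : ℝ) ^ γ := by
  set ρ := σ * γ with hρdef
  have hNR : (1 : ℝ) ≤ N := by exact_mod_cast hN
  have hN0 : (0 : ℝ) < N := by linarith
  have hρ2 : 2 ≤ ρ := by nlinarith
  set g := ⌈ρ⌉₊ - 1 with hg
  have hceil : 2 ≤ ⌈ρ⌉₊ := by
    have : (2 : ℝ) ≤ ⌈ρ⌉₊ := hρ2.trans (Nat.le_ceil ρ)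
    exact_mod_cast this
  have hg1 : g + 1 = ⌈ρ⌉₊ := by omega
  have hgR : (g : ℝ) + 1 = ⌈ρ⌉₊ := by exact_mod_cast hg1
  have hgρ : (g : ℝ) < ρ := by
    have := Nat.ceil_lt_add_one (show 0 ≤ ρ by linarith)
    linarith
  have hρg : ρ ≤ g + 1 := by rw [hgR]; exact Nat.le_ceil ρ
  have hgk : g + 1 ≤ k := by rw [hg1]; exact Nat.ceil_le.2 hρ
  set u := ⌈(N : ℝ) ^ σ⌉₊ with hu
  set w := ⌈(N : ℝ) ^ (ρ - g)⌉₊ with hw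
  have hσ1 : (1 : ℝ) ≤ (N : ℝ) ^ σ := Real.one_le_rpow hNR (by linarith)
  have hu1 := Nat.le_ceil ((N : ℝ) ^ σ)
  have hu2 := Nat.ceil_lt_add_one (show 0 ≤ (N : ℝ) ^ σ by positivity)
  have huN : u ≤ N * N := by
    rw [hu, Nat.ceil_le]
    calc (N : ℝ) ^ σ ≤ (N : ℝ) ^ (2 : ℝ) := Real.rpow_le_rpow_of_exponent_le hNR hσ2
      _ = (N * N : ℕ) := by push_cast; rw [Real.rpow_two, sq]
  have hw1 := Nat.le_ceil ((N : ℝ) ^ (ρ - g))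
  have hwone : (1 : ℝ) ≤ (N : ℝ) ^ (ρ - g) := Real.one_le_rpow hNR (by linarith)
  have hw2 := Nat.ceil_lt_add_one (show 0 ≤ (N : ℝ) ^ (ρ - g) by positivity)
  have hwpos : 0 < w := Nat.ceil_pos.2 (by linarith)
  have hwN : w ≤ N := by
    rw [hw, Nat.ceil_le]
    calc (N : ℝ) ^ (ρ - g) ≤ (N : ℝ) ^ (1 : ℝ) := Real.rpow_le_rpow_of_exponent_le hNR (by linarith)
      _ = N := Real.rpow_one _
  have hdiv : (N * u + (w - 1)) / N = u := by
    rw [Nat.mul_add_div hN, Nat.div_eq_of_lt (by omega), add_zero]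
  have hmod : (N * u + (w - 1)) % N + 1 = w := by
    rw [Nat.mul_add_mod, Nat.mod_eq_of_lt (by omega)]; omega
  -- Here `u` is `N ^ σ` rounded up and `N ^ g * w` approximates `N ^ ρ` within a factor `2`. The
  -- search uses `i % N + 1`, hence `w - 1`; both digits are in range because `σ ≤ 2` and `w ≤ N`.
  refine ⟨N * u + (w - 1), ?_, ?_⟩
  · have := Nat.mul_le_mul_left N huN
    rw [Nat.mul_succ]; omega
  rw [hdiv, hmod]
  set n := (k + 1) * N + u with hn
  set P := N ^ g * w with hP
  have hNσ : (N : ℝ) ≤ (N : ℝ) ^ σ := by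
    conv_lhs => rw [← Real.rpow_one (N : ℝ)]
    exact Real.rpow_le_rpow_of_exponent_le hNR hσ
  have hnR : (n : ℝ) = (k + 1) * N + u := by rw [hn]; push_cast; ring
  have hkR : (0 : ℝ) ≤ k := Nat.cast_nonneg k
  have hn1 : (N : ℝ) ^ σ ≤ n := by rw [hnR]; nlinarith
  have hn2 : (n : ℝ) ≤ (k + 3) * (N : ℝ) ^ σ := by rw [hnR]; nlinarith
  have hργ : ((N : ℝ) ^ σ) ^ γ = (N : ℝ) ^ ρ := by rw [← Real.rpow_mul hN0.le]
  have hργn : (N : ℝ) ^ ρ ≤ (n : ℝ) ^ γ := by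
    rw [← hργ]; exact Real.rpow_le_rpow (by positivity) hn1 (by linarith)
  have hsplit : (N : ℝ) ^ ρ = (N : ℝ) ^ g * (N : ℝ) ^ (ρ - g) := by
    rw [← Real.rpow_natCast, ← Real.rpow_add hN0]; congr 1; ring
  have hPR : (P : ℝ) = (N : ℝ) ^ g * w := by rw [hP]; push_cast; ring
  have hgpos : (0 : ℝ) < (N : ℝ) ^ g := by positivity
  have hP1 : (N : ℝ) ^ ρ ≤ P := by
    rw [hPR, hsplit]; exact mul_le_mul_of_nonneg_left hw1 hgpos.le
  have hP2 : (P : ℝ) ≤ 2 * (N : ℝ) ^ ρ := by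
    rw [hPR, hsplit]
    have : (w : ℝ) ≤ 2 * (N : ℝ) ^ (ρ - g) := by linarith
    calc _ ≤ (N : ℝ) ^ g * (2 * (N : ℝ) ^ (ρ - g)) := mul_le_mul_of_nonneg_left this hgpos.le
      _ = _ := by ring
  refine ⟨hn2, ?_, fun M V Del => ⟨?_, ?_⟩⟩
  · calc N ^ g * w ≤ N ^ g * N := Nat.mul_le_mul_left _ hwN
      _ = N ^ (g + 1) := rfl
      _ ≤ N ^ k := Nat.pow_le_pow_right hN hgk
  · have h1 : (n : ℝ) ^ γ ≤ ((k : ℝ) + 3) ^ γ * (N : ℝ) ^ ρ := by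
      rw [← hργ, ← Real.mul_rpow (by positivity) (by positivity)]
      exact Real.rpow_le_rpow (by positivity) hn2 (by linarith)
    have h2 : 1 / ((k : ℝ) + 3) ^ γ * (n : ℝ) ^ γ ≤ (N : ℝ) ^ ρ := by
      rw [div_mul_eq_mul_div, one_mul, div_le_iff₀ (by positivity), mul_comm]; exact h1
    push_cast [hP] at hP1 ⊢
    have : (0 : ℝ) ≤ (slots N n d M V Del).length := Nat.cast_nonneg _
    linarith
  · have h1 : (((slots N n d M V Del).length : ℕ) : ℝ) ≤ (n : ℝ) ^ 2 + (N : ℝ) ^ ρ := by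
      have h2 := slots_length_le_sq (N := N) (n := n) (d := d) (M := M) (V := V) (Del := Del)
      refine (Nat.cast_le.2 h2).trans ?_
      push_cast
      refine add_le_add le_rfl ?_
      rcases hd with hd | hd
      · rw [if_pos hd]; positivity
      · rw [if_neg (by omega)]
        rw [← Real.rpow_natCast]
        exact Real.rpow_le_rpow_of_exponent_le hNR (by exact_mod_cast hρ3 hd)
    have hnone : (1 : ℝ) ≤ n := hσ1.trans hn1
    have h3 : (n : ℝ) ^ 2 ≤ (n : ℝ) ^ γ := by
      rw [← Real.rpow_two]; exact Real.rpow_le_rpow_of_exponent_le hnone hγ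
    push_cast [hP] at hP2 ⊢
    linarith

/-- An algorithm for independent sets that is too fast leads to one for hypercliques that is too
fast. -/
theorem exists_fast_hyperclique {k d : ℕ} {σ γ c x K : ℝ} (hd : d = 2 ∨ d = 3) (hk : 3 < k)
    (hσ : 1 ≤ σ) (hσ2 : σ ≤ 2) (hγ : 2 ≤ γ) (hρ : σ * γ ≤ k) (hρ3 : d = 3 → 3 ≤ σ * γ) (hc : 30 ≤ c)
    (hx : 29 ≤ x)
    (hK : ∀ N : ℝ, 1 ≤ N → ∀ n m : ℕ, (n : ℝ) ≤ (k + 3) * N ^ σ → (m : ℝ) ≤ 4 * (n : ℝ) ^ γ →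
      timeBound k n m ≤ K * N ^ x)
    (h : ∃ (p : Prog) (C : ℝ), DecidesInTime p (OfDensity k γ (1 / ((k : ℝ) + 3) ^ γ) 4)
      (HasIndependentSet k) fun n m => C * (n : ℝ) ^ (-c) * timeBound k n m) :
    ∃ (p : Prog) (C : ℝ), DecidesInTime p (Uniform d) (HasHyperclique d k)
      fun n _ => C * (n : ℝ) ^ (x - 1) := by
  obtain ⟨p, C, D, hD⟩ := h
  set e := ⌈x - c⌉₊ with he
  set F := ⌈|C| * |K|⌉₊ + 1 with hF
  have hxe : x - c ≤ e := Nat.le_ceil _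
  -- Rounding up adds less than `1` and the search adds `28`, which `c ≥ 30` outweighs with `1` to
  -- spare. If `x ≤ c`, then `e = 0` and `x ≥ 29` is used instead.
  have hex : (e : ℝ) + 28 ≤ x - 1 := by
    rcases le_or_gt (x - c) 0 with h0 | h0
    · rw [he, Nat.ceil_eq_zero.2 h0]; push_cast; linarith
    · have := Nat.ceil_lt_add_one h0.le
      rw [← he] at this; linarith
  obtain ⟨p', C', hp'⟩ := exists_hyperclique_algorithm hd k D e F (⌈σ * γ⌉₊ - 1) p (by
    intro N hN M _ V
    obtain ⟨i, hi, hn, hP, hdens⟩ := exists_padding (k := k) hN hd hσ hσ2 hγ hρ hρ3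
    have hpos : 0 < (k + 1) * N + i / N := Nat.add_pos_left (Nat.mul_pos (Nat.succ_pos k) hN) _
    refine ⟨i, hi, works_of_run hd hk hN (Nat.le_add_right _ _) hP
      (T := fun n m => C * (n : ℝ) ^ (-c) * timeBound k n m) (hD _ hpos) (hdens M V) fun m hm => ?_⟩
    set n := (k + 1) * N + i / N with hndef
    have hNR : (1 : ℝ) ≤ N := by exact_mod_cast hN
    have hN0 : (0 : ℝ) < N := by linarith
    have hNn : (N : ℝ) ≤ n := by
      rw [hndef]; push_cast
      have h1 : (0 : ℝ) ≤ ((i / N : ℕ) : ℝ) := Nat.cast_nonneg _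
      have h2 : (0 : ℝ) ≤ (k : ℝ) * N := by positivity
      linarith
    have htb := hK N hNR n m hn hm
    have htb0 : 0 ≤ timeBound k n m := le_min (by positivity) (by positivity)
    have h1 : (n : ℝ) ^ (-c) ≤ (N : ℝ) ^ (-c) :=
      Real.rpow_le_rpow_of_nonpos hN0 hNn (by linarith)
    have h2 : (N : ℝ) ^ (-c) * (N : ℝ) ^ x ≤ (N : ℝ) ^ e := by
      rw [← Real.rpow_add hN0, ← Real.rpow_natCast]
      exact Real.rpow_le_rpow_of_exponent_le hNR (by linarith)
    have hNe : (1 : ℝ) ≤ (N : ℝ) ^ e := one_le_pow₀ hNR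
    have hFR : |C| * |K| + 1 ≤ F := by
      rw [hF]; push_cast
      linarith [Nat.le_ceil (|C| * |K|)]
    have h3 : C * (n : ℝ) ^ (-c) * timeBound k n m ≤ |C| * |K| * (N : ℝ) ^ e := by
      calc C * (n : ℝ) ^ (-c) * timeBound k n m
          ≤ |C| * (N : ℝ) ^ (-c) * (|K| * (N : ℝ) ^ x) := by
            refine mul_le_mul (mul_le_mul (le_abs_self C) h1 (by positivity) (abs_nonneg C)) ?_ htb0
              (by positivity)
            exact htb.trans (mul_le_mul_of_nonneg_right (le_abs_self K) (by positivity))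
        _ = |C| * |K| * ((N : ℝ) ^ (-c) * (N : ℝ) ^ x) := by ring
        _ ≤ _ := mul_le_mul_of_nonneg_left h2 (by positivity)
    push_cast
    nlinarith)
  refine ⟨p', C', hp'.mono fun n _ hn => ?_⟩
  have hnR : (1 : ℝ) ≤ n := by exact_mod_cast hn
  refine mul_le_mul_of_nonneg_left ?_ (Nat.cast_nonneg _)
  rw [← Real.rpow_natCast]
  exact Real.rpow_le_rpow_of_exponent_le hnR (by push_cast; exact hex)

/-- In each range of `γ` the padding is chosen such that `timeBound`, as a function of the original
`N`, is at most a constant times the conjectured optimum for the source problem; the factor `n ^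
(-c)` then contradicts the hypothesis with `ε = 1`. -/
theorem not_exists_algorithm {k : ℕ} {γ c : ℝ} (hk : 45 ≤ k) (hc : 30 ≤ c) (hγ : 2 ≤ γ) (hγk : γ ≤ k)
    (hcl : CliqueHypothesis) (hhc : HypercliqueHypothesis 3) :
    ¬ ∃ (p : Prog) (C : ℝ), DecidesInTime p (OfDensity k γ (1 / ((k : ℝ) + 3) ^ γ) 4)
      (HasIndependentSet k) fun n m => C * (n : ℝ) ^ (-c) * timeBound k n m := by
  intro h
  have hkR : (45 : ℝ) ≤ k := by exact_mod_cast hk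
  have hω := MatMul.two_le_omega
  have hω3 := MatMul.omega_le_three
  have hc₀ : (1 : ℝ) ≤ k + 3 := by linarith
  rcases le_or_gt 3 γ with h3 | h3
  -- For `γ ≥ 3` a linear number of vertices suffices, and `timeBound ≤ n ^ k` is already of order
  -- `N ^ k`.
  · refine hhc k (by omega) 1 one_pos (exists_fast_hyperclique (σ := 1) (K := ((k : ℝ) + 3) ^ k)
      (Or.inr rfl) (by omega) le_rfl (by norm_num) hγ (by linarith) (by intro; linarith) hc (by linarith)
      (fun N hN n m hn _ => ?_) h)
    rw [Real.rpow_one] at hn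
    refine (min_le_right _ _).trans ?_
    rw [Real.rpow_natCast, ← mul_pow]
    exact pow_le_pow_left₀ (Nat.cast_nonneg _) hn k
  rcases le_or_gt γ MatMul.omega with hγω | hγω
  -- For `γ ≤ ω` the term `m ^ (k / 3)` is dominated by `n ^ (ω * k / 3)`, the time conjectured for
  -- cliques in graphs. The condition `29 ≤ x` holds because `ω * k / 3 ≥ 2 * 45 / 3`.
  · refine hcl k (by omega) 1 one_pos (exists_fast_hyperclique (σ := 1) (Or.inl rfl) (by omega) le_rfl
      (by norm_num) hγ (by linarith) (by intro h; omega) hc (by nlinarith)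
      (fun N hN n m hn hm => timeBound_le_of_le hN hc₀ (by linarith) hn hm (by linarith) ?_) h)
    nlinarith
  -- For `ω < γ < 3` the instance gets about `N ^ (3 / γ)` vertices, so `m` is of order `N ^ 3` and
  -- `m ^ (k / 3)` of order `N ^ k`. The other term is of order `N ^ (ω * k / γ)`, which is smaller
  -- as `ω < γ`.
  · have hγ0 : 0 < γ := by linarith
    have hσγ : 3 / γ * γ = 3 := div_mul_cancel₀ 3 hγ0.ne'
    refine hhc k (by omega) 1 one_pos (exists_fast_hyperclique (σ := 3 / γ)
      (Or.inr rfl) (by omega) ?_ ?_ hγ (by linarith) (fun _ => hσγ.ge) hc (by linarith)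
      (fun N hN n m hn hm => timeBound_le_of_le hN hc₀ (by linarith) hn hm ?_ ?_) h)
    · rw [le_div_iff₀ hγ0]; linarith
    · rw [div_le_iff₀ hγ0]; linarith
    · rw [show 3 / γ * (MatMul.omega * k / 3) = MatMul.omega * k / γ by field_simp,
        div_le_iff₀ hγ0]
      nlinarith
    · rw [hσγ]; linarith

end Padded

theorem theorem1 :
    ∃ c : ℝ, ∀ k : ℕ, 2 ≤ k →
      (∀ b : ℝ, ∃ (p : WordRAM.Prog) (C : ℝ),
        HyperIS.DecidesInTime p (HyperIS.MixedArity k b) (HyperIS.HasIndependentSet k)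
          fun n m => C * (n : ℝ) ^ c * HyperIS.timeBound k n m) ∧
      (HyperIS.CliqueHypothesis → HyperIS.HypercliqueHypothesis 3 →
        ∀ γ : ℝ, 2 ≤ γ → γ ≤ k → ∃ a b : ℝ, 0 < a ∧
          ¬ ∃ (p : WordRAM.Prog) (C : ℝ),
            HyperIS.DecidesInTime p (HyperIS.OfDensity k γ a b) (HyperIS.HasIndependentSet k)
              fun n m => C * (n : ℝ) ^ (-c) * HyperIS.timeBound k n m) := by
  -- The value `45` exceeds the overheads `13` and `30` of the two directions. It also separates the
  -- small `k`, for which the lower bound is trivial, from those with `ω * k / 3` large enough for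
  -- the reduction.
  refine ⟨45, fun k hk => ⟨HyperIS.exists_algorithm (by norm_num) hk, fun hcl hhc γ hγ hγk => ?_⟩⟩
  rcases lt_or_ge k 45 with h45 | h45
  · obtain ⟨a, b, ha, h⟩ := HyperIS.not_decidesInTime_of_lt (k := k) (c := 45) (γ := γ)
      (by exact_mod_cast h45) (by linarith) hγk
    exact ⟨a, b, ha, fun ⟨p, C, hp⟩ => h _ p C hk hp⟩
  · exact ⟨_, 4, by positivity, Padded.not_exists_algorithm h45 (by norm_num) hγ hγk hcl hhc⟩
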